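/- Let $(M,g)$ be a connected closed Riemannian manifold of dimension $d\ge 2$, $T'M=T^*M\setminus\{0\}$, $h(y,\eta)=(g^{\alpha\beta}(y)\eta_\alpha\eta_\beta)^{1/2}$, $\rho=\sqrt{\det g_{\mu\nu}}$, and let $\epsilon>0$. Let $\varphi\in C^\infty(M\times T'M;\mathbb C)$ be a Levi-Civita phase function at time $t=0$, i.e. a function $\varphi(x;y,\eta)=\varphi(0,x;y,\eta;\epsilon)$ which is positively homogeneous of degree $1$ in $\eta$, satisfies $\operatorname{Im}\varphi\ge 0$, and for all $x$ sufficiently close to $y$ is given by $$\varphi(x;y,\eta)=\int_\gamma\zeta\,dz+\frac{i\epsilon}{2}\,h(y,\eta)\,\operatorname{dist}^2(x,y),$$ where $\gamma$ is the shortest geodesic from $y$ to $x$ and $\zeta$ is the parallel transport of $\eta$ along $\gamma$. Let $\chi\in C^\infty(M\times T'M)$ be a cut-off: $\chi=0$ where $h(y,\eta)\le 1/2$; $\chi=1$ on the intersection of $\{h\ge 1\}$ with a conical neighbourhood of $\{x=y\}$; $\chi(x;y,\lambda\eta)=\chi(x;y,\eta)$ for $\lambda\ge1$, $h(y,\eta)\ge1$.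 Let $v\in C^\infty(M\times T'M)$ be, on the set where $\chi\neq0$, a branch of $\rho(x)^{-1/2}\rho(y)^{1/2}[\det^2\varphi_{x^\alpha\eta_\beta}(x;y,\eta)]^{1/4}$, with $v=1$ for $x=y$. Let $\mathfrak s\in S^0_{\mathrm{ph}}(T'M)$ be a polyhomogeneous symbol, $\mathfrak s\sim\sum_{k\ge0}\mathfrak s_{-k}$ with $\mathfrak s_{-k}$ positively homogeneous of degree $-k$ in $\eta$. Consider the operator $$(\mathfrak I f)(x)=(2\pi)^{-d}\int_{T'M}e^{i\varphi(x;y,\eta)}\,\mathfrak s(y,\eta)\,\chi(x;y,\eta)\,v(x;y,\eta)\,f(y)\,dy\,d\eta ,\qquad f\in C^\infty(M),$$ the integral being understood as an oscillatory integral, i.e. as the limit for $\delta\to0^+$ of the integrals with the additional factor $e^{-\delta h(y,\eta)}$. If $\mathfrak I-\operatorname{Id}$ is an infinitely smoothing operator (an integral operator with kernel in $C^\infty(M\times M)$), then $$\mathfrak s_{-2}(y,\eta)=\frac{(d-1)(d-2)\,\epsilon^2}{8\,g^{\alpha\beta}(y)\eta_\alpha\eta_\beta}\qquad\text{for all }(y,\eta)\in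 T'M .$$ -/

import Mathlib

open scoped Manifold ContDiff Bundle Topology

namespace LeviCivita

noncomputable section

variable {d : ℕ} {M : Type*} [MetricSpace M] [ChartedSpace (EuclideanSpace ℝ (Fin d)) M]

/-! ### Local coordinates and covectors

For `p : M`, "the chart at `p`" is `extChartAt (𝓡 d) p`; it is used at all points `y` of its source.
Covectors of `ℝᵈ` are identified with vectors of components `q = (q_α)`. -/

/-- The cotangent space `T*_y M`. -/
abbrev Cotangent (d : ℕ) {M : Type*} [MetricSpace M]
    [ChartedSpace (EuclideanSpace ℝ (Fin d)) M] (y : M) : Type :=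
  TangentSpace (𝓡 d) y →L[ℝ] ℝ

/-- The standard basis vector `e_α` of `ℝᵈ`. -/
abbrev stdVec (α : Fin d) : EuclideanSpace ℝ (Fin d) := EuclideanSpace.single α (1 : ℝ)

/-- The differential at `y` of the coordinate map of the chart at `p`. -/
def coordDiff (p y : M) : TangentSpace (𝓡 d) y →L[ℝ] EuclideanSpace ℝ (Fin d) :=
  mfderiv (𝓡 d) 𝓘(ℝ, EuclideanSpace ℝ (Fin d)) (extChartAt (𝓡 d) p) y

/-- The coordinate vector field `∂/∂y^α` of the chart at `p`, at the point `y`. -/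
def coordVec (p y : M) (α : Fin d) : TangentSpace (𝓡 d) y :=
  (coordDiff p y).inverse (stdVec α)

/-- The covector `q_α dy^α` at `y`, in the coordinates of the chart at `p`. -/
def covec (p y : M) (q : EuclideanSpace ℝ (Fin d)) : Cotangent d y :=
  (innerSL ℝ q).comp (coordDiff p y)

/-! ### Smooth functions on `T'M = T*M ∖ 0` and on `M × T'M`

Such functions are represented as functions on `T*M`, whose values on the zero section are never
used. Smoothness is smoothness in all the induced local coordinates. -/

/-- `a ∈ C^∞(T'M)`. -/
def SmoothOnCotangent (a : (y : M) → Cotangent d y → ℂ) : Prop :=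
  ∀ p : M, ContDiffOn ℝ ∞
    (fun z : EuclideanSpace ℝ (Fin d) × EuclideanSpace ℝ (Fin d) =>
      a ((extChartAt (𝓡 d) p).symm z.1) (covec p ((extChartAt (𝓡 d) p).symm z.1) z.2))
    ((extChartAt (𝓡 d) p).target ×ˢ {0}ᶜ)

/-- `a ∈ C^∞(M × T'M)`. -/
def SmoothOnProd (a : M → (y : M) → Cotangent d y → ℂ) : Prop :=
  ∀ p q : M, ContDiffOn ℝ ∞
    (fun z : EuclideanSpace ℝ (Fin d) × EuclideanSpace ℝ (Fin d) × EuclideanSpace ℝ (Fin d) =>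
      a ((extChartAt (𝓡 d) p).symm z.1) ((extChartAt (𝓡 d) q).symm z.2.1)
        (covec q ((extChartAt (𝓡 d) q).symm z.2.1) z.2.2))
    ((extChartAt (𝓡 d) p).target ×ˢ (extChartAt (𝓡 d) q).target ×ˢ {0}ᶜ)

/-- The matrix `φ_{x^α η_β}(x; y, η)`, with the coordinates of the chart at `p` for `x` and those of
the chart at `q` for `y`. -/
def mixedDeriv (φ : M → (y : M) → Cotangent d y → ℂ) (p q x y : M) (η : Cotangent d y) :
    Matrix (Fin d) (Fin d) ℂ :=
  Matrix.of fun α β =>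
    deriv (fun t : ℝ => deriv (fun τ : ℝ =>
      φ ((extChartAt (𝓡 d) p).symm (extChartAt (𝓡 d) p x + t • stdVec α)) y
        (η + τ • covec q y (stdVec β))) 0) 0

/-! ### Polyhomogeneous symbols -/

/-- The estimates of the symbol class `S^m(T'M)`: in the coordinates of each chart, over each
compact subset of the chart and for `‖η‖ ≥ 1`, the derivatives of order `i` in `y` and `j` in `η`
are `O(‖η‖^{m-j})`. -/
def SymbolBound (m : ℝ) (a : (y : M) → Cotangent d y → ℂ) : Prop :=
  ∀ (p : M) (K : Set (EuclideanSpace ℝ (Fin d))), IsCompact K → K ⊆ (extChartAt (𝓡 d) p).target →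
    ∀ i j : ℕ, ∃ C : ℝ, ∀ u ∈ K, ∀ q : EuclideanSpace ℝ (Fin d), 1 ≤ ‖q‖ →
      ‖iteratedFDeriv ℝ i (fun u' => iteratedFDeriv ℝ j (fun q' =>
        a ((extChartAt (𝓡 d) p).symm u') (covec p ((extChartAt (𝓡 d) p).symm u') q')) q) u‖
        ≤ C * ‖q‖ ^ (m - (j : ℝ))

/-- `s ∈ S^0_ph(T'M)` with asymptotic expansion `s ∼ ∑_k s_{-k}` in positively homogeneous
components; `c k` is the component `s_{-k}`, of degree `-k`. -/
structure HasPolyhomogeneousExpansion (s : (y : M) → Cotangent d y → ℂ)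
    (c : ℕ → (y : M) → Cotangent d y → ℂ) : Prop where
  smooth : SmoothOnCotangent s
  smooth_component : ∀ k, SmoothOnCotangent (c k)
  homogeneous : ∀ (k : ℕ) (y : M) (η : Cotangent d y), η ≠ 0 → ∀ l : ℝ, 0 < l →
    c k y (l • η) = ((l ^ k)⁻¹ : ℝ) * c k y η
  remainder : ∀ N : ℕ,
    SymbolBound (-(N : ℝ)) (fun y η => s y η - ∑ k ∈ Finset.range N, c k y η)

/-! ### Riemannian geometry in local coordinates -/

variable [Bundle.RiemannianBundle (fun x : M => TangentSpace (𝓡 d) x)]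

/-- The matrix `g_{μν}(y)` in the coordinates of the chart at `p`. -/
def metricMatrix (p y : M) : Matrix (Fin d) (Fin d) ℝ :=
  Matrix.of fun μ ν => inner ℝ (coordVec p y μ) (coordVec p y ν)

/-- The Riemannian density `ρ(y) = √(det g_{μν}(y))` in the coordinates of the chart at `p`. -/
def density (d : ℕ) {M : Type*} [MetricSpace M] [ChartedSpace (EuclideanSpace ℝ (Fin d)) M]
    [Bundle.RiemannianBundle (fun x : M => TangentSpace (𝓡 d) x)] (p y : M) : ℝ :=
  √(metricMatrix (d := d) p y).det

/-- `g^{αβ}(y) η_α η_β` (computed in the chart at `y`; it does not depend on the chart). -/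
def cometric (y : M) (η : Cotangent d y) : ℝ :=
  ∑ α, ∑ β, (metricMatrix y y)⁻¹ α β * η (coordVec y y α) * η (coordVec y y β)

/-- The Hamiltonian `h(y, η) = (g^{αβ}(y) η_α η_β)^{1/2}`. -/
def hamiltonian (y : M) (η : Cotangent d y) : ℝ := √(cometric y η)

/-- The partial derivative `∂_κ g_{μν}` at `y`, in the coordinates of the chart at `p`. -/
def metricDeriv (p y : M) (κ μ ν : Fin d) : ℝ :=
  fderiv ℝ (fun u => metricMatrix p ((extChartAt (𝓡 d) p).symm u) μ ν)
    (extChartAt (𝓡 d) p y) (stdVec κ)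

/-- The Christoffel symbol `Γ^α_{μν}(y)` of the Levi-Civita connection, in the coordinates of the
chart at `p`. -/
def christoffel (p y : M) (α μ ν : Fin d) : ℝ :=
  (1 / 2) * ∑ β, (metricMatrix p y)⁻¹ α β *
    (metricDeriv p y μ β ν + metricDeriv p y ν β μ - metricDeriv p y β μ ν)

/-- The component `γ^α(s)` of a curve, in the coordinates of the chart at `p`. -/
def curveCoord (d : ℕ) {M : Type*} [MetricSpace M] [ChartedSpace (EuclideanSpace ℝ (Fin d)) M]
    (p : M) (γ : ℝ → M) (α : Fin d) (s : ℝ) : ℝ :=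
  (extChartAt (𝓡 d) p (γ s) : EuclideanSpace ℝ (Fin d)) α

/-- `γ`, restricted to `[0, 1]`, is a geodesic (affinely parametrised):
`γ̈^α + Γ^α_{μν} γ̇^μ γ̇^ν = 0` in local coordinates. -/
structure IsGeodesic (d : ℕ) {M : Type*} [MetricSpace M]
    [ChartedSpace (EuclideanSpace ℝ (Fin d)) M]
    [Bundle.RiemannianBundle (fun x : M => TangentSpace (𝓡 d) x)] (γ : ℝ → M) : Prop where
  smooth : ∀ s ∈ Set.Icc (0 : ℝ) 1, ContMDiffAt 𝓘(ℝ) (𝓡 d) ∞ γ s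
  equation : ∀ s ∈ Set.Icc (0 : ℝ) 1, ∀ p : M, γ s ∈ (extChartAt (𝓡 d) p).source → ∀ α : Fin d,
    HasDerivAt (deriv (curveCoord d p γ α))
      (-∑ μ, ∑ ν, christoffel p (γ s) α μ ν *
        deriv (curveCoord d p γ μ) s * deriv (curveCoord d p γ ν) s) s

/-- The covector field `ζ` along `γ` is parallel over `[0, 1]` for the Levi-Civita connection:
`ζ̇_α = Γ^μ_{αν} ζ_μ γ̇^ν` in local coordinates. -/
def IsParallel (γ : ℝ → M) (ζ : (s : ℝ) → Cotangent d (γ s)) : Prop :=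
  ∀ s ∈ Set.Icc (0 : ℝ) 1, ∀ p : M, γ s ∈ (extChartAt (𝓡 d) p).source → ∀ α : Fin d,
    HasDerivAt (fun s' => ζ s' (coordVec p (γ s') α))
      (∑ μ, ∑ ν, christoffel p (γ s) μ α ν *
        ζ s (coordVec p (γ s) μ) * deriv (curveCoord d p γ ν) s) s

/-- The integral `∫_γ ζ dz` of a covector field along the curve `γ : [0, 1] → M`. -/
def lineIntegral (γ : ℝ → M) (ζ : (s : ℝ) → Cotangent d (γ s)) : ℝ :=
  ∫ s in (0 : ℝ)..1, ζ s (mfderiv 𝓘(ℝ) (𝓡 d) γ s (1 : ℝ))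

/-! ### The phase function, the cut-off and the weight -/

/-- `φ` is a Levi-Civita phase function with parameter `ε` at time zero, as a function of
`(x; y, η)`. For `x` close to `y` it is `∫_γ ζ dz + (iε/2) h(y, η) dist²(x, y)`, where `γ` is the
shortest geodesic from `y = γ 0` to `x = γ 1` and `ζ` is the parallel transport of `η = ζ 0` along
`γ`; elsewhere it is an arbitrary smooth continuation, homogeneous of degree one in `η` and with
non-negative imaginary part. -/
structure IsLeviCivitaPhase (ε : ℝ) (φ : M → (y : M) → Cotangent d y → ℂ) : Prop where
  smooth : SmoothOnProd φ
  homogeneous : ∀ (x y : M) (η : Cotangent d y), η ≠ 0 → ∀ l : ℝ, 0 < l →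
    φ x y (l • η) = l * φ x y η
  im_nonneg : ∀ (x y : M) (η : Cotangent d y), η ≠ 0 → 0 ≤ (φ x y η).im
  near_diagonal : ∃ r : ℝ, 0 < r ∧ ∀ (γ : ℝ → M) (ζ : (s : ℝ) → Cotangent d (γ s)),
    dist (γ 1) (γ 0) < r → IsGeodesic d γ →
    Manifold.pathELength (𝓡 d) γ 0 1 = edist (γ 1) (γ 0) → IsParallel γ ζ → ζ 0 ≠ 0 →
    φ (γ 1) (γ 0) (ζ 0) = lineIntegral γ ζ +
      Complex.I * ε / 2 * hamiltonian (γ 0) (ζ 0) * (dist (γ 1) (γ 0) : ℂ) ^ 2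

/-- `χ` is an admissible cut-off. As `M` is compact, every conical neighbourhood of the diagonal
`{x = y}` in `M × T'M` contains some `{dist(x, y) < r}`, and these are conical neighbourhoods. -/
structure IsCutoff (χ : M → (y : M) → Cotangent d y → ℂ) : Prop where
  smooth : SmoothOnProd χ
  eq_zero : ∀ (x y : M) (η : Cotangent d y), η ≠ 0 → hamiltonian y η ≤ 1 / 2 → χ x y η = 0
  eq_one : ∃ r : ℝ, 0 < r ∧ ∀ (x y : M) (η : Cotangent d y),
    dist x y < r → 1 ≤ hamiltonian y η → χ x y η = 1
  homogeneous : ∀ (x y : M) (η : Cotangent d y), 1 ≤ hamiltonian y η → ∀ l : ℝ, 1 ≤ l →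
    χ x y (l • η) = χ x y η

/-- `v` is a smooth branch of the weight `ρ(x)^{-1/2} ρ(y)^{1/2} [det² φ_{xη}]^{1/4}` on the set where
`χ ≠ 0` (in any coordinates for `x` and for `y`), with `v = 1` on the diagonal. (Where `χ = 0` the values
of the weight do not matter.) -/
structure IsWeight (φ χ v : M → (y : M) → Cotangent d y → ℂ) : Prop where
  smooth : SmoothOnProd v
  pow_four : ∀ (x y : M) (η : Cotangent d y), η ≠ 0 → χ x y η ≠ 0 → ∀ p q : M,
    x ∈ (extChartAt (𝓡 d) p).source → y ∈ (extChartAt (𝓡 d) q).source →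
    v x y η ^ 4 = ((density d p x : ℂ) ^ 2)⁻¹ * (density d q y : ℂ) ^ 2 *
      (mixedDeriv φ p q x y η).det ^ 2
  diagonal : ∀ (y : M) (η : Cotangent d y), η ≠ 0 → v y y η = 1

/-! ### The oscillatory integral operator -/

variable [MeasurableSpace M]

/-- The measure `ρ(x) dx` on the domain of the chart at `p`, as a measure on `M`. -/
def chartVolume (d : ℕ) {M : Type*} [MetricSpace M] [ChartedSpace (EuclideanSpace ℝ (Fin d)) M]
    [Bundle.RiemannianBundle (fun x : M => TangentSpace (𝓡 d) x)] [MeasurableSpace M] (p : M) :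
    MeasureTheory.Measure M :=
  ((MeasureTheory.volume.restrict (extChartAt (𝓡 d) p).target).withDensity
    (fun u => ENNReal.ofReal (density d p ((extChartAt (𝓡 d) p).symm u)))).map
      (extChartAt (𝓡 d) p).symm

/-- The Riemannian volume measure: the least measure on `M` which dominates `ρ(x) dx` on each chart.
(The measures of two charts agree on the overlap, so it restricts to `ρ(x) dx` on each chart.) -/
def riemannianVolume (d : ℕ) (M : Type*) [MetricSpace M]
    [ChartedSpace (EuclideanSpace ℝ (Fin d)) M]
    [Bundle.RiemannianBundle (fun x : M => TangentSpace (𝓡 d) x)] [MeasurableSpace M] :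
    MeasureTheory.Measure M :=
  ⨆ p : M, chartVolume d p

/-- The integral `∫_{T'M} e^{iφ(x;y,η)} s(y,η) χ(x;y,η) v(x;y,η) f(y) dy dη / (2π)^d`, with the
convergence factor `e^{-δ h(y,η)}`. Here `dy dη = (ρ(y) dy) (ρ(y)^{-1} dη)`, and `dη` is the Lebesgue
measure in the components of `η` in the chart at `y`. -/
def regularisedOp (φ χ v : M → (y : M) → Cotangent d y → ℂ) (s : (y : M) → Cotangent d y → ℂ)
    (δ : ℝ) (f : M → ℂ) (x : M) : ℂ :=
  ∫ y, (∫ q : EuclideanSpace ℝ (Fin d),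
      Complex.exp (Complex.I * φ x y (covec y y q)) * s y (covec y y q) * χ x y (covec y y q) *
        v x y (covec y y q) * Real.exp (-δ * hamiltonian y (covec y y q))) /
      ((2 * Real.pi) ^ d * density d y y : ℝ) * f y ∂(riemannianVolume d M)

/-- The operator given by the oscillatory integral
`(𝔍 f)(x) = ∫_{T'M} e^{iφ} s χ v f(y) dy dη / (2π)^d` differs from the identity by an infinitely
smoothing operator, i.e. by an integral operator with infinitely smooth kernel `K` on `M × M`.
The oscillatory integral is the limit, as `δ → 0⁺`, of the integrals with the convergence factor
`e^{-δ h}`. -/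
def IsIdentityModSmoothing (φ χ v : M → (y : M) → Cotangent d y → ℂ)
    (s : (y : M) → Cotangent d y → ℂ) : Prop :=
  ∃ K : M × M → ℂ, ContMDiff ((𝓡 d).prod (𝓡 d)) 𝓘(ℝ, ℂ) ∞ K ∧
    ∀ f : M → ℂ, ContMDiff (𝓡 d) 𝓘(ℝ, ℂ) ∞ f → ∀ x : M,
      Filter.Tendsto (fun δ : ℝ => regularisedOp φ χ v s δ f x) (𝓝[>] 0)
        (𝓝 (f x + ∫ y, K (x, y) * f y ∂(riemannianVolume d M)))

end

end LeviCivita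

namespace LeviCivita

open Filter Set MeasureTheory Metric Asymptotics FourierTransform
open Finset (sum_congr mul_sum sum_comm sum_mul sum_range_succ smul_sum)
open Complex (I I_sq I_re I_im mul_re ofReal_re ofReal_one ofReal_inv real_smul norm_real ofRealCLM
  continuous_ofReal ofReal_ne_zero ofReal_pow ofReal_mul norm_exp)
open Real (norm_of_nonneg norm_eq_abs exp exp_pos exp_le_one_iff sqrt_sq sqrt_nonneg sqrt_mul
  sq_sqrt sqrt_pos pi_pos)
open Matrix (of_apply det_mul mulVec_mulVec one_mulVec)
open scoped Real
open ContinuousLinearMap (adjoint adjoint_inner_left adjoint_inner_right adjoint_adjoint)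

noncomputable section

set_option linter.unusedSectionVars false

variable {d : ℕ}

local notation "cexp" => Complex.exp

local notation "SmoothOn" => ContDiffOn ℝ ∞

local notation "Smooth" => ContDiff ℝ ∞

local notation "𝕀" => Icc (0 : ℝ) 1

local notation "𝔼" => EuclideanSpace ℝ (Fin d)

local notation "𝔼[" d "]" => EuclideanSpace ℝ (Fin d)

local notation "𝐞[" z "," θ "]" => Complex.exp (I * ((inner ℝ z θ : ℝ) : ℂ))

lemma hasFDerivAt_of_isOpen {E F : Type*} [NormedAddCommGroup E] [NormedSpace ℝ E]
    [NormedAddCommGroup F] [NormedSpace ℝ F] {f : E → F} {s : Set E} {n : WithTop ℕ∞}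
    (hf : ContDiffOn ℝ n f s) (hs : IsOpen s) {x : E} (hx : x ∈ s) (hn : n ≠ 0 := by simp) :
    HasFDerivAt f (fderiv ℝ f x) x :=
  ((hf.contDiffAt (hs.mem_nhds hx)).differentiableAt hn).hasFDerivAt

section

variable {P E : Type*} [NormedAddCommGroup P] [NormedSpace ℝ P]
  [NormedAddCommGroup E] [InnerProductSpace ℝ E] [FiniteDimensional ℝ E] [MeasurableSpace E]
  [BorelSpace E]

/-- The integral of a directional derivative of a compactly supported `C¹` function vanishes. -/
lemma integral_fderiv_eq_zero_of_hasCompactSupport {F : E → ℂ} (hF : ContDiff ℝ 1 F)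
    (hc : HasCompactSupport F) (v : E) : ∫ z, fderiv ℝ F z v = 0 := by
  have h1 : Integrable (fun z => fderiv ℝ F z v) := by
    apply Continuous.integrable_of_hasCompactSupport
    · exact (hF.continuous_fderiv one_ne_zero).clm_apply continuous_const
    · exact hc.fderiv_apply ℝ v
  have h2 : Integrable F := hF.continuous.integrable_of_hasCompactSupport hc
  have := integral_mul_fderiv_eq_neg_fderiv_mul_of_integrable (μ := (volume : Measure E))
    (f := fun _ : E => (1 : ℂ)) (g := F) (v := v) (by simp) (by simpa using h1)
    (by simpa using h2) (fun x _ => differentiableAt_const _)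
    (fun x _ => (hF.differentiable one_ne_zero) x)
  simpa using this

/-- The amplitude obtained from `a` by one integration by parts in the direction `e p`; `D` is the
derivative of the phase in this direction. -/
def reduceAmplitude (D : P × E → ℂ) (e : P → E) (a : P × E → ℂ) : P × E → ℂ :=
  fun x => I * fderiv ℝ (fun y => a y / D y) x (0, e x.1)

variable {Ω : Set P} {O K : Set E} {D : P × E → ℂ} {e : P → E}

lemma contDiffOn_div_of_vanish (hΩ : IsOpen Ω) (hO : IsOpen O) (hK : IsCompact K) (hKO : K ⊆ O)
    (hD : SmoothOn D (Ω ×ˢ O)) (hD0 : ∀ p ∈ Ω, ∀ z ∈ O, D (p, z) ≠ 0) {a : P × E → ℂ}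
    (ha : SmoothOn a (Ω ×ˢ univ)) (ha0 : ∀ p ∈ Ω, ∀ z ∉ K, a (p, z) = 0) :
    SmoothOn (fun y => a y / D y) (Ω ×ˢ univ) := by
  rintro ⟨p, z⟩ ⟨hp, -⟩
  apply ContDiffAt.contDiffWithinAt
  by_cases hz : z ∈ O
  · simp only [div_eq_mul_inv]
    exact (ha.contDiffAt ((hΩ.prod isOpen_univ).mem_nhds ⟨hp, mem_univ _⟩)).mul
      ((hD.contDiffAt ((hΩ.prod hO).mem_nhds ⟨hp, hz⟩)).inv (hD0 p hp z hz))
  · have : (fun y => a y / D y) =ᶠ[𝓝 (p, z)] fun _ => 0 := by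
      have : Ω ×ˢ Kᶜ ∈ 𝓝 (p, z) :=
        (hΩ.prod hK.isClosed.isOpen_compl).mem_nhds ⟨hp, fun h => hz (hKO h)⟩
      filter_upwards [this] with y hy
      rw [ha0 y.1 hy.1 y.2 hy.2, zero_div]
    exact contDiffAt_const.congr_of_eventuallyEq this

lemma contDiffOn_reduceAmplitude (hΩ : IsOpen Ω) (hO : IsOpen O) (hK : IsCompact K)
    (hKO : K ⊆ O) (hD : SmoothOn D (Ω ×ˢ O)) (hD0 : ∀ p ∈ Ω, ∀ z ∈ O, D (p, z) ≠ 0)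
    (he : SmoothOn e Ω) {a : P × E → ℂ}
    (ha : SmoothOn a (Ω ×ˢ univ)) (ha0 : ∀ p ∈ Ω, ∀ z ∉ K, a (p, z) = 0) :
    SmoothOn (reduceAmplitude D e a) (Ω ×ˢ univ) ∧
      ∀ p ∈ Ω, ∀ z ∉ K, reduceAmplitude D e a (p, z) = 0 := by
  have h := contDiffOn_div_of_vanish hΩ hO hK hKO hD hD0 ha ha0
  refine ⟨?_, fun p hp z hz => ?_⟩
  · unfold reduceAmplitude
    refine contDiffOn_const.mul ?_
    refine (h.fderiv_of_isOpen (hΩ.prod isOpen_univ) (by simp)).clm_apply ?_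
    exact contDiffOn_const.prodMk (he.comp contDiffOn_fst fun x hx => hx.1)
  · have : (fun y => a y / D y) =ᶠ[𝓝 (p, z)] fun _ => 0 := by
      have : Ω ×ˢ Kᶜ ∈ 𝓝 (p, z) := (hΩ.prod hK.isClosed.isOpen_compl).mem_nhds ⟨hp, hz⟩
      filter_upwards [this] with y hy
      rw [ha0 y.1 hy.1 y.2 hy.2, zero_div]
    simp [reduceAmplitude, this.fderiv_eq]

lemma contDiff_exp_mul_of_vanish (hO : IsOpen O) (hK : IsCompact K) (hKO : K ⊆ O) {Φ b : E → ℂ}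
    (hΦ : ContDiffOn ℝ 1 Φ O) (hb : ContDiff ℝ 1 b) (hbz : ∀ z ∉ K, b z = 0) (c : ℂ) :
    ContDiff ℝ 1 (fun z => cexp (c * Φ z) * b z) ∧
      HasCompactSupport (fun z => cexp (c * Φ z) * b z) := by
  refine ⟨?_, HasCompactSupport.intro hK fun z hz => by simp [hbz z hz]⟩
  rw [contDiff_iff_contDiffAt]
  intro z
  by_cases hz : z ∈ O
  · exact ((contDiffAt_const.mul (hΦ.contDiffAt (hO.mem_nhds hz))).cexp).mul hb.contDiffAt
  · have : (fun z => cexp (c * Φ z) * b z) =ᶠ[𝓝 z] fun _ => 0 := by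
      filter_upwards [hK.isClosed.isOpen_compl.mem_nhds (fun h => hz (hKO h))] with y hy
      simp [hbz y hy]
    exact contDiffAt_const.congr_of_eventuallyEq this

lemma contDiff_slice {a : P × E → ℂ} (ha : SmoothOn a (Ω ×ˢ univ)) {p : P} (hp : p ∈ Ω) :
    Smooth (fun z => a (p, z)) := by
  rw [← contDiffOn_univ]
  exact ha.comp (contDiff_const.prodMk contDiff_id).contDiffOn (fun z _ => ⟨hp, mem_univ _⟩)

lemma integral_reduceAmplitude (hΩ : IsOpen Ω) (hO : IsOpen O) (hK : IsCompact K)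
    (hKO : K ⊆ O) (hD : SmoothOn D (Ω ×ˢ O)) (hD0 : ∀ p ∈ Ω, ∀ z ∈ O, D (p, z) ≠ 0)
    (he : SmoothOn e Ω) {a : P × E → ℂ}
    (ha : SmoothOn a (Ω ×ˢ univ)) (ha0 : ∀ p ∈ Ω, ∀ z ∉ K, a (p, z) = 0)
    {p : P} (hp : p ∈ Ω) {Φ : E → ℂ} (hΦ : ContDiffOn ℝ 1 Φ O)
    (hΦD : ∀ z ∈ O, fderiv ℝ Φ z (e p) = D (p, z)) {l : ℝ} (hl : l ≠ 0) :
    ∫ z, cexp (I * l * Φ z) * a (p, z) =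
      (l : ℂ)⁻¹ * ∫ z, cexp (I * l * Φ z) * reduceAmplitude D e a (p, z) := by
  have h := contDiffOn_div_of_vanish hΩ hO hK hKO hD hD0 ha ha0
  set b : P × E → ℂ := fun y => a y / D y with hb
  have hbz : ∀ z ∉ K, b (p, z) = 0 := fun z hz => by simp [hb, ha0 p hp z hz]
  have hb1 : Smooth (fun z => b (p, z)) := contDiff_slice h hp
  have hle : (1 : WithTop ℕ∞) ≤ ∞ := by norm_cast
  obtain ⟨hF1, hFc⟩ := contDiff_exp_mul_of_vanish hO hK hKO hΦ (hb1.of_le hle) hbz (I * l)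
  set F : E → ℂ := fun z => cexp (I * l * Φ z) * b (p, z) with hF
  have hFz : ∀ z ∉ O, F =ᶠ[𝓝 z] fun _ => 0 := fun z hz => by
    filter_upwards [hK.isClosed.isOpen_compl.mem_nhds (fun h => hz (hKO h))] with y hy
    simp [hF, hbz y hy]
  have hint := integral_fderiv_eq_zero_of_hasCompactSupport hF1 hFc (e p)
  have hder : ∀ z, fderiv ℝ F z (e p) = I * l * (cexp (I * l * Φ z) * a (p, z)) +
      cexp (I * l * Φ z) * (-I * reduceAmplitude D e a (p, z)) := by
    intro z
    by_cases hz : z ∈ O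
    · have h1 : HasFDerivAt (fun z => b (p, z)) ((fderiv ℝ b (p, z)).comp
          (ContinuousLinearMap.inr ℝ P E)) z := by
        have hb2 : DifferentiableAt ℝ b (p, z) :=
          (hasFDerivAt_of_isOpen h (hΩ.prod isOpen_univ) ⟨hp, mem_univ _⟩).differentiableAt
        exact hb2.hasFDerivAt.comp z (hasFDerivAt_prodMk_right p z)
      have h2 : HasFDerivAt Φ (fderiv ℝ Φ z) z :=
        ((hΦ.contDiffAt (hO.mem_nhds hz)).differentiableAt one_ne_zero).hasFDerivAt
      have h3 := ((h2.const_mul (I * l)).cexp).mul h1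
      rw [show F = (fun z => cexp (I * l * Φ z)) * fun z => b (p, z) from rfl, h3.fderiv]
      have hD0' := hD0 p hp z hz
      simp only [add_apply, smul_apply,
        ContinuousLinearMap.comp_apply, ContinuousLinearMap.inr_apply, hΦD z hz, smul_eq_mul,
        reduceAmplitude]
      simp only [hb]
      field_simp
      linear_combination (fderiv ℝ (fun y => a y / D y) (p, z) (0, e p)) * I_sq
    · have h1 : a (p, z) = 0 := ha0 p hp z fun h => hz (hKO h)
      have h2 : reduceAmplitude D e a (p, z) = 0 := by
        have : (fun y => a y / D y) =ᶠ[𝓝 (p, z)] fun _ => 0 := by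
          have : Ω ×ˢ Kᶜ ∈ 𝓝 (p, z) :=
            (hΩ.prod hK.isClosed.isOpen_compl).mem_nhds ⟨hp, fun h => hz (hKO h)⟩
          filter_upwards [this] with y hy
          rw [ha0 y.1 hy.1 y.2 hy.2, zero_div]
        simp [reduceAmplitude, this.fderiv_eq]
      rw [(hFz z hz).fderiv_eq, h1, h2]
      simp
  obtain ⟨hr, hr0⟩ := contDiffOn_reduceAmplitude hΩ hO hK hKO hD hD0 he ha ha0
  have hA := contDiff_exp_mul_of_vanish hO hK hKO hΦ ((contDiff_slice ha hp).of_le hle)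
    (ha0 p hp) (I * l)
  have hB := contDiff_exp_mul_of_vanish hO hK hKO hΦ ((contDiff_slice hr hp).of_le hle)
    (hr0 p hp) (I * l)
  have hAi := hA.1.continuous.integrable_of_hasCompactSupport (μ := volume) hA.2
  have hBi := hB.1.continuous.integrable_of_hasCompactSupport (μ := volume) hB.2
  have hl' : (l : ℂ) ≠ 0 := by exact_mod_cast hl
  have e1 : ∫ z, fderiv ℝ F z (e p) = I * l * (∫ z, cexp (I * l * Φ z) * a (p, z)) -
      I * ∫ z, cexp (I * l * Φ z) * reduceAmplitude D e a (p, z) := by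
    rw [← integral_const_mul, ← integral_const_mul, ← integral_sub (hAi.const_mul _)
      (hBi.const_mul _)]
    congr 1
    ext z
    rw [hder z]
    ring
  rw [hint] at e1
  have e2 := mul_left_cancel₀ Complex.I_ne_zero (by linear_combination -e1 :
    I * (l * ∫ z, cexp (I * l * Φ z) * a (p, z)) =
    I * ∫ z, cexp (I * l * Φ z) * reduceAmplitude D e a (p, z))
  rw [← e2, inv_mul_cancel_left₀ hl']

/-- **Non-stationary phase.** -/
lemma exists_bound_nonstationary (hΩ : IsOpen Ω) (hO : IsOpen O) (hK : IsCompact K)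
    (hKO : K ⊆ O) (hD : SmoothOn D (Ω ×ˢ O)) (hD0 : ∀ p ∈ Ω, ∀ z ∈ O, D (p, z) ≠ 0)
    (he : SmoothOn e Ω) {P₀ : Set P} (hP₀ : IsCompact P₀) (hP₀Ω : P₀ ⊆ Ω) (N : ℕ)
    {a : P × E → ℂ} (ha : SmoothOn a (Ω ×ˢ univ)) (ha0 : ∀ p ∈ Ω, ∀ z ∉ K, a (p, z) = 0) :
    ∃ C : ℝ, 0 ≤ C ∧ ∀ p ∈ P₀, ∀ Φ : E → ℂ, ContDiffOn ℝ 1 Φ O →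
      (∀ z ∈ O, fderiv ℝ Φ z (e p) = D (p, z)) → (∀ z ∈ O, 0 ≤ (Φ z).im) → ∀ l : ℝ, 0 < l →
      ‖∫ z, cexp (I * l * Φ z) * a (p, z)‖ ≤ C * (l ^ N)⁻¹ := by
  induction N generalizing a with
  | zero =>
    have hcont : ContinuousOn a (P₀ ×ˢ K) :=
      ha.continuousOn.mono fun x hx => ⟨hP₀Ω hx.1, mem_univ _⟩
    obtain ⟨C, hC⟩ := (hP₀.prod hK).exists_bound_of_continuousOn hcont
    refine ⟨|C| * volume.real K, by positivity, fun p hp Φ _ _ hΦ l hl => ?_⟩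
    have : ∫ z, cexp (I * l * Φ z) * a (p, z) = ∫ z in K, cexp (I * l * Φ z) * a (p, z) := by
      rw [setIntegral_eq_integral_of_forall_compl_eq_zero]
      intro z hz
      simp [ha0 p (hP₀Ω hp) z hz]
    rw [this, pow_zero, inv_one, mul_one]
    refine norm_setIntegral_le_of_norm_le_const hK.measure_lt_top fun z hz => ?_
    have h1 : ‖cexp (I * l * Φ z)‖ ≤ 1 := by
      rw [norm_exp, exp_le_one_iff]
      have := mul_nonneg hl.le (hΦ z (hKO hz))
      simpa [mul_re, mul_assoc] using this
    calc _ = ‖cexp (I * l * Φ z)‖ * ‖a (p, z)‖ := norm_mul _ _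
      _ ≤ 1 * |C| := by gcongr; exact (hC (p, z) ⟨hp, hz⟩).trans (le_abs_self C)
      _ = |C| := one_mul _
  | succ N ih =>
    obtain ⟨hr, hr0⟩ := contDiffOn_reduceAmplitude hΩ hO hK hKO hD hD0 he ha ha0
    obtain ⟨C, hC0, hC⟩ := ih hr hr0
    refine ⟨C, hC0, fun p hp Φ hΦ1 hΦ2 hΦ3 l hl => ?_⟩
    rw [integral_reduceAmplitude hΩ hO hK hKO hD hD0 he ha ha0 (hP₀Ω hp) hΦ1 hΦ2 hl.ne',
      norm_mul, norm_inv, norm_real, norm_of_nonneg hl.le]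
    calc _ ≤ l⁻¹ * (C * (l ^ N)⁻¹) := by gcongr; exact hC p hp Φ hΦ1 hΦ2 hΦ3 l hl
      _ = _ := by rw [pow_succ, mul_inv]; ring

end

section

variable {P : Type*} [NormedAddCommGroup P] [NormedSpace ℝ P]

/-- A polynomial of degree less than `n` which is `O(tⁿ)` vanishes. -/
lemma coeff_eq_zero_of_isBigO (n : ℕ) (c : ℕ → ℂ)
    (h : (fun t : ℝ => ∑ k ∈ Finset.range n, (t : ℂ) ^ k * c k) =O[𝓝[>] 0] fun t => t ^ n) :
    ∀ k < n, c k = 0 := by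
  induction n generalizing c with
  | zero => intro k hk; omega
  | succ n ih =>
    have h0 : c 0 = 0 := by
      have h1 : Tendsto (fun t : ℝ => ∑ k ∈ Finset.range (n + 1), (t : ℂ) ^ k * c k) (𝓝[>] 0)
          (𝓝 (∑ k ∈ Finset.range (n + 1), ((0 : ℝ) : ℂ) ^ k * c k)) := by
        refine Tendsto.mono_left (Continuous.tendsto ?_ 0) nhdsWithin_le_nhds
        fun_prop
      have h2 : Tendsto (fun t : ℝ => t ^ (n + 1)) (𝓝[>] 0) (𝓝 0) := by
        have : Tendsto (fun t : ℝ => t ^ (n + 1)) (𝓝 0) (𝓝 (0 ^ (n + 1))) :=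
          (continuous_pow (n + 1)).tendsto 0
        simpa using this.mono_left nhdsWithin_le_nhds
      have h3 := tendsto_nhds_unique h1 (h.trans_tendsto h2)
      rw [Finset.sum_range_succ'] at h3
      simpa using h3
    have h4 : (fun t : ℝ => ∑ k ∈ Finset.range n, (t : ℂ) ^ k * c (k + 1)) =O[𝓝[>] 0]
        fun t => t ^ n := by
      have h5 : (fun t : ℝ => ((t : ℂ))⁻¹) =O[𝓝[>] 0] fun t : ℝ => t⁻¹ :=
        IsBigO.of_bound 1 (.of_forall fun t => by simp)
      refine (h5.mul h).congr' ?_ ?_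
      · filter_upwards [self_mem_nhdsWithin] with t (ht : 0 < t)
        have ht' : (t : ℂ) ≠ 0 := by exact_mod_cast ht.ne'
        rw [Finset.sum_range_succ', h0, mul_zero, add_zero, mul_sum]
        refine sum_congr rfl fun k _ => ?_
        rw [pow_succ]
        field_simp
      · filter_upwards [self_mem_nhdsWithin] with t (ht : 0 < t)
        rw [pow_succ]
        field_simp
    intro k hk
    cases k with
    | zero => exact h0
    | succ k => exact ih _ h4 k (by omega)

/-- The derivative of a function on `ℝ × P` in a fixed direction. -/
def dirDeriv (w : ℝ × P) (S : ℝ × P → ℂ) : ℝ × P → ℂ := fun x => fderiv ℝ S x w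

variable {U : Set (ℝ × P)}

lemma ContDiffOn.dirDeriv (hU : IsOpen U) {S : ℝ × P → ℂ} (hS : SmoothOn S U)
    (w : ℝ × P) : SmoothOn (dirDeriv w S) U :=
  (hS.fderiv_of_isOpen hU (by simp)).clm_apply contDiffOn_const

lemma contDiffOn_iterate_dirDeriv (hU : IsOpen U) {S : ℝ × P → ℂ} (hS : SmoothOn S U)
    (w : ℝ × P) (k : ℕ) : SmoothOn ((dirDeriv w)^[k] S) U := by
  induction k with
  | zero => exact hS
  | succ k ih => rw [Function.iterate_succ_apply']; exact ContDiffOn.dirDeriv hU ih w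

lemma dirDeriv_comm (hU : IsOpen U) {S : ℝ × P → ℂ} (hS : SmoothOn S U)
    (v w : ℝ × P) : EqOn (dirDeriv v (dirDeriv w S)) (dirDeriv w (dirDeriv v S)) U := by
  intro x hx
  have h1 : ContDiffAt ℝ ∞ S x := hS.contDiffAt (hU.mem_nhds hx)
  have h2 : DifferentiableAt ℝ (fderiv ℝ S) x :=
    (h1.fderiv_right (m := ∞) (by simp)).differentiableAt (by simp)
  have h3 : IsSymmSndFDerivAt ℝ S x := h1.isSymmSndFDerivAt (by
    rw [minSmoothness_of_isRCLikeNormedField]; exact WithTop.coe_le_coe.2 le_top)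
  have h4 : ∀ a b : ℝ × P, dirDeriv a (dirDeriv b S) x = fderiv ℝ (fderiv ℝ S) x a b := by
    intro a b
    unfold dirDeriv
    rw [fderiv_clm_apply h2 (differentiableAt_const b)]
    simp
  rw [h4, h4, h3.eq]

lemma dirDeriv_congr (hU : IsOpen U) {S T : ℝ × P → ℂ} (h : EqOn S T U) (w : ℝ × P) :
    EqOn (dirDeriv w S) (dirDeriv w T) U := fun x hx => by
  unfold dirDeriv
  rw [(h.eventuallyEq_of_mem (hU.mem_nhds hx)).fderiv_eq]

lemma iterate_dirDeriv_comm (hU : IsOpen U) {S : ℝ × P → ℂ} (hS : SmoothOn S U)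
    (v w : ℝ × P) (k : ℕ) :
    EqOn ((dirDeriv w)^[k] (dirDeriv v S)) (dirDeriv v ((dirDeriv w)^[k] S)) U := by
  induction k with
  | zero => exact fun _ _ => rfl
  | succ k ih =>
    simp only [Function.iterate_succ_apply']
    exact (dirDeriv_congr hU ih w).trans
      (dirDeriv_comm hU (contDiffOn_iterate_dirDeriv hU hS w k) w v)

lemma iteratedDerivWithin_slice (hU : IsOpen U) {S : ℝ × P → ℂ} (hS : SmoothOn S U)
    {a : ℝ} (ha : 0 < a) {p : P} (hp : ∀ t ∈ Icc 0 a, (t, p) ∈ U) (k : ℕ) :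
    ∀ t ∈ Icc 0 a, iteratedDerivWithin k (fun t => S (t, p)) (Icc 0 a) t =
      (dirDeriv (1, 0))^[k] S (t, p) := by
  induction k with
  | zero => intro t _; simp
  | succ k ih =>
    intro t ht
    rw [iteratedDerivWithin_succ, derivWithin_congr ih (ih t ht), Function.iterate_succ_apply']
    have h1 := (hasFDerivAt_of_isOpen (contDiffOn_iterate_dirDeriv hU hS (1, 0) k) hU (hp t
      ht)).differentiableAt
    have h2 : HasDerivAt (fun t : ℝ => (t, p)) (1, 0) t :=
      (hasDerivAt_id t).prodMk (hasDerivAt_const t p)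
    have h3 := h1.hasFDerivAt.comp_hasDerivAt t h2
    exact h3.hasDerivWithinAt.derivWithin ((uniqueDiffOn_Icc ha) t ht)

lemma contDiffOn_slice {S : ℝ × P → ℂ} (hS : SmoothOn S U)
    {a : ℝ} {p : P} (hp : ∀ t ∈ Icc 0 a, (t, p) ∈ U) : SmoothOn (fun t => S (t, p)) (Icc 0 a) :=
  hS.comp (contDiff_id.prodMk contDiff_const).contDiffOn hp

lemma norm_sub_taylor_le (hU : IsOpen U) {S : ℝ × P → ℂ} (hS : SmoothOn S U)
    {a C : ℝ} (ha : 0 < a) {p : P} (hp : ∀ t ∈ Icc 0 a, (t, p) ∈ U) (n : ℕ)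
    (hC : ∀ t ∈ Icc 0 a, ‖(dirDeriv (1, 0))^[n + 1] S (t, p)‖ ≤ C) :
    ∀ t ∈ Icc 0 a, ‖S (t, p) - ∑ k ∈ Finset.range (n + 1), (t : ℂ) ^ k *
      ((k.factorial : ℂ)⁻¹ * (dirDeriv (1, 0))^[k] S (0, p))‖ ≤ C * t ^ (n + 1) := by
  intro t ht
  have h1 := taylor_mean_remainder_bound (f := fun t => S (t, p)) ha.le (n := n)
    ((contDiffOn_slice hS hp).of_le (by exact_mod_cast le_top)) ht (C := C) (by
      intro y hy
      rw [iteratedDerivWithin_slice hU hS ha hp _ y hy]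
      exact hC y hy)
  have hC0 : 0 ≤ C := (norm_nonneg _).trans (hC t ht)
  have h2 : C * (t - 0) ^ (n + 1) / (n.factorial : ℝ) ≤ C * t ^ (n + 1) := by
    rw [sub_zero]
    apply div_le_self (mul_nonneg hC0 (pow_nonneg ht.1 _))
    exact_mod_cast n.factorial_pos
  refine le_trans (le_of_eq ?_) (h1.trans h2)
  rw [taylor_within_apply]
  congr 2
  refine sum_congr rfl fun k _ => ?_
  rw [iteratedDerivWithin_slice hU hS ha hp _ 0 ⟨le_rfl, ha.le⟩, real_smul]
  push_cast
  ring

lemma iterate_dirDeriv_eq_zero_of_isBigO (hU : IsOpen U) {S : ℝ × P → ℂ}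
    (hS : SmoothOn S U) {p : P} (hp : (0, p) ∈ U) (n : ℕ)
    (h : (fun t => S (t, p)) =O[𝓝[>] 0] fun t : ℝ => t ^ n) :
    ∀ k < n, (dirDeriv (1, 0))^[k] S (0, p) = 0 := by
  cases n with
  | zero => intro k hk; omega
  | succ n =>
    have hev : ∀ᶠ t : ℝ in 𝓝 0, (t, p) ∈ U :=
      (Continuous.prodMk continuous_id continuous_const).tendsto (0 : ℝ) (hU.mem_nhds hp)
    obtain ⟨a, ha, hball⟩ := eventually_nhds_iff_ball.1 hev
    have hsub : ∀ t ∈ Icc 0 (a / 2), (t, p) ∈ U := fun t ht => hball t (by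
      rw [mem_ball, Real.dist_eq, sub_zero, abs_of_nonneg ht.1]; linarith [ht.2])
    have hcont : ContinuousOn (fun t => (dirDeriv (1, 0))^[n + 1] S (t, p)) (Icc 0 (a / 2)) :=
      (contDiffOn_slice (contDiffOn_iterate_dirDeriv hU hS _ _) hsub).continuousOn
    obtain ⟨C, hC⟩ := isCompact_Icc.exists_bound_of_continuousOn hcont
    have h1 := norm_sub_taylor_le hU hS (half_pos ha) hsub n hC
    have h2 : (fun t : ℝ => S (t, p) - ∑ k ∈ Finset.range (n + 1), (t : ℂ) ^ k *
        ((k.factorial : ℂ)⁻¹ * (dirDeriv (1, 0))^[k] S (0, p))) =O[𝓝[>] 0]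
        fun t => t ^ (n + 1) := by
      refine IsBigO.of_bound C ?_
      filter_upwards [Ioc_mem_nhdsGT (half_pos ha)] with t ht
      rw [norm_of_nonneg (pow_nonneg ht.1.le _)]
      exact h1 t ⟨ht.1.le, ht.2⟩
    have h3 := (h.sub h2).congr_left (fun t => sub_sub_cancel _ _)
    intro k hk
    have h4 := coeff_eq_zero_of_isBigO _ _ h3 k hk
    exact (mul_eq_zero.1 h4).resolve_left (by simpa using Nat.factorial_ne_zero k)

/-- A smooth function which is `O(tⁿ)` for each value of the parameter is so uniformly on compact
sets. -/
lemma exists_bound_of_isBigO (hU : IsOpen U) {S : ℝ × P → ℂ} (hS : SmoothOn S U)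
    {K : Set P} (hK : IsCompact K) {a : ℝ} (ha : 0 < a) (hsub : Icc 0 a ×ˢ K ⊆ U) (n : ℕ)
    (h : ∀ p ∈ K, (fun t => S (t, p)) =O[𝓝[>] 0] fun t : ℝ => t ^ (n + 1)) :
    ∃ C : ℝ, 0 ≤ C ∧ ∀ p ∈ K, ∀ t ∈ Icc 0 a, ‖S (t, p)‖ ≤ C * t ^ (n + 1) := by
  obtain ⟨C, hC⟩ := (isCompact_Icc.prod hK).exists_bound_of_continuousOn
    ((contDiffOn_iterate_dirDeriv hU hS (1, 0) (n + 1)).continuousOn.mono hsub)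
  refine ⟨|C|, abs_nonneg _, fun p hp t ht => ?_⟩
  have h1 := norm_sub_taylor_le hU hS ha (p := p) (fun t ht => hsub ⟨ht, hp⟩) n (C := |C|)
    (fun t ht => (hC (t, p) ⟨ht, hp⟩).trans (le_abs_self C)) t ht
  rwa [Finset.sum_eq_zero, sub_zero] at h1
  intro k hk
  rw [iterate_dirDeriv_eq_zero_of_isBigO hU hS (hsub ⟨⟨le_rfl, ha.le⟩, hp⟩) (n + 1) (h p hp) k
    (Finset.mem_range.1 hk), mul_zero, mul_zero]

/-- Differentiation in the parameters preserves the order of vanishing in `t`. -/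
lemma isBigO_dirDeriv (hU : IsOpen U) {S : ℝ × P → ℂ} (hS : SmoothOn S U) (n : ℕ)
    {p : P} (hp : (0, p) ∈ U)
    (h : ∀ᶠ q in 𝓝 p, (fun t => S (t, q)) =O[𝓝[>] 0] fun t : ℝ => t ^ (n + 1)) (v : P) :
    (fun t => dirDeriv (0, v) S (t, p)) =O[𝓝[>] 0] fun t : ℝ => t ^ (n + 1) := by
  have hv := ContDiffOn.dirDeriv hU hS (0, v)
  have hz : ∀ k < n + 1, (dirDeriv (1, 0))^[k] (dirDeriv (0, v) S) (0, p) = 0 := by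
    intro k hk
    rw [iterate_dirDeriv_comm hU hS (0, v) (1, 0) k hp]
    have hk1 := (hasFDerivAt_of_isOpen (contDiffOn_iterate_dirDeriv hU hS (1, 0) k) hU
      hp).differentiableAt
    have h2 : HasFDerivAt (fun q : P => (0, q)) (ContinuousLinearMap.inr ℝ ℝ P) p :=
      hasFDerivAt_prodMk_right 0 p
    have h3 := hk1.hasFDerivAt.comp p h2
    have hUp : ∀ᶠ q in 𝓝 p, ((0 : ℝ), q) ∈ U :=
      (Continuous.prodMk continuous_const continuous_id).tendsto p (hU.mem_nhds hp)
    have h4 : ((dirDeriv (1, 0))^[k] S ∘ fun q : P => ((0 : ℝ), q)) =ᶠ[𝓝 p] fun _ => 0 := by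
      filter_upwards [h, hUp] with q hq hqU
      exact iterate_dirDeriv_eq_zero_of_isBigO hU hS hqU _ hq k hk
    have h5 := h3.fderiv
    rw [h4.fderiv_eq, fderiv_fun_const] at h5
    have h6 := congrArg (fun L => L v) h5
    simpa [dirDeriv] using h6.symm
  have hev : ∀ᶠ t : ℝ in 𝓝 0, (t, p) ∈ U :=
    (Continuous.prodMk continuous_id continuous_const).tendsto (0 : ℝ) (hU.mem_nhds hp)
  obtain ⟨a, ha, hball⟩ := eventually_nhds_iff_ball.1 hev
  have hsub : ∀ t ∈ Icc 0 (a / 2), (t, p) ∈ U := fun t ht => hball t (by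
    rw [mem_ball, Real.dist_eq, sub_zero, abs_of_nonneg ht.1]; linarith [ht.2])
  have hcont : ContinuousOn (fun t => (dirDeriv (1, 0))^[n + 1] (dirDeriv (0, v) S) (t, p))
      (Icc 0 (a / 2)) :=
    (contDiffOn_slice (contDiffOn_iterate_dirDeriv hU hv _ _) hsub).continuousOn
  obtain ⟨C, hC⟩ := isCompact_Icc.exists_bound_of_continuousOn hcont
  have h1 := norm_sub_taylor_le hU hv (half_pos ha) hsub n hC
  refine IsBigO.of_bound C ?_
  filter_upwards [Ioc_mem_nhdsGT (half_pos ha)] with t ht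
  have h2 := h1 t ⟨ht.1.le, ht.2⟩
  rw [Finset.sum_eq_zero, sub_zero] at h2
  · rwa [norm_of_nonneg (pow_nonneg ht.1.le _)]
  · intro k hk
    rw [hz k (Finset.mem_range.1 hk), mul_zero, mul_zero]

end

section

/-- A smooth function with compact support in the punctured space. -/
structure IsTest (Ψ : 𝔼 → ℂ) : Prop where
  smooth : Smooth Ψ
  compact : HasCompactSupport Ψ
  zero_notMem : (0 : 𝔼) ∉ tsupport Ψ

/-- The derivative in a fixed direction. -/
def lineD (v : 𝔼) (Ψ : 𝔼 → ℂ) : 𝔼 → ℂ := fun ξ => fderiv ℝ Ψ ξ v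

variable {Ψ Ψ₁ Ψ₂ : 𝔼[d] → ℂ}

namespace IsTest

lemma of_tsupport_subset (h : IsTest Ψ) (h1 : Smooth Ψ₁) (h2 : tsupport Ψ₁ ⊆ tsupport Ψ) :
    IsTest Ψ₁ :=
  ⟨h1, h.compact.of_isClosed_subset (isClosed_tsupport _) h2, fun h0 => h.zero_notMem (h2 h0)⟩

lemma contDiff_fderiv (h : IsTest Ψ) : Smooth (fderiv ℝ Ψ) := h.smooth.fderiv_right (by simp)

lemma lineD (h : IsTest Ψ) (v : 𝔼) : IsTest (lineD v Ψ) :=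
  h.of_tsupport_subset (h.contDiff_fderiv.clm_apply contDiff_const) (tsupport_fderiv_apply_subset ℝ
    v)

lemma radial (h : IsTest Ψ) : IsTest (fun ξ => fderiv ℝ Ψ ξ ξ) := by
  refine h.of_tsupport_subset (h.contDiff_fderiv.clm_apply contDiff_id) ?_
  refine (closure_mono ?_).trans (tsupport_fderiv_subset ℝ)
  intro x hx h0
  exact hx (by simp [h0])

lemma sum {ι : Type*} [Fintype ι] {f : ι → 𝔼 → ℂ}
    (h : ∀ i, IsTest (f i)) : IsTest (fun ξ => ∑ i, f i ξ) := by
  have hsub : tsupport (fun ξ => ∑ i, f i ξ) ⊆ ⋃ i, tsupport (f i) := by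
    refine closure_minimal ?_ (isClosed_iUnion_of_finite fun i => isClosed_tsupport _)
    intro x hx
    obtain ⟨i, -, hi⟩ := Finset.exists_ne_zero_of_sum_ne_zero hx
    exact mem_iUnion.2 ⟨i, subset_tsupport _ hi⟩
  refine ⟨ContDiff.sum fun i _ => (h i).smooth, ?_, fun h0 => ?_⟩
  · exact (isCompact_iUnion fun i => (h i).compact).of_isClosed_subset (isClosed_tsupport _) hsub
  · obtain ⟨i, hi⟩ := mem_iUnion.1 (hsub h0)
    exact (h i).zero_notMem hi

lemma integrable (h : IsTest Ψ) : Integrable Ψ :=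
  h.smooth.continuous.integrable_of_hasCompactSupport h.compact

lemma integrable_mul (h : IsTest Ψ) {f : 𝔼 → ℂ}
    (hf : ContinuousOn f {0}ᶜ) : Integrable (fun ξ => f ξ * Ψ ξ) := by
  have hc : Continuous (fun ξ => f ξ * Ψ ξ) := by
    rw [continuous_iff_continuousAt]
    intro x
    by_cases hx : x ∈ tsupport Ψ
    · have hx0 : x ≠ 0 := fun h0 => h.zero_notMem (h0 ▸ hx)
      exact (hf.continuousAt (isOpen_compl_singleton.mem_nhds hx0)).mul
        h.smooth.continuous.continuousAt
    · have : (fun ξ => f ξ * Ψ ξ) =ᶠ[𝓝 x] fun _ => 0 := by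
        filter_upwards [(isClosed_tsupport Ψ).isOpen_compl.mem_nhds hx] with y hy
        rw [image_eq_zero_of_notMem_tsupport hy, mul_zero]
      exact (continuousAt_const (y := (0 : ℂ))).congr this.symm
  exact hc.integrable_of_hasCompactSupport h.compact.mul_left

lemma integral_mul_lineD (h : IsTest Ψ) {f : 𝔼 → ℂ} (hf : ContDiffOn ℝ 1 f {0}ᶜ) (v : 𝔼) :
    ∫ ξ, f ξ * LeviCivita.lineD v Ψ ξ = -∫ ξ, fderiv ℝ f ξ v * Ψ ξ := by
  have hf' : ContinuousOn (fun ξ => fderiv ℝ f ξ v) {0}ᶜ :=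
    (hf.continuousOn_fderiv_of_isOpen isOpen_compl_singleton le_rfl |>.clm_apply continuousOn_const)
  refine integral_mul_fderiv_eq_neg_fderiv_mul_of_integrable (h.integrable_mul hf')
    ((h.lineD v).integrable_mul hf.continuousOn) (h.integrable_mul hf.continuousOn) ?_
    fun x _ => h.smooth.differentiable (by simp) x
  intro x hx
  exact (hf.contDiffAt (isOpen_compl_singleton.mem_nhds fun h0 =>
    h.zero_notMem (h0 ▸ hx))).differentiableAt one_ne_zero

end IsTest

lemma fderiv_apply_eq_sum (f : 𝔼 → ℂ) (ξ v : 𝔼) :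
    fderiv ℝ f ξ v = ∑ j, (v j : ℂ) * lineD (stdVec j) f ξ := by
  have : v = ∑ j, v j • stdVec j := by
    have := (EuclideanSpace.basisFun (Fin d) ℝ).sum_repr v
    simpa using this.symm
  conv_lhs => rw [this, map_sum]
  refine sum_congr rfl fun j _ => ?_
  rw [map_smul, real_smul]
  rfl

lemma contDiffOn_norm_ofReal : ContDiffOn ℝ 1 (fun ξ : 𝔼 => ((‖ξ‖ : ℝ) : ℂ)) {0}ᶜ := by
  have := (contDiffOn_id (𝕜 := ℝ) (E := 𝔼) (n := 1) (s := {0}ᶜ)).norm ℝ (fun x hx => hx)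
  exact ofRealCLM.contDiff.comp_contDiffOn this

lemma fderiv_norm_ofReal {ξ : 𝔼} (hξ : ξ ≠ 0) (v : 𝔼) : fderiv ℝ (fun ξ : 𝔼 => ((‖ξ‖ : ℝ) : ℂ)) ξ v
      = ((inner ℝ ξ v / ‖ξ‖ : ℝ) : ℂ) := by
  have h1 : HasStrictFDerivAt (fun ξ : 𝔼 => ‖ξ‖ ^ 2) (2 • innerSL ℝ ξ) ξ :=
    hasStrictFDerivAt_norm_sq ξ
  have hn : ‖ξ‖ ≠ 0 := norm_ne_zero_iff.2 hξ
  have h2 := h1.hasFDerivAt.sqrt (by positivity)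
  have h3 : (fun ξ : 𝔼 => √(‖ξ‖ ^ 2)) = fun ξ => ‖ξ‖ := by ext x; exact sqrt_sq (norm_nonneg x)
  rw [h3] at h2
  have h4 := ofRealCLM.hasFDerivAt.comp ξ h2
  have h5 := h4.fderiv
  simp only [Function.comp_def, Complex.ofRealCLM_apply] at h5
  rw [h5]
  simp [sqrt_sq (norm_nonneg ξ)]
  field_simp

lemma integral_norm_laplacian (h : IsTest Ψ) :
    ∫ ξ, (((‖ξ‖ : ℝ) : ℂ) * ∑ j, lineD (stdVec j) (lineD (stdVec j) Ψ) ξ +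
      ((‖ξ‖⁻¹ : ℝ) : ℂ) * fderiv ℝ Ψ ξ ξ) = 0 := by
  have hn := contDiffOn_norm_ofReal (d := d)
  have hinv : ContinuousOn (fun ξ : 𝔼 => ((‖ξ‖⁻¹ : ℝ) : ℂ)) {0}ᶜ :=
    continuous_ofReal.comp_continuousOn
      (continuous_norm.continuousOn.inv₀ fun x hx => norm_ne_zero_iff.2 hx)
  have hj : ∀ j, ∫ ξ, ((‖ξ‖ : ℝ) : ℂ) * lineD (stdVec j) (lineD (stdVec j) Ψ) ξ =
      -∫ ξ, ((‖ξ‖⁻¹ : ℝ) : ℂ) * ((ξ j : ℂ) * lineD (stdVec j) Ψ ξ) := by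
    intro j
    rw [(h.lineD (stdVec j)).integral_mul_lineD hn]
    congr 2
    ext ξ
    by_cases hξ : ξ = 0
    · have : lineD (stdVec j) Ψ ξ = 0 :=
        image_eq_zero_of_notMem_tsupport (hξ ▸ (h.lineD (stdVec j)).zero_notMem)
      simp [this]
    · rw [fderiv_norm_ofReal hξ]
      simp [EuclideanSpace.inner_single_right]
      ring
  have hi1 : ∀ j, Integrable fun ξ => ((‖ξ‖ : ℝ) : ℂ) * lineD (stdVec j) (lineD (stdVec j) Ψ) ξ :=
    fun j => ((h.lineD _).lineD _).integrable_mul hn.continuousOn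
  have hc : ∀ j, ContinuousOn (fun ξ : 𝔼 => ((‖ξ‖⁻¹ : ℝ) : ℂ) * (ξ j : ℂ)) {0}ᶜ := fun j => hinv.mul
    ((continuous_ofReal.comp (by fun_prop)).continuousOn)
  have hi2 : ∀ j, Integrable fun ξ : 𝔼 => ((‖ξ‖⁻¹ : ℝ) : ℂ) * ((ξ j : ℂ) * lineD (stdVec j) Ψ ξ) :=
    fun j => ((h.lineD (stdVec j)).integrable_mul (hc j)).congr (ae_of_all _ fun ξ => by ring)
  simp_rw [fderiv_apply_eq_sum Ψ, mul_sum]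
  rw [integral_add (integrable_finsetSum _ fun j _ => hi1 j)
    (integrable_finsetSum _ fun j _ => hi2 j), integral_finsetSum _ fun j _ => hi1 j,
    integral_finsetSum _ fun j _ => hi2 j, sum_congr rfl fun j _ => hj j]
  simp

lemma integral_normSq_laplacian (h : IsTest Ψ) :
    ∫ ξ, (((‖ξ‖ ^ 2 : ℝ) : ℂ) * ∑ j, lineD (stdVec j) (lineD (stdVec j) Ψ) ξ +
      2 * fderiv ℝ Ψ ξ ξ) = 0 := by
  have hn : ContDiffOn ℝ 1 (fun ξ : 𝔼 => ((‖ξ‖ ^ 2 : ℝ) : ℂ)) {0}ᶜ :=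
    (ofRealCLM.contDiff.comp (contDiff_norm_sq ℝ)).contDiffOn
  have hj : ∀ j, ∫ ξ, ((‖ξ‖ ^ 2 : ℝ) : ℂ) * lineD (stdVec j) (lineD (stdVec j) Ψ) ξ =
      -∫ ξ, 2 * ((ξ j : ℂ) * lineD (stdVec j) Ψ ξ) := by
    intro j
    rw [(h.lineD (stdVec j)).integral_mul_lineD hn]
    congr 2
    ext ξ
    have h4 := (ofRealCLM.hasFDerivAt.comp ξ (hasStrictFDerivAt_norm_sq ξ).hasFDerivAt).fderiv
    simp only [Function.comp_def, Complex.ofRealCLM_apply] at h4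
    rw [h4]
    simp [EuclideanSpace.inner_single_right]
    ring
  have hi1 : ∀ j, Integrable fun ξ => ((‖ξ‖ ^ 2 : ℝ) : ℂ) *
      lineD (stdVec j) (lineD (stdVec j) Ψ) ξ :=
    fun j => ((h.lineD _).lineD _).integrable_mul hn.continuousOn
  have hi2 : ∀ j, Integrable fun ξ : 𝔼 => 2 * ((ξ j : ℂ) * lineD (stdVec j) Ψ ξ) :=
    fun j => ((h.lineD (stdVec j)).integrable_mul (f := fun ξ => 2 * (ξ j : ℂ))
      (by fun_prop)).congr (ae_of_all _ fun ξ => by ring)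
  simp_rw [fderiv_apply_eq_sum Ψ, mul_sum]
  rw [integral_add (integrable_finsetSum _ fun j _ => hi1 j)
    (integrable_finsetSum _ fun j _ => hi2 j), integral_finsetSum _ fun j _ => hi1 j,
    integral_finsetSum _ fun j _ => hi2 j, sum_congr rfl fun j _ => hj j]
  simp

lemma integral_inv_normSq_radial (h : IsTest Ψ) :
    ∫ ξ, ((‖ξ‖ ^ 2 : ℝ) : ℂ)⁻¹ * fderiv ℝ Ψ ξ ξ = (2 - d) * ∫ ξ, ((‖ξ‖ ^ 2 : ℝ) : ℂ)⁻¹ * Ψ ξ := by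
  set f : 𝔼 → ℂ := fun ξ => ((‖ξ‖ ^ 2 : ℝ) : ℂ)⁻¹ with hf
  have hne : ∀ ξ : 𝔼, ξ ≠ 0 → ((‖ξ‖ ^ 2 : ℝ) : ℂ) ≠ 0 := fun ξ hξ => by
    have := norm_ne_zero_iff.2 hξ
    exact_mod_cast pow_ne_zero 2 this
  have hn : ContDiff ℝ 1 (fun ξ : 𝔼 => ((‖ξ‖ ^ 2 : ℝ) : ℂ)) :=
    ofRealCLM.contDiff.comp (contDiff_norm_sq ℝ)
  have hfC : ContDiffOn ℝ 1 f {0}ᶜ := hn.contDiffOn.inv fun x hx => hne x hx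
  have hxj : ∀ j, ContDiff ℝ 1 (fun ξ : 𝔼 => (ξ j : ℂ)) := fun j => ofRealCLM.contDiff.comp
      (EuclideanSpace.proj j : 𝔼 →L[ℝ] ℝ).contDiff
  have hfj : ∀ j, ContDiffOn ℝ 1 (fun ξ : 𝔼 => f ξ * (ξ j : ℂ)) {0}ᶜ :=
    fun j => hfC.mul (hxj j).contDiffOn
  have hder : ∀ j, ∀ ξ : 𝔼, ξ ≠ 0 → fderiv ℝ (fun ξ : 𝔼 => f ξ * (ξ j : ℂ)) ξ (stdVec j) =
      f ξ - 2 * (ξ j : ℂ) ^ 2 * f ξ ^ 2 := by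
    intro j ξ hξ
    have h1 : HasFDerivAt (fun ξ : 𝔼 => ((‖ξ‖ ^ 2 : ℝ) : ℂ)) (ofRealCLM.comp (2 • innerSL ℝ ξ)) ξ :=
      ofRealCLM.hasFDerivAt.comp ξ (hasStrictFDerivAt_norm_sq ξ).hasFDerivAt
    have h2 : HasFDerivAt (fun ξ : 𝔼 => (ξ j : ℂ))
        (ofRealCLM.comp (EuclideanSpace.proj j : 𝔼 →L[ℝ] ℝ)) ξ :=
      ofRealCLM.hasFDerivAt.comp ξ (EuclideanSpace.proj j : 𝔼 →L[ℝ] ℝ).hasFDerivAt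
    have h3 := ((hasDerivAt_inv (hne ξ hξ)).hasFDerivAt.restrictScalars ℝ).comp ξ h1
    have h4 := h3.mul h2
    rw [show (fun ξ : 𝔼 => f ξ * (ξ j : ℂ)) =
      (Inv.inv ∘ fun ξ : 𝔼 => ((‖ξ‖ ^ 2 : ℝ) : ℂ)) * fun ξ => (ξ j : ℂ) from rfl, h4.fderiv]
    have := hne ξ hξ
    simp [EuclideanSpace.inner_single_right, hf] at this ⊢
    field_simp
    ring
  have hj : ∀ j, ∫ ξ, f ξ * (ξ j : ℂ) * lineD (stdVec j) Ψ ξ =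
      -∫ ξ, (f ξ - 2 * (ξ j : ℂ) ^ 2 * f ξ ^ 2) * Ψ ξ := by
    intro j
    rw [h.integral_mul_lineD (hfj j)]
    congr 2
    ext ξ
    by_cases hξ : ξ = 0
    · have : Ψ ξ = 0 := image_eq_zero_of_notMem_tsupport (hξ ▸ h.zero_notMem)
      simp [this]
    · rw [hder j ξ hξ]
  have hi1 : ∀ j, Integrable fun ξ => f ξ * (ξ j : ℂ) * lineD (stdVec j) Ψ ξ :=
    fun j => (h.lineD _).integrable_mul (hfj j).continuousOn
  have hi2 : ∀ j, Integrable fun ξ : 𝔼 =>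
      (f ξ - 2 * (ξ j : ℂ) ^ 2 * f ξ ^ 2) * Ψ ξ := fun j => h.integrable_mul
    (hfC.continuousOn.sub (((continuous_const.mul ((hxj j).continuous.pow 2)).continuousOn).mul
      (hfC.continuousOn.pow 2)))
  have e1 : ∀ ξ, f ξ * fderiv ℝ Ψ ξ ξ = ∑ j, f ξ * (ξ j : ℂ) * lineD (stdVec j) Ψ ξ := by
    intro ξ
    rw [fderiv_apply_eq_sum Ψ, mul_sum]
    exact sum_congr rfl fun j _ => by ring
  change ∫ ξ, f ξ * fderiv ℝ Ψ ξ ξ = (2 - d) * ∫ ξ, f ξ * Ψ ξ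
  simp_rw [e1]
  rw [integral_finsetSum _ fun j _ => hi1 j, sum_congr rfl fun j _ => hj j,
    Finset.sum_neg_distrib, ← integral_finsetSum _ fun j _ => hi2 j, ← integral_neg,
    ← integral_const_mul]
  congr 1
  ext ξ
  by_cases hξ : ξ = 0
  · have : Ψ ξ = 0 := image_eq_zero_of_notMem_tsupport (hξ ▸ h.zero_notMem)
    simp [this]
  rw [← sum_mul, Finset.sum_sub_distrib, ← sum_mul, ← mul_sum]
  have hs : ∑ j, (ξ j : ℂ) ^ 2 = ((‖ξ‖ ^ 2 : ℝ) : ℂ) := by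
    rw [EuclideanSpace.norm_sq_eq]
    push_cast
    refine sum_congr rfl fun j _ => ?_
    rw [← ofReal_pow, ← ofReal_pow]
    simp
  rw [hs]
  have := hne ξ hξ
  simp only [hf, Finset.sum_const, Finset.card_univ, Fintype.card_fin, nsmul_eq_mul]
  field_simp
  ring

lemma lineD_lineD_self (h : IsTest Ψ) (ξ : 𝔼) :
    lineD ξ (lineD ξ Ψ) ξ = fderiv ℝ (fun ζ => fderiv ℝ Ψ ζ ζ) ξ ξ - fderiv ℝ Ψ ξ ξ := by
  have h2 : DifferentiableAt ℝ (fderiv ℝ Ψ) ξ := h.contDiff_fderiv.differentiable (by simp) ξ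
  unfold lineD
  rw [fderiv_clm_apply h2 (differentiableAt_const ξ), fderiv_clm_apply h2 differentiableAt_fun_id]
  simp

lemma integral_inv_normSq_lineD (h : IsTest Ψ) :
    ∫ ξ, ((‖ξ‖ ^ 2 : ℝ) : ℂ)⁻¹ * lineD ξ (lineD ξ Ψ) ξ =
      (d - 1) * (d - 2) * ∫ ξ, ((‖ξ‖ ^ 2 : ℝ) : ℂ)⁻¹ * Ψ ξ := by
  have hf : ContinuousOn (fun ξ : 𝔼 => ((‖ξ‖ ^ 2 : ℝ) : ℂ)⁻¹) {0}ᶜ := by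
    refine ContinuousOn.inv₀ (by fun_prop) fun x hx => ?_
    exact_mod_cast pow_ne_zero 2 (norm_ne_zero_iff.2 hx)
  simp_rw [lineD_lineD_self h, mul_sub]
  rw [integral_sub (h.radial.radial.integrable_mul hf) (h.radial.integrable_mul hf),
    integral_inv_normSq_radial h.radial, integral_inv_normSq_radial h]
  ring

/-- The (unnormalised) inverse Fourier transform of a test function. -/
def wavelet (Ψ : 𝔼 → ℂ) (z : 𝔼) : ℂ := ∫ ξ, cexp (-(I * (inner ℝ ξ z : ℝ))) * Ψ ξ

lemma wavelet_eq_fourier (Ψ : 𝔼 → ℂ) (z : 𝔼) : wavelet Ψ z = 𝓕 Ψ ((2 * π)⁻¹ • z) := by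
  rw [Real.fourier_eq']
  unfold wavelet
  congr 1
  ext ξ
  rw [smul_eq_mul, inner_smul_right]
  congr 2
  have : (π : ℂ) ≠ 0 := by exact_mod_cast Real.pi_ne_zero
  push_cast
  field_simp

namespace IsTest

lemma exists_schwartz (h : IsTest Ψ) : ∃ S : SchwartzMap 𝔼 ℂ,
    ∀ z, wavelet Ψ z = S ((2 * π)⁻¹ • z) := by
  refine ⟨𝓕 (h.compact.toSchwartzMap h.smooth), fun z => ?_⟩
  rw [wavelet_eq_fourier, SchwartzMap.fourier_coe]
  rfl

lemma continuous_wavelet (h : IsTest Ψ) : Continuous (wavelet Ψ) := by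
  obtain ⟨S, hS⟩ := h.exists_schwartz
  rw [funext hS]
  exact S.continuous.comp (continuous_const_smul _)

lemma integrable_pow_mul_wavelet (h : IsTest Ψ) (k : ℕ) :
    Integrable fun z : 𝔼 => ‖z‖ ^ k * ‖wavelet Ψ z‖ := by
  obtain ⟨S, hS⟩ := h.exists_schwartz
  have h1 := (SchwartzMap.integrable_pow_mul volume S k).comp_smul (R := (2 * π)⁻¹) (by positivity)
  refine (h1.const_mul ((2 * π) ^ k)).congr (ae_of_all _ fun z => ?_)
  simp only [hS]
  rw [norm_smul, norm_of_nonneg (by positivity), ← mul_assoc, ← mul_pow, ← mul_assoc,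
    mul_inv_cancel₀ (by positivity), one_mul]

lemma integrable_wavelet (h : IsTest Ψ) : Integrable (wavelet Ψ) := by
  have := h.integrable_pow_mul_wavelet 0
  simp only [pow_zero, one_mul] at this
  exact (integrable_norm_iff h.continuous_wavelet.aestronglyMeasurable).1 this

lemma integral_exp_mul_wavelet (h : IsTest Ψ) (θ : 𝔼) :
    ∫ z, 𝐞[z, θ] * wavelet Ψ z = (2 * π) ^ d * Ψ θ := by
  obtain ⟨S, hS⟩ := h.exists_schwartz
  have hF : 𝓕 Ψ = S := by
    ext w
    have := hS ((2 * π) • w)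
    rw [wavelet_eq_fourier, smul_smul, inv_mul_cancel₀ (by positivity), one_smul] at this
    exact this
  have h1 := Continuous.fourierInv_fourier_eq h.smooth.continuous h.integrable
    (by rw [hF]; exact S.integrable)
  have h2 := congrFun h1 θ
  rw [Real.fourierInv_eq'] at h2
  have h3 := Measure.integral_comp_smul (volume : Measure 𝔼)
    (fun w => cexp ((2 * π * inner ℝ w θ : ℝ) * I) • 𝓕 Ψ w) ((2 * π)⁻¹)
  rw [h2, finrank_euclideanSpace_fin] at h3
  have h4 : ∫ z, 𝐞[z, θ] * wavelet Ψ z = ∫ z : 𝔼, cexp ((2 * π *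
        inner ℝ ((2 * π)⁻¹ • z) θ : ℝ) * I) • 𝓕 Ψ ((2 * π)⁻¹ • z) := by
    congr 1
    ext z
    rw [wavelet_eq_fourier, smul_eq_mul, inner_smul_left]
    congr 2
    have : (π : ℂ) ≠ 0 := by exact_mod_cast Real.pi_ne_zero
    push_cast
    simp
    field_simp
  rw [h4, h3, abs_of_nonneg (by positivity), real_smul]
  push_cast
  rw [inv_pow, inv_inv]

lemma inner_mul_wavelet (h : IsTest Ψ) (v z : 𝔼) :
    ((inner ℝ v z : ℝ) : ℂ) * wavelet Ψ z = wavelet (fun ξ => -I * LeviCivita.lineD v Ψ ξ) z := by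
  have he : ∀ ξ, HasFDerivAt (fun ξ : 𝔼 => cexp (-(I * (inner ℝ ξ z : ℝ))))
      (cexp (-(I * (inner ℝ ξ z : ℝ))) • (-(I • ofRealCLM.comp (innerSL ℝ z)))) ξ := by
    intro ξ
    have h1 : HasFDerivAt (fun ξ : 𝔼 => ((inner ℝ ξ z : ℝ) : ℂ))
        (ofRealCLM.comp (innerSL ℝ z)) ξ := by
      have := (ofRealCLM.comp (innerSL ℝ z)).hasFDerivAt (x := ξ)
      refine this.congr_of_eventuallyEq (.of_forall fun x => ?_)
      simp [real_inner_comm]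
    exact ((h1.const_mul I).neg).cexp
  have hC : ContDiffOn ℝ 1 (fun ξ : 𝔼 => cexp (-(I * (inner ℝ ξ z : ℝ)))) {0}ᶜ := by
    refine ContDiff.contDiffOn ?_
    refine (contDiff_const.mul ?_).neg.cexp
    exact ofRealCLM.contDiff.comp (contDiff_id.inner ℝ contDiff_const)
  have h2 := h.integral_mul_lineD hC v
  unfold wavelet
  have e1 : ∀ ξ, cexp (-(I * (inner ℝ ξ z : ℝ))) * (-I * LeviCivita.lineD v Ψ ξ)
      = -I * (cexp (-(I * (inner ℝ ξ z : ℝ))) * LeviCivita.lineD v Ψ ξ) := fun ξ => by ring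
  simp_rw [e1]
  rw [integral_const_mul, h2, ← integral_neg, ← integral_const_mul, ← integral_const_mul]
  congr 1
  ext ξ
  rw [(he ξ).fderiv]
  simp [real_inner_comm]
  linear_combination ((inner ℝ v z : ℝ) * cexp (-(I * (inner ℝ z ξ : ℝ))) * Ψ ξ) * I_sq

end IsTest

lemma ae_ne_zero [Nonempty (Fin d)] : ∀ᵐ x : 𝔼, x ≠ 0 :=
  measure_eq_zero_iff_ae_notMem.1 (measure_singleton 0)

end

section

/-- The data of the oscillatory integral at a fixed point `y`, in normal coordinates `z` at `y` and
for covectors `θ` with components in an orthonormal frame: `f` is the phase, `W` the homogeneous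
amplitude, `β` the amplitude including the cut-off. -/
structure FlatModel (ε a a' : ℝ) (f W β : 𝔼 × 𝔼 → ℂ) (s : 𝔼 → ℂ) (c : ℕ → 𝔼 → ℂ) : Prop where
  eps_pos : 0 < ε
  a'_pos : 0 < a'
  a'_lt : a' < a
  f_smooth : SmoothOn f (ball 0 a ×ˢ {0}ᶜ)
  f_hom : ∀ z ∈ ball (0 : 𝔼) a, ∀ θ, θ ≠ 0 → ∀ l : ℝ, 0 < l → f (z, l • θ) = l * f (z, θ)
  f_im : ∀ z ∈ ball (0 : 𝔼) a, ∀ θ, θ ≠ 0 → 0 ≤ (f (z, θ)).im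
  f_grad : ∀ z ∈ ball (0 : 𝔼) a, ∀ θ, θ ≠ 0 → ‖θ‖ ^ 2 / 2 < (fderiv ℝ f (z, θ) (θ, 0)).re
  f_jet : ∀ z θ, θ ≠ 0 → (fun t : ℝ => f (t • z, θ) - (t * (inner ℝ z θ : ℝ) +
    I * ε / 2 * t ^ 2 * ‖θ‖ * ‖z‖ ^ 2)) =O[𝓝[>] 0] fun t : ℝ => t ^ 4
  W_smooth : SmoothOn W (univ ×ˢ {0}ᶜ)
  W_supp : ∀ z ∉ closedBall (0 : 𝔼) a', ∀ θ, W (z, θ) = 0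
  W_hom : ∀ z θ, θ ≠ 0 → ∀ l : ℝ, 0 < l → W (z, l • θ) = W (z, θ)
  W_jet : ∀ z θ, θ ≠ 0 → (fun t : ℝ => W (t • z, θ) - (1 + I * ε / 2 * t *
    ((inner ℝ z θ : ℝ) / ‖θ‖) + ε ^ 2 / 8 * t ^ 2 * ((inner ℝ z θ : ℝ) / ‖θ‖) ^ 2)) =O[𝓝[>] 0]
      fun t : ℝ => t ^ 3
  β_eq : ∀ z θ, 1 ≤ ‖θ‖ → β (z, θ) = W (z, θ)
  β_cont : ContinuousOn β (univ ×ˢ {0}ᶜ)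
  β_supp : ∀ z ∉ closedBall (0 : 𝔼) a', ∀ θ, β (z, θ) = 0
  β_zero : ∀ z θ, θ ≠ 0 → ‖θ‖ ≤ 1 / 2 → β (z, θ) = 0
  s_cont : ContinuousOn s {0}ᶜ
  c_cont : ∀ k, ContinuousOn (c k) {0}ᶜ
  c_hom : ∀ k θ, θ ≠ 0 → ∀ l : ℝ, 0 < l → c k (l • θ) = ((l ^ k)⁻¹ : ℝ) * c k θ
  s_rem : ∃ C : ℝ, ∀ θ, 1 ≤ ‖θ‖ → ‖s θ - ∑ k ∈ Finset.range 3, c k θ‖ ≤ C * (‖θ‖ ^ 3)⁻¹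

/-- The Laplacian of a function on `ℝᵈ`. -/
def lap (Ψ : 𝔼 → ℂ) : 𝔼 → ℂ := fun ξ => ∑ j, lineD (stdVec j) (lineD (stdVec j) Ψ) ξ

variable {Ψ : 𝔼[d] → ℂ}

lemma IsTest.lap (h : IsTest Ψ) : IsTest (lap Ψ) := IsTest.sum fun _ => (h.lineD _).lineD _

lemma wavelet_const_mul (c : ℂ) (Ψ : 𝔼 → ℂ)
    (z : 𝔼) : wavelet (fun ξ => c * Ψ ξ) z = c * wavelet Ψ z := by
  unfold wavelet
  rw [← integral_const_mul]
  congr 1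
  ext ξ
  ring

lemma IsTest.inner_mul_wavelet' (h : IsTest Ψ) (v z : 𝔼) :
    ((inner ℝ z v : ℝ) : ℂ) * wavelet Ψ z = -I * wavelet (LeviCivita.lineD v Ψ) z := by
  rw [real_inner_comm, h.inner_mul_wavelet v z, wavelet_const_mul]

lemma IsTest.normSq_mul_wavelet (h : IsTest Ψ) (z : 𝔼) :
    ((‖z‖ ^ 2 : ℝ) : ℂ) * wavelet Ψ z = -wavelet (LeviCivita.lap Ψ) z := by
  have h1 : ∀ j, ((inner ℝ z (stdVec j) : ℝ) : ℂ) ^ 2 * wavelet Ψ z =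
      -wavelet (LeviCivita.lineD (stdVec j) (LeviCivita.lineD (stdVec j) Ψ)) z := by
    intro j
    rw [pow_two, mul_assoc, h.inner_mul_wavelet', mul_left_comm,
      (h.lineD (stdVec j)).inner_mul_wavelet']
    linear_combination (wavelet (LeviCivita.lineD (stdVec j) (LeviCivita.lineD (stdVec j) Ψ)) z) *
      I_sq
  have h2 : ((‖z‖ ^ 2 : ℝ) : ℂ) = ∑ j, ((inner ℝ z (stdVec j) : ℝ) : ℂ) ^ 2 := by
    rw [EuclideanSpace.norm_sq_eq]
    push_cast
    refine sum_congr rfl fun j _ => ?_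
    rw [← ofReal_pow, ← ofReal_pow]
    simp [EuclideanSpace.inner_single_right]
  have h3 : wavelet (LeviCivita.lap Ψ) z =
      ∑ j, wavelet (LeviCivita.lineD (stdVec j) (LeviCivita.lineD (stdVec j) Ψ)) z := by
    unfold wavelet LeviCivita.lap
    rw [← integral_finsetSum]
    · simp_rw [mul_sum]
    · intro j _
      exact ((h.lineD (stdVec j)).lineD (stdVec j)).integrable_mul
        (f := fun ξ => cexp (-(I * (inner ℝ ξ z : ℝ)))) (by
          refine Continuous.continuousOn ?_
          have : Continuous fun ξ : 𝔼 => ((inner ℝ ξ z : ℝ) : ℂ) :=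
            continuous_ofReal.comp (by fun_prop)
          fun_prop)
  rw [h2, h3, sum_mul, sum_congr rfl fun j _ => h1 j, Finset.sum_neg_distrib]

lemma IsTest.integrable_one_add_pow_mul_wavelet (h : IsTest Ψ) (n : ℕ) :
    Integrable fun z : 𝔼 => (1 + ‖z‖) ^ n * ‖wavelet Ψ z‖ := by
  have : (fun z : 𝔼 => (1 + ‖z‖) ^ n * ‖wavelet Ψ z‖) = fun z =>
      ∑ k ∈ Finset.range (n + 1), (n.choose k : ℝ) * (‖z‖ ^ k * ‖wavelet Ψ z‖) := by
    ext z
    rw [add_comm, add_pow, sum_mul]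
    refine sum_congr rfl fun k _ => ?_
    simp
    ring
  rw [this]
  exact integrable_finsetSum _ fun k _ => (h.integrable_pow_mul_wavelet k).const_mul _

/-- The coefficients of the expansion of the oscillatory integral in powers of `r`. -/
def expansionOne (ε : ℝ) (Ψ : 𝔼 → ℂ) (θ : 𝔼) : ℂ :=
  ε / 2 * (((‖θ‖ : ℝ) : ℂ) * lap Ψ θ + ((‖θ‖⁻¹ : ℝ) : ℂ) * fderiv ℝ Ψ θ θ)

/-- The second-order term of the wavelet expansion. -/
def expansionTwo (ε : ℝ) (Ψ : 𝔼 → ℂ) (θ : 𝔼) : ℂ :=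
  ε ^ 2 / 8 * ((((‖θ‖ ^ 2 : ℝ) : ℂ) * lap (lap Ψ) θ + 2 * fderiv ℝ (lap Ψ) θ θ) -
    ((‖θ‖ ^ 2 : ℝ) : ℂ)⁻¹ * lineD θ (lineD θ Ψ) θ)

/-- The second order Taylor polynomial in `r` of the amplitude, without the factor `e^{i⟨z, θ⟩}`. -/
def taylorAmplitude (ε r : ℝ) (z θ : 𝔼) : ℂ :=
  1 + r * (-ε / 2 * ‖θ‖ * ‖z‖ ^ 2 + I * ε / 2 * ((inner ℝ z θ : ℝ) / ‖θ‖)) +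
    r ^ 2 * (ε ^ 2 / 8 * ‖θ‖ ^ 2 * ‖z‖ ^ 4 - I * ε ^ 2 / 4 * ‖z‖ ^ 2 * (inner ℝ z θ : ℝ) +
      ε ^ 2 / 8 * ((inner ℝ z θ : ℝ) / ‖θ‖) ^ 2)

lemma taylorAmplitude_mul_wavelet (h : IsTest Ψ) (ε r : ℝ) (z θ : 𝔼) :
    taylorAmplitude ε r z θ * wavelet Ψ z = wavelet Ψ z +
      r * (ε / 2 * (((‖θ‖ : ℝ) : ℂ) * wavelet (lap Ψ) z +
        ((‖θ‖⁻¹ : ℝ) : ℂ) * wavelet (lineD θ Ψ) z)) +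
      r ^ 2 * (ε ^ 2 / 8 * ((((‖θ‖ ^ 2 : ℝ) : ℂ) * wavelet (lap (lap Ψ)) z +
        2 * wavelet (lineD θ (lap Ψ)) z) -
        ((‖θ‖ ^ 2 : ℝ) : ℂ)⁻¹ * wavelet (lineD θ (lineD θ Ψ)) z)) := by
  have h1 := h.normSq_mul_wavelet z
  have h2 := h.lap.normSq_mul_wavelet z
  have h3 := h.inner_mul_wavelet' θ z
  have h4 := (h.lineD θ).inner_mul_wavelet' θ z
  have h5 := h.lap.inner_mul_wavelet' θ z
  unfold taylorAmplitude
  push_cast at *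
  simp only [div_eq_mul_inv, ← inv_pow]
  set n : ℂ := (‖θ‖ : ℂ)
  set m : ℂ := (n)⁻¹
  set q : ℂ := ((inner ℝ z θ : ℝ) : ℂ)
  set Z : ℂ := (‖z‖ : ℂ)
  have hI := I_sq
  linear_combination (-(r : ℂ) * ε * 2⁻¹ * n + r ^ 2 * ε ^ 2 * 8⁻¹ * n ^ 2 * Z ^ 2 -
    r ^ 2 * I * ε ^ 2 * 4⁻¹ * q) * h1 - r ^ 2 * ε ^ 2 * 8⁻¹ * n ^ 2 * h2 +
    (r * I * ε * 2⁻¹ * m + r ^ 2 * ε ^ 2 * 8⁻¹ * m ^ 2 * q) * h3 -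
    I * r ^ 2 * ε ^ 2 * 8⁻¹ * m ^ 2 * h4 + r ^ 2 * I * ε ^ 2 * 4⁻¹ * h5 +
    (-(r : ℂ) * ε * 2⁻¹ * m * wavelet (lineD θ Ψ) z + r ^ 2 * ε ^ 2 * 8⁻¹ * m ^ 2 *
      wavelet (lineD θ (lineD θ Ψ)) z - r ^ 2 * ε ^ 2 * 4⁻¹ * wavelet (lineD θ (lap Ψ)) z) * hI

lemma integrable_exp_mul_wavelet (h : IsTest Ψ) (θ : 𝔼) :
    Integrable fun z => 𝐞[z, θ] * wavelet Ψ z := by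
  refine h.integrable_wavelet.bdd_mul (c := 1) (Continuous.aestronglyMeasurable ?_)
    (ae_of_all _ fun z => ?_)
  · have : Continuous fun z : 𝔼 => ((inner ℝ z θ : ℝ) : ℂ) :=
      continuous_ofReal.comp (by fun_prop)
    fun_prop
  · rw [mul_comm, Complex.norm_exp_ofReal_mul_I]

lemma integral_taylorAmplitude (h : IsTest Ψ) (ε r : ℝ) (θ : 𝔼) :
    ∫ z, 𝐞[z, θ] * (taylorAmplitude ε r z θ * wavelet Ψ z) =
      (2 * π) ^ d * (Ψ θ + r * expansionOne ε Ψ θ + r ^ 2 * expansionTwo ε Ψ θ) := by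
  have hi := integrable_exp_mul_wavelet h θ
  have hi1 := integrable_exp_mul_wavelet h.lap θ
  have hi2 := integrable_exp_mul_wavelet (h.lineD θ) θ
  have hi3 := integrable_exp_mul_wavelet h.lap.lap θ
  have hi4 := integrable_exp_mul_wavelet (h.lap.lineD θ) θ
  have hi5 := integrable_exp_mul_wavelet ((h.lineD θ).lineD θ) θ
  simp_rw [taylorAmplitude_mul_wavelet h]
  have e : ∀ z : 𝔼, 𝐞[z, θ] * (wavelet Ψ z + r * (ε / 2 * (((‖θ‖ : ℝ) : ℂ) * wavelet (lap Ψ) z +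
        ((‖θ‖⁻¹ : ℝ) : ℂ) * wavelet (lineD θ Ψ) z)) +
      r ^ 2 * (ε ^ 2 / 8 * ((((‖θ‖ ^ 2 : ℝ) : ℂ) * wavelet (lap (lap Ψ)) z +
        2 * wavelet (lineD θ (lap Ψ)) z) -
        ((‖θ‖ ^ 2 : ℝ) : ℂ)⁻¹ * wavelet (lineD θ (lineD θ Ψ)) z))) = 𝐞[z, θ] * wavelet Ψ z +
      r * (ε / 2) * ‖θ‖ * (𝐞[z, θ] * wavelet (lap Ψ) z) +
      r * (ε / 2) * ((‖θ‖⁻¹ : ℝ) : ℂ) * (𝐞[z, θ] * wavelet (lineD θ Ψ) z) +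
      r ^ 2 * (ε ^ 2 / 8) * ((‖θ‖ ^ 2 : ℝ) : ℂ) *
        (𝐞[z, θ] * wavelet (lap (lap Ψ)) z) + r ^ 2 * (ε ^ 2 / 8) * 2 *
        (𝐞[z, θ] * wavelet (lineD θ (lap Ψ)) z) - r ^ 2 * (ε ^ 2 / 8) * ((‖θ‖ ^ 2 : ℝ) : ℂ)⁻¹ *
        (𝐞[z, θ] * wavelet (lineD θ (lineD θ Ψ)) z) := fun z => by ring
  simp_rw [e]
  rw [integral_sub, integral_add, integral_add, integral_add, integral_add, integral_const_mul,
    integral_const_mul, integral_const_mul, integral_const_mul, integral_const_mul,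
    h.integral_exp_mul_wavelet, h.lap.integral_exp_mul_wavelet,
    (h.lineD θ).integral_exp_mul_wavelet, h.lap.lap.integral_exp_mul_wavelet,
    (h.lap.lineD θ).integral_exp_mul_wavelet, ((h.lineD θ).lineD θ).integral_exp_mul_wavelet]
  · unfold expansionOne expansionTwo lineD
    ring
  · exact hi
  · exact hi1.const_mul _
  · exact hi.add (hi1.const_mul _)
  · exact hi2.const_mul _
  · exact (hi.add (hi1.const_mul _)).add (hi2.const_mul _)
  · exact hi3.const_mul _
  · exact ((hi.add (hi1.const_mul _)).add (hi2.const_mul _)).add (hi3.const_mul _)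
  · exact hi4.const_mul _
  · exact (((hi.add (hi1.const_mul _)).add (hi2.const_mul _)).add (hi3.const_mul _)).add
      (hi4.const_mul _)
  · exact hi5.const_mul _

end

section

variable {ε a a' : ℝ}
  {f W β : 𝔼[d] × 𝔼[d] → ℂ}
  {s : 𝔼[d] → ℂ} {c : ℕ → 𝔼[d] → ℂ}
  {Ψ : 𝔼[d] → ℂ}

local notation "𝒥[" f "," β "," Ψ "," r "," η "]" =>
  ∫ z, cexp (I * f (r • z, η)) * β (r • z, η) * wavelet Ψ z

local notation "𝒦[" f "," W "," Ψ "," r "," θ "]" =>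
  ∫ z, cexp (I * r⁻¹ * f (r • z, θ)) * W (r • z, θ) * wavelet Ψ z

lemma norm_cexp_sub_cexp_le {u v : ℂ} (hu : u.re ≤ 0) (hv : v.re ≤ 0) :
    ‖cexp u - cexp v‖ ≤ ‖u - v‖ := by
  have hconv : Convex ℝ {w : ℂ | w.re ≤ 0} := convex_halfSpace_re_le 0
  have := hconv.norm_image_sub_le_of_norm_hasDerivWithin_le (f := Complex.exp) (f' := Complex.exp)
    (C := 1) (x := v) (y := u) (fun x _ => (Complex.hasDerivAt_exp x).hasDerivWithinAt)
    (fun x hx => by rw [norm_exp, exp_le_one_iff]; exact hx) hv hu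
  simpa using this

lemma abs_exp_neg_sub_le {x : ℝ} (hx : 0 ≤ x) : |exp (-x) - (1 - x + x ^ 2 / 2)| ≤ x ^ 3 := by
  have h1 : ∀ y : ℝ, 0 ≤ y → 1 - y ≤ exp (-y) := fun y _ => by
    have := Real.add_one_le_exp (-y); linarith
  have m2 : ∀ y ∈ Ici (0 : ℝ), exp (-y) ≤ 1 - y + y ^ 2 / 2 := by
    have hmono : MonotoneOn (fun y : ℝ => 1 - y + y ^ 2 / 2 - exp (-y)) (Ici 0) := by
      refine monotoneOn_of_deriv_nonneg (convex_Ici 0) (by fun_prop) (by fun_prop) ?_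
      intro y hy
      rw [interior_Ici] at hy
      have hd : HasDerivAt (fun y : ℝ => 1 - y + y ^ 2 / 2 - exp (-y))
          (0 - 1 + (2 * y) / 2 - exp (-y) * (-1)) y := by
        have h2 : HasDerivAt (fun y : ℝ => y ^ 2) (2 * y) y := by simpa using hasDerivAt_pow 2 y
        exact ((((hasDerivAt_const y (1 : ℝ)).sub (hasDerivAt_id y)).add (h2.div_const 2)).sub
          ((hasDerivAt_id y).neg.exp))
      rw [hd.deriv]
      have := h1 y (le_of_lt hy)
      linarith
    intro y hy
    have := hmono (show (0 : ℝ) ∈ Ici 0 by simp) hy hy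
    simp at this
    linarith
  have m3 : ∀ y ∈ Ici (0 : ℝ), 1 - y + y ^ 2 / 2 - y ^ 3 ≤ exp (-y) := by
    have hmono : MonotoneOn (fun y : ℝ => exp (-y) - (1 - y + y ^ 2 / 2 - y ^ 3)) (Ici 0) := by
      refine monotoneOn_of_deriv_nonneg (convex_Ici 0) (by fun_prop) (by fun_prop) ?_
      intro y hy
      have hd : HasDerivAt (fun y : ℝ => exp (-y) - (1 - y + y ^ 2 / 2 - y ^ 3))
          (exp (-y) * (-1) - (0 - 1 + (2 * y) / 2 - 3 * y ^ 2)) y := by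
        have h2 : HasDerivAt (fun y : ℝ => y ^ 2) (2 * y) y := by simpa using hasDerivAt_pow 2 y
        have h3 : HasDerivAt (fun y : ℝ => y ^ 3) (3 * y ^ 2) y := by simpa using hasDerivAt_pow 3 y
        exact ((hasDerivAt_id y).neg.exp).sub
          ((((hasDerivAt_const y (1 : ℝ)).sub (hasDerivAt_id y)).add (h2.div_const 2)).sub h3)
      rw [hd.deriv]
      have := m2 y (interior_subset hy)
      nlinarith [sq_nonneg y]
    intro y hy
    have := hmono (show (0 : ℝ) ∈ Ici 0 by simp) hy hy
    simp at this
    linarith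
  rw [abs_le]
  constructor
  · have := m3 x hx; linarith
  · have := m2 x hx
    have : 0 ≤ x ^ 3 := by positivity
    linarith

lemma contDiffOn_norm_snd {n : WithTop ℕ∞} : ContDiffOn ℝ n
    (fun x : ℝ × 𝔼 × 𝔼 => ((‖x.2.2‖ : ℝ) : ℂ)) {x | x.2.2 ≠ 0} := by
  have h1 : ContDiff ℝ n (fun x : ℝ × 𝔼 × 𝔼 => x.2.2) := contDiff_snd.comp contDiff_snd
  exact ofRealCLM.contDiff.comp_contDiffOn (h1.contDiffOn.norm ℝ fun x hx => hx)

lemma contDiff_inner_prod {n : WithTop ℕ∞} : ContDiff ℝ n (fun x : ℝ × 𝔼 × 𝔼 =>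
      ((inner ℝ x.2.1 x.2.2 : ℝ) : ℂ)) := ofRealCLM.contDiff.comp
    ((contDiff_fst.comp contDiff_snd).inner ℝ (contDiff_snd.comp contDiff_snd))

lemma contDiff_ofReal_fst {n : WithTop ℕ∞} : ContDiff ℝ n
    (fun x : ℝ × 𝔼 × 𝔼 => (x.1 : ℂ)) := ofRealCLM.contDiff.comp contDiff_fst

lemma contDiff_smul_pair {n : WithTop ℕ∞} : ContDiff ℝ n
    (fun x : ℝ × 𝔼 × 𝔼 => (x.1 • x.2.1, x.2.2)) :=
  (contDiff_fst.smul (contDiff_fst.comp contDiff_snd)).prodMk (contDiff_snd.comp contDiff_snd)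

lemma one_le_norm_inv_smul {r : ℝ} (hr : 0 < r) {θ : 𝔼} (hθ : r ≤ ‖θ‖) : 1 ≤ ‖r⁻¹ • θ‖ := by
  rw [norm_smul, norm_inv, norm_of_nonneg hr.le, le_inv_mul_iff₀ hr]; simpa using hθ

lemma exists_eq_norm_smul (w : 𝔼) : ∃ ν : 𝔼, ‖ν‖ ≤ 1 ∧ w = ‖w‖ • ν := by
  by_cases hw : w = 0
  · exact ⟨0, by simp, by simp [hw]⟩
  · have := norm_ne_zero_iff.2 hw
    exact ⟨‖w‖⁻¹ • w, by rw [norm_smul, norm_inv, norm_norm, inv_mul_cancel₀ this],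
      by rw [smul_smul, mul_inv_cancel₀ this, one_smul]⟩

namespace FlatModel

variable (hM : FlatModel ε a a' f W β s c)
include hM

lemma exists_direction {θ : 𝔼} (hθ : θ ≠ 0) : ∃ υ : 𝔼, ‖υ‖ = 1 ∧ υ ≠ 0 ∧ θ = ‖θ‖ • υ ∧
    (∀ w ∈ ball 0 a, f (w, θ) = ‖θ‖ * f (w, υ)) ∧ ∀ w, W (w, θ) = W (w, υ) := by
  have hn := norm_ne_zero_iff.2 hθ
  have hυ0 : ‖θ‖⁻¹ • θ ≠ 0 := smul_ne_zero (inv_ne_zero hn) hθ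
  have hθυ : ‖θ‖ • ‖θ‖⁻¹ • θ = θ := by rw [smul_smul, mul_inv_cancel₀ hn, one_smul]
  exact ⟨‖θ‖⁻¹ • θ, by rw [norm_smul, norm_inv, norm_norm, inv_mul_cancel₀ hn], hυ0, hθυ.symm,
    fun w hw => (congrArg (f ⟨w, ·⟩) hθυ).symm.trans <| hM.f_hom w hw _ hυ0 _ (norm_pos_iff.2 hθ),
    fun w => (congrArg (W ⟨w, ·⟩) hθυ).symm.trans <| hM.W_hom w _ hυ0 _ (norm_pos_iff.2 hθ)⟩

lemma exists_phase_bound : ∃ C : ℝ, 0 ≤ C ∧ ∀ w ∈ closedBall (0 : 𝔼) a', ∀ θ, θ ≠ 0 →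
    ‖f (w, θ) - ((inner ℝ w θ : ℝ) + I * ε / 2 * ‖θ‖ * ‖w‖ ^ 2)‖ ≤ C * ‖θ‖ * ‖w‖ ^ 4 := by
  set S : ℝ × 𝔼 × 𝔼 → ℂ := fun x => f (x.1 • x.2.1, x.2.2) - (x.1 * (inner ℝ x.2.1 x.2.2 : ℝ) +
      I * ε / 2 * x.1 ^ 2 * ‖x.2.2‖ * ((‖x.2.1‖ ^ 2 : ℝ) : ℂ)) with hSdef
  set U : Set (ℝ × 𝔼 × 𝔼) := (fun x => (x.1 • x.2.1, x.2.2)) ⁻¹' (ball 0 a ×ˢ {0}ᶜ)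
  have hU : IsOpen U := (isOpen_ball.prod isOpen_compl_singleton).preimage
    (contDiff_smul_pair (n := 0)).continuous
  have hS : SmoothOn S U := by
    refine (hM.f_smooth.comp contDiff_smul_pair.contDiffOn fun x hx => hx).sub ?_
    refine ((contDiff_ofReal_fst.mul contDiff_inner_prod).contDiffOn).add ?_
    refine ((contDiffOn_const.mul (contDiff_ofReal_fst.pow 2).contDiffOn).mul
      (contDiffOn_norm_snd.mono fun x hx => hx.2)).mul ?_
    exact (ofRealCLM.contDiff.comp ((contDiff_fst.comp contDiff_snd).norm_sq ℝ)).contDiffOn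
  obtain ⟨C, hC0, hC⟩ := exists_bound_of_isBigO hU hS ((isCompact_closedBall (0 : 𝔼) 1).prod
      (isCompact_sphere (0 : 𝔼) 1)) hM.a'_pos (by
      rintro ⟨t, z, θ⟩ ⟨ht, hz, hθ⟩
      refine ⟨?_, ?_⟩
      · simp only [mem_ball_zero_iff, norm_smul, norm_of_nonneg ht.1]
        have hz' : ‖z‖ ≤ 1 := by simpa using hz
        have := mul_le_mul ht.2 hz' (norm_nonneg _) hM.a'_pos.le
        linarith [hM.a'_lt]
      · intro h0
        simp [show θ = 0 from h0] at hθ) 3 (by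
      rintro ⟨z, θ⟩ ⟨hz, hθ⟩
      have hθ0 : θ ≠ 0 := by rintro rfl; simp at hθ
      refine (hM.f_jet z θ hθ0).congr_left fun t => ?_
      simp only [hSdef]
      push_cast
      ring)
  refine ⟨C, hC0, fun w hw θ hθ => ?_⟩
  have hθn : 0 < ‖θ‖ := norm_pos_iff.2 hθ
  have hwn : ‖w‖ ≤ a' := by simpa using hw
  obtain ⟨ν, hν, hwν⟩ := exists_eq_norm_smul w
  have hνn : ‖w‖ * ‖ν‖ = ‖w‖ := by conv_rhs => rw [hwν, norm_smul, norm_norm]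
  obtain ⟨υ, hυ1, hυ0, hθυ, hfυ, hWυ⟩ := hM.exists_direction hθ
  have h1 := hC (ν, υ) ⟨by simpa using hν, by simpa using hυ1⟩ ‖w‖ ⟨norm_nonneg _, hwn⟩
  simp only [hSdef, ← hwν, hυ1] at h1
  have hwb : w ∈ ball (0 : 𝔼) a := by simp only [mem_ball_zero_iff]; linarith [hM.a'_lt]
  have h3 : ((inner ℝ w θ : ℝ) : ℂ) = ‖θ‖ * (‖w‖ * (inner ℝ ν υ : ℝ)) := by
    conv_lhs => rw [hwν, hθυ, inner_smul_left, inner_smul_right]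
    simp
    ring
  have h4 : ((‖w‖ : ℝ) : ℂ) ^ 2 = (‖w‖ : ℂ) ^ 2 * ((‖ν‖ ^ 2 : ℝ) : ℂ) := by
    rw [← ofReal_pow, ← ofReal_mul, ← mul_pow, hνn]
  have h5 : f (w, θ) - ((inner ℝ w θ : ℝ) + I * ε / 2 * ‖θ‖ * ‖w‖ ^ 2) = ‖θ‖ *
      (f (w, υ) - (‖w‖ * (inner ℝ ν υ : ℝ) + I * ε / 2 * (‖w‖ : ℂ) ^ 2 * ((1 : ℝ) : ℂ) *
        ((‖ν‖ ^ 2 : ℝ) : ℂ))) := by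
    rw [hfυ w hwb, h3]
    push_cast at h4 ⊢
    linear_combination (-(I * ε / 2 * ‖θ‖)) * h4
  rw [h5, norm_mul, norm_real, norm_norm]
  calc _ ≤ ‖θ‖ * (C * ‖w‖ ^ (3 + 1)) := by gcongr
    _ = _ := by ring

lemma exists_amplitude_bound : ∃ C : ℝ, 0 ≤ C ∧ (∀ w θ, θ ≠ 0 → ‖W (w, θ)‖ ≤ C) ∧ ∀ w θ, θ ≠ 0 →
    ‖W (w, θ) - (1 + I * ε / 2 * ((inner ℝ w θ : ℝ) / ‖θ‖) +
      ε ^ 2 / 8 * ((inner ℝ w θ : ℝ) / ‖θ‖) ^ 2)‖ ≤ C * ‖w‖ ^ 3 := by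
  set S : ℝ × 𝔼 × 𝔼 → ℂ := fun x => W (x.1 • x.2.1, x.2.2) - (1 + I * ε / 2 * x.1 *
    ((inner ℝ x.2.1 x.2.2 : ℝ) / ‖x.2.2‖) + ε ^ 2 / 8 * x.1 ^ 2 *
      ((inner ℝ x.2.1 x.2.2 : ℝ) / ‖x.2.2‖) ^ 2) with hSdef
  set U : Set (ℝ × 𝔼 × 𝔼) := {x | x.2.2 ≠ 0}
  have hU : IsOpen U := isOpen_ne_fun (by fun_prop) continuous_const
  have hq : SmoothOn (fun x : ℝ × 𝔼 × 𝔼 => ((inner ℝ x.2.1 x.2.2 : ℝ) : ℂ) / ‖x.2.2‖) U := by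
    simp only [div_eq_mul_inv]
    exact contDiff_inner_prod.contDiffOn.mul (contDiffOn_norm_snd.inv fun x hx => by
      exact_mod_cast norm_ne_zero_iff.2 hx)
  have hS : SmoothOn S U := by
    refine (hM.W_smooth.comp contDiff_smul_pair.contDiffOn fun x hx => ⟨mem_univ _, hx⟩).sub ?_
    refine (contDiffOn_const.add ((contDiff_const.mul contDiff_ofReal_fst).contDiffOn.mul hq)).add
      ?_
    exact (contDiff_const.mul (contDiff_ofReal_fst.pow 2)).contDiffOn.mul (hq.pow 2)
  obtain ⟨C, hC0, hC⟩ := exists_bound_of_isBigO hU hS ((isCompact_closedBall (0 : 𝔼) 1).prod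
      (isCompact_sphere (0 : 𝔼) 1)) hM.a'_pos (by
      rintro ⟨t, z, θ⟩ ⟨ht, hz, hθ⟩ h0
      simp only at h0
      simp [h0] at hθ) 2 (by
      rintro ⟨z, θ⟩ ⟨hz, hθ⟩
      have hθ0 : θ ≠ 0 := by rintro rfl; simp at hθ
      exact hM.W_jet z θ hθ0)
  obtain ⟨B, hB⟩ := ((isCompact_closedBall (0 : 𝔼) a').prod
      (isCompact_sphere (0 : 𝔼) 1)).exists_bound_of_continuousOn (hM.W_smooth.continuousOn.mono (by
        rintro ⟨w, θ⟩ ⟨-, hθ⟩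
        refine ⟨mem_univ _, fun h0 => ?_⟩
        simp [show θ = 0 from h0] at hθ))
  have ha' := hM.a'_pos
  have hε := hM.eps_pos
  set C' : ℝ := C + |B| + ((a'⁻¹) ^ 3 + ε / 2 * (a'⁻¹) ^ 2 + ε ^ 2 / 8 * a'⁻¹) with hC'
  refine ⟨C', by positivity, fun w θ hθ => ?_, fun w θ hθ => ?_⟩
  all_goals
    have hθn : 0 < ‖θ‖ := norm_pos_iff.2 hθ
    obtain ⟨υ, hυ1, hυ0, hθυ, hfυ, hWυ⟩ := hM.exists_direction hθ
  · by_cases hw : w ∈ closedBall (0 : 𝔼) a'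
    · rw [hWυ]
      have := (hB (w, υ) ⟨hw, by simpa using hυ1⟩).trans (le_abs_self B)
      have h2 : 0 ≤ (a'⁻¹) ^ 3 + ε / 2 * (a'⁻¹) ^ 2 + ε ^ 2 / 8 * a'⁻¹ := by positivity
      linarith
    · rw [hM.W_supp w hw θ, norm_zero]
      positivity
  · by_cases hw : w ∈ closedBall (0 : 𝔼) a'
    · have hwn : ‖w‖ ≤ a' := by simpa using hw
      obtain ⟨ν, hν, hwν⟩ := exists_eq_norm_smul w
      have h1 := hC (ν, υ) ⟨by simpa using hν, by simpa using hυ1⟩ ‖w‖ ⟨norm_nonneg _, hwn⟩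
      simp only [hSdef, ← hwν, hυ1] at h1
      have h3 : ((inner ℝ w θ : ℝ) : ℂ) / ‖θ‖ = ‖w‖ * (inner ℝ ν υ : ℝ) := by
        have : (‖θ‖ : ℂ) ≠ 0 := by exact_mod_cast hθn.ne'
        rw [div_eq_iff this]
        conv_lhs => rw [hwν, hθυ, inner_smul_left, inner_smul_right]
        simp
        ring
      rw [hWυ, h3]
      refine (le_of_eq ?_).trans (h1.trans ?_)
      · congr 1
        push_cast
        ring
      · gcongr
        have h2 : 0 ≤ (a'⁻¹) ^ 3 + ε / 2 * (a'⁻¹) ^ 2 + ε ^ 2 / 8 * a'⁻¹ := by positivity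
        have := abs_nonneg B
        linarith
    · have hwn : a' < ‖w‖ := by simpa using hw
      rw [hM.W_supp w hw θ, zero_sub, norm_neg]
      have hq : ‖((inner ℝ w θ : ℝ) : ℂ) / ‖θ‖‖ ≤ ‖w‖ := by
        rw [norm_div, norm_real, norm_real, norm_norm, div_le_iff₀ hθn]
        exact norm_inner_le_norm w θ
      have hw1 : 1 ≤ a'⁻¹ * ‖w‖ := by rw [← div_eq_inv_mul, le_div_iff₀ ha']; linarith
      have hε1 : ‖I * ε / 2‖ = ε / 2 := by simp [abs_of_pos hε]
      have hε2 : ‖(ε : ℂ) ^ 2 / 8‖ = ε ^ 2 / 8 := by simp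
      have hw0 := norm_nonneg w
      calc _ ≤ ‖(1 : ℂ)‖ + ‖I * ε / 2 * ((inner ℝ w θ : ℝ) / ‖θ‖)‖ +
          ‖(ε : ℂ) ^ 2 / 8 * ((inner ℝ w θ : ℝ) / ‖θ‖) ^ 2‖ := norm_add₃_le
        _ ≤ 1 + ε / 2 * ‖w‖ + ε ^ 2 / 8 * ‖w‖ ^ 2 := by
          rw [norm_mul, norm_mul, norm_pow, hε1, hε2, norm_one]
          gcongr
        _ ≤ (a'⁻¹ * ‖w‖) ^ 3 + ε / 2 * ‖w‖ * (a'⁻¹ * ‖w‖) ^ 2 +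
            ε ^ 2 / 8 * ‖w‖ ^ 2 * (a'⁻¹ * ‖w‖) := by
          exact add_le_add (add_le_add (one_le_pow₀ hw1)
            (le_mul_of_one_le_right (by positivity) (one_le_pow₀ hw1)))
            (le_mul_of_one_le_right (by positivity) hw1)
        _ = ((a'⁻¹) ^ 3 + ε / 2 * (a'⁻¹) ^ 2 + ε ^ 2 / 8 * a'⁻¹) * ‖w‖ ^ 3 := by ring
        _ ≤ C' * ‖w‖ ^ 3 := by
          gcongr
          have := abs_nonneg B
          linarith

end FlatModel

lemma norm_exp_I_mul_ofReal (x : ℝ) : ‖cexp (I * (x : ℂ))‖ = 1 := by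
  rw [mul_comm, Complex.norm_exp_ofReal_mul_I]

lemma continuous_ofReal_inner (θ : 𝔼) :
    Continuous fun z : 𝔼 => ((inner ℝ z θ : ℝ) : ℂ) := continuous_ofReal.comp (by fun_prop)

lemma continuous_taylorAmplitude (ε r : ℝ) (θ : 𝔼) :
    Continuous fun z => taylorAmplitude ε r z θ := by
  have h1 := continuous_ofReal_inner θ
  have h2 : Continuous fun z : 𝔼 => ((‖z‖ : ℝ) : ℂ) :=
    continuous_ofReal.comp continuous_norm
  unfold taylorAmplitude
  fun_prop

namespace FlatModel

variable (hM : FlatModel ε a a' f W β s c)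
include hM

lemma closedBall_subset_ball :
    closedBall (0 : 𝔼) a' ⊆ ball 0 a := Metric.closedBall_subset_ball hM.a'_lt

lemma contDiffOn_phase {θ : 𝔼} (hθ : θ ≠ 0) : SmoothOn (fun w => f (w, θ)) (ball 0 a) :=
  hM.f_smooth.comp (contDiff_id.prodMk contDiff_const).contDiffOn fun _ hw => ⟨hw, hθ⟩

lemma hasFDerivAt_phase {w θ : 𝔼} (hw : w ∈ ball 0 a) (hθ : θ ≠ 0) :
    HasFDerivAt f (fderiv ℝ f (w, θ)) (w, θ) := by
  have h := hM.f_smooth.contDiffAt (x := (w, θ))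
    ((isOpen_ball.prod isOpen_compl_singleton).mem_nhds (mem_prod.2 ⟨hw, hθ⟩))
  exact (h.differentiableAt (by simp)).hasFDerivAt

lemma contDiff_amplitude {θ : 𝔼} (hθ : θ ≠ 0) : Smooth (fun w => W (w, θ)) := by
  rw [← contDiffOn_univ]
  exact hM.W_smooth.comp (contDiff_id.prodMk contDiff_const).contDiffOn fun _ _ => ⟨mem_univ _, hθ⟩

lemma contDiff_exp_mul_amplitude {θ : 𝔼} (hθ : θ ≠ 0) (k : ℂ) :
    ContDiff ℝ 1 (fun w => cexp (k * f (w, θ)) * W (w, θ)) ∧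
      HasCompactSupport (fun w => cexp (k * f (w, θ)) * W (w, θ)) :=
  contDiff_exp_mul_of_vanish isOpen_ball (isCompact_closedBall 0 a') hM.closedBall_subset_ball
    ((hM.contDiffOn_phase hθ).of_le (by norm_cast)) ((hM.contDiff_amplitude hθ).of_le (by
      norm_cast))
    (fun z hz => hM.W_supp z hz θ) k

lemma exists_pointwise_bound (Θ : ℝ) (hΘ : 0 ≤ Θ) : ∃ C : ℝ, 0 ≤ C ∧
    ∀ r : ℝ, 0 < r → r ≤ 1 → ∀ θ, θ ≠ 0 → ‖θ‖ ≤ Θ → ∀ z,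
    ‖cexp (I * r⁻¹ * f (r • z, θ)) * W (r • z, θ) -
      𝐞[z, θ] * taylorAmplitude ε r z θ‖ ≤ C * r ^ 3 * (1 + ‖z‖) ^ 7 := by
  obtain ⟨Cf, hCf0, hCf⟩ := hM.exists_phase_bound
  obtain ⟨Cw, hCw0, hCw1, hCw2⟩ := hM.exists_amplitude_bound
  have hε := hM.eps_pos
  set B : ℝ := ε / 2 * Θ with hB
  have hB0 : 0 ≤ B := by positivity
  refine ⟨Cf * Θ * Cw + B ^ 3 * Cw + (1 + B) ^ 2 * Cw +
    (B * ε ^ 2 / 8 + ε * B ^ 2 / 4 + ε ^ 2 * B ^ 2 / 16), by positivity, ?_⟩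
  intro r hr hr1 θ hθ hθΘ z
  have hθn : 0 < ‖θ‖ := norm_pos_iff.2 hθ
  have hr' : (r : ℂ) ≠ 0 := by exact_mod_cast hr.ne'
  have hθ' : (‖θ‖ : ℂ) ≠ 0 := by exact_mod_cast hθn.ne'
  set R : ℝ := 1 + ‖z‖ with hR
  have hR1 : 1 ≤ R := by simp [hR]
  have hzR : ‖z‖ ≤ R := by simp [hR]
  have hR0 : 0 ≤ R := by linarith
  set X : ℝ := ε / 2 * ‖θ‖ * ‖z‖ ^ 2 with hX
  have hX0 : 0 ≤ X := by positivity
  have hXR : X ≤ B * R ^ 2 := by rw [hX, hB]; gcongr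
  set y : ℂ := (inner ℝ z θ : ℝ) / ‖θ‖ with hy
  have hyR : ‖y‖ ≤ R := by
    rw [hy, norm_div, norm_real, norm_real, norm_norm, div_le_iff₀ hθn]
    exact (norm_inner_le_norm z θ).trans (by gcongr)
  set T : ℂ := 𝐞[z, θ] with hT
  have hT1 : ‖T‖ = 1 := norm_exp_I_mul_ofReal _
  set q : ℂ := 1 - ((r * X : ℝ) : ℂ) + ((r * X : ℝ) : ℂ) ^ 2 / 2 with hq
  set W2 : ℂ := 1 + I * ε / 2 * (r * y) + ε ^ 2 / 8 * (r * y) ^ 2 with hW2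
  set Ef : ℂ := cexp (I * r⁻¹ * f (r • z, θ)) with hEf
  set W' : ℂ := W (r • z, θ) with hW'
  set ex : ℂ := cexp (-((r * X : ℝ) : ℂ)) with hex
  have hL : q * W2 - taylorAmplitude ε r z θ = r ^ 3 * (-(X * ε ^ 2 / 8 * y ^ 2) +
      I * (ε * X ^ 2 / 4) * y + r * (ε ^ 2 * X ^ 2 / 16) * y ^ 2) := by
    have hinn : ((inner ℝ z θ : ℝ) : ℂ) = y * ‖θ‖ := by rw [hy]; field_simp
    unfold taylorAmplitude
    rw [← hy, hinn, hq, hW2, hX]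
    push_cast
    ring
  have hdec : Ef * W' - T * taylorAmplitude ε r z θ = (Ef - T * ex) * W' + T * (ex - q) * W' +
      T * q * (W' - W2) + T * (q * W2 - taylorAmplitude ε r z θ) := by ring
  have hWW : ‖W' - W2‖ ≤ Cw * r ^ 3 * R ^ 3 := by
    have := hCw2 (r • z) θ hθ
    have hin : ((inner ℝ (r • z) θ : ℝ) : ℂ) / ‖θ‖ = r * y := by
      rw [inner_smul_left, hy]; simp; ring
    rw [hin, norm_smul, norm_of_nonneg hr.le] at this
    refine this.trans ?_
    calc _ = Cw * r ^ 3 * ‖z‖ ^ 3 := by ring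
      _ ≤ _ := by gcongr
  have hexq : ‖ex - q‖ ≤ (r * X) ^ 3 := by
    have := abs_exp_neg_sub_le (mul_nonneg hr.le hX0)
    rw [← norm_eq_abs, ← norm_real] at this
    refine (le_of_eq ?_).trans this
    rw [hex, hq]
    push_cast
    rfl
  have hqn : ‖q‖ ≤ ((1 + B) * R ^ 2) ^ 2 := by
    have h1 : r * X ≤ B * R ^ 2 := (mul_le_of_le_one_left hX0 hr1).trans hXR
    have h2 : 0 ≤ r * X := mul_nonneg hr.le hX0
    calc ‖q‖ ≤ ‖(1 : ℂ) - ((r * X : ℝ) : ℂ)‖ + ‖((r * X : ℝ) : ℂ) ^ 2 / 2‖ := norm_add_le _ _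
      _ ≤ (‖(1 : ℂ)‖ + ‖((r * X : ℝ) : ℂ)‖) + ‖((r * X : ℝ) : ℂ) ^ 2 / 2‖ := by
        gcongr; exact norm_sub_le _ _
      _ = 1 + r * X + (r * X) ^ 2 / 2 := by
        rw [norm_one, norm_div, norm_pow, norm_real, norm_of_nonneg h2]; simp
      _ ≤ (1 + r * X) ^ 2 := by nlinarith
      _ ≤ _ := by
        have : (1 : ℝ) ≤ R ^ 2 := one_le_pow₀ hR1
        gcongr
        linarith
  have hEe : ‖(Ef - T * ex) * W'‖ ≤ Cf * Θ * r ^ 3 * R ^ 4 * Cw := by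
    by_cases hz : r • z ∈ closedBall (0 : 𝔼) a'
    · rw [norm_mul]
      refine mul_le_mul ?_ (hCw1 _ _ hθ) (norm_nonneg _) (by positivity)
      have hTe : T * ex = cexp (I * r⁻¹ * ((inner ℝ (r • z) θ : ℝ) +
          I * ε / 2 * ‖θ‖ * ‖r • z‖ ^ 2)) := by
        rw [hT, hex, ← Complex.exp_add, inner_smul_left, norm_smul, norm_of_nonneg hr.le, hX]
        congr 1
        push_cast
        simp only [conj_trivial]
        field_simp
        linear_combination (-((r : ℂ) * ε * ‖θ‖ * ‖z‖ ^ 2)) * I_sq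
      rw [hTe, hEf]
      have him := hM.f_im _ (hM.closedBall_subset_ball hz) θ hθ
      refine (norm_cexp_sub_cexp_le ?_ ?_).trans ?_
      · rw [show I * r⁻¹ * f (r • z, θ) = ((r⁻¹ : ℝ) : ℂ) * (I * f (r • z, θ)) by
          push_cast; ring, Complex.re_ofReal_mul]
        have : 0 ≤ r⁻¹ := by positivity
        simp only [mul_re, I_re, I_im]
        nlinarith [mul_nonneg this him]
      · rw [show I * r⁻¹ * ((inner ℝ (r • z) θ : ℝ) +
          I * ε / 2 * ‖θ‖ * ‖r • z‖ ^ 2) = ((-(r⁻¹ * (ε / 2) * ‖θ‖ * ‖r • z‖ ^ 2) : ℝ) : ℂ) +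
            I * ((r⁻¹ * inner ℝ (r • z) θ : ℝ) : ℂ) by
          push_cast
          linear_combination (((r : ℂ)⁻¹) * ε / 2 * ‖θ‖ * ‖r • z‖ ^ 2) * I_sq]
        rw [Complex.add_re, ofReal_re, mul_re]
        simp only [I_re, I_im, ofReal_re, Complex.ofReal_im]
        have : 0 ≤ r⁻¹ * (ε / 2) * ‖θ‖ * ‖r • z‖ ^ 2 := by positivity
        linarith
      · rw [← mul_sub, norm_mul, norm_mul, Complex.norm_I, one_mul, norm_real, norm_inv,
          norm_of_nonneg hr.le]
        calc _ ≤ r⁻¹ * (Cf * ‖θ‖ * ‖r • z‖ ^ 4) := by gcongr; exact hCf _ hz θ hθ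
          _ = Cf * ‖θ‖ * r ^ 3 * ‖z‖ ^ 4 := by rw [norm_smul, norm_of_nonneg hr.le]; field_simp
          _ ≤ _ := by gcongr
    · rw [hW', hM.W_supp _ hz θ, mul_zero, norm_zero]
      positivity
  have hLn : ‖q * W2 - taylorAmplitude ε r z θ‖ ≤
      r ^ 3 * ((B * ε ^ 2 / 8 + ε * B ^ 2 / 4 + ε ^ 2 * B ^ 2 / 16) * R ^ 7) := by
    have hnX : ‖(X : ℂ)‖ = X := by rw [norm_real, norm_of_nonneg hX0]
    have hne : ‖(ε : ℂ)‖ = ε := by rw [norm_real, norm_of_nonneg hε.le]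
    have hnr : ‖(r : ℂ)‖ = r := by rw [norm_real, norm_of_nonneg hr.le]
    rw [hL, norm_mul, norm_pow, hnr]
    gcongr
    calc _ ≤ ‖-((X : ℂ) * ε ^ 2 / 8 * y ^ 2)‖ + ‖I * (ε * X ^ 2 / 4) * y‖ +
          ‖(r : ℂ) * (ε ^ 2 * X ^ 2 / 16) * y ^ 2‖ := norm_add₃_le
      _ = X * ε ^ 2 / 8 * ‖y‖ ^ 2 + ε * X ^ 2 / 4 * ‖y‖ + r * (ε ^ 2 * X ^ 2 / 16) * ‖y‖ ^ 2 := by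
        simp only [norm_neg, norm_mul, norm_div, norm_pow, hnX, hne, hnr, Complex.norm_I]
        norm_num
      _ ≤ (B * R ^ 2) * ε ^ 2 / 8 * R ^ 2 + ε * (B * R ^ 2) ^ 2 / 4 * R +
          1 * (ε ^ 2 * (B * R ^ 2) ^ 2 / 16) * R ^ 2 := by gcongr
      _ = B * ε ^ 2 / 8 * R ^ 4 + ε * B ^ 2 / 4 * R ^ 5 + ε ^ 2 * B ^ 2 / 16 * R ^ 6 := by ring
      _ ≤ B * ε ^ 2 / 8 * R ^ 7 + ε * B ^ 2 / 4 * R ^ 7 + ε ^ 2 * B ^ 2 / 16 * R ^ 7 := by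
        gcongr <;> first | exact hR1 | norm_num
      _ = _ := by ring
  rw [hdec]
  calc _ ≤ ‖(Ef - T * ex) * W'‖ + ‖T * (ex - q) * W'‖ + ‖T * q * (W' - W2)‖ +
        ‖T * (q * W2 - taylorAmplitude ε r z θ)‖ := by
          refine (norm_add_le _ _).trans ?_
          gcongr
          exact norm_add₃_le
    _ ≤ Cf * Θ * r ^ 3 * R ^ 4 * Cw + (r * (B * R ^ 2)) ^ 3 * Cw +
        ((1 + B) * R ^ 2) ^ 2 * (Cw * r ^ 3 * R ^ 3) +
        r ^ 3 * ((B * ε ^ 2 / 8 + ε * B ^ 2 / 4 + ε ^ 2 * B ^ 2 / 16) * R ^ 7) := by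
      rw [norm_mul (T * (ex - q)), norm_mul T, norm_mul (T * q), norm_mul T, norm_mul T, hT1,
        one_mul, one_mul, one_mul]
      gcongr
      · exact hexq.trans (by gcongr)
      · exact hCw1 _ _ hθ
    _ = (Cf * Θ * Cw * R ^ 4 + B ^ 3 * Cw * R ^ 6 + (1 + B) ^ 2 * Cw * R ^ 7 +
        (B * ε ^ 2 / 8 + ε * B ^ 2 / 4 + ε ^ 2 * B ^ 2 / 16) * R ^ 7) * r ^ 3 := by ring
    _ ≤ (Cf * Θ * Cw * R ^ 7 + B ^ 3 * Cw * R ^ 7 + (1 + B) ^ 2 * Cw * R ^ 7 +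
        (B * ε ^ 2 / 8 + ε * B ^ 2 / 4 + ε ^ 2 * B ^ 2 / 16) * R ^ 7) * r ^ 3 := by
      gcongr <;> first | exact hR1 | norm_num
    _ = _ := by ring

lemma integrable_exp_mul_amplitude_mul_wavelet (h : IsTest Ψ) {r : ℝ} {θ : 𝔼} (hθ : θ ≠ 0) (k : ℂ) :
    Integrable fun z => cexp (k * f (r • z, θ)) * W (r • z, θ) * wavelet Ψ z := by
  obtain ⟨h1, h2⟩ := hM.contDiff_exp_mul_amplitude hθ k
  obtain ⟨C, hC⟩ := h2.exists_bound_of_continuous h1.continuous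
  exact h.integrable_wavelet.bdd_mul (c := C)
    (h1.continuous.comp (continuous_const_smul r)).aestronglyMeasurable
    (ae_of_all _ fun z => hC (r • z))

lemma exists_taylor_bound (h : IsTest Ψ) (Θ : ℝ) (hΘ : 0 ≤ Θ) : ∃ C : ℝ, 0 ≤ C ∧
    ∀ r : ℝ, 0 < r → r ≤ 1 → ∀ θ, θ ≠ 0 → ‖θ‖ ≤ Θ → ‖𝒦[f, W, Ψ, r, θ] -
      (2 * π) ^ d * (Ψ θ + r * expansionOne ε Ψ θ + r ^ 2 * expansionTwo ε Ψ θ)‖ ≤ C * r ^ 3 := by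
  obtain ⟨C, hC0, hC⟩ := hM.exists_pointwise_bound Θ hΘ
  have hw := h.integrable_one_add_pow_mul_wavelet 7
  refine ⟨C * ∫ z, (1 + ‖z‖) ^ 7 * ‖wavelet Ψ z‖,
    mul_nonneg hC0 (integral_nonneg fun z => by positivity), fun r hr hr1 θ hθ hθΘ => ?_⟩
  have hA := hM.integrable_exp_mul_amplitude_mul_wavelet h (r := r) hθ (I * r⁻¹)
  have hbound : ∀ z, ‖cexp (I * r⁻¹ * f (r • z, θ)) * W (r • z, θ) * wavelet Ψ z -
      𝐞[z, θ] * (taylorAmplitude ε r z θ * wavelet Ψ z)‖ ≤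
      C * r ^ 3 * ((1 + ‖z‖) ^ 7 * ‖wavelet Ψ z‖) := by
    intro z
    rw [← mul_assoc, ← sub_mul, norm_mul, ← mul_assoc (C * r ^ 3)]
    gcongr
    exact hC r hr hr1 θ hθ hθΘ z
  have hBc : Continuous fun z => 𝐞[z, θ] * (taylorAmplitude ε r z θ * wavelet Ψ z) := by
    have h1 := continuous_ofReal_inner θ
    have h2 := continuous_taylorAmplitude ε r θ
    have h3 := h.continuous_wavelet
    fun_prop
  have hD : Integrable fun z => cexp (I * r⁻¹ * f (r • z, θ)) * W (r • z, θ) *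
      wavelet Ψ z - 𝐞[z, θ] * (taylorAmplitude ε r z θ * wavelet Ψ z) :=
    (hw.const_mul (C * r ^ 3)).mono' (hA.aestronglyMeasurable.sub hBc.aestronglyMeasurable)
      (ae_of_all _ hbound)
  have hB : Integrable fun z => 𝐞[z, θ] * (taylorAmplitude ε r z θ * wavelet Ψ z) :=
    (hA.sub hD).congr (ae_of_all _ fun z => by simp)
  rw [← integral_taylorAmplitude h, ← integral_sub hA hB]
  calc _ ≤ ∫ z, C * r ^ 3 * ((1 + ‖z‖) ^ 7 * ‖wavelet Ψ z‖) :=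
        norm_integral_le_of_norm_le (hw.const_mul _) (ae_of_all _ hbound)
    _ = _ := by rw [integral_const_mul]; ring

set_option maxHeartbeats 400000 in
lemma exists_decay_bound (h : IsTest Ψ) (Θ : ℝ) (hΘ : 1 ≤ Θ)
    (hsupp : tsupport Ψ ⊆ closedBall 0 (Θ / 4)) (n : ℕ) : ∃ C : ℝ, 0 ≤ C ∧
    ∀ r : ℝ, 0 < r → r ≤ 1 → ∀ θ, Θ ≤ ‖θ‖ → ‖𝒦[f, W, Ψ, r, θ]‖ ≤ C * r ^ n * (‖θ‖ ^ (n + d))⁻¹ := by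
  set Ω : Set (𝔼 × 𝔼) := {p | p.1 ≠ 0 ∧ ‖p.2‖ < ‖p.1‖ / 2}
  have hΩ : IsOpen Ω := (isOpen_ne_fun continuous_fst continuous_const).inter
    (isOpen_lt continuous_snd.norm (continuous_fst.norm.div_const 2))
  set D : (𝔼 × 𝔼) × 𝔼 → ℂ :=
    fun x => fderiv ℝ f (x.2, x.1.1) (x.1.1, 0) - ((inner ℝ x.1.1 x.1.2 : ℝ) : ℂ) with hDdef
  have hD : SmoothOn D (Ω ×ˢ ball 0 a) := by
    refine ContDiffOn.sub ?_ ?_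
    · refine ContDiffOn.clm_apply ?_ ?_
      · refine (hM.f_smooth.fderiv_of_isOpen (isOpen_ball.prod isOpen_compl_singleton)
          (m := ∞) (by simp)).comp (contDiff_snd.prodMk (contDiff_fst.comp contDiff_fst)).contDiffOn
            ?_
        rintro ⟨p, w⟩ ⟨hp, hw⟩
        exact ⟨hw, hp.1⟩
      · exact ((contDiff_fst.comp contDiff_fst).prodMk contDiff_const).contDiffOn
    · exact (ofRealCLM.contDiff.comp ((contDiff_fst.comp contDiff_fst).inner ℝ
        (contDiff_snd.comp contDiff_fst))).contDiffOn
  have hD0 : ∀ p ∈ Ω, ∀ w ∈ ball (0 : 𝔼) a, D (p, w) ≠ 0 := by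
    rintro ⟨u, ζ⟩ ⟨hu, hζ⟩ w hw h0
    have h1 := hM.f_grad w hw u hu
    have h2 := congrArg Complex.re h0
    simp only [hDdef, Complex.sub_re, ofReal_re, Complex.zero_re] at h2
    have h3 := real_inner_le_norm u ζ
    have h4 : ‖u‖ * ‖ζ‖ ≤ ‖u‖ * (‖u‖ / 2) := by
      have := norm_nonneg u
      simp only at hζ
      gcongr
    nlinarith
  obtain ⟨C, hC0, hC⟩ := exists_bound_nonstationary hΩ isOpen_ball (isCompact_closedBall 0 a')
    hM.closedBall_subset_ball hD hD0 (e := fun p => p.1) contDiff_fst.contDiffOn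
    ((isCompact_sphere (0 : 𝔼) 1).prod (isCompact_closedBall (0 : 𝔼) (1 / 4))) (by
      rintro ⟨u, ζ⟩ ⟨hu, hζ⟩
      have hu1 : ‖u‖ = 1 := by simpa using hu
      have hζ1 : ‖ζ‖ ≤ 1 / 4 := by simpa using hζ
      refine ⟨fun h0 => ?_, ?_⟩
      · simp only at h0
        simp [h0] at hu1
      · simp only [hu1]; linarith) (n + d) (a := fun x => W (x.2, x.1.1))
    (hM.W_smooth.comp (contDiff_snd.prodMk (contDiff_fst.comp contDiff_fst)).contDiffOn
      fun x hx => ⟨mem_univ _, hx.1.1⟩) (fun p _ z hz => hM.W_supp z hz _)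
  refine ⟨C * ∫ ξ, ‖Ψ ξ‖, mul_nonneg hC0 (integral_nonneg fun _ => norm_nonneg _),
    fun r hr hr1 θ hθ => ?_⟩
  have hθn : 0 < ‖θ‖ := by linarith
  have hθ0 : θ ≠ 0 := norm_pos_iff.1 hθn
  obtain ⟨υ, hυ1, hυ0, hθυ, hfυ, hWυ⟩ := hM.exists_direction hθ0
  obtain ⟨hg1, hg2⟩ := hM.contDiff_exp_mul_amplitude hθ0 (I * r⁻¹)
  set g : 𝔼 → ℂ := fun w => cexp (I * r⁻¹ * f (w, θ)) * W (w, θ) with hg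
  set H : 𝔼 → 𝔼 → ℂ := fun w ξ => g w * (cexp (-(I * (inner ℝ ξ (r⁻¹ • w) : ℝ))) * Ψ ξ) with hH
  have e1 : 𝒦[f, W, Ψ, r, θ] = ((r ^ d)⁻¹ : ℝ) * ∫ w, ∫ ξ, H w ξ := by
    have h1 := Measure.integral_comp_smul (volume : Measure 𝔼)
      (fun w => g w * wavelet Ψ (r⁻¹ • w)) r
    rw [finrank_euclideanSpace_fin, abs_of_nonneg (by positivity), real_smul] at h1
    simp only [smul_smul, inv_mul_cancel₀ hr.ne', one_smul] at h1
    rw [h1]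
    congr 2
    ext w
    rw [hH, integral_const_mul]
    rfl
  have hHi : Integrable (Function.uncurry H) := by
    refine Continuous.integrable_of_hasCompactSupport ?_ ?_
    · have h1 : Continuous fun x : 𝔼 × 𝔼 =>
          ((inner ℝ x.2 (r⁻¹ • x.1) : ℝ) : ℂ) := continuous_ofReal.comp (by fun_prop)
      have h2 := hg1.continuous
      have h3 := h.smooth.continuous
      simp only [hH, Function.uncurry_def]
      fun_prop
    · refine HasCompactSupport.intro (hg2.isCompact.prod h.compact.isCompact) ?_
      rintro ⟨w, ξ⟩ hx
      simp only [mem_prod, not_and_or] at hx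
      rcases hx with hx | hx
      · simp [hH, image_eq_zero_of_notMem_tsupport hx]
      · simp [hH, image_eq_zero_of_notMem_tsupport hx]
  have hl : 0 < ‖θ‖ / r := by positivity
  have e2 : ∀ ξ, ‖∫ w, H w ξ‖ ≤ C * ((‖θ‖ / r) ^ (n + d))⁻¹ * ‖Ψ ξ‖ := by
    intro ξ
    by_cases hξ : ξ ∈ tsupport Ψ
    · have hξn : ‖ξ‖ ≤ Θ / 4 := by simpa using hsupp hξ
      have h1 : ∀ w, H w ξ = cexp (I * ((‖θ‖ / r : ℝ) : ℂ) *
          (f (w, υ) - ((inner ℝ w (‖θ‖⁻¹ • ξ) : ℝ) : ℂ))) * W (w, υ) * Ψ ξ := by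
        intro w
        by_cases hw : w ∈ closedBall (0 : 𝔼) a'
        · simp only [hH, hg, hfυ w (hM.closedBall_subset_ball hw), hWυ]
          rw [show ∀ A B C D : ℂ, A * B * (C * D) = (A * C) * B * D from fun _ _ _ _ => by ring,
            ← Complex.exp_add]
          congr 3
          have h5 : (‖θ‖ : ℂ) ≠ 0 := by exact_mod_cast hθn.ne'
          have h6 : (r : ℂ) ≠ 0 := by exact_mod_cast hr.ne'
          rw [inner_smul_right, inner_smul_right, real_inner_comm]
          push_cast
          field_simp
          ring
        · simp [hH, hg, hM.W_supp w hw]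
      simp_rw [h1]
      rw [integral_mul_const, norm_mul]
      gcongr
      refine hC (υ, ‖θ‖⁻¹ • ξ) ⟨by simpa using hυ1, ?_⟩ _ ?_ ?_ ?_ _ hl
      · rw [mem_closedBall_zero_iff, norm_smul, norm_inv, norm_norm, inv_mul_le_iff₀ hθn]
        linarith
      · refine ((hM.contDiffOn_phase hυ0).of_le (by norm_cast)).sub ?_
        exact (ofRealCLM.contDiff.comp (contDiff_id.inner ℝ contDiff_const)).contDiffOn
      · intro w hw
        have h5 : HasFDerivAt f (fderiv ℝ f (w, υ)) (w, υ) := hM.hasFDerivAt_phase hw hυ0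
        have h6 := h5.comp w (hasFDerivAt_prodMk_left (𝕜 := ℝ) w υ)
        have h7 : HasFDerivAt (fun w : 𝔼 => ((inner ℝ w (‖θ‖⁻¹ • ξ) : ℝ) : ℂ))
            (ofRealCLM.comp (innerSL ℝ (‖θ‖⁻¹ • ξ))) w := by
          refine (ofRealCLM.comp (innerSL ℝ (‖θ‖⁻¹ • ξ))).hasFDerivAt.congr_of_eventuallyEq
            (.of_forall fun x => ?_)
          exact congrArg Complex.ofReal (real_inner_comm _ _)
        have h8 := (h6.sub h7).fderiv
        simp only [hDdef]
        rw [show (fun w => f (w, υ) - ((inner ℝ w (‖θ‖⁻¹ • ξ) : ℝ) : ℂ)) =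
          (f ∘ fun w => (w, υ)) - fun w => ((inner ℝ w (‖θ‖⁻¹ • ξ) : ℝ) : ℂ) from rfl, h8]
        exact congrArg (fderiv ℝ f (w, υ) (υ, 0) - Complex.ofReal ·) (real_inner_comm υ (‖θ‖⁻¹ • ξ))
      · intro w hw
        simpa using hM.f_im w hw υ hυ0
    · have : Ψ ξ = 0 := image_eq_zero_of_notMem_tsupport hξ
      simp [hH, this]
  rw [e1, integral_integral_swap hHi, norm_mul, norm_real, norm_of_nonneg (by positivity)]
  have e3 : ‖∫ ξ, ∫ w, H w ξ‖ ≤ C * ((‖θ‖ / r) ^ (n + d))⁻¹ * ∫ ξ, ‖Ψ ξ‖ := by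
    rw [← integral_const_mul]
    exact norm_integral_le_of_norm_le (h.integrable.norm.const_mul _) (ae_of_all _ e2)
  calc _ ≤ (r ^ d)⁻¹ * (C * ((‖θ‖ / r) ^ (n + d))⁻¹ * ∫ ξ, ‖Ψ ξ‖) := by gcongr
    _ = C * (∫ ξ, ‖Ψ ξ‖) * r ^ n * (‖θ‖ ^ (n + d))⁻¹ := by
      rw [div_pow, inv_div, pow_add r]
      field_simp

end FlatModel

lemma lap_eq_zero_of_notMem {ξ : 𝔼} (hξ : ξ ∉ tsupport Ψ) : lap Ψ ξ = 0 := by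
  have h1 : lap Ψ =ᶠ[𝓝 ξ] 0 := by
    have h0 := notMem_tsupport_iff_eventuallyEq.1 hξ
    have hl : ∀ (v : 𝔼) {g : 𝔼 → ℂ}, g =ᶠ[𝓝 ξ] 0 → lineD v g =ᶠ[𝓝 ξ] 0 := by
      intro v g hg
      filter_upwards [hg.eventuallyEq_nhds] with x hx
      simp [lineD, hx.fderiv_eq]
    have h2 : ∀ᶠ x in 𝓝 ξ, ∀ j, lineD (stdVec j) (lineD (stdVec j) Ψ) x = 0 :=
      eventually_all.2 fun j => hl _ (hl _ h0)
    filter_upwards [h2] with x hx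
    simp [lap, hx]
  exact h1.eq_of_nhds

lemma tsupport_lap_subset : tsupport (lap Ψ) ⊆ tsupport Ψ :=
  closure_minimal (fun _ hx => by_contra fun hn => hx (lap_eq_zero_of_notMem hn))
    (isClosed_tsupport _)

lemma fderiv_eq_zero_of_notMem {ξ : 𝔼} (hξ : ξ ∉ tsupport Ψ) : fderiv ℝ Ψ ξ = 0 := by
  rw [(notMem_tsupport_iff_eventuallyEq.1 hξ).fderiv_eq]
  simp

lemma expansionOne_eq_zero (ε : ℝ) {ξ : 𝔼} (hξ : ξ ∉ tsupport Ψ) : expansionOne ε Ψ ξ = 0 := by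
  simp [expansionOne, lap_eq_zero_of_notMem hξ, fderiv_eq_zero_of_notMem hξ]

lemma expansionTwo_eq_zero (h : IsTest Ψ) (ε : ℝ) {ξ : 𝔼}
    (hξ : ξ ∉ tsupport Ψ) : expansionTwo ε Ψ ξ = 0 := by
  have h1 : ξ ∉ tsupport (lap Ψ) := fun h2 => hξ (tsupport_lap_subset h2)
  have h2 : ξ ∉ tsupport (fun ζ => fderiv ℝ Ψ ζ ζ) := fun h3 => hξ (closure_minimal
    (fun x (hx : fderiv ℝ Ψ x x ≠ 0) => by_contra fun hn => hx (by
      simp [fderiv_eq_zero_of_notMem hn])) (isClosed_tsupport _) h3)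
  simp [expansionTwo, lap_eq_zero_of_notMem h1, fderiv_eq_zero_of_notMem h1,
    lineD_lineD_self h, fderiv_eq_zero_of_notMem hξ, fderiv_eq_zero_of_notMem h2]

lemma continuousOn_norm_pow (k : ℕ) : ContinuousOn (fun ξ : 𝔼 => ((‖ξ‖ ^ k : ℝ) : ℂ)⁻¹) {0}ᶜ := by
  refine ContinuousOn.inv₀ (by fun_prop) fun x hx => ?_
  exact_mod_cast pow_ne_zero k (norm_ne_zero_iff.2 hx)

lemma IsTest.integrable_mul_expansionOne (h : IsTest Ψ) (ε : ℝ)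
    {f : 𝔼 → ℂ} (hf : ContinuousOn f {0}ᶜ) : Integrable fun ξ => f ξ * expansionOne ε Ψ ξ := by
  have hn : Continuous fun ξ : 𝔼 => ((‖ξ‖ : ℝ) : ℂ) :=
    continuous_ofReal.comp continuous_norm
  have hi := continuousOn_norm_pow (d := d) 1
  have h1 := (h.lap.integrable_mul (hf.mul hn.continuousOn)).const_mul ((ε : ℂ) / 2)
  have h2 := (h.radial.integrable_mul (hf.mul hi)).const_mul ((ε : ℂ) / 2)
  refine (h1.add h2).congr (ae_of_all _ fun ξ => ?_)
  simp only [Pi.add_apply, Pi.mul_apply, expansionOne, pow_one]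
  push_cast
  ring

lemma IsTest.integrable_mul_expansionTwo (h : IsTest Ψ) (ε : ℝ)
    {f : 𝔼 → ℂ} (hf : ContinuousOn f {0}ᶜ) : Integrable fun ξ => f ξ * expansionTwo ε Ψ ξ := by
  have hn : Continuous fun ξ : 𝔼 => ((‖ξ‖ ^ 2 : ℝ) : ℂ) :=
    continuous_ofReal.comp (continuous_norm.pow 2)
  have hi := continuousOn_norm_pow (d := d) 2
  have h1 := (h.lap.lap.integrable_mul (hf.mul hn.continuousOn)).const_mul ((ε : ℂ) ^ 2 / 8)
  have h2 := (h.lap.radial.integrable_mul hf).const_mul ((ε : ℂ) ^ 2 / 8 * 2)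
  have h3 := (h.radial.radial.integrable_mul (hf.mul hi)).const_mul (-(ε : ℂ) ^ 2 / 8)
  have h4 := (h.radial.integrable_mul (hf.mul hi)).const_mul ((ε : ℂ) ^ 2 / 8)
  refine (((h1.add h2).add h3).add h4).congr (ae_of_all _ fun ξ => ?_)
  simp only [Pi.add_apply, Pi.mul_apply, expansionTwo, lineD_lineD_self h]
  ring

lemma IsTest.integral_expansionOne (h : IsTest Ψ) (ε : ℝ) : ∫ ξ, expansionOne ε Ψ ξ = 0 := by
  simp only [expansionOne, LeviCivita.lap]
  rw [integral_const_mul, integral_norm_laplacian h, mul_zero]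

lemma IsTest.integral_expansionTwo (h : IsTest Ψ) (ε : ℝ) : ∫ ξ, expansionTwo ε Ψ ξ =
      -(ε ^ 2 / 8 * ((d - 1) * (d - 2))) * ∫ ξ, ((‖ξ‖ ^ 2 : ℝ) : ℂ)⁻¹ * Ψ ξ := by
  have hn : Continuous fun ξ : 𝔼 => ((‖ξ‖ ^ 2 : ℝ) : ℂ) :=
    continuous_ofReal.comp (continuous_norm.pow 2)
  have hi := continuousOn_norm_pow (d := d) 2
  have h1 := h.lap.lap.integrable_mul hn.continuousOn
  have h2 := h.lap.radial.integrable.const_mul 2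
  have h3 : Integrable fun ξ => ((‖ξ‖ ^ 2 : ℝ) : ℂ)⁻¹ * LeviCivita.lineD ξ (LeviCivita.lineD ξ Ψ) ξ
    := by
    refine ((h.radial.radial.integrable_mul hi).sub (h.radial.integrable_mul hi)).congr
      (ae_of_all _ fun ξ => ?_)
    simp only [Pi.sub_apply, lineD_lineD_self h]
    ring
  have h4 := integral_normSq_laplacian h.lap
  simp only [expansionTwo]
  rw [integral_const_mul, integral_sub (by exact h1.add h2) h3, integral_inv_normSq_lineD h]
  have h5 : ∫ ξ, (((‖ξ‖ ^ 2 : ℝ) : ℂ) * LeviCivita.lap (LeviCivita.lap Ψ) ξ + 2 * fderiv ℝ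
    (LeviCivita.lap Ψ) ξ ξ) = 0 := h4
  rw [h5]
  ring

lemma innerIntegral_zero (h : IsTest Ψ) (η : 𝔼) : 𝒥[f, β, Ψ, (0 : ℝ), η] = 0 := by
  simp only [zero_smul]
  rw [integral_const_mul]
  have := h.integral_exp_mul_wavelet 0
  simp only [inner_zero_right, Complex.ofReal_zero, mul_zero, Complex.exp_zero, one_mul,
    image_eq_zero_of_notMem_tsupport h.zero_notMem] at this
  rw [this, mul_zero]

namespace FlatModel

variable (hM : FlatModel ε a a' f W β s c)
include hM

lemma continuousOn_exp_mul : ContinuousOn (fun x : 𝔼 ×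
    𝔼 => cexp (I * f x) * β x) (univ ×ˢ {0}ᶜ) := by
  rintro ⟨w, η⟩ ⟨-, hη⟩
  by_cases hw : w ∈ ball (0 : 𝔼) a
  · have h1 : ContinuousAt f (w, η) := hM.f_smooth.continuousOn.continuousAt
      ((isOpen_ball.prod isOpen_compl_singleton).mem_nhds (mem_prod.2 ⟨hw, hη⟩))
    have h2 : ContinuousAt (fun x => cexp (I * f x)) (w, η) := (continuousAt_const.mul h1).cexp
    exact h2.continuousWithinAt.mul (hM.β_cont _ ⟨mem_univ _, hη⟩)
  · have h1 : w ∈ (closedBall (0 : 𝔼) a')ᶜ := fun h => hw (hM.closedBall_subset_ball h)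
    have h2 : (fun x => cexp (I * f x) * β x) =ᶠ[𝓝 (w, η)] fun _ => 0 := by
      filter_upwards [(isClosed_closedBall.isOpen_compl.preimage continuous_fst).mem_nhds
        (show (w, η) ∈ Prod.fst ⁻¹' _ from h1)] with x hx
      rw [show x = (x.1, x.2) from rfl, hM.β_supp x.1 hx x.2, mul_zero]
    exact (continuousAt_const.congr h2.symm).continuousWithinAt

lemma exists_bound_exp_mul : ∃ C : ℝ, 0 ≤ C ∧ ∀ w η, η ≠ 0 →
    ‖cexp (I * f (w, η)) * β (w, η)‖ ≤ C := by
  obtain ⟨Cw, hCw0, hCw, -⟩ := hM.exists_amplitude_bound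
  obtain ⟨C1, hC1⟩ := ((isCompact_closedBall (0 : 𝔼) a').prod ((isCompact_closedBall (0 : 𝔼) 1).diff
      (isOpen_ball (x := (0 : 𝔼)) (ε := 1 / 2)))).exists_bound_of_continuousOn (hM.β_cont.mono (by
      rintro ⟨w, η⟩ ⟨-, -, hη⟩
      refine ⟨mem_univ _, fun h0 => hη ?_⟩
      simp [show η = 0 from h0]))
  refine ⟨max Cw C1, le_max_of_le_left hCw0, fun w η hη => ?_⟩
  by_cases hw : w ∈ closedBall (0 : 𝔼) a'
  · have h1 : ‖cexp (I * f (w, η))‖ ≤ 1 := by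
      rw [norm_exp]
      have := hM.f_im w (hM.closedBall_subset_ball hw) η hη
      simpa using this
    have h2 : ‖β (w, η)‖ ≤ max Cw C1 := by
      by_cases h3 : 1 ≤ ‖η‖
      · rw [hM.β_eq w η h3]; exact le_max_of_le_left (hCw _ _ hη)
      · by_cases h4 : ‖η‖ ≤ 1 / 2
        · rw [hM.β_zero w η hη h4, norm_zero]; exact le_max_of_le_left hCw0
        · refine le_max_of_le_right (hC1 (w, η) ⟨hw, ?_, ?_⟩)
          · simpa using (not_le.1 h3).le
          · simp only [mem_ball_zero_iff, not_lt]
            exact (not_le.1 h4).le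
    rw [norm_mul]
    calc _ ≤ 1 * max Cw C1 := by gcongr
      _ = _ := one_mul _
  · rw [hM.β_supp w hw, mul_zero, norm_zero]
    exact le_max_of_le_left hCw0

lemma continuousOn_innerIntegral (h : IsTest Ψ) : ContinuousOn (fun x : ℝ × 𝔼 =>
      𝒥[f, β, Ψ, x.1, x.2]) (univ ×ˢ {0}ᶜ) := by
  obtain ⟨C, hC0, hC⟩ := hM.exists_bound_exp_mul
  have hb := hM.continuousOn_exp_mul
  refine continuousOn_of_dominated (bound := fun z => C * ‖wavelet Ψ z‖) ?_ ?_
    (h.integrable_wavelet.norm.const_mul C) ?_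
  · rintro ⟨r, η⟩ ⟨-, hη⟩
    refine (Continuous.mul ?_ h.continuous_wavelet).aestronglyMeasurable
    rw [← continuousOn_univ]
    exact hb.comp (f := fun z => (r • z, η)) (by fun_prop) fun z _ => ⟨mem_univ _, hη⟩
  · rintro ⟨r, η⟩ ⟨-, hη⟩
    refine ae_of_all _ fun z => ?_
    rw [norm_mul]
    gcongr
    exact hC _ _ hη
  · refine ae_of_all _ fun z => ContinuousOn.mul ?_ continuousOn_const
    exact hb.comp (f := fun x : ℝ × 𝔼 => (x.1 • z, x.2)) (by fun_prop)
      fun z hz => ⟨mem_univ _, hz.2⟩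

lemma exists_bound_innerIntegral (h : IsTest Ψ) : ∃ C : ℝ, 0 ≤ C ∧ ∀ (r : ℝ) (η), η ≠ 0 →
    ‖𝒥[f, β, Ψ, r, η]‖ ≤ C := by
  obtain ⟨C, hC0, hC⟩ := hM.exists_bound_exp_mul
  refine ⟨∫ z, C * ‖wavelet Ψ z‖, integral_nonneg fun z => by positivity, fun r η hη =>
    norm_integral_le_of_norm_le (h.integrable_wavelet.norm.const_mul C) (ae_of_all _ fun z => ?_)⟩
  rw [norm_mul]
  gcongr
  exact hC _ _ hη

lemma innerIntegral_eq {r : ℝ} (hr : 0 < r) {θ : 𝔼} (hθ : r ≤ ‖θ‖) : 𝒥[f, β, Ψ, r, r⁻¹ • θ] =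
      𝒦[f, W, Ψ, r, θ] := by
  have hθ0 : θ ≠ 0 := norm_pos_iff.1 (hr.trans_le hθ)
  congr 1
  ext z
  have h1 : 1 ≤ ‖r⁻¹ • θ‖ := one_le_norm_inv_smul hr hθ
  rw [hM.β_eq _ _ h1, hM.W_hom _ _ hθ0 _ (inv_pos.2 hr)]
  by_cases hz : r • z ∈ closedBall (0 : 𝔼) a'
  · rw [hM.f_hom _ (hM.closedBall_subset_ball hz) _ hθ0 _ (inv_pos.2 hr)]
    push_cast
    rw [mul_assoc I]
  · simp [hM.W_supp _ hz]

lemma exists_remainder_bound (h : IsTest Ψ) : ∃ C : ℝ, 0 ≤ C ∧ ∀ r : ℝ, 0 < r → r ≤ 1 → ∀ θ, θ ≠ 0 →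
    ‖𝒦[f, W, Ψ, r, θ] - (2 * π) ^ d * (Ψ θ + r * expansionOne ε Ψ θ + r ^ 2 * expansionTwo ε Ψ θ)‖ ≤
      C * r ^ 3 * ((1 + ‖θ‖) ^ (d + 1))⁻¹ := by
  obtain ⟨R, hR⟩ := h.compact.isCompact.isBounded.subset_closedBall (0 : 𝔼)
  set Θ : ℝ := max 1 (4 * (R + 1))
  have hΘ1 : 1 ≤ Θ := le_max_left _ _
  have hsupp : tsupport Ψ ⊆ closedBall 0 (Θ / 4) := hR.trans (closedBall_subset_closedBall (by
    have := le_max_right 1 (4 * (R + 1)); linarith))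
  have hlt : ∀ θ ∈ tsupport Ψ, ‖θ‖ < Θ := fun θ hθ => by
    have h1 : ‖θ‖ ≤ R := by simpa using hR hθ
    have h2 := le_max_right 1 (4 * (R + 1))
    have h3 := norm_nonneg θ
    linarith
  obtain ⟨C1, hC10, hC1⟩ := hM.exists_taylor_bound h Θ (by linarith)
  obtain ⟨C2, hC20, hC2⟩ := hM.exists_decay_bound h Θ hΘ1 hsupp 3
  refine ⟨C1 * (1 + Θ) ^ (d + 1) + C2 * 2 ^ (d + 1), by positivity, fun r hr hr1 θ hθ => ?_⟩
  have hn := norm_nonneg θ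
  rcases le_or_gt Θ ‖θ‖ with h1 | h1
  · have h2 : θ ∉ tsupport Ψ := fun h3 => (hlt θ h3).not_ge h1
    rw [image_eq_zero_of_notMem_tsupport h2, expansionOne_eq_zero ε h2, expansionTwo_eq_zero h ε h2]
    simp only [mul_zero, add_zero, sub_zero]
    have h3 : (1 + ‖θ‖) ^ (d + 1) ≤ 2 ^ (d + 1) * ‖θ‖ ^ (3 + d) := by
      calc (1 + ‖θ‖) ^ (d + 1) ≤ (2 * ‖θ‖) ^ (d + 1) := by gcongr; linarith
        _ = 2 ^ (d + 1) * ‖θ‖ ^ (d + 1) := mul_pow _ _ _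
        _ ≤ _ := by
          exact mul_le_mul_of_nonneg_left (pow_le_pow_right₀ (by linarith) (by omega))
            (by positivity)
    have hθp : 0 < ‖θ‖ := by linarith
    calc _ ≤ C2 * r ^ 3 * (‖θ‖ ^ (3 + d))⁻¹ := hC2 r hr hr1 θ h1
      _ ≤ C2 * r ^ 3 * (2 ^ (d + 1) * ((1 + ‖θ‖) ^ (d + 1))⁻¹) := by
        gcongr
        rw [← div_eq_mul_inv, le_div_iff₀ (by positivity), inv_mul_le_iff₀ (by positivity)]
        linarith
      _ = (0 + C2 * 2 ^ (d + 1)) * r ^ 3 * ((1 + ‖θ‖) ^ (d + 1))⁻¹ := by ring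
      _ ≤ _ := by gcongr; positivity
  · calc _ ≤ C1 * r ^ 3 := hC1 r hr hr1 θ hθ h1.le
      _ ≤ C1 * r ^ 3 * ((1 + Θ) ^ (d + 1) * ((1 + ‖θ‖) ^ (d + 1))⁻¹) := by
        refine le_mul_of_one_le_right (by positivity) ?_
        rw [← div_eq_mul_inv, one_le_div (by positivity)]
        gcongr
      _ = (C1 * (1 + Θ) ^ (d + 1) + 0) * r ^ 3 * ((1 + ‖θ‖) ^ (d + 1))⁻¹ := by ring
      _ ≤ _ := by gcongr; positivity

lemma exists_bound_component (k : ℕ) : ∃ C : ℝ, 0 ≤ C ∧ ∀ θ, 1 ≤ ‖θ‖ → ‖c k θ‖ ≤ C := by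
  obtain ⟨C, hC⟩ := (isCompact_sphere (0 : 𝔼) 1).exists_bound_of_continuousOn
    ((hM.c_cont k).mono fun x hx h0 => by
      simp [show x = 0 from h0] at hx)
  refine ⟨max C 0, le_max_right _ _, fun θ hθ => ?_⟩
  have hθ0 : 0 < ‖θ‖ := by linarith
  obtain ⟨υ, hυ1, hυ0, hθυ, -⟩ := hM.exists_direction (norm_pos_iff.1 hθ0)
  rw [hθυ, hM.c_hom k υ hυ0 _ hθ0, norm_mul, norm_real, norm_of_nonneg (by positivity)]
  have h2 : (‖θ‖ ^ k)⁻¹ ≤ 1 := inv_le_one_of_one_le₀ (one_le_pow₀ hθ)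
  have h3 : ‖c k υ‖ ≤ max C 0 := (hC _ (by simpa using hυ1)).trans (le_max_left _ _)
  calc _ ≤ 1 * max C 0 := by gcongr
    _ = _ := one_mul _

lemma exists_bound_symbol : ∃ C : ℝ, 0 ≤ C ∧ ∀ θ, 1 ≤ ‖θ‖ → ‖s θ‖ ≤ C := by
  obtain ⟨C, hC⟩ := hM.s_rem
  choose B hB0 hB using hM.exists_bound_component
  refine ⟨max C 0 + ∑ k ∈ Finset.range 3, B k, add_nonneg (le_max_right _ _)
    (Finset.sum_nonneg fun k _ => hB0 k), fun θ hθ => ?_⟩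
  calc ‖s θ‖ = ‖(s θ - ∑ k ∈ Finset.range 3, c k θ) + ∑ k ∈ Finset.range 3, c k θ‖ := by
        rw [sub_add_cancel]
    _ ≤ C * (‖θ‖ ^ 3)⁻¹ + ∑ k ∈ Finset.range 3, B k :=
        (norm_add_le _ _).trans (add_le_add (hC θ hθ) (norm_sum_le_of_le _ fun k _ => hB k θ hθ))
    _ ≤ max C 0 * 1 + ∑ k ∈ Finset.range 3, B k := by
        gcongr
        · exact le_max_left _ _
        · exact inv_le_one_of_one_le₀ (one_le_pow₀ hθ)
    _ = _ := by ring

end FlatModel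

lemma coeff_eq_zero_of_isLittleO_sq {e₀ e₁ e₂ : ℂ}
    (h : (fun r : ℝ => e₀ + r * e₁ + r ^ 2 * e₂) =o[𝓝[>] 0] fun r : ℝ => r ^ 2) :
    e₀ = 0 ∧ e₁ = 0 ∧ e₂ = 0 := by
  have h1 : (fun r : ℝ => (r : ℂ) ^ 2 * e₂) =O[𝓝[>] 0] fun r : ℝ => r ^ 2 := by
    refine IsBigO.of_bound ‖e₂‖ (.of_forall fun r => ?_)
    rw [norm_mul, norm_pow, norm_pow, norm_real, mul_comm]
  have h2 := coeff_eq_zero_of_isBigO 2 (fun k => if k = 0 then e₀ else e₁) (by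
    refine (h.isBigO.sub h1).congr_left fun r => ?_
    simp [sum_range_succ])
  have h3 : e₀ = 0 := by simpa using h2 0 (by norm_num)
  have h4 : e₁ = 0 := by simpa using h2 1 (by norm_num)
  refine ⟨h3, h4, ?_⟩
  by_contra h5
  have h6 : 0 < ‖e₂‖ := norm_pos_iff.2 h5
  obtain ⟨r, hr, hr0⟩ := ((h.def (half_pos h6)).and self_mem_nhdsWithin).exists
  have hr0 : (0 : ℝ) < r := hr0
  rw [h3, h4, mul_zero, zero_add, zero_add, norm_mul, norm_pow, norm_pow, norm_real,
    norm_of_nonneg hr0.le] at hr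
  nlinarith [mul_pos (pow_pos hr0 2) h6]

lemma eq_zero_of_integral_mul_isTest {g : 𝔼 → ℂ}
    (hg : ContinuousOn g {0}ᶜ) (h : ∀ Ψ, IsTest Ψ → ∫ ξ, g ξ * Ψ ξ = 0) : ∀ ξ, ξ ≠ 0 → g ξ = 0 := by
  have h1 := (isOpen_compl_singleton (x := (0 : 𝔼))).ae_eq_zero_of_integral_contDiff_smul_eq_zero
    (hg.locallyIntegrableOn (μ := volume) isOpen_compl_singleton.measurableSet) (fun ρ hρ hρc hρs =>
      by
      have h2 : IsTest (fun ξ => (ρ ξ : ℂ)) := by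
        have h3 : tsupport (fun ξ => (ρ ξ : ℂ)) ⊆ tsupport ρ :=
          closure_mono fun x (hx : (ρ x : ℂ) ≠ 0) => by simpa using hx
        exact ⟨ofRealCLM.contDiff.comp hρ,
          hρc.of_isClosed_subset (isClosed_tsupport _) h3, fun h0 => hρs (h3 h0) rfl⟩
      rw [← h _ h2]
      congr 1
      ext ξ
      rw [real_smul, mul_comm])
  intro ξ hξ
  have h2 : EqOn g (fun _ => 0) {0}ᶜ := Measure.eqOn_open_of_ae_eq (μ := volume)
    ((ae_restrict_iff' isOpen_compl_singleton.measurableSet).2 h1)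
    isOpen_compl_singleton hg continuousOn_const
  exact h2 hξ

lemma integrable_one_add_norm_pow_inv : Integrable fun x : 𝔼 => ((1 + ‖x‖) ^ (d + 1))⁻¹ := by
  have h := integrable_one_add_norm (μ := (volume : Measure 𝔼))
    (r := (d : ℝ) + 1) (by rw [finrank_euclideanSpace_fin]; linarith)
  refine h.congr (ae_of_all _ fun x => ?_)
  have h1 : (0 : ℝ) < 1 + ‖x‖ := by positivity
  simp only
  rw [Real.rpow_neg h1.le, ← Real.rpow_natCast]
  norm_num

namespace FlatModel

variable (hM : FlatModel ε a a' f W β s c)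
include hM

lemma continuousOn_symbol_mul (h : IsTest Ψ) (r : ℝ) : ContinuousOn (fun η => s η *
    𝒥[f, β, Ψ, r, η]) {0}ᶜ :=
  hM.s_cont.mul ((hM.continuousOn_innerIntegral h).comp (f := fun η => (r, η)) (by fun_prop)
    fun _ hη => ⟨mem_univ _, hη⟩)

lemma exists_bound_symbol_mul (h : IsTest Ψ) : ∃ C : ℝ, 0 ≤ C ∧ ∀ (r : ℝ) (η), η ≠ 0 →
    ‖s η * 𝒥[f, β, Ψ, r, η]‖ ≤ C := by
  obtain ⟨C1, hC10, hC1⟩ := hM.exists_bound_symbol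
  obtain ⟨C2, hC2⟩ := ((isCompact_closedBall (0 : 𝔼) 1).diff
    (isOpen_ball (x := (0 : 𝔼)) (ε := 1 / 2))).exists_bound_of_continuousOn (hM.s_cont.mono (by
      rintro η ⟨-, hη⟩ h0
      simp [show η = 0 from h0] at hη))
  obtain ⟨C3, hC30, hC3⟩ := hM.exists_bound_innerIntegral h
  refine ⟨max C1 C2 * C3, mul_nonneg (le_max_of_le_left hC10) hC30, fun r η hη => ?_⟩
  by_cases h4 : ‖η‖ ≤ 1 / 2
  · simp only [hM.β_zero _ η hη h4, mul_zero, zero_mul, integral_zero, norm_zero]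
    exact mul_nonneg (le_max_of_le_left hC10) hC30
  · rw [norm_mul]
    refine mul_le_mul ?_ (hC3 r η hη) (norm_nonneg _) (le_max_of_le_left hC10)
    by_cases h3 : 1 ≤ ‖η‖
    · exact le_max_of_le_left (hC1 _ h3)
    · refine le_max_of_le_right (hC2 η ⟨?_, ?_⟩)
      · simpa using (not_le.1 h3).le
      · simp only [mem_ball_zero_iff, not_lt]
        exact (not_le.1 h4).le

lemma isLittleO_integral_ball (hd : 2 ≤ d) (h : IsTest Ψ) :
    (fun r : ℝ => ∫ θ in ball 0 r, s (r⁻¹ • θ) * 𝒥[f, β, Ψ, r, r⁻¹ • θ])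
      =o[𝓝[>] 0] fun r : ℝ => r ^ 2 := by
  have : Nonempty (Fin d) := ⟨⟨0, by omega⟩⟩
  obtain ⟨C, hC0, hC⟩ := hM.exists_bound_symbol_mul h
  set F : ℝ → 𝔼 → ℂ := fun r η => s η * 𝒥[f, β, Ψ, r, η]
  have hne : ∀ᵐ η ∂(volume.restrict (ball (0 : 𝔼) 1)), η ≠ 0 :=
    ae_restrict_of_ae ae_ne_zero
  have h1 : Tendsto (fun r : ℝ => ∫ η in ball 0 1, F r η) (𝓝[>] 0) (𝓝 0) := by
    have h2 := tendsto_integral_filter_of_dominated_convergence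
      (μ := volume.restrict (ball (0 : 𝔼) 1)) (F := F)
      (f := fun _ => 0) (l := 𝓝[>] (0 : ℝ)) (fun _ => C) (.of_forall fun r => by
        have h3 := (hM.continuousOn_symbol_mul h r).aestronglyMeasurable (μ := volume)
          isOpen_compl_singleton.measurableSet
        rw [restrict_compl_singleton] at h3
        exact h3.restrict) (.of_forall fun r => by filter_upwards [hne] with η hη using hC r η hη)
      (integrableOn_const measure_ball_lt_top.ne) (by
        filter_upwards [hne] with η hη
        have h3 := (hM.continuousOn_innerIntegral h).continuousAt (x := ((0 : ℝ), η))
          ((isOpen_univ.prod isOpen_compl_singleton).mem_nhds (mem_prod.2 ⟨mem_univ _, hη⟩))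
        have h4 : Tendsto (fun r : ℝ => (r, η)) (𝓝[>] 0) (𝓝 (0, η)) :=
          ((continuous_id.prodMk continuous_const).tendsto' _ _ rfl).mono_left nhdsWithin_le_nhds
        have h5 := (h3.tendsto.comp h4).const_mul (s η)
        rw [innerIntegral_zero h, mul_zero] at h5
        exact h5)
    simpa using h2
  have h2 : (fun r : ℝ => ∫ θ in ball 0 r, F r (r⁻¹ • θ)) =ᶠ[𝓝[>] 0]
      fun r => ((r ^ d : ℝ) : ℂ) * ∫ η in ball 0 1, F r η := by
    filter_upwards [self_mem_nhdsWithin] with r hr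
    have hr : (0 : ℝ) < r := hr
    rw [Measure.setIntegral_comp_smul_of_pos _ _ _ (inv_pos.2 hr), finrank_euclideanSpace_fin,
      _root_.smul_ball (inv_ne_zero hr.ne'), smul_zero, norm_inv, norm_of_nonneg hr.le,
      inv_mul_cancel₀ hr.ne', inv_pow, inv_inv, real_smul]
  refine IsLittleO.congr' (f₁ := fun r : ℝ => ((r ^ d : ℝ) : ℂ) * ∫ η in ball 0 1, F r η)
    (g₁ := fun r : ℝ => r ^ 2 * 1) ?_ h2.symm (.of_forall fun r => mul_one _)
  refine IsBigO.mul_isLittleO ?_ ((isLittleO_one_iff ℝ).2 h1)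
  refine IsBigO.of_bound 1 ?_
  filter_upwards [Ioo_mem_nhdsGT (zero_lt_one' ℝ)] with r hr
  rw [norm_real, norm_of_nonneg (pow_nonneg hr.1.le _),
    norm_of_nonneg (pow_nonneg hr.1.le _), one_mul]
  exact pow_le_pow_of_le_one hr.1.le hr.2.le hd

lemma exists_bound_symbol_sub : ∃ C : ℝ, 0 ≤ C ∧ ∀ r : ℝ, 0 < r → ∀ θ, r ≤ ‖θ‖ →
    ‖s (r⁻¹ • θ) - (c 0 θ + r * c 1 θ + r ^ 2 * c 2 θ)‖ ≤ C * r ^ 3 * (‖θ‖ ^ 3)⁻¹ := by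
  obtain ⟨C, hC⟩ := hM.s_rem
  refine ⟨max C 0, le_max_right _ _, fun r hr θ hθ => ?_⟩
  have hθ0 : θ ≠ 0 := norm_pos_iff.1 (hr.trans_le hθ)
  have hn : ‖r⁻¹ • θ‖ = r⁻¹ * ‖θ‖ := by rw [norm_smul, norm_inv, norm_of_nonneg hr.le]
  have h2 := hC _ (one_le_norm_inv_smul hr hθ)
  simp only [sum_range_succ, Finset.sum_range_zero, zero_add,
    hM.c_hom _ _ hθ0 _ (inv_pos.2 hr)] at h2
  simp only [inv_pow, inv_inv] at h2
  push_cast at h2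
  simp only [pow_zero, one_mul, pow_one] at h2
  refine h2.trans ?_
  rw [hn, mul_pow, mul_inv, inv_pow, inv_inv, mul_assoc]
  gcongr
  exact le_max_left _ _

lemma integral_eq_of_isLittleO (hd : 2 ≤ d) (h : IsTest Ψ) (hlim : (fun r : ℝ => (∫ θ, s (r⁻¹ • θ) *
      𝒥[f, β, Ψ, r, r⁻¹ • θ]) - (2 * π) ^ d * wavelet Ψ 0) =o[𝓝[>] 0] fun r : ℝ => r ^ 2) :
    ∫ ξ, c 0 ξ * Ψ ξ = ∫ ξ, Ψ ξ ∧ (∫ ξ, c 1 ξ * Ψ ξ) + (∫ ξ, c 0 ξ * expansionOne ε Ψ ξ) = 0 ∧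
    (∫ ξ, c 2 ξ * Ψ ξ) + (∫ ξ, c 1 ξ * expansionOne ε Ψ ξ) +
      (∫ ξ, c 0 ξ * expansionTwo ε Ψ ξ) = 0 := by
  have : Nonempty (Fin d) := ⟨⟨0, by omega⟩⟩
  obtain ⟨Cr, hCr0, hCr⟩ := hM.exists_remainder_bound h
  obtain ⟨Cs, hCs0, hCs⟩ := hM.exists_bound_symbol
  obtain ⟨Cd, hCd0, hCd⟩ := hM.exists_bound_symbol_sub
  obtain ⟨Cb, hCb0, hCb⟩ := hM.exists_bound_symbol_mul h
  obtain ⟨Θ, hΘ0, hΘ⟩ : ∃ Θ : ℝ, 0 < Θ ∧ ∀ θ : 𝔼, ‖θ‖ < Θ → θ ∉ tsupport Ψ := by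
    obtain ⟨Θ, hΘ0, hΘ⟩ := isOpen_iff.1 (isClosed_tsupport Ψ).isOpen_compl 0 h.zero_notMem
    exact ⟨Θ, hΘ0, fun θ hθ => hΘ (by simpa using hθ)⟩
  set E₁ := expansionOne ε Ψ with hE₁
  set E₂ := expansionTwo ε Ψ with hE₂
  set F : ℝ → 𝔼 → ℂ := fun r θ => s (r⁻¹ • θ) * 𝒥[f, β, Ψ, r, r⁻¹ • θ] with hF
  set κ : ℂ := (2 * π) ^ d with hκ
  have hκ0 : κ ≠ 0 := by simp [hκ, Real.pi_ne_zero]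
  set P : ℝ → 𝔼 → ℂ := fun r θ => κ * (Ψ θ + r * E₁ θ + r ^ 2 * E₂ θ) with hP
  set Q : ℝ → 𝔼 → ℂ := fun r θ => (c 0 θ + r * c 1 θ + r ^ 2 * c 2 θ) * P r θ with hQ
  have hi : ∀ {g : 𝔼 → ℂ}, ContinuousOn g {0}ᶜ →
      Integrable (fun ξ => g ξ * Ψ ξ) ∧ Integrable (fun ξ => g ξ * E₁ ξ) ∧
      Integrable (fun ξ => g ξ * E₂ ξ) := fun hg =>
    ⟨h.integrable_mul hg, h.integrable_mul_expansionOne ε hg, h.integrable_mul_expansionTwo ε hg⟩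
  set m : ℕ → ℂ := fun k => ∫ ξ, c k ξ * Ψ ξ with hm
  set m₁ : ℕ → ℂ := fun k => ∫ ξ, c k ξ * E₁ ξ with hm₁
  set m₂ : ℕ → ℂ := fun k => ∫ ξ, c k ξ * E₂ ξ with hm₂
  have hcP : ∀ (k : ℕ) (r : ℝ), Integrable (fun ξ => c k ξ * P r ξ) ∧
      ∫ ξ, c k ξ * P r ξ = κ * (m k + r * m₁ k + r ^ 2 * m₂ k) := by
    intro k r
    obtain ⟨i0, i1, i2⟩ := hi (hM.c_cont k)
    have j0 := i0.const_mul κ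
    have j1 := i1.const_mul (κ * r)
    have j2 := i2.const_mul (κ * r ^ 2)
    have e : (fun ξ => c k ξ * P r ξ) = fun ξ => κ * (c k ξ * Ψ ξ) + κ * r * (c k ξ * E₁ ξ) +
        κ * r ^ 2 * (c k ξ * E₂ ξ) := by
      ext ξ
      simp only [hP]
      ring
    rw [e]
    refine ⟨(j0.add j1).add j2, ?_⟩
    rw [integral_add (by exact j0.add j1) j2, integral_add j0 j1, integral_const_mul,
      integral_const_mul, integral_const_mul]
    simp only [hm, hm₁, hm₂]
    ring
  have hQi : ∀ r : ℝ, Integrable (Q r) ∧ ∫ ξ, Q r ξ = κ * ((m 0 + r * m₁ 0 + r ^ 2 * m₂ 0) +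
      r * (m 1 + r * m₁ 1 + r ^ 2 * m₂ 1) + r ^ 2 * (m 2 + r * m₁ 2 + r ^ 2 * m₂ 2)) := by
    intro r
    obtain ⟨i0, e0⟩ := hcP 0 r
    obtain ⟨i1, e1⟩ := hcP 1 r
    obtain ⟨i2, e2⟩ := hcP 2 r
    have j1 := i1.const_mul (r : ℂ)
    have j2 := i2.const_mul ((r : ℂ) ^ 2)
    have e : Q r = fun ξ => c 0 ξ * P r ξ + r * (c 1 ξ * P r ξ) + r ^ 2 * (c 2 ξ * P r ξ) := by
      ext ξ
      simp only [hQ]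
      ring
    rw [e]
    refine ⟨(i0.add j1).add j2, ?_⟩
    rw [integral_add (by exact i0.add j1) j2, integral_add i0 j1, integral_const_mul,
      integral_const_mul, e0, e1, e2]
    ring
  set b : 𝔼 → ℝ := fun θ => Cs * Cr * ((1 + ‖θ‖) ^ (d + 1))⁻¹ +
    Cd * ‖κ‖ * (‖((‖θ‖ ^ 3 : ℝ) : ℂ)⁻¹ * Ψ θ‖ + ‖((‖θ‖ ^ 3 : ℝ) : ℂ)⁻¹ * E₁ θ‖ +
      ‖((‖θ‖ ^ 3 : ℝ) : ℂ)⁻¹ * E₂ θ‖) with hb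
  have hbi : Integrable b := by
    obtain ⟨i0, i1, i2⟩ := hi (continuousOn_norm_pow 3)
    exact (integrable_one_add_norm_pow_inv.const_mul _).add
      (((i0.norm.add i1.norm).add i2.norm).const_mul _)
  have hb0 : ∀ θ, 0 ≤ b θ := fun θ => by positivity
  have hFQ : ∀ r : ℝ, 0 < r → r ≤ 1 → ∀ θ, r ≤ ‖θ‖ → ‖F r θ - Q r θ‖ ≤ r ^ 3 * b θ := by
    intro r hr hr1 θ hθ
    have hθ0 : θ ≠ 0 := norm_pos_iff.1 (hr.trans_le hθ)
    have h1 : 1 ≤ ‖r⁻¹ • θ‖ := one_le_norm_inv_smul hr hθ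
    have h2 := hCr r hr hr1 θ hθ0
    rw [← hM.innerIntegral_eq hr hθ] at h2
    have h3 := hCd r hr θ hθ
    have h4 : ‖P r θ‖ ≤ ‖κ‖ * (‖Ψ θ‖ + ‖E₁ θ‖ + ‖E₂ θ‖) := by
      simp only [hP]
      rw [norm_mul]
      gcongr
      refine norm_add₃_le.trans ?_
      rw [norm_mul, norm_mul, norm_pow, norm_real, norm_of_nonneg hr.le]
      gcongr
      · exact mul_le_of_le_one_left (norm_nonneg _) hr1
      · exact mul_le_of_le_one_left (norm_nonneg _) (pow_le_one₀ hr.le hr1)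
    have h5 : F r θ - Q r θ = s (r⁻¹ • θ) * (𝒥[f, β, Ψ, r, r⁻¹ • θ] - P r θ) +
        (s (r⁻¹ • θ) - (c 0 θ + r * c 1 θ + r ^ 2 * c 2 θ)) * P r θ := by
      simp only [hF, hQ]
      ring
    rw [h5]
    refine (norm_add_le _ _).trans ?_
    rw [norm_mul, norm_mul]
    calc _ ≤ Cs * (Cr * r ^ 3 * ((1 + ‖θ‖) ^ (d + 1))⁻¹) +
          Cd * r ^ 3 * (‖θ‖ ^ 3)⁻¹ * (‖κ‖ * (‖Ψ θ‖ + ‖E₁ θ‖ + ‖E₂ θ‖)) := by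
          have := hCs _ h1
          gcongr
      _ = _ := by
        simp only [hb, norm_mul, norm_inv, norm_real, norm_of_nonneg (pow_nonneg (norm_nonneg θ) 3)]
        ring
  have hFm : ∀ r : ℝ, 0 < r → AEStronglyMeasurable (F r) volume := by
    intro r hr
    have h1 : ContinuousOn (F r) {0}ᶜ :=
      (hM.continuousOn_symbol_mul h r).comp (f := fun θ => r⁻¹ • θ) (by fun_prop)
        fun θ hθ => smul_ne_zero (inv_ne_zero hr.ne') hθ
    have h3 := h1.aestronglyMeasurable (μ := volume) isOpen_compl_singleton.measurableSet
    rwa [restrict_compl_singleton] at h3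
  have hdiff : (fun r : ℝ => (∫ θ, F r θ) - (∫ θ in ball 0 r, F r θ) - ∫ θ, Q r θ)
      =O[𝓝[>] 0] fun r : ℝ => r ^ 3 := by
    refine IsBigO.of_bound (∫ θ, b θ) ?_
    filter_upwards [Ioo_mem_nhdsGT (lt_min zero_lt_one hΘ0)] with r hr
    have hr0 : 0 < r := hr.1
    have hr1 : r ≤ 1 := (hr.2.trans_le (min_le_left _ _)).le
    have hrΘ : r < Θ := hr.2.trans_le (min_le_right _ _)
    have hc : ∀ᵐ θ ∂(volume.restrict (ball (0 : 𝔼) r)ᶜ), ‖F r θ - Q r θ‖ ≤ r ^ 3 * b θ := by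
      filter_upwards [ae_restrict_mem measurableSet_ball.compl] with θ hθ
      exact hFQ r hr0 hr1 θ (by simpa using hθ)
    have i1 : IntegrableOn (fun θ => F r θ - Q r θ) (ball 0 r)ᶜ :=
      ((hbi.const_mul (r ^ 3)).integrableOn).mono'
        ((hFm r hr0).sub (hQi r).1.aestronglyMeasurable).restrict hc
    have i2 : IntegrableOn (F r) (ball 0 r)ᶜ :=
      (i1.add (hQi r).1.integrableOn).congr (ae_of_all _ fun θ => by simp)
    have i3 : IntegrableOn (F r) (ball 0 r) := by
      refine IntegrableOn.of_bound measure_ball_lt_top (hFm r hr0).restrict Cb ?_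
      refine ae_restrict_of_ae ?_
      filter_upwards [ae_ne_zero] with θ hθ
      exact hCb r _ (smul_ne_zero (inv_ne_zero hr0.ne') hθ)
    have e1 : (∫ θ in ball 0 r, F r θ) + ∫ θ in (ball 0 r)ᶜ, F r θ = ∫ θ, F r θ := by
      rw [← setIntegral_union disjoint_compl_right measurableSet_ball.compl i3 i2, union_compl_self,
        setIntegral_univ]
    have e2 : ∫ θ in (ball 0 r)ᶜ, Q r θ = ∫ θ, Q r θ := by
      refine setIntegral_eq_integral_of_forall_compl_eq_zero fun θ hθ => ?_
      have h1 : θ ∉ tsupport Ψ := hΘ θ (lt_trans (by simpa using hθ) hrΘ)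
      simp only [hQ, hP, hE₁, hE₂, expansionOne_eq_zero ε h1, expansionTwo_eq_zero h ε h1,
        image_eq_zero_of_notMem_tsupport h1, mul_zero, add_zero]
    rw [← e1, add_sub_cancel_left, ← e2, ← integral_sub i2 (hQi r).1.integrableOn,
      norm_of_nonneg (pow_nonneg hr0.le 3)]
    calc _ ≤ ∫ θ in (ball 0 r)ᶜ, r ^ 3 * b θ :=
          norm_integral_le_of_norm_le (hbi.const_mul _).integrableOn hc
      _ ≤ ∫ θ, r ^ 3 * b θ := setIntegral_le_integral (hbi.const_mul _)
          (ae_of_all _ fun θ => mul_nonneg (pow_nonneg hr0.le 3) (hb0 θ))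
      _ = _ := by rw [integral_const_mul, mul_comm]
  have hball := hM.isLittleO_integral_ball hd h
  have h32 : (fun r : ℝ => r ^ 3) =o[𝓝[>] 0] fun r : ℝ => r ^ 2 :=
    (isLittleO_pow_pow (by norm_num)).mono nhdsWithin_le_nhds
  have hw : wavelet Ψ 0 = ∫ ξ, Ψ ξ := by simp [wavelet]
  have hmain : (fun r : ℝ => (∫ θ, Q r θ) - κ * ∫ ξ, Ψ ξ) =o[𝓝[>] 0] fun r : ℝ => r ^ 2 := by
    rw [← hw]
    refine ((hlim.sub hball).sub (hdiff.trans_isLittleO h32)).congr_left fun r => ?_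
    simp only [hF]
    ring
  have hpoly : (fun r : ℝ => (m 0 - ∫ ξ, Ψ ξ) + r * (m 1 + m₁ 0) + r ^ 2 * (m 2 + m₁ 1 + m₂ 0))
      =o[𝓝[>] 0] fun r : ℝ => r ^ 2 := by
    have h1 := hmain.const_mul_left κ⁻¹
    have h2 : (fun r : ℝ => (r : ℂ) ^ 3 * (m₁ 2 + m₂ 1 + r * m₂ 2)) =o[𝓝[>] 0]
        fun r : ℝ => r ^ 2 := by
      refine IsBigO.trans_isLittleO ?_ h32
      refine IsBigO.of_bound (‖m₁ 2 + m₂ 1‖ + ‖m₂ 2‖) ?_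
      filter_upwards [Ioo_mem_nhdsGT (zero_lt_one' ℝ)] with r hr
      rw [norm_mul, norm_pow, norm_pow, norm_real, mul_comm]
      gcongr
      refine (norm_add_le _ _).trans ?_
      rw [norm_mul, norm_real, norm_of_nonneg hr.1.le]
      gcongr
      exact mul_le_of_le_one_left (norm_nonneg _) hr.2.le
    refine (h1.sub h2).congr_left fun r => ?_
    rw [(hQi r).2]
    field_simp
    ring
  obtain ⟨h0, h1, h2⟩ := coeff_eq_zero_of_isLittleO_sq hpoly
  exact ⟨sub_eq_zero.1 h0, h1, h2⟩

lemma component_two_eq (hd : 2 ≤ d) (hlim : ∀ Ψ, IsTest Ψ → (fun r : ℝ => (∫ θ, s (r⁻¹ • θ) *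
      𝒥[f, β, Ψ, r, r⁻¹ • θ]) -
      (2 * π) ^ d * wavelet Ψ 0) =o[𝓝[>] 0] fun r : ℝ => r ^ 2) {θ : 𝔼} (hθ : θ ≠ 0) :
    c 2 θ = (((((d : ℝ) - 1) * ((d : ℝ) - 2) * ε ^ 2) / (8 * ‖θ‖ ^ 2) : ℝ) : ℂ) := by
  have : Nonempty (Fin d) := ⟨⟨0, by omega⟩⟩
  have hcongr : ∀ {k : ℕ} {v : ℂ} (_ : ∀ ξ, ξ ≠ 0 → c k ξ = v)
      (g : 𝔼 → ℂ), ∫ ξ, c k ξ * g ξ = v * ∫ ξ, g ξ := by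
    intro k v hv g
    rw [← integral_const_mul]
    refine integral_congr_ae ?_
    filter_upwards [ae_ne_zero] with ξ hξ
    rw [hv ξ hξ]
  have h0 : ∀ ξ, ξ ≠ 0 → c 0 ξ = 1 := by
    intro ξ hξ
    refine sub_eq_zero.1 (eq_zero_of_integral_mul_isTest (g := fun ξ => c 0 ξ - 1)
      ((hM.c_cont 0).sub continuousOn_const) (fun Ψ h => ?_) ξ hξ)
    simp only [sub_mul, one_mul]
    rw [integral_sub (h.integrable_mul (hM.c_cont 0)) h.integrable,
      (hM.integral_eq_of_isLittleO hd h (hlim Ψ h)).1, sub_self]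
  have h1 : ∀ ξ, ξ ≠ 0 → c 1 ξ = 0 := by
    refine eq_zero_of_integral_mul_isTest (hM.c_cont 1) fun Ψ h => ?_
    have h2 := (hM.integral_eq_of_isLittleO hd h (hlim Ψ h)).2.1
    rw [hcongr h0, h.integral_expansionOne, mul_zero, add_zero] at h2
    exact h2
  have h2 : ∀ ξ, ξ ≠ 0 → c 2 ξ - ε ^ 2 / 8 * ((d - 1) * (d - 2)) * ((‖ξ‖ ^ 2 : ℝ) : ℂ)⁻¹ = 0 := by
    refine eq_zero_of_integral_mul_isTest ((hM.c_cont 2).sub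
      (continuousOn_const.mul (continuousOn_norm_pow 2))) fun Ψ h => ?_
    have h3 := (hM.integral_eq_of_isLittleO hd h (hlim Ψ h)).2.2
    rw [hcongr h0, hcongr h1, h.integral_expansionTwo, zero_mul, add_zero, one_mul] at h3
    simp only [sub_mul]
    have h4 := h.integrable_mul (continuousOn_norm_pow (d := d) 2)
    simp only [mul_assoc _ (((‖_‖ ^ 2 : ℝ) : ℂ)⁻¹)]
    rw [integral_sub (h.integrable_mul (hM.c_cont 2)) (h4.const_mul _), integral_const_mul]
    linear_combination h3
  rw [sub_eq_zero.1 (h2 θ hθ)]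
  push_cast
  have : (‖θ‖ : ℂ) ≠ 0 := by exact_mod_cast norm_ne_zero_iff.2 hθ
  field_simp

end FlatModel

end

lemma continuousOn_mul_of_tsupport {X : Type*} [TopologicalSpace X] {k F : X → ℂ} {S T : Set X}
    (hS : IsOpen S) (hk : Continuous k) (hF : ContinuousOn F S) (hT : tsupport k ∩ T ⊆ S) :
    ContinuousOn (fun x => F x * k x) T := by
  intro x hx
  by_cases h : x ∈ tsupport k
  · exact ((hF.continuousAt (hS.mem_nhds (hT ⟨h, hx⟩))).mul hk.continuousAt).continuousWithinAt
  · refine ContinuousAt.continuousWithinAt ((continuousAt_const (y := (0 : ℂ))).congr ?_)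
    filter_upwards [notMem_tsupport_iff_eventuallyEq.1 h] with z hz
    simp [hz]

lemma contDiffOn_mul_of_tsupport {X : Type*} [NormedAddCommGroup X] [NormedSpace ℝ X]
    {k F : X → ℂ} {S T : Set X} (hS : IsOpen S) (hk : Smooth k) (hF : SmoothOn F S)
    (hT : tsupport k ∩ T ⊆ S) : SmoothOn (fun x => F x * k x) T := by
  intro x hx
  by_cases h : x ∈ tsupport k
  · exact ((hF.contDiffAt (hS.mem_nhds (hT ⟨h, hx⟩))).mul hk.contDiffAt).contDiffWithinAt
  · refine ContDiffAt.contDiffWithinAt ((contDiffAt_const (c := (0 : ℂ))).congr_of_eventuallyEq ?_)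
    filter_upwards [notMem_tsupport_iff_eventuallyEq.1 h] with z hz
    simp [hz]

lemma tsupport_comp_subset {X Y : Type*} [TopologicalSpace X] [TopologicalSpace Y] (f : Y → ℂ)
    {p : X → Y} (hp : Continuous p) : tsupport (fun x => f (p x)) ⊆ p ⁻¹' tsupport f :=
  closure_minimal (fun x hx => subset_tsupport f (a := p x) hx) ((isClosed_tsupport f).preimage hp)

lemma le_mul_one_add_pow_inv {x C₁ C₂ R t : ℝ} {N : ℕ} (hR : 1 ≤ R) (ht : 0 ≤ t) (hC₁ : 0 ≤ C₁)
    (hC₂ : 0 ≤ C₂) (h₁ : x ≤ C₁) (h₂ : R ≤ t → x ≤ C₂ * (t ^ N)⁻¹) :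
    x ≤ (C₁ * (1 + R) ^ N + C₂ * 2 ^ N) * ((1 + t) ^ N)⁻¹ := by
  rw [← div_eq_mul_inv, le_div_iff₀ (by positivity)]
  rcases le_or_gt R t with h | h
  · have ht0 : 0 < t := by linarith
    have h3 : (1 + t) ^ N ≤ 2 ^ N * t ^ N := by rw [← mul_pow]; gcongr; linarith
    calc x * (1 + t) ^ N ≤ C₂ * (t ^ N)⁻¹ * (1 + t) ^ N := by gcongr; exact h₂ h
      _ ≤ C₂ * (t ^ N)⁻¹ * (2 ^ N * t ^ N) := by gcongr
      _ = 0 + C₂ * 2 ^ N := by field_simp; ring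
      _ ≤ _ := by gcongr; positivity
  · calc x * (1 + t) ^ N ≤ C₁ * (1 + R) ^ N := by gcongr
      _ = C₁ * (1 + R) ^ N + 0 := (add_zero _).symm
      _ ≤ _ := by gcongr; positivity

lemma isCompact_annulus (r R : ℝ) : IsCompact {q : 𝔼 | r ≤ ‖q‖ ∧ ‖q‖ ≤ R} := by
  refine (isCompact_closedBall (0 : 𝔼) R).of_isClosed_subset
    ((isClosed_le continuous_const continuous_norm).inter
      (isClosed_le continuous_norm continuous_const)) fun q hq => ?_
  simpa using hq.2

lemma norm_inv_smul_self {q : 𝔼} (hq : q ≠ 0) : ‖‖q‖⁻¹ • q‖ = 1 := by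
  rw [norm_smul, norm_inv, norm_norm, inv_mul_cancel₀ (norm_ne_zero_iff.2 hq)]

lemma norm_smul_inv_smul_self {q : 𝔼} (hq : q ≠ 0) : ‖q‖ • ‖q‖⁻¹ • q = q := by
  rw [smul_smul, mul_inv_cancel₀ (norm_ne_zero_iff.2 hq), one_smul]

section

lemma integrable_exp_neg_mul_norm {a : ℝ} (ha : 0 < a) :
    Integrable fun q : 𝔼 => exp (-a * ‖q‖) := by
  refine (integrable_one_add_norm_pow_inv.const_mul
    (exp a * ((d + 1).factorial / a ^ (d + 1)))).mono'
    (Continuous.aestronglyMeasurable (by fun_prop)) (ae_of_all _ fun q => ?_)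
  rw [norm_of_nonneg (exp_pos _).le]
  have h1 := Real.pow_div_factorial_le_exp (a * (1 + ‖q‖)) (by positivity) (d + 1)
  have h2 : exp (-a * ‖q‖) = exp a * (exp (a * (1 + ‖q‖)))⁻¹ := by
    rw [← Real.exp_neg, ← Real.exp_add]
    ring_nf
  rw [h2, mul_assoc]
  gcongr
  calc _ ≤ ((a * (1 + ‖q‖)) ^ (d + 1) / (d + 1).factorial)⁻¹ := by gcongr
    _ = _ := by rw [inv_div, mul_pow]; field_simp

/-- The data of the oscillatory integral operator in a coordinate patch `O`: the phase `φ`, the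
amplitude `b` with its homogeneous part `V`, the Hamiltonian `h`, the symbol `s` and its components
`c k`. -/
structure LocalKernel (O : Set 𝔼) (φ V b : 𝔼 × 𝔼 × 𝔼 → ℂ) (h : 𝔼 × 𝔼 → ℝ) (s : 𝔼 × 𝔼 → ℂ)
    (c : ℕ → 𝔼 × 𝔼 → ℂ) : Prop where
  isOpen : IsOpen O
  φ_smooth : SmoothOn φ (O ×ˢ O ×ˢ {0}ᶜ)
  φ_hom : ∀ u ∈ O, ∀ w ∈ O, ∀ q, q ≠ 0 → ∀ l : ℝ, 0 < l → φ (u, w, l • q) = l * φ (u, w, q)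
  φ_im : ∀ u ∈ O, ∀ w ∈ O, ∀ q, q ≠ 0 → 0 ≤ (φ (u, w, q)).im
  φ_fst : ∀ u ∈ O, ∀ w ∈ O, ∀ q, q ≠ 0 → 0 < (fderiv ℝ φ (u, w, q) (q, 0, 0)).re
  φ_snd : ∀ u ∈ O, ∀ w ∈ O, ∀ q, q ≠ 0 → (fderiv ℝ φ (u, w, q) (0, q, 0)).re < 0
  h_smooth : SmoothOn h (O ×ˢ {0}ᶜ)
  h_pos : ∀ w ∈ O, ∀ q, q ≠ 0 → 0 < h (w, q)
  h_hom : ∀ w ∈ O, ∀ q, q ≠ 0 → ∀ l : ℝ, 0 < l → h (w, l • q) = l * h (w, q)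
  V_smooth : SmoothOn V (O ×ˢ O ×ˢ {0}ᶜ)
  V_hom : ∀ u ∈ O, ∀ w ∈ O, ∀ q, q ≠ 0 → ∀ l : ℝ, 0 < l → V (u, w, l • q) = V (u, w, q)
  b_cont : ContinuousOn b (O ×ˢ O ×ˢ {0}ᶜ)
  b_eq : ∀ u ∈ O, ∀ w ∈ O, ∀ q, q ≠ 0 → 1 ≤ h (w, q) → b (u, w, q) = V (u, w, q)
  b_zero : ∀ u ∈ O, ∀ w ∈ O, ∀ q, q ≠ 0 → h (w, q) ≤ 1 / 2 → b (u, w, q) = 0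
  s_cont : ContinuousOn s (O ×ˢ {0}ᶜ)
  c_smooth : ∀ k, SmoothOn (c k) (O ×ˢ {0}ᶜ)
  c_hom : ∀ k, ∀ w ∈ O, ∀ q, q ≠ 0 → ∀ l : ℝ, 0 < l → c k (w, l • q) = ((l ^ k)⁻¹ : ℝ) * c k (w, q)
  s_rem : ∀ (N : ℕ) (K : Set 𝔼), IsCompact K → K ⊆ O → ∃ C : ℝ,
    ∀ w ∈ K, ∀ q, 1 ≤ ‖q‖ → ‖s (w, q) - ∑ k ∈ Finset.range N, c k (w, q)‖ ≤ C * (‖q‖ ^ N)⁻¹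

/-- The integrand of the oscillatory integral, with the convergence factor. -/
def kernelFun (φ b : 𝔼 × 𝔼 × 𝔼 → ℂ) (h : 𝔼 × 𝔼 → ℝ) (s : 𝔼 × 𝔼 → ℂ) (δ : ℝ)
    (x : 𝔼 × 𝔼 × 𝔼) : ℂ := cexp (I * φ x) * s x.2 * b x * exp (-δ * h x.2)

variable {O : Set 𝔼[d]}
  {φ V b : 𝔼[d] × 𝔼[d] × 𝔼[d] → ℂ}
  {h : 𝔼[d] × 𝔼[d] → ℝ}
  {s : 𝔼[d] × 𝔼[d] → ℂ}
  {c : ℕ → 𝔼[d] × 𝔼[d] → ℂ}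
  {K K' : Set 𝔼[d]}

namespace LocalKernel

variable (hL : LocalKernel O φ V b h s c)
include hL

lemma isOpen₂ : IsOpen (O ×ˢ ({0}ᶜ : Set 𝔼)) := hL.isOpen.prod isOpen_compl_singleton

lemma isOpen₃ : IsOpen (O ×ˢ O ×ˢ ({0}ᶜ : Set 𝔼)) := hL.isOpen.prod hL.isOpen₂

lemma continuousOn_kernelFun (δ : ℝ) : ContinuousOn (kernelFun φ b h s δ) (O ×ˢ O ×ˢ {0}ᶜ) := by
  have h1 : ContinuousOn (fun x : 𝔼 × 𝔼 × 𝔼 => s x.2) (O ×ˢ O ×ˢ {0}ᶜ) :=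
    hL.s_cont.comp continuousOn_snd fun x hx => hx.2
  have h2 : ContinuousOn (fun x : 𝔼 × 𝔼 × 𝔼 => h x.2) (O ×ˢ O ×ˢ {0}ᶜ) :=
    hL.h_smooth.continuousOn.comp continuousOn_snd fun x hx => hx.2
  have h3 : ContinuousOn (fun x => ((exp (-δ * h x.2) : ℝ) : ℂ)) (O ×ˢ O ×ˢ {0}ᶜ) :=
    continuous_ofReal.comp_continuousOn ((continuousOn_const.mul h2).rexp)
  exact ((((continuousOn_const.mul hL.φ_smooth.continuousOn).cexp.mul h1).mul hL.b_cont).mul h3)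

lemma exists_bounds_hamiltonian (hK : IsCompact K) (hKO : K ⊆ O) : ∃ m M : ℝ, 0 < m ∧ 0 < M ∧
    ∀ w ∈ K, ∀ q, q ≠ 0 → m * ‖q‖ ≤ h (w, q) ∧ h (w, q) ≤ M * ‖q‖ := by
  have hc : IsCompact (K ×ˢ sphere (0 : 𝔼) 1) := hK.prod (isCompact_sphere 0 1)
  have hsub : K ×ˢ sphere (0 : 𝔼) 1 ⊆ O ×ˢ {0}ᶜ := fun x hx =>
    ⟨hKO hx.1, ne_zero_of_mem_unit_sphere ⟨x.2, hx.2⟩⟩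
  have hcont := hL.h_smooth.continuousOn.mono hsub
  rcases (K ×ˢ sphere (0 : 𝔼) 1).eq_empty_or_nonempty with he | hne
  · refine ⟨1, 1, one_pos, one_pos, fun w hw q hq => ?_⟩
    have : (w, ‖q‖⁻¹ • q) ∈ K ×ˢ sphere (0 : 𝔼) 1 :=
      ⟨hw, by rw [mem_sphere_zero_iff_norm]; exact norm_inv_smul_self hq⟩
    rw [he] at this
    exact this.elim
  · obtain ⟨x, hx, hmin⟩ := hc.exists_isMinOn hne hcont
    obtain ⟨y, hy, hmax⟩ := hc.exists_isMaxOn hne hcont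
    refine ⟨h x, h y, hL.h_pos x.1 (hsub hx).1 x.2 (hsub hx).2,
      hL.h_pos y.1 (hsub hy).1 y.2 (hsub hy).2, fun w hw q hq => ?_⟩
    have h1 : (w, ‖q‖⁻¹ • q) ∈ K ×ˢ sphere (0 : 𝔼) 1 :=
      ⟨hw, by rw [mem_sphere_zero_iff_norm]; exact norm_inv_smul_self hq⟩
    have h2 := hL.h_hom w (hKO hw) (‖q‖⁻¹ • q) (hsub h1).2 ‖q‖ (norm_pos_iff.2 hq)
    rw [norm_smul_inv_smul_self hq] at h2
    rw [h2, mul_comm, mul_comm (h y)]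
    have h3 : h x ≤ h (w, ‖q‖⁻¹ • q) := hmin h1
    have h4 : h (w, ‖q‖⁻¹ • q) ≤ h y := hmax h1
    exact ⟨by gcongr, by gcongr⟩

lemma exists_bound_V (hK : IsCompact K) (hKO : K ⊆ O) (hK' : IsCompact K') (hKO' : K' ⊆ O) :
    ∃ C : ℝ, 0 ≤ C ∧ ∀ u ∈ K, ∀ w ∈ K', ∀ q, q ≠ 0 → ‖V (u, w, q)‖ ≤ C := by
  obtain ⟨C, hC⟩ := (hK.prod (hK'.prod (isCompact_sphere (0 : 𝔼)
    1))).exists_bound_of_continuousOn (hL.V_smooth.continuousOn.mono fun x hx =>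
      ⟨hKO hx.1, hKO' hx.2.1, ne_zero_of_mem_unit_sphere ⟨x.2.2, hx.2.2⟩⟩)
  refine ⟨max C 0, le_max_right _ _, fun u hu w hw q hq => ?_⟩
  rw [← hL.V_hom u (hKO hu) w (hKO' hw) q hq ‖q‖⁻¹ (inv_pos.2 (norm_pos_iff.2 hq))]
  exact (hC (u, w, ‖q‖⁻¹ • q) ⟨hu, hw, by
    rw [mem_sphere_zero_iff_norm]; exact norm_inv_smul_self hq⟩).trans (le_max_left _ _)

lemma exists_bound_symbol (hK : IsCompact K) (hKO : K ⊆ O) :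
    ∃ C : ℝ, 0 ≤ C ∧ ∀ w ∈ K, ∀ q, 1 ≤ ‖q‖ → ‖s (w, q)‖ ≤ C := by
  obtain ⟨C, hC⟩ := hL.s_rem 0 K hK hKO
  refine ⟨max C 0, le_max_right _ _, fun w hw q hq => ?_⟩
  have := hC w hw q hq
  simp only [Finset.range_zero, Finset.sum_empty, sub_zero, pow_zero, inv_one, mul_one] at this
  exact this.trans (le_max_left _ _)

lemma exists_bound_mul (hK : IsCompact K) (hKO : K ⊆ O) (hK' : IsCompact K') (hKO' : K' ⊆ O) :
    ∃ C : ℝ, 0 ≤ C ∧ ∀ u ∈ K, ∀ w ∈ K', ∀ q, q ≠ 0 → ‖s (w, q) * b (u, w, q)‖ ≤ C := by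
  obtain ⟨m, M, hm, hM, hmM⟩ := hL.exists_bounds_hamiltonian hK' hKO'
  obtain ⟨C1, hC10, hC1⟩ := hL.exists_bound_V hK hKO hK' hKO'
  obtain ⟨C2, hC20, hC2⟩ := hL.exists_bound_symbol hK' hKO'
  have hcs : ContinuousOn (fun x : 𝔼 × 𝔼 × 𝔼 => s x.2) (O ×ˢ O ×ˢ {0}ᶜ) :=
    hL.s_cont.comp continuousOn_snd fun x hx => hx.2
  obtain ⟨C3, hC3⟩ := (hK.prod (hK'.prod (isCompact_annulus (d := d) (1 / (2 * M))
    (max 1 m⁻¹)))).exists_bound_of_continuousOn ((hcs.mul hL.b_cont).mono fun x hx =>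
      ⟨hKO hx.1, hKO' hx.2.1, norm_pos_iff.1 (lt_of_lt_of_le (by positivity) hx.2.2.1)⟩)
  refine ⟨max (C2 * C1) C3, le_max_of_le_left (by positivity), fun u hu w hw q hq => ?_⟩
  obtain ⟨h1, h2⟩ := hmM w hw q hq
  by_cases h3 : h (w, q) ≤ 1 / 2
  · rw [hL.b_zero u (hKO hu) w (hKO' hw) q hq h3, mul_zero, norm_zero]
    exact le_max_of_le_left (by positivity)
  · have h4 : 1 / (2 * M) ≤ ‖q‖ := by
      rw [div_le_iff₀ (by positivity)]
      nlinarith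
    by_cases h5 : ‖q‖ ≤ max 1 m⁻¹
    · exact le_max_of_le_right (hC3 (u, w, q) ⟨hu, hw, h4, h5⟩)
    · rw [not_le, max_lt_iff] at h5
      have h6 : 1 ≤ h (w, q) := by
        refine le_trans ?_ h1
        rw [← div_le_iff₀' hm, one_div]
        exact h5.2.le
      rw [hL.b_eq u (hKO hu) w (hKO' hw) q hq h6, norm_mul]
      exact le_max_of_le_left (mul_le_mul (hC2 w hw q h5.1.le) (hC1 u hu w hw q hq)
        (norm_nonneg _) hC20)

lemma norm_exp_phase_le {u w q : 𝔼} (hu : u ∈ O) (hw : w ∈ O)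
    (hq : q ≠ 0) : ‖cexp (I * φ (u, w, q))‖ ≤ 1 := by
  rw [norm_exp]
  have := hL.φ_im u hu w hw q hq
  simpa using this

lemma exists_bound_kernelFun (hK : IsCompact K) (hKO : K ⊆ O) (hK' : IsCompact K')
    (hKO' : K' ⊆ O) : ∃ C m : ℝ, 0 ≤ C ∧ 0 < m ∧ ∀ u ∈ K, ∀ w ∈ K', ∀ q, q ≠ 0 → ∀ δ : ℝ, 0 ≤ δ →
      ‖kernelFun φ b h s δ (u, w, q)‖ ≤ C * exp (-(δ * m) * ‖q‖) := by
  obtain ⟨m, M, hm, hM, hmM⟩ := hL.exists_bounds_hamiltonian hK' hKO'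
  obtain ⟨C, hC0, hC⟩ := hL.exists_bound_mul hK hKO hK' hKO'
  refine ⟨C, m, hC0, hm, fun u hu w hw q hq δ hδ => ?_⟩
  rw [kernelFun, mul_assoc (cexp _), norm_mul, norm_mul, norm_real, norm_of_nonneg (exp_pos _).le]
  calc _ ≤ 1 * C * exp (-(δ * m) * ‖q‖) := by
        refine mul_le_mul (mul_le_mul (hL.norm_exp_phase_le (hKO hu) (hKO' hw) hq)
          (hC u hu w hw q hq) (norm_nonneg _) zero_le_one) ?_ (exp_pos _).le (by positivity)
        rw [Real.exp_le_exp]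
        have := mul_le_mul_of_nonneg_left (hmM w hw q hq).1 hδ
        simp only
        linarith
    _ = _ := by rw [one_mul]

lemma hasFDerivAt_phase {u w q : 𝔼} (hu : u ∈ O) (hw : w ∈ O)
    (hq : q ≠ 0) : HasFDerivAt φ (fderiv ℝ φ (u, w, q)) (u, w, q) := by
  have h1 : (u, w, q) ∈ O ×ˢ O ×ˢ ({0}ᶜ : Set 𝔼) := ⟨hu, hw, hq⟩
  exact (hasFDerivAt_of_isOpen hL.φ_smooth hL.isOpen₃ h1)

lemma hasFDerivAt_hamiltonian {w q : 𝔼} (hw : w ∈ O) (hq : q ≠ 0) :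
    HasFDerivAt h (fderiv ℝ h (w, q)) (w, q) := by
  have h1 : (w, q) ∈ O ×ˢ ({0}ᶜ : Set 𝔼) := ⟨hw, hq⟩
  exact (hasFDerivAt_of_isOpen hL.h_smooth hL.isOpen₂ h1)

lemma exists_decay_fst {g : 𝔼 → ℂ} (hg : Smooth g)
    (hgc : HasCompactSupport g) (hgO : tsupport g ⊆ O) (hK : IsCompact K) (hKO : K ⊆ O) :
    ∃ C : ℝ, 0 ≤ C ∧ ∀ w ∈ K, ∀ q, q ≠ 0 →
      ‖s (w, q) * ∫ u, cexp (I * φ (u, w, q)) * b (u, w, q) * g u‖ ≤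
        C * ((1 + ‖q‖) ^ (d + 1))⁻¹ := by
  obtain ⟨m, M, hm, hM, hmM⟩ := hL.exists_bounds_hamiltonian hK hKO
  obtain ⟨C1, hC10, hC1⟩ := hL.exists_bound_mul hgc.isCompact hgO hK hKO
  obtain ⟨C2, hC20, hC2⟩ := hL.exists_bound_symbol hK hKO
  have hmap : Smooth fun x : (𝔼 × 𝔼) × 𝔼 => (x.2, x.1.1, x.1.2) := by fun_prop
  have hmaps : ∀ x ∈ (O ×ˢ ({0}ᶜ : Set 𝔼)) ×ˢ O, (x.2, x.1.1, x.1.2) ∈ O ×ˢ O ×ˢ ({0}ᶜ : Set 𝔼) :=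
    fun x hx => ⟨hx.2, hx.1.1, hx.1.2⟩
  obtain ⟨C3, hC30, hC3⟩ := exists_bound_nonstationary hL.isOpen₂ hL.isOpen hgc.isCompact hgO
    (D := fun x => fderiv ℝ φ (x.2, x.1.1, x.1.2) (x.1.2, 0, 0))
    (((hL.φ_smooth.fderiv_of_isOpen hL.isOpen₃ (m := ∞) (by simp)).comp hmap.contDiffOn
      hmaps).clm_apply (ContDiff.contDiffOn (by fun_prop)))
    (fun p hp z hz h0 => (hL.φ_fst z hz p.1 hp.1 p.2 hp.2).ne' (by simp only at h0; rw [h0]; rfl))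
    (e := fun p => p.2) contDiff_snd.contDiffOn (hK.prod (isCompact_sphere (0 : 𝔼) 1))
    (fun x hx => ⟨hKO hx.1, ne_zero_of_mem_unit_sphere ⟨x.2, hx.2⟩⟩) (d + 1)
    (a := fun x => V (x.2, x.1.1, x.1.2) * g x.2)
    (contDiffOn_mul_of_tsupport (hL.isOpen₂.prod hL.isOpen) (hg.comp contDiff_snd)
      (hL.V_smooth.comp hmap.contDiffOn hmaps) fun x hx =>
        ⟨hx.2.1, hgO (tsupport_comp_subset g continuous_snd hx.1)⟩)
    (fun p _ z hz => by simp [image_eq_zero_of_notMem_tsupport hz])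
  refine ⟨_, by positivity, fun w hw q hq => le_mul_one_add_pow_inv (le_max_left 1 m⁻¹)
    (norm_nonneg q) (C₁ := C1 * ∫ u, ‖g u‖) (C₂ := C2 * C3)
    (mul_nonneg hC10 (integral_nonneg fun _ => norm_nonneg _)) (by positivity) ?_ fun hR => ?_⟩
  · rw [← integral_const_mul, ← integral_const_mul]
    refine norm_integral_le_of_norm_le
      ((hg.continuous.integrable_of_hasCompactSupport hgc).norm.const_mul _) (ae_of_all _ fun u =>
        ?_)
    by_cases hu : u ∈ tsupport g
    · rw [show s (w, q) * (cexp (I * φ (u, w, q)) * b (u, w, q) * g u) =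
        cexp (I * φ (u, w, q)) * (s (w, q) * b (u, w, q)) * g u by ring, norm_mul, norm_mul]
      gcongr
      calc _ ≤ 1 * C1 := mul_le_mul (hL.norm_exp_phase_le (hgO hu) (hKO hw) hq)
            (hC1 u hu w hw q hq) (norm_nonneg _) zero_le_one
        _ = C1 := one_mul _
    · simp [image_eq_zero_of_notMem_tsupport hu]
  · have hn := norm_pos_iff.2 hq
    have h1 : 1 ≤ ‖q‖ := (le_max_left _ _).trans hR
    have h2 : 1 ≤ h (w, q) := by
      refine le_trans ?_ (hmM w hw q hq).1
      rw [← div_le_iff₀' hm, one_div]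
      exact (le_max_right _ _).trans hR
    have hυ : ‖q‖⁻¹ • q ≠ 0 := smul_ne_zero (inv_ne_zero hn.ne') hq
    have h3 : ∀ u, cexp (I * φ (u, w, q)) * b (u, w, q) * g u =
        cexp (I * ‖q‖ * φ (u, w, ‖q‖⁻¹ • q)) * (V (u, w, ‖q‖⁻¹ • q) * g u) := by
      intro u
      by_cases hu : u ∈ tsupport g
      · have h4 := hL.φ_hom u (hgO hu) w (hKO hw) (‖q‖⁻¹ • q) hυ ‖q‖ hn
        rw [norm_smul_inv_smul_self hq] at h4
        rw [h4, hL.b_eq u (hgO hu) w (hKO hw) q hq h2,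
          hL.V_hom u (hgO hu) w (hKO hw) q hq _ (inv_pos.2 hn)]
        ring_nf
      · simp [image_eq_zero_of_notMem_tsupport hu]
    simp_rw [h3]
    rw [norm_mul, mul_assoc]
    refine mul_le_mul (hC2 w hw q h1) ?_ (norm_nonneg _) hC20
    refine hC3 (w, ‖q‖⁻¹ • q) ⟨hw, by
      rw [mem_sphere_zero_iff_norm]; exact norm_inv_smul_self hq⟩ (fun u => φ (u, w, ‖q‖⁻¹ • q))
      ?_ ?_ ?_ _ hn
    · exact (hL.φ_smooth.comp (f := fun u => (u, w, ‖q‖⁻¹ • q))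
        (ContDiff.contDiffOn (by fun_prop)) fun u hu => ⟨hu, hKO hw, hυ⟩).of_le (by norm_cast)
    · intro u hu
      have h6 := (hL.hasFDerivAt_phase hu (hKO hw) hυ).comp u (hasFDerivAt_prodMk_left (𝕜 := ℝ) u
        (w, ‖q‖⁻¹ • q))
      exact congrArg (fun L => L (‖q‖⁻¹ • q)) h6.fderiv
    · intro u hu
      exact hL.φ_im u hu w (hKO hw) _ hυ

lemma exists_nonstationary_snd {f : 𝔼 → ℂ} (hf : Smooth f)
    (hfc : HasCompactSupport f) (hfO : tsupport f ⊆ O) (hK : IsCompact K) (hKO : K ⊆ O) (N : ℕ) :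
    ∃ C : ℝ, 0 ≤ C ∧ ∀ u ∈ K, ∀ υ, ‖υ‖ = 1 → ∀ δ : ℝ, 0 ≤ δ → δ ≤ 1 → ∀ l : ℝ, 1 ≤ l →
      Integrable (fun w => cexp (I * l * (φ (u, w, υ) + I * δ * h (w, υ))) *
        ((∑ k ∈ Finset.range N, (l⁻¹ : ℂ) ^ k * c k (w, υ)) * V (u, w, υ) * f w)) ∧
      ‖∫ w, cexp (I * l * (φ (u, w, υ) + I * δ * h (w, υ))) *
        ((∑ k ∈ Finset.range N, (l⁻¹ : ℂ) ^ k * c k (w, υ)) * V (u, w, υ) * f w)‖ ≤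
        C * (l ^ N)⁻¹ := by
  set Ω : Set ((ℝ × ℝ) × 𝔼 × 𝔼) := univ ×ˢ O ×ˢ {0}ᶜ
  have hΩ : IsOpen Ω := isOpen_univ.prod hL.isOpen₂
  have hmap : Smooth fun x : ((ℝ × ℝ) × 𝔼 × 𝔼) × 𝔼 => (x.1.2.1, x.2, x.1.2.2) := by fun_prop
  have hmaps : ∀ x ∈ Ω ×ˢ O, (x.1.2.1, x.2, x.1.2.2) ∈ O ×ˢ O ×ˢ ({0}ᶜ : Set 𝔼) :=
    fun x hx => ⟨hx.1.2.1, hx.2, hx.1.2.2⟩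
  have hmap2 : Smooth fun x : ((ℝ × ℝ) × 𝔼 × 𝔼) × 𝔼 => (x.2, x.1.2.2) := by fun_prop
  have hmaps2 : ∀ x ∈ Ω ×ˢ O, (x.2, x.1.2.2) ∈ O ×ˢ ({0}ᶜ : Set 𝔼) := fun x hx => ⟨hx.2, hx.1.2.2⟩
  have hδ : Smooth fun x : ((ℝ × ℝ) × 𝔼 × 𝔼) × 𝔼 => I * (x.1.1.2 : ℂ) :=
    contDiff_const.mul (ofRealCLM.contDiff.comp (by fun_prop))
  have hμ : Smooth fun x : ((ℝ × ℝ) × 𝔼 × 𝔼) × 𝔼 => (x.1.1.1 : ℂ) :=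
    ofRealCLM.contDiff.comp (by fun_prop)
  set a : ((ℝ × ℝ) × 𝔼 × 𝔼) × 𝔼 → ℂ := fun x => (∑ k ∈ Finset.range N,
        (x.1.1.1 : ℂ) ^ k * c k (x.2, x.1.2.2)) * V (x.1.2.1, x.2, x.1.2.2) * f x.2 with hadef
  have ha : SmoothOn a (Ω ×ˢ univ) := by
    refine contDiffOn_mul_of_tsupport (hΩ.prod hL.isOpen) (hf.comp contDiff_snd) ?_ fun x hx =>
        ⟨hx.2.1, hfO (tsupport_comp_subset f continuous_snd hx.1)⟩
    refine ContDiffOn.mul (ContDiffOn.sum fun k _ => ?_) (hL.V_smooth.comp hmap.contDiffOn hmaps)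
    exact (hμ.pow k).contDiffOn.mul ((hL.c_smooth k).comp hmap2.contDiffOn hmaps2)
  have ha0 : ∀ p ∈ Ω, ∀ z ∉ tsupport f, a (p, z) = 0 := fun p _ z hz => by
    simp [hadef, image_eq_zero_of_notMem_tsupport hz]
  obtain ⟨C, hC0, hC⟩ := exists_bound_nonstationary hΩ hL.isOpen hfc.isCompact hfO
    (D := fun x => fderiv ℝ φ (x.1.2.1, x.2, x.1.2.2) (0, x.1.2.2, 0) +
      I * x.1.1.2 * ((fderiv ℝ h (x.2, x.1.2.2) (x.1.2.2, 0) : ℝ) : ℂ))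
    ((((hL.φ_smooth.fderiv_of_isOpen hL.isOpen₃ (m := ∞) (by simp)).comp hmap.contDiffOn
      hmaps).clm_apply (ContDiff.contDiffOn (by fun_prop))).add (hδ.contDiffOn.mul
      (ofRealCLM.contDiff.comp_contDiffOn
      (((hL.h_smooth.fderiv_of_isOpen hL.isOpen₂ (m := ∞) (by simp)).comp hmap2.contDiffOn
      hmaps2).clm_apply (ContDiff.contDiffOn (by fun_prop)))))) (fun p hp z hz h0 => by
      have h1 := hL.φ_snd p.2.1 hp.2.1 z hz p.2.2 hp.2.2
      have h2 := congrArg Complex.re h0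
      simp at h2
      linarith) (e := fun p => p.2.2) (ContDiff.contDiffOn (by fun_prop))
    (((isCompact_Icc (a := (0 : ℝ)) (b := 1)).prod (isCompact_Icc (a := (0 : ℝ)) (b := 1))).prod
      (hK.prod (isCompact_sphere (0 : 𝔼) 1)))
    (fun x hx => ⟨mem_univ _, hKO hx.2.1, ne_zero_of_mem_unit_sphere ⟨x.2.2, hx.2.2⟩⟩) N ha ha0
  refine ⟨C, hC0, fun u hu υ hυ δ hδ0 hδ1 l hl => ?_⟩
  have hl0 : 0 < l := by linarith
  have hυ0 : υ ≠ 0 := norm_pos_iff.1 (by rw [hυ]; exact one_pos)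
  have hΦ : ContDiffOn ℝ 1 (fun w => φ (u, w, υ) + I * δ * h (w, υ)) O := by
    refine ContDiffOn.of_le (n := ∞) ?_ (by norm_cast)
    refine ContDiffOn.add (hL.φ_smooth.comp (f := fun w => (u, w, υ))
        (ContDiff.contDiffOn (by fun_prop)) fun w hw => ⟨hKO hu, hw, hυ0⟩) ?_
    exact contDiffOn_const.mul (ofRealCLM.contDiff.comp_contDiffOn
      (hL.h_smooth.comp (f := fun w => (w, υ)) (ContDiff.contDiffOn (by fun_prop))
        fun w hw => ⟨hw, hυ0⟩))
  have hp : ((l⁻¹, δ), u, υ) ∈ Ω := ⟨mem_univ _, hKO hu, hυ0⟩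
  have h1 := contDiff_exp_mul_of_vanish hL.isOpen hfc.isCompact hfO hΦ
    ((contDiff_slice ha hp).of_le (by norm_cast)) (ha0 _ hp) (I * l)
  have h2 := hC ((l⁻¹, δ), u, υ) ⟨⟨⟨by positivity, inv_le_one_of_one_le₀ hl⟩, hδ0, hδ1⟩, hu, by
    rw [mem_sphere_zero_iff_norm, hυ]⟩ _ hΦ ?_ ?_ l hl0
  · simp only [hadef, ofReal_inv] at h1 h2
    exact ⟨h1.1.continuous.integrable_of_hasCompactSupport h1.2, h2⟩
  · intro w hw
    have h4 : HasFDerivAt (𝕜 := ℝ) (fun w => (u, w, υ)) _ w :=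
      (hasFDerivAt_const u w).prodMk ((hasFDerivAt_id w).prodMk (hasFDerivAt_const υ w))
    have h5 := (hL.hasFDerivAt_phase (hKO hu) hw hυ0).comp w h4
    have h6 := (ofRealCLM.hasFDerivAt.comp w ((hL.hasFDerivAt_hamiltonian hw hυ0).comp w
      (hasFDerivAt_prodMk_left (𝕜 := ℝ) w υ))).const_mul (I * δ)
    exact congrArg (fun L => L υ) (h5.add h6).fderiv
  · intro w hw
    have h7 := hL.φ_im u (hKO hu) w hw υ hυ0
    have h8 := mul_nonneg hδ0 (hL.h_pos w hw υ hυ0).le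
    simp
    linarith

lemma integrable_kernelFun_snd {f : 𝔼 → ℂ} (hf : Continuous f)
    (hfc : HasCompactSupport f) (hfO : tsupport f ⊆ O) {u q : 𝔼} (hu : u ∈ O) (hq : q ≠ 0) (δ : ℝ) :
    Integrable fun w => kernelFun φ b h s δ (u, w, q) * f w := by
  have h1 : ContinuousOn (fun w => kernelFun φ b h s δ (u, w, q)) O :=
    (hL.continuousOn_kernelFun δ).comp (f := fun w => (u, w, q)) (by fun_prop)
      fun w hw => ⟨hu, hw, hq⟩
  have h2 := continuousOn_mul_of_tsupport (T := univ) hL.isOpen hf h1 fun x hx => hfO hx.1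
  exact (continuousOn_univ.1 h2).integrable_of_hasCompactSupport hfc.mul_left

lemma exists_decay_snd {f : 𝔼 → ℂ} (hf : Smooth f)
    (hfc : HasCompactSupport f) (hfO : tsupport f ⊆ O) (hK : IsCompact K) (hKO : K ⊆ O) :
    ∃ C : ℝ, 0 ≤ C ∧ ∀ u ∈ K, ∀ q, q ≠ 0 → ∀ δ : ℝ, 0 ≤ δ → δ ≤ 1 →
      ‖∫ w, kernelFun φ b h s δ (u, w, q) * f w‖ ≤ C * ((1 + ‖q‖) ^ (d + 1))⁻¹ := by
  obtain ⟨m, M, hm, hM, hmM⟩ := hL.exists_bounds_hamiltonian hfc.isCompact hfO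
  obtain ⟨C1, m1, hC10, hm1, hC1⟩ := hL.exists_bound_kernelFun hK hKO hfc.isCompact hfO
  obtain ⟨C2, hC20, hC2⟩ := hL.exists_nonstationary_snd hf hfc hfO hK hKO (d + 1)
  obtain ⟨C3, hC30, hC3⟩ := hL.exists_bound_V hK hKO hfc.isCompact hfO
  obtain ⟨C4, hC4⟩ := hL.s_rem (d + 1) _ hfc.isCompact hfO
  have hfi := hf.continuous.integrable_of_hasCompactSupport hfc (μ := volume)
  have hfn : 0 ≤ ∫ w, ‖f w‖ := integral_nonneg fun _ => norm_nonneg _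
  refine ⟨_, by positivity, fun u hu q hq δ hδ0 hδ1 => le_mul_one_add_pow_inv (le_max_left 1 m⁻¹)
    (norm_nonneg q) (C₁ := C1 * ∫ w, ‖f w‖) (C₂ := C2 + max C4 0 * C3 * ∫ w, ‖f w‖)
    (by positivity) (by positivity) ?_ fun hR => ?_⟩
  · rw [← integral_const_mul]
    refine norm_integral_le_of_norm_le (hfi.norm.const_mul _) (ae_of_all _ fun w => ?_)
    by_cases hw : w ∈ tsupport f
    · rw [norm_mul]
      gcongr
      refine (hC1 u hu w hw q hq δ hδ0).trans (mul_le_of_le_one_right hC10 ?_)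
      rw [exp_le_one_iff]
      have : 0 ≤ δ * m1 * ‖q‖ := by positivity
      linarith
    · simp [image_eq_zero_of_notMem_tsupport hw]
  · have hn := norm_pos_iff.2 hq
    have h1 : 1 ≤ ‖q‖ := (le_max_left _ _).trans hR
    have hυ1 := norm_inv_smul_self hq
    have hυ : ‖q‖⁻¹ • q ≠ 0 := smul_ne_zero (inv_ne_zero hn.ne') hq
    obtain ⟨hi, hb⟩ := hC2 u hu _ hυ1 δ hδ0 hδ1 ‖q‖ h1
    set Y : 𝔼 → ℂ := fun w => cexp (I * ‖q‖ * (φ (u, w, ‖q‖⁻¹ • q) + I * δ * h (w, ‖q‖⁻¹ • q))) *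
      ((∑ k ∈ Finset.range (d + 1), (‖q‖⁻¹ : ℂ) ^ k * c k (w, ‖q‖⁻¹ • q)) *
        V (u, w, ‖q‖⁻¹ • q) * f w) with hY
    have hX := hL.integrable_kernelFun_snd hf.continuous hfc hfO (hKO hu) hq δ
    have h3 : ∀ w, ‖kernelFun φ b h s δ (u, w, q) * f w - Y w‖ ≤
        max C4 0 * C3 * (‖q‖ ^ (d + 1))⁻¹ * ‖f w‖ := by
      intro w
      by_cases hw : w ∈ tsupport f
      · have hwO := hfO hw
        have h2 : 1 ≤ h (w, q) := by
          refine le_trans ?_ (hmM w hw q hq).1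
          rw [← div_le_iff₀' hm, one_div]
          exact (le_max_right _ _).trans hR
        have e1 := hL.φ_hom u (hKO hu) w hwO _ hυ ‖q‖ hn
        have e2 := hL.h_hom w hwO _ hυ ‖q‖ hn
        have e3 := fun k => hL.c_hom k w hwO _ hυ ‖q‖ hn
        rw [norm_smul_inv_smul_self hq] at e1 e2
        simp only [norm_smul_inv_smul_self hq] at e3
        have e4 : ∑ k ∈ Finset.range (d + 1), (‖q‖⁻¹ : ℂ) ^ k * c k (w, ‖q‖⁻¹ • q) =
            ∑ k ∈ Finset.range (d + 1), c k (w, q) := by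
          refine sum_congr rfl fun k _ => ?_
          rw [e3 k]
          push_cast
          rw [inv_pow]
        have e5 : cexp (I * ‖q‖ * (φ (u, w, ‖q‖⁻¹ • q) + I * δ * h (w, ‖q‖⁻¹ • q))) =
            cexp (I * φ (u, w, q)) * exp (-δ * h (w, q)) := by
          rw [Complex.ofReal_exp, ← Complex.exp_add, e1, e2]
          congr 1
          push_cast
          linear_combination (‖q‖ * δ * h (w, ‖q‖⁻¹ • q) : ℂ) * I_sq
        have e6 : kernelFun φ b h s δ (u, w, q) * f w - Y w =
            cexp (I * φ (u, w, q)) * exp (-δ * h (w, q)) *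
            (s (w, q) - ∑ k ∈ Finset.range (d + 1), c k (w, q)) * V (u, w, q) * f w := by
          simp only [hY, e4, e5, kernelFun, hL.b_eq u (hKO hu) w hwO q hq h2,
            hL.V_hom u (hKO hu) w hwO q hq _ (inv_pos.2 hn)]
          ring
        rw [e6, norm_mul, norm_mul, norm_mul, norm_mul, norm_real, norm_of_nonneg (exp_pos _).le]
        refine mul_le_mul_of_nonneg_right ?_ (norm_nonneg _)
        have e7 : exp (-δ * h (w, q)) ≤ 1 := by
          rw [exp_le_one_iff]
          have := mul_nonneg hδ0 (hL.h_pos w hwO q hq).le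
          linarith
        calc _ ≤ 1 * (C4 * (‖q‖ ^ (d + 1))⁻¹) * C3 := mul_le_mul (mul_le_mul
              (mul_le_one₀ (hL.norm_exp_phase_le (hKO hu) hwO hq) (exp_pos _).le e7)
              (hC4 w hw q h1) (norm_nonneg _) zero_le_one) (hC3 u hu w hw q hq) (norm_nonneg _)
              (by rw [one_mul]; exact (norm_nonneg _).trans (hC4 w hw q h1))
          _ ≤ 1 * (max C4 0 * (‖q‖ ^ (d + 1))⁻¹) * C3 := by
              gcongr
              exact le_max_left _ _
          _ = max C4 0 * C3 * (‖q‖ ^ (d + 1))⁻¹ := by ring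
      · simp [hY, image_eq_zero_of_notMem_tsupport hw]
    have h4 : ∫ w, kernelFun φ b h s δ (u, w, q) * f w =
        (∫ w, Y w) + ∫ w, (kernelFun φ b h s δ (u, w, q) * f w - Y w) := by
      rw [integral_sub hX hi]
      ring
    rw [h4]
    refine (norm_add_le _ _).trans ?_
    have h5 := norm_integral_le_of_norm_le (hfi.norm.const_mul
      (max C4 0 * C3 * (‖q‖ ^ (d + 1))⁻¹)) (ae_of_all _ h3)
    rw [integral_const_mul] at h5
    calc _ ≤ C2 * (‖q‖ ^ (d + 1))⁻¹ + max C4 0 * C3 * (‖q‖ ^ (d + 1))⁻¹ * ∫ w, ‖f w‖ :=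
          add_le_add hb h5
      _ = _ := by ring

variable {f g : 𝔼[d] → ℂ}

lemma integrable_kernelFun (hd : 0 < d) (hf : Continuous f) (hfc : HasCompactSupport f)
    (hfO : tsupport f ⊆ O) (hg : Continuous g) (hgc : HasCompactSupport g) (hgO : tsupport g ⊆ O)
    {δ : ℝ} (hδ : 0 < δ) : Integrable (fun x : 𝔼 × 𝔼 ×
      𝔼 => kernelFun φ b h s δ x * (g x.1 * f x.2.1)) (volume.prod (volume.prod volume)) := by
  have : Nonempty (Fin d) := ⟨⟨0, hd⟩⟩
  have hnull : ∀ᵐ x : 𝔼 × 𝔼 × 𝔼 ∂(volume.prod (volume.prod volume)), x.2.2 ≠ 0 := by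
    refine (measure_eq_zero_iff_ae_notMem (s := univ ×ˢ univ ×ˢ {0})).1 ?_ |>.mono fun x hx h0 =>
      hx ⟨mem_univ _, mem_univ _, h0⟩
    rw [Measure.prod_prod, Measure.prod_prod, measure_singleton, mul_zero, mul_zero]
  obtain ⟨C, m, hC0, hm, hC⟩ := hL.exists_bound_kernelFun hgc.isCompact hgO hfc.isCompact hfO
  have hfi := hf.integrable_of_hasCompactSupport hfc (μ := volume)
  have hgi := hg.integrable_of_hasCompactSupport hgc (μ := volume)
  have hdom := (hgi.norm.const_mul C).mul_prod (hfi.norm.mul_prod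
    (integrable_exp_neg_mul_norm (d := d) (mul_pos hδ hm)))
  refine hdom.mono' ?_ ?_
  · have h1 : ContinuousOn (fun x : 𝔼 × 𝔼 × 𝔼 => kernelFun φ b h s δ x * (g x.1 * f x.2.1))
        (univ ×ˢ univ ×ˢ {0}ᶜ) := by
      refine continuousOn_mul_of_tsupport hL.isOpen₃ (by fun_prop) (hL.continuousOn_kernelFun δ)
        fun x hx => ⟨?_, ?_, hx.2.2.2⟩
      · exact hgO (tsupport_comp_subset g continuous_fst (tsupport_mul_subset_left hx.1))
      · exact hfO (tsupport_comp_subset f (continuous_fst.comp continuous_snd)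
          (tsupport_mul_subset_right hx.1))
    have h2 := h1.aestronglyMeasurable (μ := volume.prod (volume.prod volume))
      (isOpen_univ.prod (isOpen_univ.prod isOpen_compl_singleton)).measurableSet
    rwa [Measure.restrict_eq_self_of_ae_mem] at h2
    filter_upwards [hnull] with x hx using ⟨mem_univ _, mem_univ _, hx⟩
  · filter_upwards [hnull] with x hx
    by_cases hu : x.1 ∈ tsupport g
    · by_cases hw : x.2.1 ∈ tsupport f
      · rw [norm_mul, norm_mul]
        calc _ ≤ C * exp (-(δ * m) * ‖x.2.2‖) * (‖g x.1‖ * ‖f x.2.1‖) := by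
              gcongr
              exact hC _ hu _ hw _ hx δ hδ.le
          _ = _ := by ring
      · simp [image_eq_zero_of_notMem_tsupport hw]
    · simp [image_eq_zero_of_notMem_tsupport hu]

lemma continuousOn_transposed (hg : Continuous g) (hgc : HasCompactSupport g)
    (hgO : tsupport g ⊆ O) : ContinuousOn (fun p : 𝔼 ×
      𝔼 => s p * ∫ u, cexp (I * φ (u, p)) * b (u, p) * g u) (O ×ˢ {0}ᶜ) := by
  refine hL.s_cont.mul (continuousOn_integral_of_compact_support hgc.isCompact ?_ fun p u _ hu =>
    ?_)
  · have h1 : ContinuousOn (fun x => cexp (I * φ x) * b x) (O ×ˢ O ×ˢ {0}ᶜ) :=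
      (continuousOn_const.mul hL.φ_smooth.continuousOn).cexp.mul hL.b_cont
    have h2 : ContinuousOn (fun y : (𝔼 × 𝔼) × 𝔼 => cexp (I * φ (y.2, y.1)) * b (y.2, y.1))
        ((O ×ˢ {0}ᶜ) ×ˢ O) := h1.comp (f := fun y : (𝔼 × 𝔼) ×
        𝔼 => (y.2, y.1)) (by fun_prop) fun y hy => ⟨hy.2, hy.1⟩
    exact continuousOn_mul_of_tsupport (hL.isOpen₂.prod hL.isOpen) (hg.comp continuous_snd) h2
      fun x hx => ⟨hx.2.1, hgO (tsupport_comp_subset g continuous_snd hx.1)⟩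
  · simp [image_eq_zero_of_notMem_tsupport hu]

lemma continuousOn_integral_transposed (hd : 0 < d) (hg : Smooth g)
    (hgc : HasCompactSupport g) (hgO : tsupport g ⊆ O) :
    ContinuousOn (fun w => ∫ q, s (w, q) * ∫ u, cexp (I * φ (u, w, q)) * b (u, w, q) * g u) O := by
  have : Nonempty (Fin d) := ⟨⟨0, hd⟩⟩
  have hG := hL.continuousOn_transposed hg.continuous hgc hgO
  intro w₀ hw₀
  obtain ⟨r, hr, hrO⟩ := nhds_basis_closedBall.mem_iff.1 (hL.isOpen.mem_nhds hw₀)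
  obtain ⟨C, hC0, hC⟩ := hL.exists_decay_fst hg hgc hgO (isCompact_closedBall w₀ r) hrO
  have hne : ∀ᵐ q : 𝔼, q ≠ 0 := ae_ne_zero
  refine ContinuousAt.continuousWithinAt (ContinuousOn.continuousAt (s := closedBall w₀ r) ?_
    (closedBall_mem_nhds w₀ hr))
  refine continuousOn_of_dominated (bound := fun q => C * ((1 + ‖q‖) ^ (d + 1))⁻¹) ?_ ?_
    (integrable_one_add_norm_pow_inv.const_mul C) ?_
  · intro w hw
    have h1 := (hG.comp (f := fun q => (w, q)) (s := {0}ᶜ) (by fun_prop)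
      fun q hq => ⟨hrO hw, hq⟩).aestronglyMeasurable (μ := volume)
        isOpen_compl_singleton.measurableSet
    rwa [restrict_compl_singleton] at h1
  · intro w hw
    filter_upwards [hne] with q hq using hC w hw q hq
  · filter_upwards [hne] with q hq
    exact hG.comp (f := fun w => (w, q)) (by fun_prop) fun w hw => ⟨hrO hw, hq⟩

lemma integral_mul_eq_integral_transposed (hd : 0 < d) (hf : Smooth f)
    (hfc : HasCompactSupport f) (hfO : tsupport f ⊆ O) (hg : Smooth g)
    (hgc : HasCompactSupport g) (hgO : tsupport g ⊆ O) {L : 𝔼 → ℂ}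
    (hlim : ∀ u ∈ O, Tendsto (fun δ : ℝ => ∫ w, (∫ q, kernelFun φ b h s δ (u, w, q)) * f w)
      (𝓝[>] 0) (𝓝 (L u))) : ∫ u, g u * L u = ∫ w, f w * ∫ q, s (w, q) *
      ∫ u, cexp (I * φ (u, w, q)) * b (u, w, q) * g u := by
  have : Nonempty (Fin d) := ⟨⟨0, hd⟩⟩
  have hne : ∀ᵐ q : 𝔼, q ≠ 0 := ae_ne_zero
  have hne2 : ∀ᵐ p : 𝔼 × 𝔼 ∂(volume.prod volume), p.2 ≠ 0 := by
    refine (measure_eq_zero_iff_ae_notMem (s := univ ×ˢ {0})).1 ?_ |>.mono fun x hx h0 =>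
      hx ⟨mem_univ _, h0⟩
    rw [Measure.prod_prod, measure_singleton, mul_zero]
  obtain ⟨C, hC0, hC⟩ := hL.exists_decay_snd hf hfc hfO hgc.isCompact hgO
  obtain ⟨C', hC'0, hC'⟩ := hL.exists_decay_fst hg hgc hgO hfc.isCompact hfO
  have hI := fun {δ : ℝ} (hδ : 0 < δ) => hL.integrable_kernelFun hd hf.continuous hfc hfO
    hg.continuous hgc hgO hδ
  set G : 𝔼 × 𝔼 → ℂ := fun p => s p * ∫ u, cexp (I * φ (u, p)) * b (u, p) * g u with hG
  have hfi := hf.continuous.integrable_of_hasCompactSupport hfc (μ := volume)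
  have hgi := hg.continuous.integrable_of_hasCompactSupport hgc (μ := volume)
  have hq := integrable_one_add_norm_pow_inv (d := d)
  have hpos : ∀ᶠ δ : ℝ in 𝓝[>] 0, 0 < δ ∧ δ ≤ 1 := by
    filter_upwards [Ioo_mem_nhdsGT (zero_lt_one' ℝ)] with δ hδ using ⟨hδ.1, hδ.2.le⟩
  have e1 : ∀ δ : ℝ, 0 < δ → ∀ᵐ u, (∫ p : 𝔼 × 𝔼,
      kernelFun φ b h s δ (u, p) * (g u * f p.1) ∂(volume.prod volume)) =
        g u * ∫ w, (∫ q, kernelFun φ b h s δ (u, w, q)) * f w := by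
    intro δ hδ
    filter_upwards [(hI hδ).prod_right_ae] with u hu
    rw [integral_prod _ hu, ← integral_const_mul]
    congr 1
    ext w
    refine (integral_mul_const (g u * f w) fun q => kernelFun φ b h s δ (u, w, q)).trans ?_
    ring
  have e2 : ∀ δ : ℝ, 0 < δ → δ ≤ 1 → ∀ᵐ u, ‖∫ p : 𝔼 × 𝔼,
      kernelFun φ b h s δ (u, p) * (g u * f p.1) ∂(volume.prod volume)‖ ≤
        ‖g u‖ * ∫ q : 𝔼, C * ((1 + ‖q‖) ^ (d + 1))⁻¹ := by
    intro δ hδ hδ1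
    filter_upwards [(hI hδ).prod_right_ae] with u hu
    by_cases hgu : u ∈ tsupport g
    · have e3 : (∫ p : 𝔼 × 𝔼, kernelFun φ b h s δ (u, p) * (g u * f p.1) ∂(volume.prod volume)) =
          g u * ∫ q, ∫ w, kernelFun φ b h s δ (u, w, q) * f w := by
        rw [integral_prod_symm _ hu, ← integral_const_mul]
        congr 1
        ext q
        rw [← integral_const_mul]
        congr 1
        ext w
        ring
      rw [e3, norm_mul]
      gcongr
      refine norm_integral_le_of_norm_le (hq.const_mul C) ?_
      filter_upwards [hne] with q hq0 using hC u hgu q hq0 δ hδ.le hδ1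
    · simp [image_eq_zero_of_notMem_tsupport hgu]
  have t1 : Tendsto (fun δ : ℝ => ∫ u, ∫ p : 𝔼 × 𝔼,
      kernelFun φ b h s δ (u, p) * (g u * f p.1) ∂(volume.prod volume)) (𝓝[>] 0)
      (𝓝 (∫ u, g u * L u)) := by
    have h1 := tendsto_integral_filter_of_dominated_convergence (μ := volume) (l := 𝓝[>] (0 : ℝ))
      (F := fun δ u => g u * ∫ w, (∫ q, kernelFun φ b h s δ (u, w, q)) * f w)
      (f := fun u => g u * L u) (fun u => ‖g u‖ * ∫ q : 𝔼, C * ((1 + ‖q‖) ^ (d + 1))⁻¹) (by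
        filter_upwards [hpos] with δ hδ
        exact (hI hδ.1).integral_prod_left.aestronglyMeasurable.congr (e1 δ hδ.1)) (by
        filter_upwards [hpos] with δ hδ
        filter_upwards [e1 δ hδ.1, e2 δ hδ.1 hδ.2] with u h1 h2
        rwa [← h1]) (hgi.norm.mul_const _) (ae_of_all _ fun u => by
        by_cases hgu : u ∈ tsupport g
        · exact (hlim u (hgO hgu)).const_mul (g u)
        · simp [image_eq_zero_of_notMem_tsupport hgu])
    refine h1.congr' ?_
    filter_upwards [hpos] with δ hδ
    exact (integral_congr_ae (e1 δ hδ.1)).symm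
  have e4 : ∀ (δ : ℝ) (p : 𝔼 × 𝔼), ∫ u, kernelFun φ b h s δ (u, p) * (g u * f p.1) =
      f p.1 * exp (-δ * h p) * G p := by
    intro δ p
    simp only [hG, kernelFun]
    rw [← integral_const_mul, ← integral_const_mul]
    congr 1
    ext u
    ring
  have t2 : Tendsto (fun δ : ℝ => ∫ p : 𝔼 × 𝔼,
      f p.1 * exp (-δ * h p) * G p ∂(volume.prod volume)) (𝓝[>] 0)
      (𝓝 (∫ p : 𝔼 × 𝔼, f p.1 * G p ∂(volume.prod volume))) := by
    refine tendsto_integral_filter_of_dominated_convergence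
      (fun p => ‖f p.1‖ * (C' * ((1 + ‖p.2‖) ^ (d + 1))⁻¹)) ?_ ?_
      (hfi.norm.mul_prod (hq.const_mul C')) ?_
    · filter_upwards [hpos] with δ hδ
      refine (hI hδ.1).integral_prod_right.aestronglyMeasurable.congr (ae_of_all _ fun p => ?_)
      exact e4 δ p
    · filter_upwards [hpos] with δ hδ
      filter_upwards [hne2] with p hp
      by_cases hfp : p.1 ∈ tsupport f
      · rw [norm_mul, norm_mul, norm_real, norm_of_nonneg (exp_pos _).le]
        refine mul_le_mul (mul_le_of_le_one_right (norm_nonneg _) ?_) (hC' p.1 hfp p.2 hp)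
          (norm_nonneg _) (norm_nonneg _)
        rw [exp_le_one_iff]
        have := mul_nonneg hδ.1.le (hL.h_pos p.1 (hfO hfp) p.2 hp).le
        simp only [Prod.mk.eta] at this
        linarith
      · simp [image_eq_zero_of_notMem_tsupport hfp]
    · refine ae_of_all _ fun p => ?_
      have h1 : Tendsto (fun δ : ℝ => f p.1 * exp (-δ * h p) * G p) (𝓝 0)
          (𝓝 (f p.1 * exp (-0 * h p) * G p)) := Continuous.tendsto (by fun_prop) 0
      simp only [neg_zero, zero_mul, Real.exp_zero, ofReal_one, mul_one] at h1
      exact h1.mono_left nhdsWithin_le_nhds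
  have hGi : Integrable (fun p : 𝔼 × 𝔼 => f p.1 * G p) (volume.prod volume) := by
    refine (hfi.norm.mul_prod (hq.const_mul C')).mono' ?_ ?_
    · have h1 : ContinuousOn (fun p : 𝔼 × 𝔼 => G p * f p.1) (univ ×ˢ {0}ᶜ) :=
        continuousOn_mul_of_tsupport hL.isOpen₂ (hf.continuous.comp continuous_fst)
          (hL.continuousOn_transposed hg.continuous hgc hgO)
          fun x hx => ⟨hfO (tsupport_comp_subset f continuous_fst hx.1), hx.2.2⟩
      have h2 := h1.aestronglyMeasurable (μ := volume.prod volume)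
        (isOpen_univ.prod isOpen_compl_singleton).measurableSet
      rw [Measure.restrict_eq_self_of_ae_mem (by
        filter_upwards [hne2] with x hx using ⟨mem_univ _, hx⟩)] at h2
      simpa only [mul_comm] using h2
    · filter_upwards [hne2] with p hp
      by_cases hfp : p.1 ∈ tsupport f
      · rw [norm_mul]
        exact mul_le_mul_of_nonneg_left (hC' p.1 hfp p.2 hp) (norm_nonneg _)
      · simp [image_eq_zero_of_notMem_tsupport hfp]
  refine (tendsto_nhds_unique t1 (t2.congr' ?_)).trans ?_
  · filter_upwards [hpos] with δ hδ
    have h1 := integral_integral_swap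
      (f := fun u p => kernelFun φ b h s δ (u, p) * (g u * f p.1)) (hI hδ.1)
    rw [h1]
    simp_rw [e4]
  · rw [integral_prod _ hGi]
    congr 1
    ext w
    rw [← integral_const_mul]

lemma transposed_eq (hd : 0 < d) {κ : ℂ} {R : 𝔼 × 𝔼 → ℂ} (hR : ContinuousOn R (O ×ˢ O))
    (hlim : ∀ f : 𝔼 → ℂ, Smooth f → HasCompactSupport f → tsupport f ⊆ O → ∀ u ∈ O,
      Tendsto (fun δ : ℝ => ∫ w, (∫ q, kernelFun φ b h s δ (u, w, q)) * f w)
      (𝓝[>] 0) (𝓝 (κ * (f u + ∫ w, R (u, w) * f w)))) (hg : Smooth g)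
    (hgc : HasCompactSupport g) (hgO : tsupport g ⊆ O) {w : 𝔼} (hw : w ∈ O) :
    ∫ q, s (w, q) * ∫ u, cexp (I * φ (u, w, q)) * b (u, w, q) * g u =
      κ * (g w + ∫ u, R (u, w) * g u) := by
  have hH := hL.continuousOn_integral_transposed hd hg hgc hgO
  have hRg : ContinuousOn (fun w => ∫ u, R (u, w) * g u) O := by
    refine continuousOn_integral_of_compact_support hgc.isCompact ?_ fun p u _ hu => by
      simp [image_eq_zero_of_notMem_tsupport hu]
    refine continuousOn_mul_of_tsupport (hL.isOpen.prod hL.isOpen)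
      (hg.continuous.comp continuous_snd) (hR.comp (f := fun y : 𝔼 ×
        𝔼 => (y.2, y.1)) (by fun_prop) fun y hy => ⟨hy.2, hy.1⟩)
      fun x hx => ⟨hx.2.1, hgO (tsupport_comp_subset g continuous_snd hx.1)⟩
  set T : 𝔼 → ℂ := fun w => κ * (g w + ∫ u, R (u, w) * g u) with hT
  have hTc : ContinuousOn T O := continuousOn_const.mul (hg.continuous.continuousOn.add hRg)
  have hz := hL.isOpen.ae_eq_zero_of_integral_contDiff_smul_eq_zero (μ := volume)
    ((hH.sub hTc).locallyIntegrableOn hL.isOpen.measurableSet) fun ρ hρ hρc hρO => by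
    set f : 𝔼 → ℂ := fun w => (ρ w : ℂ) with hfdef
    have hsub : tsupport f ⊆ tsupport ρ := closure_mono fun x (hx : (ρ x : ℂ) ≠ 0) => by simpa using
      hx
    have hf : Smooth f := ofRealCLM.contDiff.comp hρ
    have hfc : HasCompactSupport f := hρc.of_isClosed_subset (isClosed_tsupport _) hsub
    have hfO : tsupport f ⊆ O := hsub.trans hρO
    have h1 := hL.integral_mul_eq_integral_transposed hd hf hfc hfO hg hgc hgO (hlim f hf hfc hfO)
    have hRfg : Integrable (fun x : 𝔼 × 𝔼 => R x * (g x.1 * f x.2)) (volume.prod volume) := by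
      refine Continuous.integrable_of_hasCompactSupport (continuousOn_univ.1
        (continuousOn_mul_of_tsupport (hL.isOpen.prod hL.isOpen) (by
          have := hg.continuous
          have := hf.continuous
          fun_prop) hR fun x hx =>
          ⟨hgO (tsupport_comp_subset g continuous_fst (tsupport_mul_subset_left hx.1)),
          hfO (tsupport_comp_subset f continuous_snd (tsupport_mul_subset_right hx.1))⟩)) ?_
      refine HasCompactSupport.intro (hgc.isCompact.prod hfc.isCompact) fun x hx => ?_
      rw [mem_prod, not_and_or] at hx
      rcases hx with hx | hx <;> simp [image_eq_zero_of_notMem_tsupport hx]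
    have hfg : Integrable fun u => g u * f u := (hg.continuous.mul
      hf.continuous).integrable_of_hasCompactSupport hgc.mul_right
    have h2 : ∫ u, g u * (κ * (f u + ∫ w, R (u, w) * f w)) = ∫ w, f w * T w := by
      have e1 : ∀ u, g u * (κ * (f u + ∫ w, R (u, w) * f w)) =
          κ * (g u * f u) + κ * ∫ w, R (u, w) * (g u * f w) := by
        intro u
        have : ∫ w, R (u, w) * (g u * f w) = g u * ∫ w, R (u, w) * f w := by
          rw [← integral_const_mul]; congr 1; ext w; ring
        rw [this]
        ring
      have e2 : ∀ w, f w * T w = κ * (g w * f w) + κ * ∫ u, R (u, w) * (g u * f w) := by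
        intro w
        have : ∫ u, R (u, w) * (g u * f w) = f w * ∫ u, R (u, w) * g u := by
          rw [← integral_const_mul]; congr 1; ext w; ring
        simp only [this, hT]
        ring
      simp_rw [e1, e2]
      rw [integral_add (hfg.const_mul κ) (hRfg.integral_prod_left.const_mul κ),
        integral_add (hfg.const_mul κ) (hRfg.integral_prod_right.const_mul κ), integral_const_mul κ,
        integral_const_mul κ, integral_const_mul κ, integral_integral_swap hRfg]
    rw [h2] at h1
    have hfT : Integrable fun w => T w * f w := (continuousOn_univ.1
      (continuousOn_mul_of_tsupport (T := univ) hL.isOpen hf.continuous hTc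
        fun x hx => hfO hx.1)).integrable_of_hasCompactSupport hfc.mul_left
    have hfH := (continuousOn_univ.1 (continuousOn_mul_of_tsupport (T := univ) hL.isOpen
      hf.continuous hH fun x hx => hfO hx.1)).integrable_of_hasCompactSupport hfc.mul_left
      (μ := volume)
    have h3 := integral_sub hfH hfT
    rw [show (∫ w, T w * f w) = ∫ w, f w * T w by simp_rw [mul_comm], h1] at h3
    simp_rw [mul_comm (∫ q, s (_, q) * _) (f _)] at h3
    rw [sub_self] at h3
    rw [← h3]
    congr 1
    ext w
    simp only [real_smul, Pi.sub_apply, hfdef]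
    ring
  have h4 := Measure.eqOn_open_of_ae_eq (μ := volume)
    ((ae_restrict_iff' hL.isOpen.measurableSet).2 hz) hL.isOpen (hH.sub hTc)
    (continuousOn_const (c := (0 : ℂ)))
  exact sub_eq_zero.1 (h4 hw)

end LocalKernel

end

variable {M : Type*} [MetricSpace M] [ChartedSpace 𝔼[d] M] [IsManifold (𝓡 d) ∞ M]
  [Bundle.RiemannianBundle (fun x : M => TangentSpace (𝓡 d) x)]
  [IsContMDiffRiemannianBundle (𝓡 d) ∞ 𝔼[d]
      (fun x : M => TangentSpace (𝓡 d) x)]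
  [IsRiemannianManifold (𝓡 d) M] [MeasurableSpace M] [BorelSpace M]

local notation "κ[" p "]" => extChartAt (𝓡 d) p

local notation "τ[" p "]" => PartialEquiv.target (extChartAt (𝓡 d) p)

local notation "σ[" p "]" => PartialEquiv.symm (extChartAt (𝓡 d) p)

local notation "⟪" B "⟫" => (B : 𝔼[d] →L[ℝ] 𝔼[d])

local notation "⟪" B "⟫†" => adjoint
  (B : 𝔼[d] →L[ℝ] 𝔼[d])

lemma isInvertible_coordDiff {p y : M} (hy : y ∈ κ[p].source) :
    (coordDiff (d := d) p y).IsInvertible := by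
  have : IsManifold (𝓡 d) 1 M := .of_le (n := ∞) (by simp)
  exact isInvertible_mfderiv_extChartAt hy

lemma coordDiff_inverse_coordDiff {p y : M} (hy : y ∈ κ[p].source)
    (X : TangentSpace (𝓡 d) y) : (coordDiff p y).inverse (coordDiff p y X) = X := by
  obtain ⟨e, he⟩ := isInvertible_coordDiff hy
  rw [← he, ContinuousLinearMap.inverse_equiv]
  exact e.symm_apply_apply X

lemma coordDiff_coordDiff_inverse {p y : M} (hy : y ∈ κ[p].source)
    (a : 𝔼) : coordDiff p y ((coordDiff p y).inverse a) = a := by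
  obtain ⟨e, he⟩ := isInvertible_coordDiff hy
  rw [← he, ContinuousLinearMap.inverse_equiv]
  exact e.apply_symm_apply a

lemma coordDiff_coordVec {p y : M} (hy : y ∈ κ[p].source)
    (α : Fin d) : coordDiff p y (coordVec p y α) = stdVec α := coordDiff_coordDiff_inverse hy _

lemma eq_sum_stdVec (a : 𝔼) : a = ∑ μ, a μ • stdVec μ := by
  ext i
  simp [Finset.sum_apply, Pi.single_apply]

lemma covec_apply (p y : M) (q : 𝔼) (X : TangentSpace (𝓡 d) y) :
    covec p y q X = inner ℝ q (coordDiff p y X) := rfl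

lemma covec_coordVec {p y : M} (hy : y ∈ κ[p].source) (q : 𝔼)
    (α : Fin d) : covec p y q (coordVec p y α) = q α := by
  rw [covec_apply, coordDiff_coordVec hy]
  simp [stdVec, EuclideanSpace.inner_single_right]

lemma covec_smul (p y : M) (t : ℝ) (q : 𝔼) : covec p y (t • q) = t • covec p y q := by
  ext X
  simp [covec_apply, inner_smul_left]

lemma covec_add (p y : M) (q q' : 𝔼) : covec p y (q + q') = covec p y q + covec p y q' := by
  ext X
  simp [covec_apply, inner_add_left]

lemma covec_injective {p y : M} (hy : y ∈ κ[p].source) :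
    Function.Injective (covec (d := d) p y) := by
  intro q q' h
  ext α
  rw [← covec_coordVec hy, h, covec_coordVec hy]

lemma covec_ne_zero {p y : M} (hy : y ∈ κ[p].source) {q : 𝔼} (hq : q ≠ 0) : covec p y q ≠ 0 := by
  intro h
  refine hq (covec_injective hy (h.trans ?_))
  ext X
  simp [covec_apply]

lemma exists_covec_eq {p y : M} (hy : y ∈ κ[p].source) (η : Cotangent d y) :
    ∃ q : 𝔼, covec p y q = η := by
  refine ⟨(InnerProductSpace.toDual ℝ 𝔼).symm (η.comp (coordDiff p y).inverse), ?_⟩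
  ext X
  rw [covec_apply, InnerProductSpace.toDual_symm_apply]
  simp [coordDiff_inverse_coordDiff hy]

/-- The transition map from the chart at `p` to the chart at `p'`. -/
def transition (d : ℕ) {M : Type*} [MetricSpace M] [ChartedSpace 𝔼[d] M]
    (p p' : M) (u : 𝔼[d]) : 𝔼[d] :=
  extChartAt (𝓡 d) p' ((extChartAt (𝓡 d) p).symm u)

/-- The domain of the transition map. -/
def overlap (d : ℕ) {M : Type*} [MetricSpace M] [ChartedSpace 𝔼[d] M] (p p' : M) : Set 𝔼[d] :=
  (extChartAt (𝓡 d) p).target ∩ (extChartAt (𝓡 d) p).symm ⁻¹' (extChartAt (𝓡 d) p').source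

lemma isOpen_overlap (p p' : M) : IsOpen (overlap d p p') :=
  (continuousOn_extChartAt_symm p).isOpen_inter_preimage (isOpen_extChartAt_target p)
    (isOpen_extChartAt_source p')

lemma mem_overlap {p p' y : M} (hy : y ∈ κ[p].source) (hy' : y ∈ κ[p'].source) :
    κ[p] y ∈ overlap d p p' := ⟨κ[p].map_source hy, by
    rw [mem_preimage, κ[p].left_inv hy]; exact hy'⟩

lemma contDiffOn_transition (p p' : M) : SmoothOn (transition d p p') (overlap d p p') := by
  have := contDiffOn_ext_coord_change (I := 𝓡 d) (n := ∞) p' p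
  refine this.mono fun u hu => ?_
  rw [PartialEquiv.trans_source]
  exact ⟨hu.1, hu.2⟩

lemma contDiffAt_transition {p p' : M} {u : 𝔼} (hu : u ∈ overlap d p p') :
    ContDiffAt ℝ ∞ (transition d p p') u :=
  (contDiffOn_transition p p').contDiffAt ((isOpen_overlap p p').mem_nhds hu)

lemma hasFDerivAt_transition {p p' : M} {u : 𝔼} (hu : u ∈ overlap d p p') :
    HasFDerivAt (transition d p p') (fderiv ℝ (transition d p p') u) u :=
  ((contDiffAt_transition hu).differentiableAt (by simp)).hasFDerivAt

lemma coordDiff_eq_fderiv_transition {p p' y : M} (hy : y ∈ κ[p].source) (hy' : y ∈ κ[p'].source) :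
    coordDiff (d := d) p' y = (fderiv ℝ (transition d p p') (κ[p] y)).comp (coordDiff p y) := by
  have : IsManifold (𝓡 d) 1 M := .of_le (n := ∞) (by simp)
  have hτ : DifferentiableAt ℝ (transition d p p') (κ[p] y) :=
    (hasFDerivAt_transition (mem_overlap hy hy')).differentiableAt
  have h1 : HasMFDerivAt (𝓡 d) 𝓘(ℝ, 𝔼) κ[p] y (coordDiff p y) :=
    (mdifferentiableAt_extChartAt (by simpa using hy)).hasMFDerivAt
  have h2 := hτ.hasFDerivAt.hasMFDerivAt.comp y h1
  have h3 : (transition d p p' ∘ κ[p]) =ᶠ[𝓝 y] κ[p'] := by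
    filter_upwards [(isOpen_extChartAt_source (I := 𝓡 d) p).mem_nhds hy] with x hx
    rw [Function.comp_apply, transition, κ[p].left_inv hx]
  exact ((h2.congr_of_eventuallyEq h3.symm).mfderiv)

lemma transition_comp_transition {p p' : M} {u : 𝔼} (hu : u ∈ overlap d p p') :
    transition d p' p (transition d p p' u) = u := by
  rw [transition, transition, κ[p'].left_inv hu.2, κ[p].right_inv hu.1]

lemma covec_eq_covec_transition {p p' y : M} (hy : y ∈ κ[p].source)
    (hy' : y ∈ κ[p'].source) (q : 𝔼) : covec p' y q = covec p y
      ((adjoint (fderiv ℝ (transition d p p') (κ[p] y))) q) := by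
  ext X
  rw [covec_apply, covec_apply, coordDiff_eq_fderiv_transition hy hy', adjoint_inner_left]
  rfl

/-- The transpose of a matrix, as an operator on `ℝᵈ`. -/
def matrixOp (g : Matrix (Fin d) (Fin d) ℝ) : 𝔼 →L[ℝ] 𝔼 :=
  ∑ μ, ∑ ν, g μ ν • (EuclideanSpace.proj μ : 𝔼 →L[ℝ] ℝ).smulRight (stdVec ν : 𝔼)

/-- The bilinear form of a matrix. -/
def matrixForm (g : Matrix (Fin d) (Fin d) ℝ) (a b : 𝔼) : ℝ := inner ℝ (matrixOp g a) b

lemma matrixForm_apply (g : Matrix (Fin d) (Fin d) ℝ) (a b : 𝔼) :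
    matrixForm g a b = ∑ μ, ∑ ν, g μ ν * a μ * b ν := by
  simp [matrixForm, matrixOp, mul_assoc, sum_inner, inner_smul_left,
    EuclideanSpace.inner_single_left]

lemma matrixForm_stdVec (g : Matrix (Fin d) (Fin d) ℝ) (μ ν : Fin d) :
    matrixForm g (stdVec μ) (stdVec ν) = g μ ν := by
  rw [matrixForm_apply]
  simp

/-- The metric in the chart at `p`, as an operator on `ℝᵈ`. -/
def metricOp (p : M) (u : 𝔼) : 𝔼 →L[ℝ] 𝔼 := matrixOp (metricMatrix p (σ[p] u))

/-- The metric in the chart at `p`, as a bilinear form on `ℝᵈ`. -/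
def metricForm (p : M) (u a b : 𝔼) : ℝ := inner ℝ (metricOp p u a) b

lemma metricForm_eq_matrixForm (p : M) (u : 𝔼) :
    metricForm p u = matrixForm (metricMatrix p (σ[p] u)) := rfl

lemma matrixForm_metricMatrix (p y : M) (a b : 𝔼) : matrixForm (metricMatrix p y) a b =
      inner ℝ ((coordDiff p y).inverse a) ((coordDiff p y).inverse b) := by
  conv_rhs => rw [eq_sum_stdVec a, eq_sum_stdVec b]
  rw [map_sum, map_sum, sum_inner, matrixForm_apply]
  refine sum_congr rfl fun μ _ => ?_
  rw [inner_sum]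
  refine sum_congr rfl fun ν _ => ?_
  rw [map_smul, map_smul, real_inner_smul_left, real_inner_smul_right]
  simp only [metricMatrix, coordVec, of_apply]
  ring

lemma metricForm_apply (p : M) (u a b : 𝔼) :
    metricForm p u a b = inner ℝ ((coordDiff p (σ[p] u)).inverse a)
      ((coordDiff p (σ[p] u)).inverse b) := matrixForm_metricMatrix _ _ _ _

lemma metricForm_comm (p : M) (u a b : 𝔼) : metricForm p u a b = metricForm p u b a := by
  rw [metricForm_apply, metricForm_apply, real_inner_comm]

lemma inner_eq_metricForm {p y : M} (hy : y ∈ κ[p].source) (X Y : TangentSpace (𝓡 d) y) :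
    inner ℝ X Y = metricForm p (κ[p] y) (coordDiff p y X) (coordDiff p y Y) := by
  rw [metricForm_eq_matrixForm, κ[p].left_inv hy, matrixForm_metricMatrix,
    coordDiff_inverse_coordDiff hy, coordDiff_inverse_coordDiff hy]

lemma metricForm_pos {p : M} {u a : 𝔼} (hu : u ∈ τ[p]) (ha : a ≠ 0) : 0 < metricForm p u a a := by
  rw [metricForm_apply, real_inner_self_eq_norm_sq]
  have : (coordDiff p (σ[p] u)).inverse a ≠ 0 := by
    intro h
    apply ha
    rw [← coordDiff_coordDiff_inverse (κ[p].map_target hu) a, h, map_zero]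
  positivity

lemma metricForm_transition {p p' : M} {u : 𝔼} (hu : u ∈ overlap d p p') (a b : 𝔼) :
    metricForm p u a b = metricForm p' (transition d p p' u)
      (fderiv ℝ (transition d p p') u a) (fderiv ℝ (transition d p p') u b) := by
  have h1 : σ[p] u ∈ κ[p].source := κ[p].map_target hu.1
  have h2 := coordDiff_eq_fderiv_transition h1 hu.2
  rw [κ[p].right_inv hu.1] at h2
  rw [metricForm_apply, inner_eq_metricForm hu.2, h2]
  simp only [ContinuousLinearMap.comp_apply, coordDiff_coordDiff_inverse h1]
  rfl

lemma contMDiffOn_metricMatrix (p : M) (μ ν : Fin d) :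
    ContMDiffOn (𝓡 d) 𝓘(ℝ) ∞ (fun y => metricMatrix (d := d) p y μ ν) κ[p].source := by
  have : IsManifold (𝓡 d) 1 M := .of_le (n := ∞) (by simp)
  have : IsManifold (𝓡 d) (∞ + 1) M := by
    rw [show (∞ + 1 : WithTop ℕ∞) = ∞ from by rfl]; infer_instance
  let e := trivializationAt 𝔼 (TangentSpace (𝓡 d)) p
  let b := (EuclideanSpace.basisFun (Fin d) ℝ).toBasis
  have hbase : κ[p].source = e.baseSet := by rw [extChartAt_source]; rfl
  have key : ∀ y ∈ κ[p].source, ∀ α, coordVec p y α = e.localFrame b α y := by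
    intro y hy α
    have hy' : y ∈ e.baseSet := hbase ▸ hy
    rw [Bundle.Trivialization.localFrame_apply_of_mem_baseSet _ _ hy']
    have hc := TangentBundle.continuousLinearMapAt_trivializationAt (I := 𝓡 d) (x₀ := p) (x := y)
      (by simpa using hy)
    have h1 : coordDiff p y (e.basisAt b hy' α) = stdVec α := by
      rw [coordDiff, ← hc]
      rw [Bundle.Trivialization.basisAt, Module.Basis.map_apply,
        Bundle.Trivialization.linearEquivAt_symm_apply]
      refine (e.linearMapAt_symm (R := ℝ) hy' _).trans ?_
      simp [b, EuclideanSpace.basisFun_apply]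
    rw [← coordDiff_inverse_coordDiff hy (e.basisAt b hy' α), h1]
    rfl
  have h := ContMDiffOn.inner_bundle (IM := 𝓡 d) (IB := 𝓡 d) (n := ∞) (F := 𝔼) (b := id)
    (e.contMDiffOn_localFrame_baseSet (I := 𝓡 d) ∞ b μ)
    (e.contMDiffOn_localFrame_baseSet (I := 𝓡 d) ∞ b ν)
  rw [hbase]
  refine h.congr fun y hy => ?_
  simp only [metricMatrix, of_apply]
  rw [key y (hbase ▸ hy), key y (hbase ▸ hy)]

lemma contDiffOn_metricMatrix (p : M) (μ ν : Fin d) :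
    SmoothOn (fun u => metricMatrix (d := d) p (σ[p] u) μ ν) τ[p] := by
  rw [← contMDiffOn_iff_contDiffOn]
  exact (contMDiffOn_metricMatrix p μ ν).comp (contMDiffOn_extChartAt_symm p)
    (fun u hu => κ[p].map_target hu)

lemma contDiffOn_metricOp (p : M) : SmoothOn (metricOp (d := d) p) τ[p] := by
  rw [contDiffOn_clm_apply]
  intro a
  have : ∀ u, metricOp (d := d) p u a = ∑ μ, ∑ ν,
      (metricMatrix (d := d) p (σ[p] u) μ ν * a μ) • stdVec ν := fun u => by
    simp [metricOp, matrixOp, smul_smul]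
  simp only [this]
  refine ContDiffOn.sum fun μ _ => ContDiffOn.sum fun ν _ => ?_
  exact ((contDiffOn_metricMatrix p μ ν).mul contDiffOn_const).smul contDiffOn_const

section

variable {F : Type*} [NormedAddCommGroup F] [InnerProductSpace ℝ F]

/-- The Christoffel symbols of the first kind of a metric on an inner product space. -/
def christoffelLower (G : F → F →L[ℝ] F) (u a b v : F) : ℝ :=
  (1 / 2) * (inner ℝ (fderiv ℝ G u a b) v + inner ℝ (fderiv ℝ G u b a) v -
    inner ℝ (fderiv ℝ G u v a) b)

lemma christoffelLower_pullback {G G' : F → F →L[ℝ] F} {τ : F → F} {u : F}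
    (hG : DifferentiableAt ℝ G u) (hG' : DifferentiableAt ℝ G' (τ u)) (hτ : ContDiffAt ℝ 2 τ u)
    (hsymm : ∀ a b, inner ℝ (G' (τ u) a) b = inner ℝ (G' (τ u) b) a) (h : ∀ᶠ x in 𝓝 u, ∀ a b,
      inner ℝ (G x a) b = inner ℝ (G' (τ x) (fderiv ℝ τ x a)) (fderiv ℝ τ x b)) (a b v : F) :
    christoffelLower G u a b v =
      christoffelLower G' (τ u) (fderiv ℝ τ u a) (fderiv ℝ τ u b) (fderiv ℝ τ u v) +
        inner ℝ (G' (τ u) (fderiv ℝ (fderiv ℝ τ) u a b)) (fderiv ℝ τ u v) := by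
  have hτ1 : DifferentiableAt ℝ τ u := hτ.differentiableAt (by simp)
  have hτ2 : DifferentiableAt ℝ (fderiv ℝ τ) u :=
    (hτ.fderiv_right (m := 1) (by norm_num)).differentiableAt (by simp)
  have key : ∀ a b c : F, inner ℝ (fderiv ℝ G u c a) b =
      inner ℝ (fderiv ℝ G' (τ u) (fderiv ℝ τ u c) (fderiv ℝ τ u a)) (fderiv ℝ τ u b) +
      inner ℝ (G' (τ u) (fderiv ℝ (fderiv ℝ τ) u c a)) (fderiv ℝ τ u b) +
      inner ℝ (G' (τ u) (fderiv ℝ τ u a)) (fderiv ℝ (fderiv ℝ τ) u c b) := by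
    intro a b c
    have h1 := (hG.hasFDerivAt.clm_apply (hasFDerivAt_const a u)).inner ℝ (hasFDerivAt_const b u)
    have hA := HasFDerivAt.comp u hG'.hasFDerivAt hτ1.hasFDerivAt
    have hB : ∀ e : F, HasFDerivAt (fun x => fderiv ℝ τ x e) _ u := fun e =>
      hτ2.hasFDerivAt.clm_apply (hasFDerivAt_const e u)
    have h2 := (hA.clm_apply (hB a)).inner ℝ (hB b)
    have h3 := h1.unique (h2.congr_of_eventuallyEq (h.mono fun x hx => hx a b))
    have h4 := congrArg (fun L : F →L[ℝ] ℝ => L c) h3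
    simp [fderivInnerCLM_apply, inner_add_left] at h4
    linarith
  have hs : ∀ x y, fderiv ℝ (fderiv ℝ τ) u x y = fderiv ℝ (fderiv ℝ τ) u y x := fun x y =>
    (hτ.isSymmSndFDerivAt (by simp)).eq x y
  unfold christoffelLower
  rw [key, key, key, hs b a, hs v a, hs v b, hsymm (fderiv ℝ τ u b) (fderiv ℝ (fderiv ℝ τ) u a v),
    hsymm (fderiv ℝ τ u a) (fderiv ℝ (fderiv ℝ τ) u b v)]
  ring

end

/-- The vector `Γ^α_{μν} a^μ b^ν`, in the chart at `p`. -/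
def connection (p : M) (u a b : 𝔼) : 𝔼 :=
  ∑ α, (∑ μ, ∑ ν, christoffel p (σ[p] u) α μ ν * a μ * b ν) • stdVec α

lemma sum_smul_stdVec_apply (f : Fin d → ℝ) (α : Fin d) : (∑ β, f β • (stdVec β : 𝔼)) α = f α := by
  simp [Finset.sum_apply, Pi.single_apply]

lemma connection_coord (p : M) (u a b : 𝔼) (α : Fin d) : connection p u a b α =
    ∑ μ, ∑ ν, christoffel p (σ[p] u) α μ ν * a μ * b ν := sum_smul_stdVec_apply _ α

lemma posDef_metricMatrix {p y : M} (hy : y ∈ κ[p].source) :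
    (metricMatrix (d := d) p y).PosDef := by
  refine Matrix.PosDef.of_dotProduct_mulVec_pos ?_ ?_
  · refine Matrix.IsHermitian.ext fun i j => ?_
    simp only [metricMatrix, of_apply]
    exact real_inner_comm _ _
  · intro x hx
    have h := metricForm_pos (p := p) (u := κ[p] y) (a := WithLp.toLp 2 x)
      (κ[p].map_source hy) (by simpa using hx)
    rw [metricForm_eq_matrixForm, κ[p].left_inv hy, matrixForm_apply] at h
    refine h.trans_eq (Eq.symm ?_)
    change ∑ i, x i * ∑ j, metricMatrix p y i j * x j = _
    simp only [mul_sum]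
    refine sum_congr rfl fun i _ => sum_congr rfl fun j _ => ?_
    ring

lemma differentiableAt_metricOp {p : M} {u : 𝔼} (hu : u ∈ τ[p]) :
    DifferentiableAt ℝ (metricOp (d := d) p) u :=
  (hasFDerivAt_of_isOpen (contDiffOn_metricOp p) (isOpen_extChartAt_target p) hu).differentiableAt

lemma metricDeriv_eq {p : M} {u : 𝔼} (hu : u ∈ τ[p]) (κ μ ν : Fin d) :
    metricDeriv p (σ[p] u) κ μ ν =
      inner ℝ (fderiv ℝ (metricOp (d := d) p) u (stdVec κ) (stdVec μ)) (stdVec ν) := by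
  rw [metricDeriv, κ[p].right_inv hu]
  have h1 := ((differentiableAt_metricOp hu).hasFDerivAt.clm_apply
    (hasFDerivAt_const (stdVec μ) u)).inner ℝ (hasFDerivAt_const (stdVec ν) u)
  have h2 : (fun x => inner ℝ (metricOp (d := d) p x (stdVec μ)) (stdVec ν)) =
      fun x => metricMatrix p (σ[p] x) μ ν := by
    ext x
    exact matrixForm_stdVec _ _ _
  rw [h2] at h1
  rw [h1.fderiv]
  simp [fderivInnerCLM_apply]

lemma sum_metricMatrix_mul_christoffel {p : M} {u : 𝔼} (hu : u ∈ τ[p]) (κ μ ν : Fin d) :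
    ∑ α, metricMatrix p (σ[p] u) α κ * christoffel p (σ[p] u) α μ ν =
      christoffelLower (metricOp (d := d) p) u (stdVec μ) (stdVec ν) (stdVec κ) := by
  set y := σ[p] u with hy
  set X : Fin d → ℝ := fun β =>
    metricDeriv p y μ β ν + metricDeriv p y ν β μ - metricDeriv p y β μ ν with hX
  have hpd := posDef_metricMatrix (κ[p].map_target hu)
  rw [← hy] at hpd
  have h1 : ∀ α, christoffel p y α μ ν = (1 / 2) * ((metricMatrix p y)⁻¹.mulVec X) α := fun α => rfl
  have h2 : (metricMatrix p y).mulVec ((metricMatrix p y)⁻¹.mulVec X) = X := by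
    rw [mulVec_mulVec, Matrix.mul_nonsing_inv _ hpd.det_pos.ne'.isUnit, one_mulVec]
  have h3 := congrFun h2 κ
  have hs : ∀ i j, metricMatrix (d := d) p y i j = metricMatrix p y j i := fun i j => by
    simp only [metricMatrix, of_apply]
    rw [real_inner_comm]
  have hsd : ∀ a b c : Fin d, metricDeriv p y a b c = metricDeriv p y a c b := fun a b c => by
    unfold metricDeriv
    congr 2
    ext x
    simp only [metricMatrix, of_apply]
    rw [real_inner_comm]
  calc _ = (1 / 2) * ∑ α, metricMatrix p y κ α * ((metricMatrix p y)⁻¹.mulVec X) α := by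
        rw [mul_sum]
        refine sum_congr rfl fun α _ => ?_
        rw [h1, hs]
        ring
    _ = (1 / 2) * X κ := by rw [← h3]; rfl
    _ = _ := by
        rw [hX, christoffelLower, ← metricDeriv_eq hu, ← metricDeriv_eq hu, ← metricDeriv_eq hu]
        simp only [← hy]
        rw [hsd μ κ ν, hsd ν κ μ]

lemma metricForm_connection {p : M} {u : 𝔼} (hu : u ∈ τ[p]) (a b v : 𝔼) :
    metricForm p u (connection p u a b) v = christoffelLower (metricOp p) u a b v := by
  have hR : christoffelLower (metricOp p) u a b v = ∑ μ, ∑ ν, ∑ κ, a μ * b ν * v κ *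
      christoffelLower (metricOp (d := d) p) u (stdVec μ) (stdVec ν) (stdVec κ) := by
    have h1 : ∀ x y z : 𝔼, inner ℝ (fderiv ℝ (metricOp (d := d) p) u x y) z = ∑ i, ∑ j, ∑ k,
        x i * y j * z k *
          inner ℝ (fderiv ℝ (metricOp (d := d) p) u (stdVec i) (stdVec j)) (stdVec k) := by
      intro x y z
      conv_lhs => rw [eq_sum_stdVec x, eq_sum_stdVec y, eq_sum_stdVec z]
      simp only [map_sum, map_smul, _root_.sum_apply, _root_.smul_apply, sum_inner, inner_sum,
        real_inner_smul_left, real_inner_smul_right, smul_sum, smul_smul]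
      rw [sum_comm]
      refine Eq.trans (sum_congr rfl fun j _ => sum_comm) ?_
      rw [sum_comm]
      refine sum_congr rfl fun i _ => sum_congr rfl fun j _ => sum_congr rfl fun k _ => ?_
      ring
    unfold christoffelLower
    have e2 : inner ℝ (fderiv ℝ (metricOp (d := d) p) u b a) v = ∑ μ, ∑ ν, ∑ κ, a μ * b ν * v κ *
          inner ℝ (fderiv ℝ (metricOp (d := d) p) u (stdVec ν) (stdVec μ)) (stdVec κ) := by
      rw [h1, sum_comm]
      refine sum_congr rfl fun i _ => sum_congr rfl fun j _ => sum_congr rfl fun k _ => ?_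
      ring
    have e3 : inner ℝ (fderiv ℝ (metricOp (d := d) p) u v a) b = ∑ μ, ∑ ν, ∑ κ, a μ * b ν * v κ *
          inner ℝ (fderiv ℝ (metricOp (d := d) p) u (stdVec κ) (stdVec μ)) (stdVec ν) := by
      rw [h1, sum_comm]
      refine sum_congr rfl fun i _ => ?_
      rw [sum_comm]
      refine sum_congr rfl fun j _ => sum_congr rfl fun k _ => ?_
      ring
    rw [h1 a b v, e2, e3]
    simp only [← Finset.sum_add_distrib, ← Finset.sum_sub_distrib, mul_sum]
    refine sum_congr rfl fun i _ => sum_congr rfl fun j _ => sum_congr rfl fun k _ => ?_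
    ring
  rw [hR, metricForm_eq_matrixForm, matrixForm_apply]
  simp only [← sum_metricMatrix_mul_christoffel hu, connection_coord, mul_sum, sum_mul]
  rw [sum_comm]
  have : ∀ f : Fin d → Fin d → Fin d → Fin d → ℝ,
      ∑ κ, ∑ α, ∑ μ, ∑ ν, f κ α μ ν = ∑ μ, ∑ ν, ∑ κ, ∑ α, f κ α μ ν := by
    intro f
    calc _ = ∑ κ, ∑ μ, ∑ ν, ∑ α, f κ α μ ν := by
          refine sum_congr rfl fun κ _ => ?_
          rw [sum_comm]
          refine sum_congr rfl fun μ _ => ?_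
          rw [sum_comm]
      _ = _ := by
          rw [sum_comm]
          refine sum_congr rfl fun μ _ => ?_
          rw [sum_comm]
  rw [this]
  refine sum_congr rfl fun i _ => sum_congr rfl fun j _ =>
        sum_congr rfl fun k _ => sum_congr rfl fun l _ => ?_
  ring

lemma metricForm_sub_left (p : M) (u a b v : 𝔼) :
    metricForm p u (a - b) v = metricForm p u a v - metricForm p u b v := by
  simp [metricForm, inner_sub_left]

lemma eq_of_metricForm_eq {p : M} {u : 𝔼} (hu : u ∈ τ[p]) {a b : 𝔼}
    (h : ∀ v, metricForm p u a v = metricForm p u b v) : a = b := by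
  by_contra hab
  have := metricForm_pos hu (sub_ne_zero.2 hab)
  have h2 := h (a - b)
  rw [metricForm_sub_left, h2, sub_self] at this
  exact lt_irrefl _ this

lemma fderiv_transition_comp {p p' : M} {u : 𝔼} (hu : u ∈ overlap d p p') (a : 𝔼) :
    fderiv ℝ (transition d p' p) (transition d p p' u) (fderiv ℝ (transition d p p') u a) = a := by
  have h1 := (hasFDerivAt_transition hu)
  have hu' : transition d p p' u ∈ overlap d p' p :=
    mem_overlap hu.2 (κ[p].map_target hu.1)
  have h2 := (hasFDerivAt_transition hu')
  have h3 := h2.comp u h1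
  have h4 : transition d p' p ∘ transition d p p' =ᶠ[𝓝 u] id := by
    filter_upwards [(isOpen_overlap p p').mem_nhds hu] with x hx
    exact transition_comp_transition hx
  have h5 := (h3.congr_of_eventuallyEq h4.symm).unique (hasFDerivAt_id u)
  exact congrArg (fun L : 𝔼 →L[ℝ] 𝔼 => L a) h5

lemma mem_overlap_transition {p p' : M} {u : 𝔼} (hu : u ∈ overlap d p p') :
    transition d p p' u ∈ overlap d p' p :=
  mem_overlap hu.2 (κ[p].map_target hu.1)

/-- The transformation law of the Christoffel symbols. -/
lemma connection_transition {p p' : M} {u : 𝔼} (hu : u ∈ overlap d p p') (a b : 𝔼) :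
    connection p' (transition d p p' u) (fderiv ℝ (transition d p p') u a)
        (fderiv ℝ (transition d p p') u b) = fderiv ℝ (transition d p p') u (connection p u a b) -
        fderiv ℝ (fderiv ℝ (transition d p p')) u a b := by
  have hu' := mem_overlap_transition hu
  refine eq_of_metricForm_eq hu'.1 fun v => ?_
  have hv : fderiv ℝ (transition d p p') u (fderiv ℝ (transition d p' p) (transition d p p' u) v)
      = v := by
    have := fderiv_transition_comp hu' v
    rwa [transition_comp_transition hu] at this
  set w := fderiv ℝ (transition d p' p) (transition d p p' u) v
  rw [← hv, metricForm_sub_left, ← metricForm_transition hu,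
    metricForm_connection hu.1, metricForm_connection hu'.1,
    christoffelLower_pullback (G' := metricOp p') (differentiableAt_metricOp hu.1)
      (differentiableAt_metricOp hu'.1)
      ((contDiffAt_transition hu).of_le (by norm_cast)) (metricForm_comm p' _) ?_]
  · rw [metricForm]
    ring
  · filter_upwards [(isOpen_overlap p p').mem_nhds hu] with x hx
    exact metricForm_transition hx

lemma contDiffOn_det {F : Type*} [NormedAddCommGroup F] [NormedSpace ℝ F] {𝕂 : Type*}
    [NormedField 𝕂] [NormedAlgebra ℝ 𝕂] {n : ℕ} {N : WithTop ℕ∞}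
    {A : F → Matrix (Fin n) (Fin n) 𝕂} {s : Set F}
    (hA : ∀ i j, ContDiffOn ℝ N (fun x => A x i j) s) : ContDiffOn ℝ N (fun x => (A x).det) s := by
  simp only [Matrix.det_apply]
  refine ContDiffOn.sum fun σ _ => ?_
  have : ContDiffOn ℝ N (fun x => ∏ i, A x (σ i) i) s := contDiffOn_prod fun i _ => hA _ _
  refine (this.const_smul ((Equiv.Perm.sign σ : ℤ) : ℝ)).congr fun x _ => ?_
  rcases Int.units_eq_one_or (Equiv.Perm.sign σ) with h | h <;> simp [h]

lemma contDiffOn_matrix_inv {F : Type*} [NormedAddCommGroup F] [NormedSpace ℝ F] {n : ℕ}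
    {N : WithTop ℕ∞} {A : F → Matrix (Fin n) (Fin n) ℝ} {s : Set F}
    (hA : ∀ i j, ContDiffOn ℝ N (fun x => A x i j) s) (h0 : ∀ x ∈ s, (A x).det ≠ 0) (i j : Fin n) :
    ContDiffOn ℝ N (fun x => (A x)⁻¹ i j) s := by
  have h1 : ∀ x, (A x)⁻¹ i j = ((A x).det)⁻¹ * (A x).adjugate i j := fun x => by
    rw [Matrix.inv_def, Ring.inverse_eq_inv', Matrix.smul_apply, smul_eq_mul]
  simp only [h1, Matrix.adjugate_apply]
  refine ((contDiffOn_det hA).inv h0).mul (contDiffOn_det fun k l => ?_)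
  by_cases hk : k = j
  · subst hk
    simp only [Matrix.updateRow_self]
    exact contDiffOn_const
  · simp only [Matrix.updateRow_ne hk]
    exact hA k l

lemma contDiffOn_metricMatrix_inv (p : M) (i j : Fin d) : SmoothOn
    (fun u => (metricMatrix (d := d) p (σ[p] u))⁻¹ i j)
      τ[p] := contDiffOn_matrix_inv (contDiffOn_metricMatrix p)
    (fun _ hu => (posDef_metricMatrix (κ[p].map_target hu)).det_pos.ne') i j

lemma contDiffOn_christoffel (p : M) (α μ ν : Fin d) : SmoothOn
    (fun u => christoffel (d := d) p (σ[p] u) α μ ν) τ[p] := by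
  have h : ∀ κ μ ν, SmoothOn (fun u => metricDeriv (d := d) p (σ[p] u) κ μ ν) τ[p] := by
    intro κ μ ν
    have h1 := ((contDiffOn_metricMatrix p μ ν).fderiv_of_isOpen (isOpen_extChartAt_target p)
      (m := ∞) (by simp)).clm_apply (contDiffOn_const (c := (stdVec κ : 𝔼)))
    refine h1.congr fun u hu => ?_
    simp only [metricDeriv]
    rw [κ[p].right_inv hu]
  unfold christoffel
  refine contDiffOn_const.mul (ContDiffOn.sum fun β _ => ?_)
  exact (contDiffOn_metricMatrix_inv p α β).mul (((h _ _ _).add (h _ _ _)).sub (h _ _ _))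

lemma contDiffOn_connection (p : M) : SmoothOn
    (fun z : 𝔼 × 𝔼 × 𝔼 => connection p z.1 z.2.1 z.2.2) (τ[p] ×ˢ univ) := by
  unfold connection
  refine ContDiffOn.sum fun α _ => ContDiffOn.smul (f := fun z : 𝔼 × 𝔼 × 𝔼 =>
    (∑ μ, ∑ ν, christoffel p (σ[p] z.1) α μ ν * z.2.1 μ * z.2.2 ν))
    (g := fun _ => stdVec α) (ContDiffOn.sum fun μ _ => ContDiffOn.sum fun ν _ => ?_)
    contDiffOn_const
  refine ContDiffOn.mul (ContDiffOn.mul ?_ ?_) ?_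
  · exact (contDiffOn_christoffel p α μ ν).comp contDiffOn_fst fun z hz => hz.1
  · exact ((EuclideanSpace.proj μ : 𝔼 →L[ℝ] ℝ).contDiff.comp
      (contDiff_fst.comp contDiff_snd)).contDiffOn
  · exact ((EuclideanSpace.proj ν : 𝔼 →L[ℝ] ℝ).contDiff.comp
      (contDiff_snd.comp contDiff_snd)).contDiffOn

section

lemma connection_add_left (p : M) (u a a' b : 𝔼) :
    connection p u (a + a') b = connection p u a b + connection p u a' b := by
  ext α
  simp only [connection_coord, PiLp.add_apply, ← Finset.sum_add_distrib]
  refine sum_congr rfl fun μ _ => sum_congr rfl fun ν _ => ?_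
  ring

lemma connection_smul_left (p : M) (u a b : 𝔼) (t : ℝ) :
    connection p u (t • a) b = t • connection p u a b := by
  ext α
  simp only [connection_coord, PiLp.smul_apply, smul_eq_mul, mul_sum]
  refine sum_congr rfl fun μ _ => sum_congr rfl fun ν _ => ?_
  ring

lemma connection_smul_right (p : M) (u a b : 𝔼) (t : ℝ) :
    connection p u a (t • b) = t • connection p u a b := by
  ext α
  simp only [connection_coord, PiLp.smul_apply, smul_eq_mul, mul_sum]
  refine sum_congr rfl fun μ _ => sum_congr rfl fun ν _ => ?_
  ring

/-- The right-hand side `Γ^μ_{αν} ζ_μ v^ν` of the equation of parallel transport. -/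
def transport (p : M) (u v q : 𝔼) : 𝔼 := ∑ α, (inner ℝ q (connection p u (stdVec α) v)) • stdVec α

lemma inner_transport (p : M) (u v q a : 𝔼) :
    inner ℝ (transport p u v q) a = inner ℝ q (connection p u a v) := by
  conv_rhs => rw [eq_sum_stdVec a]
  have h : connection p u (∑ μ, a μ • stdVec μ) v = ∑ μ, a μ • connection p u (stdVec μ) v := by
    have h1 := map_sum (AddMonoidHom.mk' (fun x => connection p u x v)
      (fun x y => connection_add_left p u x y v)) (fun μ => a μ • (stdVec μ : 𝔼)) Finset.univ
    simp only [AddMonoidHom.mk'_apply] at h1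
    rw [h1]
    exact sum_congr rfl fun μ _ => connection_smul_left p u _ v _
  rw [h, inner_sum, transport, sum_inner]
  refine sum_congr rfl fun μ _ => ?_
  rw [real_inner_smul_left, real_inner_smul_right, EuclideanSpace.inner_single_left]
  simp [mul_comm]

lemma transport_smul (p : M) (u v q : 𝔼) (t : ℝ) :
    transport p u (t • v) q = t • transport p u v q := by
  simp only [transport, connection_smul_right, inner_smul_right, smul_sum, smul_smul]

/-- A solution over an open set `I` of times of the equations of geodesics and of parallel
transport, in the chart at `p`: position `c`, velocity `v`, covector `ζ`. -/
structure IsCoordGeodesic (p : M) (I : Set ℝ) (c v ζ : ℝ → 𝔼) : Prop where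
  isOpen : IsOpen I
  mem : ∀ s ∈ I, c s ∈ τ[p]
  smooth : SmoothOn c I
  pos : ∀ s ∈ I, HasDerivAt c (v s) s
  vel : ∀ s ∈ I, HasDerivAt v (-connection p (c s) (v s) (v s)) s
  cov : ∀ s ∈ I, HasDerivAt ζ (transport p (c s) (v s) (ζ s)) s

namespace IsCoordGeodesic

variable {p : M} {I : Set ℝ} {c v ζ : ℝ → 𝔼[d]}

lemma contMDiffAt (h : IsCoordGeodesic p I c v ζ) {s : ℝ} (hs : s ∈ I) :
    ContMDiffAt 𝓘(ℝ) (𝓡 d) ∞ (fun s => σ[p] (c s)) s := by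
  have h1 := (contMDiffOn_extChartAt_symm (I := 𝓡 d) (n := ∞) p).contMDiffAt
    ((isOpen_extChartAt_target p).mem_nhds (h.mem s hs))
  exact h1.comp s ((h.smooth.contDiffAt (h.isOpen.mem_nhds hs)).contMDiffAt)

lemma hasDerivAt_transition (h : IsCoordGeodesic p I c v ζ) {p' : M} {s : ℝ} (hs : s ∈ I)
    (hc : c s ∈ overlap d p p') :
    HasDerivAt (fun s => transition d p p' (c s)) (fderiv ℝ (transition d p p') (c s) (v s)) s :=
  (hasFDerivAt_transition hc).comp_hasDerivAt s (h.pos s hs)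

lemma eventually_mem (h : IsCoordGeodesic p I c v ζ) {p' : M} {s : ℝ} (hs : s ∈ I)
    (hc : c s ∈ overlap d p p') : ∀ᶠ t in 𝓝 s, t ∈ I ∧ c t ∈ overlap d p p' :=
  (h.isOpen.eventually_mem hs).and ((h.pos s hs).continuousAt.eventually
    ((isOpen_overlap p p').mem_nhds hc))

lemma deriv_curveCoord (h : IsCoordGeodesic p I c v ζ) {p' : M} {s : ℝ} (hs : s ∈ I)
    (hc : c s ∈ overlap d p p') (α : Fin d) : deriv (curveCoord d p' (fun s => σ[p] (c s)) α) s =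
      (fderiv ℝ (transition d p p') (c s) (v s)) α :=
  ((EuclideanSpace.proj α : 𝔼 →L[ℝ] ℝ).hasFDerivAt.comp_hasDerivAt s
    (h.hasDerivAt_transition hs hc)).deriv

lemma isGeodesic (h : IsCoordGeodesic p I c v ζ) (hI : 𝕀 ⊆ I) :
    IsGeodesic d (fun s => σ[p] (c s)) where
  smooth s hs := h.contMDiffAt (hI hs)
  equation s hs p' hp' α := by
    have hc : c s ∈ overlap d p p' := ⟨h.mem s (hI hs), hp'⟩
    have hτ := (contDiffAt_transition hc)
    have h2 : DifferentiableAt ℝ (fderiv ℝ (transition d p p')) (c s) :=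
      (hτ.fderiv_right (m := 1) (by norm_cast)).differentiableAt (by simp)
    have h3 := (h2.hasFDerivAt.comp_hasDerivAt s (h.pos s (hI hs))).clm_apply (h.vel s (hI hs))
    have h4 := (EuclideanSpace.proj α : 𝔼 →L[ℝ] ℝ).hasFDerivAt.comp_hasDerivAt s h3
    have h5 : deriv (curveCoord d p' (fun s => σ[p] (c s)) α) =ᶠ[𝓝 s]
        fun t => (fderiv ℝ (transition d p p') (c t) (v t)) α := by
      filter_upwards [h.eventually_mem (hI hs) hc] with t ht
      exact h.deriv_curveCoord ht.1 ht.2 α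
    refine (h4.congr_of_eventuallyEq h5).congr_deriv ?_
    have h6 := connection_transition hc (v s) (v s)
    have h7 := congrArg (fun x : 𝔼 => x α) h6
    simp only [connection_coord, PiLp.sub_apply] at h7
    rw [transition, κ[p'].left_inv hp'] at h7
    simp only [h.deriv_curveCoord (hI hs) hc]
    rw [h7]
    simp
    ring

lemma hasDerivAt_clm_comp_apply {F F' : Type*} [NormedAddCommGroup F] [NormedSpace ℝ F]
    [NormedAddCommGroup F'] [NormedSpace ℝ F'] {G : F → F →L[ℝ] F'} {f : ℝ → F} {f' : F} {s : ℝ}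
    (hG : DifferentiableAt ℝ G (f s)) (hf : HasDerivAt f f' s) (e : F) :
    HasDerivAt (fun t => G (f t) e) (fderiv ℝ G (f s) f' e) s :=
  ((hG.hasFDerivAt.comp_hasDerivAt s hf).clm_apply (hasDerivAt_const s e)).congr_deriv (by simp)

lemma hasDerivAt_inner_cov (h : IsCoordGeodesic p I c v ζ) {s : ℝ} (hs : s ∈ I) {p' : M}
    (hc : c s ∈ overlap d p p') (e : 𝔼) :
    HasDerivAt (fun t => inner ℝ (ζ t) (fderiv ℝ (transition d p' p) (transition d p p' (c t)) e))
      (inner ℝ (ζ s) (fderiv ℝ (transition d p' p) (transition d p p' (c s))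
        (connection p' (transition d p p' (c s)) e (fderiv ℝ (transition d p p') (c s) (v s))))) s
          := by
  have hc' := mem_overlap_transition hc
  have hτ := (contDiffAt_transition hc')
  have h2 : DifferentiableAt ℝ (fderiv ℝ (transition d p' p)) (transition d p p' (c s)) :=
    (hτ.fderiv_right (m := 1) (by norm_cast)).differentiableAt (by simp)
  have h3 := hasDerivAt_clm_comp_apply (f := fun t => transition d p p' (c t)) h2
    (h.hasDerivAt_transition hs hc) e
  refine ((h.cov s hs).inner ℝ h3).congr_deriv ?_
  set w := transition d p p' (c s)
  set b := fderiv ℝ (transition d p p') (c s) (v s)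
  have hback : transition d p' p w = c s := transition_comp_transition hc
  have hv : fderiv ℝ (transition d p' p) w b = v s := fderiv_transition_comp hc (v s)
  have h6 := connection_transition hc' e b
  rw [hback, hv] at h6
  have hsymm : fderiv ℝ (fderiv ℝ (transition d p' p)) w e b =
      fderiv ℝ (fderiv ℝ (transition d p' p)) w b e :=
    ((hτ.of_le (n := ∞) (m := 2) (by norm_cast)).isSymmSndFDerivAt (by simp)).eq _ _
  rw [inner_transport, h6, hsymm, ← inner_add_right, add_sub_cancel]

lemma isParallel (h : IsCoordGeodesic p I c v ζ) (hI : 𝕀 ⊆ I) :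
    IsParallel (fun s => σ[p] (c s)) (fun s => covec p (σ[p] (c s)) (ζ s)) := by
  intro s hs p' hp' α
  have hc : c s ∈ overlap d p p' := ⟨h.mem s (hI hs), hp'⟩
  have key : ∀ t, t ∈ I → c t ∈ overlap d p p' → ∀ β, covec p (σ[p] (c t)) (ζ t)
        (coordVec p' (σ[p] (c t)) β) =
      inner ℝ (ζ t) (fderiv ℝ (transition d p' p) (transition d p p' (c t)) (stdVec β)) := by
    intro t ht hct β
    rw [covec_apply, coordDiff_eq_fderiv_transition hct.2
      (κ[p].map_target hct.1), ContinuousLinearMap.comp_apply, coordDiff_coordVec hct.2]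
    rfl
  have h7 : (σ[p'] (transition d p p' (c s))) = σ[p] (c s) := by rw [transition, κ[p'].left_inv hp']
  have h8 : inner ℝ (ζ s) (fderiv ℝ (transition d p' p) (transition d p p' (c s))
        (connection p' (transition d p p' (c s)) (stdVec α)
          (fderiv ℝ (transition d p p') (c s) (v s)))) =
      ∑ μ, ∑ ν, christoffel p' (σ[p] (c s)) μ α ν * covec p (σ[p] (c s)) (ζ s)
          (coordVec p' (σ[p] (c s)) μ) * deriv (curveCoord d p' (fun s => σ[p] (c s)) ν) s := by
    rw [connection, h7]
    simp only [map_sum, map_smul, inner_sum, real_inner_smul_right]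
    refine sum_congr rfl fun β _ => ?_
    rw [sum_mul, Finset.sum_eq_single α]
    · rw [sum_mul]
      refine sum_congr rfl fun ν _ => ?_
      rw [key s (hI hs) hc, h.deriv_curveCoord (hI hs) hc]
      simp only [PiLp.single_apply, if_true]
      ring
    · intro i _ hi
      simp [hi]
    · simp
  have h9 := h.hasDerivAt_inner_cov (hI hs) hc (stdVec α)
  rw [h8] at h9
  refine h9.congr_of_eventuallyEq ?_
  filter_upwards [h.eventually_mem (hI hs) hc] with t ht
  exact key t ht.1 ht.2 α

lemma coordDiff_mfderiv (h : IsCoordGeodesic p I c v ζ) {s : ℝ} (hs : s ∈ I) :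
    coordDiff p (σ[p] (c s)) (mfderiv 𝓘(ℝ) (𝓡 d) (fun s => σ[p] (c s)) s (1 : ℝ)) = v s := by
  have hsrc := κ[p].map_target (h.mem s hs)
  have h1 : HasMFDerivAt (𝓡 d) 𝓘(ℝ, 𝔼) κ[p] (σ[p] (c s)) (coordDiff p (σ[p] (c s))) :=
    (mdifferentiableAt_extChartAt (by simpa using hsrc)).hasMFDerivAt
  have h2 := h1.comp s ((h.contMDiffAt hs).mdifferentiableAt (by simp)).hasMFDerivAt
  have h3 : (κ[p] ∘ fun s => σ[p] (c s)) =ᶠ[𝓝 s] c := by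
    filter_upwards [h.isOpen.mem_nhds hs] with t ht
    exact κ[p].right_inv (h.mem t ht)
  have h4 := (h2.congr_of_eventuallyEq h3.symm).mfderiv
  have h5 := ((h.pos s hs).hasFDerivAt.hasMFDerivAt).mfderiv
  have h6 := congrArg (fun L : ℝ →L[ℝ] 𝔼 => L 1) (h4.symm.trans h5)
  refine h6.trans ?_
  simp

lemma metricForm_vel (h : IsCoordGeodesic p I c v ζ) {s : ℝ} (hs : s ∈ I) :
    HasDerivAt (fun s => metricForm p (c s) (v s) (v s)) 0 s := by
  have h1 := (((differentiableAt_metricOp (h.mem s hs)).hasFDerivAt.comp_hasDerivAt s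
    (h.pos s hs)).clm_apply (h.vel s hs)).inner ℝ (h.vel s hs)
  refine h1.congr_deriv ?_
  have h2 := metricForm_connection (h.mem s hs) (v s) (v s) (v s)
  have h3 := metricForm_comm p (c s) (v s) (connection p (c s) (v s) (v s))
  simp only [metricForm, christoffelLower] at h2 h3
  simp only [Function.comp_apply, map_neg, inner_add_left, inner_neg_left, inner_neg_right]
  linarith

lemma inner_vel (h : IsCoordGeodesic p I c v ζ) {s : ℝ} (hs : s ∈ I) :
    HasDerivAt (fun s => inner ℝ (ζ s) (v s)) 0 s := by
  refine ((h.cov s hs).inner ℝ (h.vel s hs)).congr_deriv ?_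
  rw [inner_transport, inner_neg_right]
  ring

lemma eq_const_of_hasDerivAt_zero {f : ℝ → ℝ} {I : Set ℝ} (hI : 𝕀 ⊆ I)
    (hf : ∀ s ∈ I, HasDerivAt f 0 s) {s : ℝ} (hs : s ∈ 𝕀) : f s = f 0 := by
  have := (convex_Icc (0 : ℝ) 1).is_const_of_fderivWithin_eq_zero (𝕜 := ℝ) (f := f)
    (fun t ht => (hf t (hI ht)).hasFDerivAt.hasFDerivWithinAt.differentiableWithinAt) ?_ hs
    (left_mem_Icc.2 zero_le_one)
  · exact this
  · intro t ht
    rw [(hf t (hI ht)).hasFDerivAt.hasFDerivWithinAt.fderivWithin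
      (uniqueDiffOn_Icc zero_lt_one t ht)]
    ext
    simp

lemma lineIntegral_eq (h : IsCoordGeodesic p I c v ζ) (hI : 𝕀 ⊆ I) :
    lineIntegral (fun s => σ[p] (c s))
      (fun s => covec p (σ[p] (c s)) (ζ s)) = inner ℝ (ζ 0) (v 0) := by
  have h1 : ∀ s ∈ uIcc 0 1, covec p (σ[p] (c s)) (ζ s)
      (mfderiv 𝓘(ℝ) (𝓡 d) (fun s => σ[p] (c s)) s (1 : ℝ)) = inner ℝ (ζ 0) (v 0) := by
    intro s hs
    rw [uIcc_of_le zero_le_one] at hs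
    rw [covec_apply, h.coordDiff_mfderiv (hI hs)]
    exact eq_const_of_hasDerivAt_zero hI (fun s hs => h.inner_vel hs) hs
  rw [lineIntegral, intervalIntegral.integral_congr h1]
  simp

lemma enorm_mfderiv (h : IsCoordGeodesic p I c v ζ) (hI : 𝕀 ⊆ I) {s : ℝ}
    (hs : s ∈ 𝕀) : ‖mfderiv 𝓘(ℝ) (𝓡 d) (fun s => σ[p] (c s)) s (1 : ℝ)‖ =
      √(metricForm p (c 0) (v 0) (v 0)) := by
  have hsrc := κ[p].map_target (h.mem s (hI hs))
  rw [← eq_const_of_hasDerivAt_zero hI (fun s hs => h.metricForm_vel hs) hs,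
    ← h.coordDiff_mfderiv (hI hs)]
  have h1 := inner_eq_metricForm hsrc (mfderiv 𝓘(ℝ) (𝓡 d) (fun s => σ[p] (c s)) s (1 : ℝ))
    (mfderiv 𝓘(ℝ) (𝓡 d) (fun s => σ[p] (c s)) s (1 : ℝ))
  rw [κ[p].right_inv (h.mem s (hI hs))] at h1
  rw [← h1, real_inner_self_eq_norm_sq, sqrt_sq (norm_nonneg _)]

lemma pathELength_eq (h : IsCoordGeodesic p I c v ζ) (hI : 𝕀 ⊆ I) :
    Manifold.pathELength (𝓡 d) (fun s => σ[p] (c s)) 0 1 =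
      ENNReal.ofReal √(metricForm p (c 0) (v 0) (v 0)) := by
  rw [Manifold.pathELength_eq_lintegral_mfderiv_Icc]
  rw [setLIntegral_congr_fun measurableSet_Icc (g := fun _ =>
    ENNReal.ofReal √(metricForm p (c 0) (v 0) (v 0))) ?_]
  · simp
  · intro s hs
    dsimp only
    rw [← h.enorm_mfderiv hI hs]
    exact (ofReal_norm _).symm

lemma rescale (h : IsCoordGeodesic p I c v ζ) (t : ℝ) :
    IsCoordGeodesic p ((fun s => t * s) ⁻¹' I) (fun s => c (t * s)) (fun s => t • v (t * s))
      (fun s => ζ (t * s)) := by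
  have hlin : ∀ s : ℝ, HasDerivAt (fun s => t * s) t s := fun s => by
    simpa using (hasDerivAt_id s).const_mul t
  refine ⟨h.isOpen.preimage (by fun_prop), fun s hs => h.mem _ hs,
    h.smooth.comp (by fun_prop) (fun s hs => hs), fun s hs => ?_, fun s hs => ?_, fun s hs => ?_⟩
  · exact (h.pos _ hs).scomp s (hlin s)
  · refine (((h.vel _ hs).scomp s (hlin s)).const_smul t).congr_deriv ?_
    rw [connection_smul_left, connection_smul_right]
    simp
  · refine ((h.cov _ hs).scomp s (hlin s)).congr_deriv ?_
    rw [transport_smul]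

end IsCoordGeodesic

lemma exists_isCoordGeodesic {p : M} {u : 𝔼} (hu : u ∈ τ[p]) (a q : 𝔼) :
    ∃ δ > 0, ∃ c v ζ : ℝ → 𝔼, IsCoordGeodesic p (Ioo (-δ) δ) c v ζ ∧ c 0 = u ∧ v 0 = a ∧
      ζ 0 = q := by
  set X : 𝔼 × 𝔼 × 𝔼 → 𝔼 × 𝔼 × 𝔼 := fun z =>
    (z.2.1, -connection p z.1 z.2.1 z.2.1, transport p z.1 z.2.1 z.2.2)
  set S : Set (𝔼 × 𝔼 × 𝔼) := τ[p] ×ˢ univ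
  have hSo : IsOpen S := (isOpen_extChartAt_target p).prod isOpen_univ
  have hXs : SmoothOn X S := by
    refine ContDiffOn.prodMk (by fun_prop) (ContDiffOn.prodMk ?_ ?_)
    · exact ((contDiffOn_connection p).comp (f := fun z : 𝔼 × 𝔼 × 𝔼 => (z.1, z.2.1, z.2.1))
        (by fun_prop) fun z hz => ⟨hz.1, trivial⟩).neg
    · unfold transport
      refine ContDiffOn.sum fun α _ => ContDiffOn.smul (f := fun z : 𝔼 × 𝔼 × 𝔼 =>
        inner ℝ z.2.2 (connection p z.1 (stdVec α) z.2.1)) (g := fun _ => stdVec α)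
        (ContDiffOn.inner ℝ (by fun_prop) ?_) contDiffOn_const
      exact (contDiffOn_connection p).comp (f := fun z : 𝔼 × 𝔼 × 𝔼 => (z.1, stdVec α, z.2.1))
        (by fun_prop) fun z hz => ⟨hz.1, trivial⟩
  have hz : (u, a, q) ∈ S := ⟨hu, trivial⟩
  obtain ⟨α, hα0, ε, hε, hα⟩ :=
    ContDiffAt.exists_forall_mem_closedBall_exists_eq_forall_mem_Ioo_hasDerivAt₀
      ((hXs.contDiffAt (hSo.mem_nhds hz)).of_le (by norm_cast)) 0
  have hcont : ContinuousAt α 0 := (hα 0 (by constructor <;> linarith)).continuousAt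
  have hev : ∀ᶠ t in 𝓝 (0 : ℝ), α t ∈ S := hcont.eventually (by rw [hα0]; exact hSo.mem_nhds hz)
  obtain ⟨δ', hδ', hδS⟩ := Metric.eventually_nhds_iff.1 hev
  set δ := min ε δ'
  have hpos : 0 < δ := lt_min hε hδ'
  have hder : ∀ t ∈ Ioo (-δ) δ, HasDerivAt α (X (α t)) t := fun t ht =>
    hα t ⟨by linarith [ht.1, min_le_left ε δ'], by linarith [ht.2, min_le_left ε δ']⟩
  have hmem : ∀ t ∈ Ioo (-δ) δ, α t ∈ S := fun t ht => by
    apply hδS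
    rw [Real.dist_0_eq_abs, abs_lt]
    exact ⟨by linarith [ht.1, min_le_right ε δ'], by linarith [ht.2, min_le_right ε δ']⟩
  have hsm : ∀ n : ℕ, ContDiffOn ℝ n α (Ioo (-δ) δ) := by
    intro n
    induction n with
    | zero => exact contDiffOn_zero.2 fun t ht => (hder t ht).continuousAt.continuousWithinAt
    | succ n ih =>
      push_cast
      rw [contDiffOn_succ_iff_deriv_of_isOpen isOpen_Ioo]
      refine ⟨fun t ht => (hder t ht).differentiableAt.differentiableWithinAt, by simp, ?_⟩
      refine ((hXs.of_le (by exact_mod_cast le_top)).comp ih hmem).congr fun t ht => ?_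
      exact (hder t ht).deriv
  refine ⟨δ, hpos, fun t => (α t).1, fun t => (α t).2.1, fun t => (α t).2.2,
    ⟨isOpen_Ioo, fun s hs => (hmem s hs).1, ?_, fun s hs => ?_, fun s hs => ?_, fun s hs => ?_⟩,
    by simp [hα0], by simp [hα0], by simp [hα0]⟩
  · exact contDiff_fst.comp_contDiffOn (contDiffOn_infty.2 hsm)
  · exact (ContinuousLinearMap.fst ℝ 𝔼 (𝔼 × 𝔼)).hasFDerivAt.comp_hasDerivAt s (hder s hs)
  · exact ((ContinuousLinearMap.fst ℝ 𝔼 𝔼).comp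
      (ContinuousLinearMap.snd ℝ 𝔼 (𝔼 × 𝔼))).hasFDerivAt.comp_hasDerivAt s (hder s hs)
  · exact ((ContinuousLinearMap.snd ℝ 𝔼 𝔼).comp
      (ContinuousLinearMap.snd ℝ 𝔼 (𝔼 × 𝔼))).hasFDerivAt.comp_hasDerivAt s (hder s hs)

end

section

variable {F : Type*} [NormedAddCommGroup F] [InnerProductSpace ℝ F]

/-- Uniform bounds for a metric on a subset of an inner product space. -/
structure MetricBounds (G : F → F →L[ℝ] F) (K : Set F) (m C : ℝ) : Prop where
  m_pos : 0 < m
  C_nonneg : 0 ≤ C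
  continuousOn : ContinuousOn G K
  symm : ∀ x ∈ K, ∀ a b, inner ℝ (G x a) b = inner ℝ (G x b) a
  coercive : ∀ x ∈ K, ∀ a, m * ‖a‖ ^ 2 ≤ inner ℝ (G x a) a
  lipschitz : ∀ x ∈ K, ∀ y ∈ K, ‖G x - G y‖ ≤ C * ‖x - y‖
  taylor : ∀ x ∈ K, ∀ y ∈ K, ‖G x - G y - fderiv ℝ G y (x - y)‖ ≤ C * ‖x - y‖ ^ 2

lemma abs_inner_clm_le (L : F →L[ℝ] F) (a b : F) : |inner ℝ (L a) b| ≤ ‖L‖ * ‖a‖ * ‖b‖ :=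
  (abs_real_inner_le_norm _ _).trans (by gcongr; exact L.le_opNorm a)

lemma MetricBounds.energy_ge {G : F → F →L[ℝ] F} {K : Set F} {m C : ℝ}
    (hG : MetricBounds G K m C) {x c : F} (hx : x ∈ K) (hc : c ∈ K) (v x' : F) {h : ℝ}
    (hh : 0 < h) {l : ℝ} (hl : inner ℝ (G c v) v = l ^ 2) :
    h * l ^ 2 + 2 * (inner ℝ (G c v) (x' - h • v) +
        h * ((1 / 2) * inner ℝ (fderiv ℝ G c (x - c) v) v)) +
      m / 2 * (‖x' - h • v‖ ^ 2 / h) - (C + 2 * C ^ 2 / m) / m * l ^ 2 * (h * ‖x - c‖ ^ 2) ≤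
    inner ℝ (G x x') x' / h := by
  have hm := hG.m_pos
  have hC := hG.C_nonneg
  set ν := x - c
  set ν' := x' - h • v with hν'
  have hx' : x' = ν' + h • v := by rw [hν']; abel
  have hv : m * ‖v‖ ^ 2 ≤ l ^ 2 := hl ▸ hG.coercive c hc v
  have e1 : inner ℝ (G x x') x' / h = inner ℝ (G x ν') ν' / h + 2 * inner ℝ (G x v) ν' +
      h * inner ℝ (G x v) v := by
    rw [hx', map_add, map_smul, inner_add_left, inner_add_right, inner_add_right,
      real_inner_smul_left, real_inner_smul_left, real_inner_smul_right, real_inner_smul_right,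
      hG.symm x hx ν' v]
    field_simp
    ring
  have e2 : m * (‖ν'‖ ^ 2 / h) ≤ inner ℝ (G x ν') ν' / h := by
    rw [← mul_div_assoc]
    gcongr
    exact hG.coercive x hx ν'
  have e3 : inner ℝ (G c v) ν' - C * ‖ν‖ * ‖v‖ * ‖ν'‖ ≤ inner ℝ (G x v) ν' := by
    have h1 := (abs_le.1 (abs_inner_clm_le (G x - G c) v ν')).1
    rw [_root_.sub_apply, inner_sub_left] at h1
    have h2 : ‖G x - G c‖ * ‖v‖ * ‖ν'‖ ≤ C * ‖ν‖ * ‖v‖ * ‖ν'‖ := by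
      gcongr
      exact hG.lipschitz x hx c hc
    linarith
  have e4 : l ^ 2 + inner ℝ (fderiv ℝ G c ν v) v - C * ‖ν‖ ^ 2 * ‖v‖ ^ 2 ≤ inner ℝ (G x v) v := by
    have h1 := (abs_le.1 (abs_inner_clm_le (G x - G c - fderiv ℝ G c ν) v v)).1
    rw [_root_.sub_apply, _root_.sub_apply, inner_sub_left, inner_sub_left, hl] at h1
    have h2 : ‖G x - G c - fderiv ℝ G c ν‖ * ‖v‖ * ‖v‖ ≤ C * ‖ν‖ ^ 2 * ‖v‖ * ‖v‖ := by
      gcongr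
      exact hG.taylor x hx c hc
    linarith
  have e5 : 2 * (C * ‖ν‖ * ‖v‖ * ‖ν'‖) ≤
      m / 2 * (‖ν'‖ ^ 2 / h) + 2 * C ^ 2 / m * h * ‖ν‖ ^ 2 * ‖v‖ ^ 2 := by
    have h1 : 0 ≤ (m * ‖ν'‖ - 2 * C * h * ‖ν‖ * ‖v‖) ^ 2 / (2 * m * h) := by positivity
    have h2 : (m * ‖ν'‖ - 2 * C * h * ‖ν‖ * ‖v‖) ^ 2 / (2 * m * h) =
        m / 2 * (‖ν'‖ ^ 2 / h) + 2 * C ^ 2 / m * h * ‖ν‖ ^ 2 * ‖v‖ ^ 2 -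
          2 * (C * ‖ν‖ * ‖v‖ * ‖ν'‖) := by
      field_simp
      ring
    linarith
  have e6 : (C + 2 * C ^ 2 / m) * (h * ‖ν‖ ^ 2) * ‖v‖ ^ 2 ≤
      (C + 2 * C ^ 2 / m) / m * l ^ 2 * (h * ‖ν‖ ^ 2) := by
    have h1 : ‖v‖ ^ 2 ≤ l ^ 2 / m := by
      rw [le_div_iff₀ hm]
      linarith
    calc _ ≤ (C + 2 * C ^ 2 / m) * (h * ‖ν‖ ^ 2) * (l ^ 2 / m) := by gcongr
      _ = _ := by ring
  have e7 := mul_le_mul_of_nonneg_left e4 hh.le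
  rw [e1]
  linarith

lemma norm_sq_le_integral [CompleteSpace F] {ν ν' : ℝ → F} {η : ℝ → ℝ}
    (hν : ∀ s ∈ 𝕀, HasDerivAt ν (ν' s) s) (hν' : ContinuousOn ν' 𝕀)
    (hη : ContinuousOn η 𝕀) (hpos : ∀ s ∈ 𝕀, 0 < η s)
    (h1 : ∫ s in (0 : ℝ)..1, η s = 1) (h0 : ν 0 = 0) {s : ℝ} (hs : s ∈ 𝕀) :
    ‖ν s‖ ^ 2 ≤ ∫ s in (0 : ℝ)..1, ‖ν' s‖ ^ 2 / η s := by
  have huIcc : uIcc (0 : ℝ) 1 = 𝕀 := uIcc_of_le zero_le_one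
  have hsub : uIcc (0 : ℝ) s ⊆ 𝕀 := by
    rw [uIcc_of_le hs.1]
    exact Icc_subset_Icc_right hs.2
  have hi : ∀ {f : ℝ → ℝ}, ContinuousOn f 𝕀 → IntervalIntegrable f volume 0 1 := fun hf =>
    ContinuousOn.intervalIntegrable (by rwa [huIcc])
  set N := ∫ s in (0 : ℝ)..1, ‖ν' s‖ with hN
  have hq : ContinuousOn (fun s => ‖ν' s‖ ^ 2 / η s) 𝕀 :=
    (hν'.norm.pow 2).div hη fun s hs => (hpos s hs).ne'
  have hle : ‖ν s‖ ≤ N := by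
    have h2 : ∫ t in (0 : ℝ)..s, ν' t = ν s := by
      rw [intervalIntegral.integral_eq_sub_of_hasDerivAt (fun t ht => hν t (hsub ht))
        (hν'.mono hsub).intervalIntegrable, h0, sub_zero]
    rw [← h2]
    refine (intervalIntegral.norm_integral_le_integral_norm hs.1).trans ?_
    refine intervalIntegral.integral_mono_interval le_rfl hs.1 hs.2 ?_ (hi hν'.norm)
    exact Eventually.of_forall fun t => norm_nonneg _
  have hN2 : N ^ 2 ≤ ∫ s in (0 : ℝ)..1, ‖ν' s‖ ^ 2 / η s := by
    have h2 : ∫ s in (0 : ℝ)..1, 2 * N * ‖ν' s‖ ≤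
        ∫ s in (0 : ℝ)..1, (‖ν' s‖ ^ 2 / η s + N ^ 2 * η s) := by
      refine intervalIntegral.integral_mono_on zero_le_one (hi (hν'.norm.const_mul _))
        ((hi hq).add (hi (hη.const_mul _))) fun t ht => ?_
      have hp := hpos t ht
      have h3 : 0 ≤ (‖ν' t‖ - N * η t) ^ 2 / η t := by positivity
      have h4 : (‖ν' t‖ - N * η t) ^ 2 / η t = ‖ν' t‖ ^ 2 / η t + N ^ 2 * η t - 2 * N * ‖ν' t‖ := by
        field_simp
        ring
      linarith
    rw [intervalIntegral.integral_add (hi hq) (hi (hη.const_mul _)),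
      intervalIntegral.integral_const_mul, intervalIntegral.integral_const_mul, h1, ← hN] at h2
    linarith
  exact (pow_le_pow_left₀ (norm_nonneg _) hle 2).trans hN2

lemma MetricBounds.sq_le_mul {G : F → F →L[ℝ] F} [CompleteSpace F] {K : Set F} {m C : ℝ}
    (hG : MetricBounds G K m C) {c v w : ℝ → F} {x x' : ℝ → F} {l : ℝ}
    (hc : ∀ s ∈ 𝕀, HasDerivAt c (v s) s) (hv : ∀ s ∈ 𝕀, HasDerivAt (fun s => G (c s) (v s)) (w s) s)
    (hvc : ContinuousOn v 𝕀) (hwc : ContinuousOn w 𝕀) (hw : ∀ s ∈ 𝕀, ∀ ν,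
      inner ℝ (w s) ν = (1 / 2) * inner ℝ (fderiv ℝ G (c s) ν (v s)) (v s))
    (hl : ∀ s ∈ 𝕀, inner ℝ (G (c s) (v s)) (v s) = l ^ 2) (hcK : ∀ s ∈ 𝕀, c s ∈ K)
    (hx : ∀ s ∈ 𝕀, HasDerivAt x (x' s) s) (hx' : ContinuousOn x' 𝕀)
    (hxK : ∀ s ∈ 𝕀, x s ∈ K) (h0 : x 0 = c 0) (h1 : x 1 = c 1)
    (hsmall : (C + 2 * C ^ 2 / m) / m * l ^ 2 ≤ m / 2) {σ : ℝ → ℝ} (hσc : Continuous σ)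
    (hσ0 : ∀ s, 0 ≤ σ s)
    (hσ : ∀ s ∈ 𝕀, σ s ^ 2 = inner ℝ (G (x s) (x' s)) (x' s)) {ε : ℝ} (hε : 0 < ε) :
    l ^ 2 ≤ ((∫ s in (0 : ℝ)..1, σ s) + ε) * ∫ s in (0 : ℝ)..1, σ s := by
  have huIcc : uIcc (0 : ℝ) 1 = 𝕀 := uIcc_of_le zero_le_one
  have hi : ∀ {f : ℝ → ℝ}, ContinuousOn f 𝕀 → IntervalIntegrable f volume 0 1 := fun hf =>
    ContinuousOn.intervalIntegrable (by rwa [huIcc])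
  set L := ∫ s in (0 : ℝ)..1, σ s with hL
  have hL0 : 0 ≤ L := intervalIntegral.integral_nonneg zero_le_one fun s _ => hσ0 s
  set η : ℝ → ℝ := fun s => (σ s + ε) / (L + ε) with hη
  have hηc : Continuous η := by
    rw [hη]
    fun_prop
  have hηpos : ∀ s, 0 < η s := fun s => by
    have := hσ0 s
    rw [hη]
    positivity
  set h : ℝ → ℝ := fun s => ∫ t in (0 : ℝ)..s, η t with hh
  have hh0 : h 0 = 0 := by simp [hh]
  have hh1 : h 1 = 1 := by
    have : ∫ s in (0 : ℝ)..1, (σ s + ε) = L + ε := by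
      rw [intervalIntegral.integral_add (hσc.intervalIntegrable _ _) (by simp)]
      simp [hL]
    simp only [hh, hη, intervalIntegral.integral_div, this]
    exact div_self (by positivity)
  have hhd : ∀ s, HasDerivAt h (η s) s := fun s =>
    intervalIntegral.integral_hasDerivAt_right (hηc.intervalIntegrable _ _)
      (hηc.stronglyMeasurableAtFilter _ _) hηc.continuousAt
  have hmono : Monotone h := monotone_of_hasDerivAt_nonneg hhd fun s => (hηpos s).le
  have hmaps : ∀ s ∈ 𝕀, h s ∈ 𝕀 := fun s hs => ⟨hh0 ▸ hmono hs.1, hh1 ▸ hmono hs.2⟩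
  have hhc : ContinuousOn h 𝕀 := fun s _ => (hhd s).continuousAt.continuousWithinAt
  set ν : ℝ → F := fun s => x s - c (h s) with hν
  set ν' : ℝ → F := fun s => x' s - η s • v (h s) with hν'
  have hνd : ∀ s ∈ 𝕀, HasDerivAt ν (ν' s) s := fun s hs =>
    (hx s hs).sub ((hc _ (hmaps s hs)).scomp s (hhd s))
  have hνc : ContinuousOn ν 𝕀 := fun s hs => (hνd s hs).continuousAt.continuousWithinAt
  have hvh : ContinuousOn (fun s => v (h s)) 𝕀 := hvc.comp hhc hmaps
  have hν'c : ContinuousOn ν' 𝕀 := hx'.sub (hηc.continuousOn.smul hvh)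
  have hν0 : ν 0 = 0 := by simp [hν, hh0, h0]
  have hν1 : ν 1 = 0 := by simp [hν, hh1, h1]
  set J := ∫ s in (0 : ℝ)..1, ‖ν' s‖ ^ 2 / η s with hJ
  have hηint : ∫ s in (0 : ℝ)..1, η s = 1 := hh1
  have hνJ : ∀ s ∈ 𝕀, ‖ν s‖ ^ 2 ≤ J := fun s hs =>
    norm_sq_le_integral hνd hν'c hηc.continuousOn (fun s _ => hηpos s) hηint hν0 hs
  set D : ℝ → ℝ := fun s => inner ℝ (G (c (h s)) (v (h s))) (ν' s) +
    inner ℝ (η s • w (h s)) (ν s) with hD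
  have hGv : ContinuousOn (fun s => G (c (h s)) (v (h s))) 𝕀 := by
    have : ContinuousOn (fun s => G (c s) (v s)) 𝕀 := fun s hs =>
      (hv s hs).continuousAt.continuousWithinAt
    exact this.comp hhc hmaps
  have hDc : ContinuousOn D 𝕀 :=
    (hGv.inner hν'c).add ((hηc.continuousOn.smul (hwc.comp hhc hmaps)).inner hνc)
  have hDint : ∫ s in (0 : ℝ)..1, D s = 0 := by
    rw [intervalIntegral.integral_eq_sub_of_hasDerivAt
      (f := fun s => inner ℝ (G (c (h s)) (v (h s))) (ν s)) ?_ (hi hDc)]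
    · simp [hν0, hν1]
    · intro s hs
      rw [huIcc] at hs
      exact (((hv _ (hmaps s hs)).scomp s (hhd s)).inner ℝ (hνd s hs))
  set B := (C + 2 * C ^ 2 / m) / m * l ^ 2
  have hB0 : 0 ≤ B := by
    have := hG.m_pos
    have := hG.C_nonneg
    positivity
  have hq : ContinuousOn (fun s => ‖ν' s‖ ^ 2 / η s) 𝕀 :=
    (hν'c.norm.pow 2).div hηc.continuousOn fun s _ => (hηpos s).ne'
  have hptw : ∀ s ∈ 𝕀,
      l ^ 2 * η s + 2 * D s + m / 2 * (‖ν' s‖ ^ 2 / η s) - B * J * η s ≤ (L + ε) * σ s := by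
    intro s hs
    have e1 := hG.energy_ge (hxK s hs) (hcK _ (hmaps s hs)) (v (h s)) (x' s) (hηpos s)
      (hl _ (hmaps s hs))
    have e2 : inner ℝ (G (x s) (x' s)) (x' s) / η s ≤ (L + ε) * σ s := by
      rw [← hσ s hs, hη]
      have := hσ0 s
      rw [div_div_eq_mul_div, div_le_iff₀ (by positivity)]
      nlinarith [mul_nonneg (mul_nonneg (add_nonneg hL0 hε.le) this) hε.le]
    have e3 : B * (η s * ‖ν s‖ ^ 2) ≤ B * J * η s := by
      have := hνJ s hs
      have := hηpos s
      calc _ = B * η s * ‖ν s‖ ^ 2 := by ring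
        _ ≤ B * η s * J := by gcongr
        _ = _ := by ring
    have e4 : D s = inner ℝ (G (c (h s)) (v (h s))) (x' s - η s • v (h s)) +
        η s * ((1 / 2) * inner ℝ (fderiv ℝ G (c (h s)) (x s - c (h s)) (v (h s))) (v (h s))) := by
      rw [← hw _ (hmaps s hs), hD]
      simp only [real_inner_smul_left, hν, hν']
    rw [e4]
    linarith
  have hint := intervalIntegral.integral_mono_on (μ := volume) zero_le_one ?_ ?_ hptw
  · rw [intervalIntegral.integral_sub ?_ ?_, intervalIntegral.integral_add ?_ ?_,
      intervalIntegral.integral_add ?_ ?_] at hint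
    · simp only [intervalIntegral.integral_const_mul, hDint, hηint, ← hJ, ← hL] at hint
      have hJ0 : 0 ≤ J := (sq_nonneg _).trans (hνJ 0 ⟨le_rfl, zero_le_one⟩)
      nlinarith [mul_le_mul_of_nonneg_right hsmall hJ0]
    · exact hi (hηc.continuousOn.const_mul _)
    · exact hi (hDc.const_mul _)
    · exact (hi (hηc.continuousOn.const_mul _)).add (hi (hDc.const_mul _))
    · exact hi (hq.const_mul _)
    · exact ((hi (hηc.continuousOn.const_mul _)).add (hi (hDc.const_mul _))).add
        (hi (hq.const_mul _))
    · exact hi (hηc.continuousOn.const_mul _)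
  · exact (((hi (hηc.continuousOn.const_mul _)).add (hi (hDc.const_mul _))).add
        (hi (hq.const_mul _))).sub (hi (hηc.continuousOn.const_mul _))
  · exact hi (hσc.continuousOn.const_mul _)

lemma MetricBounds.le_length {G : F → F →L[ℝ] F} [CompleteSpace F] {K : Set F} {m C : ℝ}
    (hG : MetricBounds G K m C) {c v w : ℝ → F} {x x' : ℝ → F} {l : ℝ}
    (hc : ∀ s ∈ 𝕀, HasDerivAt c (v s) s) (hv : ∀ s ∈ 𝕀, HasDerivAt (fun s => G (c s) (v s)) (w s) s)
    (hvc : ContinuousOn v 𝕀) (hwc : ContinuousOn w 𝕀) (hw : ∀ s ∈ 𝕀, ∀ ν,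
      inner ℝ (w s) ν = (1 / 2) * inner ℝ (fderiv ℝ G (c s) ν (v s)) (v s))
    (hl : ∀ s ∈ 𝕀, inner ℝ (G (c s) (v s)) (v s) = l ^ 2) (hcK : ∀ s ∈ 𝕀, c s ∈ K)
    (hx : ∀ s ∈ 𝕀, HasDerivAt x (x' s) s) (hx' : ContinuousOn x' 𝕀)
    (hxK : ∀ s ∈ 𝕀, x s ∈ K) (h0 : x 0 = c 0) (h1 : x 1 = c 1)
    (hsmall : (C + 2 * C ^ 2 / m) / m * l ^ 2 ≤ m / 2) :
    l ≤ ∫ s in (0 : ℝ)..1, √(inner ℝ (G (x s) (x' s)) (x' s)) := by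
  set σ : ℝ → ℝ := IccExtend zero_le_one (domRestrict (𝕀)
    fun s => √(inner ℝ (G (x s) (x' s)) (x' s))) with hσ
  have hxc : ContinuousOn x 𝕀 := fun s hs => (hx s hs).continuousAt.continuousWithinAt
  have hcont : ContinuousOn (fun s => √(inner ℝ (G (x s) (x' s)) (x' s))) 𝕀 :=
    (((hG.continuousOn.comp hxc hxK).clm_apply hx').inner hx').sqrt
  have hσc : Continuous σ := (continuousOn_iff_continuous_domRestrict.1 hcont).Icc_extend'
  have hσe : ∀ s ∈ 𝕀, σ s = √(inner ℝ (G (x s) (x' s)) (x' s)) := fun s hs => by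
    rw [hσ, IccExtend_of_mem _ _ hs]
    rfl
  have hσ0 : ∀ s, 0 ≤ σ s := fun s => sqrt_nonneg _
  have hσ2 : ∀ s ∈ 𝕀, σ s ^ 2 = inner ℝ (G (x s) (x' s)) (x' s) := fun s hs => by
    rw [hσe s hs, sq_sqrt]
    exact (mul_nonneg hG.m_pos.le (sq_nonneg _)).trans (hG.coercive _ (hxK s hs) _)
  have hint : ∫ s in (0 : ℝ)..1, √(inner ℝ (G (x s) (x' s)) (x' s)) = ∫ s in (0 : ℝ)..1, σ s := by
    refine intervalIntegral.integral_congr fun s hs => ?_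
    rw [uIcc_of_le zero_le_one] at hs
    exact (hσe s hs).symm
  rw [hint]
  set L := ∫ s in (0 : ℝ)..1, σ s
  have hL0 : 0 ≤ L := intervalIntegral.integral_nonneg zero_le_one fun s _ => hσ0 s
  have hlim : Tendsto (fun ε : ℝ => (L + ε) * L) (𝓝[>] 0) (𝓝 ((L + 0) * L)) :=
    (Continuous.tendsto (by fun_prop) 0).mono_left nhdsWithin_le_nhds
  have h2 : l ^ 2 ≤ (L + 0) * L := by
    refine ge_of_tendsto hlim ?_
    filter_upwards [self_mem_nhdsWithin] with ε hε
    exact hG.sq_le_mul hc hv hvc hwc hw hl hcK hx hx' hxK h0 h1 hsmall hσc hσ0 hσ2 hε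
  nlinarith

lemma exists_lipschitz_of_contDiffOn {F F' : Type*} [NormedAddCommGroup F] [NormedSpace ℝ F]
    [NormedAddCommGroup F'] [NormedSpace ℝ F'] {f : F → F'} {U K : Set F} (hU : IsOpen U)
    (hf : ContDiffOn ℝ 1 f U) (hKU : K ⊆ U) (hK : IsCompact K) (hconv : Convex ℝ K) :
    ∃ C, 0 ≤ C ∧ ∀ x ∈ K, ∀ y ∈ K, ‖f x - f y‖ ≤ C * ‖x - y‖ := by
  obtain ⟨C, hC⟩ := hK.exists_bound_of_continuousOn
    (((hf.fderiv_of_isOpen hU (m := 0) (by norm_num)).continuousOn).mono hKU)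
  refine ⟨max C 0, le_max_right _ _, fun x hx y hy => ?_⟩
  refine (hconv.norm_image_sub_le_of_norm_fderiv_le (𝕜 := ℝ) (fun z hz =>
    (hasFDerivAt_of_isOpen hf hU (hKU hz)).differentiableAt) hC hy hx).trans ?_
  gcongr
  exact le_max_left _ _

set_option synthInstance.maxHeartbeats 400000 in
lemma exists_metricBounds [FiniteDimensional ℝ F] {G : F → F →L[ℝ] F} {U : Set F}
    (hU : IsOpen U) (hG : ContDiffOn ℝ 2 G U)
    (hsymm : ∀ x ∈ U, ∀ a b, inner ℝ (G x a) b = inner ℝ (G x b) a)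
    (hpos : ∀ x ∈ U, ∀ a, a ≠ 0 → 0 < inner ℝ (G x a) a) {u : F} (hu : u ∈ U) :
    ∃ r > 0, ∃ m C, closedBall u r ⊆ U ∧ MetricBounds G (closedBall u r) m C := by
  obtain ⟨r, hr, hrU⟩ := nhds_basis_closedBall.mem_iff.1 (hU.mem_nhds hu)
  set K := closedBall u r
  have hKc : IsCompact K := isCompact_closedBall u r
  have hconv : Convex ℝ K := convex_closedBall u r
  have hdiff : ∀ x ∈ K, DifferentiableAt ℝ G x := fun x hx =>
    ((hG.contDiffAt (hU.mem_nhds (hrU hx)))).differentiableAt (by simp)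
  have hD : ContDiffOn ℝ 1 (fderiv ℝ G) U := hG.fderiv_of_isOpen hU (by norm_num)
  obtain ⟨C1, hC10, hC1⟩ := exists_lipschitz_of_contDiffOn hU (hG.of_le (by norm_num)) hrU hKc hconv
  obtain ⟨C2, hC20, hC2⟩ := exists_lipschitz_of_contDiffOn hU hD hrU hKc hconv
  have hcoer : ∃ m > 0, ∀ x ∈ K, ∀ a, m * ‖a‖ ^ 2 ≤ inner ℝ (G x a) a := by
    rcases subsingleton_or_nontrivial F with hs | hn
    · exact ⟨1, one_pos, fun x _ a => by simp [Subsingleton.elim a 0]⟩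
    · have hcs : IsCompact (K ×ˢ sphere (0 : F) 1) := hKc.prod (isCompact_sphere 0 1)
      have hne : (K ×ˢ sphere (0 : F) 1).Nonempty :=
        ⟨(u, (NormedSpace.sphere_nonempty (E := F) (x := 0) (r := 1)).2 zero_le_one |>.some),
          mem_closedBall_self hr.le, Nonempty.some_mem _⟩
      have hcont : ContinuousOn (fun z : F × F => inner ℝ (G z.1 z.2) z.2)
          (K ×ˢ sphere (0 : F) 1) :=
        (((hG.continuousOn.mono hrU).comp continuousOn_fst fun z hz => hz.1).clm_apply
          continuousOn_snd).inner continuousOn_snd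
      obtain ⟨z, hz, hmin⟩ := hcs.exists_isMinOn hne hcont
      refine ⟨inner ℝ (G z.1 z.2) z.2, hpos _ (hrU hz.1) _ (ne_zero_of_mem_unit_sphere ⟨z.2, hz.2⟩),
        fun x hx a => ?_⟩
      rcases eq_or_ne a 0 with rfl | ha
      · simp
      · have h1 := hmin (a := (x, ‖a‖⁻¹ • a)) ⟨hx, by simp [norm_smul, ha]⟩
        simp only [mem_ofPred_eq, map_smul, real_inner_smul_left, real_inner_smul_right] at h1
        have hn : 0 < ‖a‖ := norm_pos_iff.2 ha
        calc _ ≤ (‖a‖⁻¹ * (‖a‖⁻¹ * inner ℝ (G x a) a)) * ‖a‖ ^ 2 := by gcongr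
          _ = _ := by field_simp
  obtain ⟨m, hm, hcoer⟩ := hcoer
  refine ⟨r, hr, m, C1 + C2, hrU, ⟨hm, by positivity, hG.continuousOn.mono hrU,
    fun x hx => hsymm x (hrU hx), hcoer, fun x hx y hy => ?_, fun x hx y hy => ?_⟩⟩
  · refine (hC1 x hx y hy).trans ?_
    gcongr
    linarith
  · have hseg : segment ℝ y x ⊆ K := hconv.segment_subset hy hx
    have h1 := (convex_segment y x).norm_image_sub_le_of_norm_hasFDerivWithin_le
      (f := fun z => G z - fderiv ℝ G y z) (f' := fun z => fderiv ℝ G z - fderiv ℝ G y)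
      (C := C2 * ‖x - y‖) (fun z hz => ((hdiff z (hseg hz)).hasFDerivAt.sub
        (fderiv ℝ G y).hasFDerivAt).hasFDerivWithinAt) (fun z hz => ?_)
      (left_mem_segment ℝ y x) (right_mem_segment ℝ y x)
    · have h2 : G x - fderiv ℝ G y x - (G y - fderiv ℝ G y y) = G x - G y - fderiv ℝ G y (x - y) :=
        by
        rw [map_sub]
        abel
      rw [h2] at h1
      refine h1.trans ?_
      have : 0 ≤ C1 * ‖x - y‖ ^ 2 := by positivity
      nlinarith
    · refine (hC2 z (hseg hz) y hy).trans ?_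
      gcongr
      obtain ⟨a, b, ha, hb, hab, rfl⟩ := hz
      rw [show a • y + b • x - y = b • (x - y) from by
        rw [show a = 1 - b from by linarith, sub_smul, one_smul, smul_sub]; abel, norm_smul,
        norm_of_nonneg hb]
      exact mul_le_of_le_one_left (norm_nonneg _) (by linarith)

end

/-- A differentiable path in the domain of a chart, in coordinates. -/
lemma contDiffOn_coord_path {p : M} {γ : ℝ → M} (hγ : ContMDiff 𝓘(ℝ) (𝓡 d) 1 γ) :
    ContDiffOn ℝ 1 (fun s => (κ[p] (γ s) : 𝔼)) (γ ⁻¹' κ[p].source) := by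
  have : IsManifold (𝓡 d) 1 M := .of_le (n := ∞) (by simp)
  rw [← contMDiffOn_iff_contDiffOn]
  have h1 : ContMDiffOn (𝓡 d) 𝓘(ℝ, 𝔼) 1 κ[p] κ[p].source := by
    rw [extChartAt_source]
    exact contMDiffOn_extChartAt
  exact h1.comp hγ.contMDiffOn fun s hs => hs

lemma hasDerivAt_coord_path {p : M} {γ : ℝ → M} (hγ : ContMDiff 𝓘(ℝ) (𝓡 d) 1 γ) {s : ℝ}
    (hs : γ s ∈ κ[p].source) : HasDerivAt (fun s => (κ[p] (γ s) : 𝔼))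
      (coordDiff p (γ s) (mfderiv 𝓘(ℝ) (𝓡 d) γ s (1 : ℝ))) s := by
  have : IsManifold (𝓡 d) 1 M := .of_le (n := ∞) (by simp)
  have h1 : HasMFDerivAt (𝓡 d) 𝓘(ℝ, 𝔼) κ[p] (γ s) (coordDiff p (γ s)) :=
    (mdifferentiableAt_extChartAt (by simpa using hs)).hasMFDerivAt
  have h2 := h1.comp s ((hγ.contMDiffAt (x := s)).mdifferentiableAt (by simp)).hasMFDerivAt
  have h3 : DifferentiableAt ℝ (fun s => (κ[p] (γ s) : 𝔼)) s :=
    (hasFDerivAt_of_isOpen (contDiffOn_coord_path (p := p) hγ)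
      ((isOpen_extChartAt_source p).preimage hγ.continuous) hs).differentiableAt
  have h4 := h2.mfderiv.symm.trans h3.hasFDerivAt.hasMFDerivAt.mfderiv
  have h5 := congrArg (fun L : ℝ →L[ℝ] 𝔼 => L 1) h4
  refine h3.hasDerivAt.congr_deriv ?_
  rw [← fderiv_apply_one_eq_deriv]
  exact h5.symm

lemma hasDerivAt_clm_comp_apply₂ {F F' : Type*} [NormedAddCommGroup F] [NormedSpace ℝ F]
    [NormedAddCommGroup F'] [NormedSpace ℝ F'] {G : F → F →L[ℝ] F'} {f g : ℝ → F} {f' g' : F}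
    {s : ℝ} (hG : DifferentiableAt ℝ G (f s)) (hf : HasDerivAt f f' s) (hg : HasDerivAt g g' s) :
    HasDerivAt (fun t => G (f t) (g t)) (fderiv ℝ G (f s) f' (g s) + G (f s) g') s :=
  (hG.hasFDerivAt.comp_hasDerivAt s hf).clm_apply hg

lemma continuousOn_fderiv_clm_apply {F F' : Type*} [NormedAddCommGroup F] [NormedSpace ℝ F]
    [NormedAddCommGroup F'] [NormedSpace ℝ F'] {G : F → F →L[ℝ] F'} {U : Set F} (hU : IsOpen U)
    (hG : SmoothOn G U) {f g h : ℝ → F} {S : Set ℝ} (hf : ContinuousOn f S)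
    (hg : ContinuousOn g S) (hh : ContinuousOn h S) (hfU : ∀ s ∈ S, f s ∈ U) :
    ContinuousOn (fun s => fderiv ℝ G (f s) (g s) (h s)) S :=
  (((hG.continuousOn_fderiv_of_isOpen hU (by simp)).comp hf hfU).clm_apply hg).clm_apply hh

lemma pathELength_eq_ofReal {p : M} {γ : ℝ → M} (hγ : ContMDiff 𝓘(ℝ) (𝓡 d) 1 γ)
    (hs : ∀ s ∈ 𝕀, γ s ∈ κ[p].source) :
    Manifold.pathELength (𝓡 d) γ 0 1 = ENNReal.ofReal (∫ s in (0 : ℝ)..1,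
      √(metricForm p (κ[p] (γ s)) (deriv (fun s => κ[p] (γ s)) s)
        (deriv (fun s => κ[p] (γ s)) s))) := by
  set x : ℝ → 𝔼 := fun s => κ[p] (γ s)
  have hopen : IsOpen (γ ⁻¹' κ[p].source) := (isOpen_extChartAt_source p).preimage hγ.continuous
  have hxc := contDiffOn_coord_path (p := p) hγ
  have hx' : ContinuousOn (deriv x) 𝕀 :=
    (hxc.continuousOn_deriv_of_isOpen hopen le_rfl).mono hs
  have hcont : ContinuousOn (fun s => √(metricForm p (x s) (deriv x s) (deriv x s)))
      𝕀 := ((((contDiffOn_metricOp p).continuousOn.comp (hxc.continuousOn.mono hs)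
      fun s hs' => κ[p].map_source (hs s hs')).clm_apply hx').inner hx').sqrt
  rw [Manifold.pathELength_eq_lintegral_mfderiv_Icc, intervalIntegral.integral_of_le zero_le_one,
    ← integral_Icc_eq_integral_Ioc, ofReal_integral_eq_lintegral_ofReal
      (hcont.integrableOn_compact isCompact_Icc) (.of_forall fun s => sqrt_nonneg _)]
  refine setLIntegral_congr_fun measurableSet_Icc fun s hs' => ?_
  have h1 := inner_eq_metricForm (hs s hs') (mfderiv 𝓘(ℝ) (𝓡 d) γ s (1 : ℝ))
    (mfderiv 𝓘(ℝ) (𝓡 d) γ s (1 : ℝ))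
  rw [← (hasDerivAt_coord_path hγ (hs s hs')).deriv] at h1
  rw [← h1, real_inner_self_eq_norm_sq, sqrt_sq (norm_nonneg _)]
  exact (ofReal_norm _).symm

lemma IsCoordGeodesic.le_length {p : M} {I : Set ℝ} {c v ζ : ℝ → 𝔼}
    (h : IsCoordGeodesic p I c v ζ) (hI : 𝕀 ⊆ I) {K : Set 𝔼} {m C l : ℝ}
    (hG : MetricBounds (metricOp p) K m C) (hl : ∀ s ∈ 𝕀, metricForm p (c s) (v s) (v s) = l ^ 2)
    (hcK : ∀ s ∈ 𝕀, c s ∈ K) {x : ℝ → 𝔼} (hxd : ∀ s ∈ 𝕀, HasDerivAt x (deriv x s) s)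
    (hx' : ContinuousOn (deriv x) 𝕀) (hxK : ∀ s ∈ 𝕀, x s ∈ K)
    (h0 : x 0 = c 0) (h1 : x 1 = c 1) (hsmall : (C + 2 * C ^ 2 / m) / m * l ^ 2 ≤ m / 2) :
    l ≤ ∫ s in (0 : ℝ)..1, √(metricForm p (x s) (deriv x s) (deriv x s)) := by
  set w : ℝ → 𝔼 := fun s => fderiv ℝ (metricOp p) (c s) (v s) (v s) +
    metricOp p (c s) (-connection p (c s) (v s) (v s)) with hw
  have hcc : ContinuousOn c 𝕀 := fun s hs => (h.pos s (hI hs)).continuousAt.continuousWithinAt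
  have hvc : ContinuousOn v 𝕀 := fun s hs => (h.vel s (hI hs)).continuousAt.continuousWithinAt
  have hcs : ∀ s ∈ 𝕀, c s ∈ τ[p] := fun s hs => h.mem s (hI hs)
  have hwc1 : ContinuousOn (fun s => fderiv ℝ (metricOp p) (c s) (v s) (v s)) 𝕀 :=
    continuousOn_fderiv_clm_apply (isOpen_extChartAt_target p) (contDiffOn_metricOp p) hcc hvc hvc
      hcs
  have hwc2 : ContinuousOn (fun s => connection p (c s) (v s) (v s)) 𝕀 :=
    ContinuousOn.comp (g := fun z : 𝔼 × 𝔼 × 𝔼 => connection p z.1 z.2.1 z.2.2)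
      (f := fun s => (c s, v s, v s)) (contDiffOn_connection p).continuousOn
      (hcc.prodMk (hvc.prodMk hvc)) fun s hs => ⟨hcs s hs, trivial⟩
  have hwc : ContinuousOn w 𝕀 :=
    hwc1.add (((contDiffOn_metricOp p).continuousOn.comp hcc hcs).clm_apply hwc2.neg)
  refine hG.le_length (c := c) (v := v) (w := w) (fun s hs => h.pos s (hI hs)) (fun s hs => ?_)
    hvc hwc (fun s hs ν => ?_) hl hcK hxd hx' hxK h0 h1 hsmall
  · exact hasDerivAt_clm_comp_apply₂ (differentiableAt_metricOp (hcs s hs)) (h.pos s (hI hs))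
      (h.vel s (hI hs))
  · have e := metricForm_connection (hcs s hs) (v s) (v s) ν
    simp only [metricForm, christoffelLower] at e
    rw [hw]
    simp only [inner_add_left, map_neg, inner_neg_left]
    linarith

/-- Short geodesics are minimising. -/
lemma IsCoordGeodesic.eventually_edist_eq {p : M} {δ : ℝ} {c v ζ : ℝ → 𝔼}
    (h : IsCoordGeodesic p (Ioo (-δ) δ) c v ζ) (hδ : 0 < δ) :
    ∀ᶠ t in 𝓝[≥] (0 : ℝ), edist (σ[p] (c t))
        (σ[p] (c 0)) = ENNReal.ofReal (t * √(metricForm p (c 0) (v 0) (v 0))) := by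
  have h0 : (0 : ℝ) ∈ Ioo (-δ) δ := ⟨by linarith, hδ⟩
  have hc0 := h.mem 0 h0
  set u := c 0 with hu
  set g := √(metricForm p u (v 0) (v 0)) with hg
  obtain ⟨r, hr, m, C, hrU, hG⟩ := exists_metricBounds (isOpen_extChartAt_target p)
    ((contDiffOn_metricOp (d := d) p).of_le (by norm_cast)) (fun x _ => metricForm_comm p x)
    (fun x hx a ha => metricForm_pos hx ha) hc0
  have hy := κ[p].map_target hc0
  set y := σ[p] u with hyd
  have hNopen : IsOpen (κ[p].source ∩ κ[p] ⁻¹' ball u r) :=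
    (continuousOn_extChartAt p).isOpen_inter_preimage (isOpen_extChartAt_source p) isOpen_ball
  obtain ⟨R, hR, hRN⟩ := isOpen_iff.1 hNopen y ⟨hy, by
    rw [mem_preimage, hyd, κ[p].right_inv hc0]
    exact mem_ball_self hr⟩
  have ev1 : ∀ᶠ t in 𝓝 (0 : ℝ), (C + 2 * C ^ 2 / m) / m * (t * g) ^ 2 < m / 2 := by
    have : ContinuousAt (fun t : ℝ => (C + 2 * C ^ 2 / m) / m * (t * g) ^ 2) 0 := by fun_prop
    refine this.eventually_lt continuousAt_const ?_
    have := hG.m_pos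
    simp
    positivity
  have ev2 : ∀ᶠ t in 𝓝 (0 : ℝ), t * g < R := by
    have : ContinuousAt (fun t : ℝ => t * g) 0 := by fun_prop
    refine this.eventually_lt continuousAt_const ?_
    simpa
  obtain ⟨κ, hκ, hκc⟩ := Metric.eventually_nhds_iff.1
    ((h.pos 0 h0).continuousAt.eventually (closedBall_mem_nhds _ hr))
  have ev3 : ∀ᶠ t in 𝓝 (0 : ℝ), t < min κ δ := eventually_lt_nhds (by positivity)
  filter_upwards [self_mem_nhdsWithin, ev1.filter_mono nhdsWithin_le_nhds,
    ev2.filter_mono nhdsWithin_le_nhds, ev3.filter_mono nhdsWithin_le_nhds] with t ht h1 h2 h3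
  have ht0 : (0 : ℝ) ≤ t := ht
  have hscale : ∀ s ∈ 𝕀, 0 ≤ t * s ∧ t * s < min κ δ := fun s hs =>
    ⟨mul_nonneg ht0 hs.1, (mul_le_of_le_one_right ht0 hs.2).trans_lt h3⟩
  have hI : 𝕀 ⊆ (fun s => t * s) ⁻¹' Ioo (-δ) δ := fun s hs =>
    ⟨by linarith [(hscale s hs).1], (hscale s hs).2.trans_le (min_le_right _ _)⟩
  have hcK : ∀ s ∈ 𝕀, c (t * s) ∈ closedBall u r := fun s hs => by
    apply hκc
    rw [Real.dist_0_eq_abs, abs_of_nonneg (hscale s hs).1]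
    exact (hscale s hs).2.trans_le (min_le_left _ _)
  have hres := h.rescale t
  have hlen := hres.pathELength_eq hI
  have hl : ∀ s ∈ 𝕀, metricForm p (c (t * s)) (t • v (t * s)) (t • v (t * s)) = (t * g) ^ 2 := by
    intro s hs
    have e := IsCoordGeodesic.eq_const_of_hasDerivAt_zero hI (fun s hs => hres.metricForm_vel hs) hs
    rw [e]
    simp only [mul_zero, metricForm, map_smul, real_inner_smul_left, real_inner_smul_right]
    rw [mul_pow, hg, sq_sqrt, ← hu, metricForm]
    · ring
    · exact (mul_nonneg hG.m_pos.le (sq_nonneg _)).trans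
        (hG.coercive u (mem_closedBall_self hr.le) _)
  have hg0 : 0 ≤ t * g := mul_nonneg ht0 (sqrt_nonneg _)
  have hle : edist (σ[p] (c t)) y ≤ ENNReal.ofReal (t * g) := by
    have e1 := Manifold.riemannianEDist_le_pathELength (I := 𝓡 d)
      (γ := fun s => σ[p] (c (t * s))) (a := 0) (b := 1) (x := y) (y := σ[p] (c t))
      (fun s hs => ((hres.contMDiffAt (hI hs)).of_le (by norm_cast)).contMDiffWithinAt)
      (by simp [hyd, hu]) (by simp) zero_le_one
    rw [hlen, hl 0 ⟨le_rfl, zero_le_one⟩, sqrt_sq hg0] at e1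
    rw [edist_comm, IsRiemannianManifold.out (I := 𝓡 d) y]
    exact e1
  refine le_antisymm hle (le_of_not_gt fun hlt => ?_)
  rw [edist_comm, IsRiemannianManifold.out (I := 𝓡 d) y] at hlt
  obtain ⟨γ, hγ0, hγ1, hγ, hγl, -, -⟩ :=
    Manifold.exists_lt_locally_constant_of_riemannianEDist_lt hlt zero_lt_one
  have hstay : ∀ s ∈ 𝕀, γ s ∈ κ[p].source ∩ κ[p] ⁻¹' ball u r := by
    intro s hs
    apply hRN
    rw [mem_ball, dist_comm, ← ENNReal.ofReal_lt_ofReal_iff hR, ← edist_dist,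
      IsRiemannianManifold.out (I := 𝓡 d) y]
    calc _ ≤ Manifold.pathELength (𝓡 d) γ 0 s :=
          Manifold.riemannianEDist_le_pathELength hγ.contMDiffOn hγ0 rfl hs.1
      _ ≤ Manifold.pathELength (𝓡 d) γ 0 1 := Manifold.pathELength_mono le_rfl hs.2
      _ ≤ ENNReal.ofReal (t * g) := hγl.le
      _ < ENNReal.ofReal R := (ENNReal.ofReal_lt_ofReal_iff hR).2 h2
  set x : ℝ → 𝔼 := fun s => κ[p] (γ s) with hx
  have hxd : ∀ s ∈ 𝕀, HasDerivAt x (deriv x s) s := fun s hs =>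
    (hasDerivAt_coord_path hγ (hstay s hs).1).differentiableAt.hasDerivAt
  have hx' : ContinuousOn (deriv x) 𝕀 :=
    ((contDiffOn_coord_path (p := p) hγ).continuousOn_deriv_of_isOpen
      ((isOpen_extChartAt_source p).preimage hγ.continuous) le_rfl).mono fun s hs => (hstay s hs).1
  have hkey := hres.le_length hI hG hl hcK hxd hx'
    (fun s hs => ball_subset_closedBall (hstay s hs).2) (by
      simp only [hx, hγ0, mul_zero]
      exact κ[p].right_inv hc0) (by
      simp only [hx, hγ1, mul_one]
      exact κ[p].right_inv (by simpa using hres.mem 1 (hI ⟨zero_le_one, le_rfl⟩))) h1.le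
  refine absurd hγl (not_lt.2 ?_)
  rw [pathELength_eq_ofReal hγ fun s hs => (hstay s hs).1]
  exact ENNReal.ofReal_le_ofReal hkey

lemma sum_metricMatrix_inv_mul {p y : M} (hy : y ∈ κ[p].source) (X : TangentSpace (𝓡 d) y) :
    ∑ α, ∑ β, (metricMatrix p y)⁻¹ α β * inner ℝ X (coordVec p y α) *
      inner ℝ X (coordVec p y β) = ‖X‖ ^ 2 := by
  set b := coordDiff p y X
  have hX : X = (coordDiff p y).inverse b := (coordDiff_inverse_coordDiff hy X).symm
  have h1 : ∀ α, inner ℝ X (coordVec p y α) = (metricMatrix p y).mulVec b α := by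
    intro α
    rw [hX, coordVec, ← matrixForm_metricMatrix, matrixForm_apply]
    simp only [PiLp.single_apply, mul_ite, mul_one, mul_zero, Finset.sum_ite_eq', Finset.mem_univ,
      if_true]
    refine sum_congr rfl fun β _ => ?_
    congr 1
    simp only [metricMatrix, of_apply]
    exact real_inner_comm _ _
  have hpd := posDef_metricMatrix hy
  have h2 : (metricMatrix p y)⁻¹.mulVec ((metricMatrix p y).mulVec b) = b := by
    rw [mulVec_mulVec, Matrix.nonsing_inv_mul _ hpd.det_pos.ne'.isUnit, one_mulVec]
  calc _ = ∑ α, (metricMatrix p y).mulVec b α *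
        (metricMatrix p y)⁻¹.mulVec ((metricMatrix p y).mulVec b) α := by
        refine sum_congr rfl fun α _ => ?_
        rw [show (metricMatrix p y)⁻¹.mulVec ((metricMatrix p y).mulVec b) α =
          ∑ β, (metricMatrix p y)⁻¹ α β * (metricMatrix p y).mulVec b β from rfl, mul_sum]
        refine sum_congr rfl fun β _ => ?_
        rw [h1, h1]
        ring
    _ = ∑ α, (metricMatrix p y).mulVec b α * b α := by rw [h2]
    _ = matrixForm (metricMatrix p y) b b := by
        rw [matrixForm_apply]
        refine sum_congr rfl fun α _ => ?_
        rw [Matrix.mulVec, dotProduct, sum_mul]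
        refine sum_congr rfl fun β _ => ?_
        ring
    _ = _ := by rw [matrixForm_metricMatrix, ← hX, real_inner_self_eq_norm_sq]

lemma exists_covec_eq_inner {p y : M} (hy : y ∈ κ[p].source) (q : 𝔼) :
    ∃ X : TangentSpace (𝓡 d) y, ∀ Z, covec p y q Z = inner ℝ X Z := by
  have hpd := posDef_metricMatrix hy
  set b : 𝔼 := WithLp.toLp 2 ((metricMatrix p y)⁻¹.mulVec q) with hb
  refine ⟨(coordDiff p y).inverse b, fun Z => ?_⟩
  have h1 : (metricMatrix p y).mulVec b = q := by
    rw [hb, mulVec_mulVec, Matrix.mul_nonsing_inv _ hpd.det_pos.ne'.isUnit, one_mulVec]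
  conv_rhs => rw [← coordDiff_inverse_coordDiff hy Z]
  rw [covec_apply, ← matrixForm_metricMatrix, matrixForm_apply, sum_comm]
  set z := coordDiff p y Z
  rw [PiLp.inner_apply]
  refine sum_congr rfl fun ν _ => ?_
  rw [← congrFun h1 ν, Matrix.mulVec, dotProduct]
  simp only [RCLike.inner_apply, conj_trivial, mul_sum]
  refine sum_congr rfl fun μ _ => ?_
  have : metricMatrix (d := d) p y μ ν = metricMatrix p y ν μ := by
    simp only [metricMatrix, of_apply]
    exact real_inner_comm _ _
  rw [this]
  ring

lemma cometric_covec {p y : M} (hy : y ∈ κ[p].source) (q : 𝔼) :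
    cometric y (covec p y q) = ∑ α, ∑ β, (metricMatrix p y)⁻¹ α β * q α * q β := by
  obtain ⟨X, hX⟩ := exists_covec_eq_inner hy q
  have h1 := sum_metricMatrix_inv_mul hy X
  have h2 := sum_metricMatrix_inv_mul (mem_extChartAt_source (I := 𝓡 d) y) X
  simp only [← hX, covec_coordVec hy] at h1
  rw [cometric, h1, ← h2]
  simp only [hX]

lemma cometric_pos {p y : M} (hy : y ∈ κ[p].source) {q : 𝔼} (hq : q ≠ 0) :
    0 < cometric y (covec p y q) := by
  obtain ⟨X, hX⟩ := exists_covec_eq_inner hy q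
  have h1 := sum_metricMatrix_inv_mul hy X
  simp only [← hX, covec_coordVec hy] at h1
  rw [cometric_covec hy, h1]
  have : X ≠ 0 := by
    rintro rfl
    apply hq
    ext α
    rw [← covec_coordVec hy q, hX]
    simp
  positivity

lemma hamiltonian_smul (y : M) (η : Cotangent d y) {t : ℝ} (ht : 0 ≤ t) :
    hamiltonian y (t • η) = t * hamiltonian y η := by
  have : cometric y (t • η) = t ^ 2 * cometric y η := by
    simp only [cometric, mul_sum]
    refine sum_congr rfl fun α _ => sum_congr rfl fun β _ => ?_
    simp
    ring
  rw [hamiltonian, this, sqrt_mul (sq_nonneg t), sqrt_sq ht]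
  rfl

/-- The Hamiltonian in the coordinates of the chart at `p`. -/
def coordHam (p : M) (z : 𝔼 × 𝔼) : ℝ :=
  hamiltonian (σ[p] z.1) (covec p (σ[p] z.1) z.2)

lemma coordHam_smul (p : M) (w q : 𝔼) {t : ℝ} (ht : 0 ≤ t) :
    coordHam p (w, t • q) = t * coordHam p (w, q) := by
  rw [coordHam, covec_smul, hamiltonian_smul _ _ ht]
  rfl

lemma coordHam_pos {p : M} {w q : 𝔼} (hw : w ∈ τ[p]) (hq : q ≠ 0) : 0 < coordHam p (w, q) :=
  sqrt_pos.2 (cometric_pos (κ[p].map_target hw) hq)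

lemma contDiffOn_coordHam (p : M) : SmoothOn (coordHam (d := d) p) (τ[p] ×ˢ {0}ᶜ) := by
  have h1 : SmoothOn (fun z : 𝔼 × 𝔼 => cometric (σ[p] z.1)
      (covec p (σ[p] z.1) z.2)) (τ[p] ×ˢ {0}ᶜ) := by
    have h2 : SmoothOn (fun z : 𝔼 × 𝔼 => ∑ α, ∑ β,
        (metricMatrix p (σ[p] z.1))⁻¹ α β * z.2 α * z.2 β) (τ[p] ×ˢ {0}ᶜ) := by
      refine ContDiffOn.sum fun α _ => ContDiffOn.sum fun β _ => ?_
      refine ((ContDiffOn.comp (g := fun u => (metricMatrix p (σ[p] u))⁻¹ α β)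
        (f := Prod.fst) (contDiffOn_metricMatrix_inv p α β) contDiffOn_fst
        fun z hz => hz.1).mul ?_).mul ?_
      · exact ((EuclideanSpace.proj α : 𝔼 →L[ℝ] ℝ).contDiff.comp contDiff_snd).contDiffOn
      · exact ((EuclideanSpace.proj β : 𝔼 →L[ℝ] ℝ).contDiff.comp contDiff_snd).contDiffOn
    exact h2.congr fun z hz => cometric_covec (κ[p].map_target hz.1) _
  exact h1.sqrt fun z hz => (cometric_pos (κ[p].map_target hz.1) hz.2).ne'

section

/-- Complex functions on the cotangent bundle. -/
abbrev CotFun (d : ℕ) (M : Type*) [MetricSpace M] [ChartedSpace 𝔼[d] M] : Type _ :=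
  (y : M) → Cotangent d y → ℂ

/-- A function on `M × T'M` in the coordinates of the chart at `p`. -/
def coordFun (p : M) (a : M → CotFun d M) (z : 𝔼 × 𝔼 × 𝔼) : ℂ :=
  a (σ[p] z.1) (σ[p] z.2.1) (covec p (σ[p] z.2.1) z.2.2)

lemma SmoothOnProd.contDiffOn {a : M → CotFun d M} (ha : SmoothOnProd a)
    (p : M) : SmoothOn (coordFun p a) (τ[p] ×ˢ τ[p] ×ˢ {0}ᶜ) := ha p p

variable {ε : ℝ} {φ : M → CotFun d M}

/-- A Levi-Civita phase function along a geodesic. -/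
lemma IsLeviCivitaPhase.eventually_eq (hφ : IsLeviCivitaPhase ε φ) {p : M} {δ : ℝ} {c v ζ : ℝ → 𝔼}
    (h : IsCoordGeodesic p (Ioo (-δ) δ) c v ζ) (hδ : 0 < δ) (hζ : ζ 0 ≠ 0) :
    ∀ᶠ t in 𝓝[≥] (0 : ℝ), coordFun p φ (c t, c 0, ζ 0) = ((t * inner ℝ (ζ 0) (v 0) : ℝ) : ℂ) +
      I * ((ε / 2 * coordHam p (c 0, ζ 0) * (t ^ 2 * metricForm p (c 0) (v 0) (v 0)) : ℝ) : ℂ) := by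
  obtain ⟨r, hr, hnear⟩ := hφ.near_diagonal
  have h0 : (0 : ℝ) ∈ Ioo (-δ) δ := ⟨by linarith, hδ⟩
  have hc0 := h.mem 0 h0
  have hmf : 0 ≤ metricForm p (c 0) (v 0) (v 0) := by
    rcases eq_or_ne (v 0) 0 with hv | hv
    · simp [metricForm, hv]
    · exact (metricForm_pos hc0 hv).le
  set g := √(metricForm p (c 0) (v 0) (v 0)) with hg
  have ev1 : ∀ᶠ t in 𝓝 (0 : ℝ), t * g < r := by
    have : ContinuousAt (fun t : ℝ => t * g) 0 := by fun_prop
    refine this.eventually_lt continuousAt_const ?_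
    simpa
  filter_upwards [self_mem_nhdsWithin, h.eventually_edist_eq hδ,
    ev1.filter_mono nhdsWithin_le_nhds, (eventually_lt_nhds hδ).filter_mono nhdsWithin_le_nhds]
    with t ht hdist h1 h2
  have ht0 : (0 : ℝ) ≤ t := ht
  have hI : 𝕀 ⊆ (fun s => t * s) ⁻¹' Ioo (-δ) δ := fun s hs =>
    ⟨by linarith [mul_nonneg ht0 hs.1], (mul_le_of_le_one_right ht0 hs.2).trans_lt h2⟩
  have hres := h.rescale t
  have hg0 : 0 ≤ t * g := mul_nonneg ht0 (sqrt_nonneg _)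
  have hd : dist (σ[p] (c t)) (σ[p] (c 0)) = t * g := by
    rw [edist_dist] at hdist
    exact (ENNReal.ofReal_eq_ofReal_iff dist_nonneg hg0).1 hdist
  have hd' : dist (σ[p] (c (t * 1))) (σ[p] (c (t * 0))) = t * g := by
    rw [mul_one, mul_zero]
    exact hd
  have hlen := hres.pathELength_eq hI
  have e1 : √(metricForm p (c (t * 0)) (t • v (t * 0)) (t • v (t * 0))) = t * g := by
    simp only [mul_zero, metricForm, map_smul, real_inner_smul_left, real_inner_smul_right]
    rw [← mul_assoc, sqrt_mul (mul_self_nonneg t), Real.sqrt_mul_self ht0, hg]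
    rfl
  have key := hnear (fun s => σ[p] (c (t * s))) (fun s => covec p (σ[p] (c (t * s))) (ζ (t * s)))
    (hd'.trans_lt h1) (hres.isGeodesic hI)
    (by rw [hlen, e1, edist_dist]; exact congrArg _ hd'.symm) (hres.isParallel hI)
    (covec_ne_zero (κ[p].map_target (by simpa using hc0)) (by simpa using hζ))
  have e3 : coordFun p φ (c t, c 0, ζ 0) = coordFun p φ (c (t * 1), c (t * 0), ζ (t * 0)) := by simp
  refine e3.trans (key.trans ?_)
  rw [hres.lineIntegral_eq hI]
  have e2 : (g : ℂ) ^ 2 = (metricForm p (c 0) (v 0) (v 0) : ℂ) := by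
    rw [← sq_sqrt hmf]
    push_cast
    rfl
  have e4 : hamiltonian (σ[p] (c (t * 0)))
      (covec p (σ[p] (c (t * 0))) (ζ (t * 0))) = coordHam p (c 0, ζ 0) := by
    change coordHam p (c (t * 0), ζ (t * 0)) = _
    rw [mul_zero]
  simp only [e4, hd']
  simp only [mul_zero, real_inner_smul_right]
  push_cast
  rw [mul_pow, e2]
  ring

variable (hφ : IsLeviCivitaPhase ε φ) {p : M}
include hφ

lemma IsLeviCivitaPhase.coordFun_diag {w q : 𝔼} (hw : w ∈ τ[p])
    (hq : q ≠ 0) : coordFun p φ (w, w, q) = 0 := by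
  obtain ⟨δ, hδ, c, v, ζ, h, rfl, -, rfl⟩ := exists_isCoordGeodesic hw 0 q
  have := (hφ.eventually_eq h hδ hq).self_of_nhdsWithin (by simp : (0 : ℝ) ∈ Ici (0 : ℝ))
  simpa using this

lemma IsLeviCivitaPhase.differentiableAt_coordFun {u w q : 𝔼} (hu : u ∈ τ[p]) (hw : w ∈ τ[p])
    (hq : q ≠ 0) : DifferentiableAt ℝ (coordFun p φ) (u, w, q) := by
  have hopen : IsOpen (τ[p] ×ˢ τ[p] ×ˢ ({0}ᶜ : Set 𝔼)) := (isOpen_extChartAt_target p).prod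
        ((isOpen_extChartAt_target p).prod isOpen_compl_singleton)
  have hm : (u, w, q) ∈ τ[p] ×ˢ τ[p] ×ˢ ({0}ᶜ : Set 𝔼) := ⟨hu, hw, hq⟩
  exact (hasFDerivAt_of_isOpen (hφ.smooth.contDiffOn p) hopen hm).differentiableAt

lemma IsLeviCivitaPhase.fderiv_coordFun_fst {w q : 𝔼} (hw : w ∈ τ[p]) (hq : q ≠ 0) (a : 𝔼) :
    fderiv ℝ (coordFun p φ) (w, w, q) (a, 0, 0) = ((inner ℝ q a : ℝ) : ℂ) := by
  obtain ⟨δ, hδ, c, v, ζ, h, hc0, hv0, rfl⟩ := exists_isCoordGeodesic hw a q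
  have h0 : (0 : ℝ) ∈ Ioo (-δ) δ := ⟨by linarith, hδ⟩
  have h1 : HasDerivAt (fun t : ℝ => (c t, w, ζ 0)) (a, 0, 0) 0 :=
    (hv0 ▸ h.pos 0 h0).prodMk ((hasDerivAt_const _ _).prodMk (hasDerivAt_const _ _))
  have h2 : HasFDerivAt (coordFun p φ) (fderiv ℝ (coordFun p φ) (w, w, ζ 0)) (c 0, w, ζ 0) := by
    rw [hc0]
    exact (hφ.differentiableAt_coordFun hw hw hq).hasFDerivAt
  have h3 := (HasFDerivAt.comp_hasDerivAt (f := fun t : ℝ => (c t, w, ζ 0)) 0 h2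
    h1).hasDerivWithinAt
    (s := Ici 0)
  have hev := hφ.eventually_eq h hδ hq
  have h4 : HasDerivWithinAt (fun t : ℝ => ((t * inner ℝ (ζ 0) (v 0) : ℝ) : ℂ) +
      I * ((ε / 2 * coordHam p (c 0, ζ 0) *
        (t ^ 2 * metricForm p (c 0) (v 0) (v 0)) : ℝ) : ℂ)) ((inner ℝ (ζ 0) a : ℝ) : ℂ)
      (Ici 0) 0 := by
    have e1 : HasDerivAt (fun t : ℝ => t * inner ℝ (ζ 0) (v 0)) (inner ℝ (ζ 0) a) 0 := by
      simpa [hv0] using (hasDerivAt_id (0 : ℝ)).mul_const (inner ℝ (ζ 0) (v 0))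
    have e2 : HasDerivAt (fun t : ℝ => ε / 2 * coordHam p (c 0, ζ 0) *
        (t ^ 2 * metricForm p (c 0) (v 0) (v 0))) 0 0 := by
      have := (((hasDerivAt_id (0 : ℝ)).pow 2).mul_const
        (metricForm p (c 0) (v 0) (v 0))).const_mul (ε / 2 * coordHam p (c 0, ζ 0))
      simpa using this
    have := (e1.ofReal_comp.add (e2.ofReal_comp.const_mul I)).hasDerivWithinAt (s := Ici 0)
    exact this.congr_deriv (by simp)
  have h5 := h4.congr_of_eventuallyEq (f₁ := fun t : ℝ => coordFun p φ (c t, w, ζ 0))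
    (by rw [← hc0]; exact hev)
    (by have := hev.self_of_nhdsWithin (by simp : (0 : ℝ) ∈ Ici (0 : ℝ)); rw [hc0] at this ⊢
        exact this)
  exact (uniqueDiffWithinAt_Ici (0 : ℝ)).eq_deriv _ h3 h5

lemma IsLeviCivitaPhase.fderiv_coordFun_snd {w q : 𝔼} (hw : w ∈ τ[p]) (hq : q ≠ 0) (a : 𝔼) :
    fderiv ℝ (coordFun p φ) (w, w, q) (0, a, 0) = -((inner ℝ q a : ℝ) : ℂ) := by
  have h1 : HasFDerivAt (𝕜 := ℝ) (fun x : 𝔼 => (x, x, q)) _ w :=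
    (hasFDerivAt_id w).prodMk ((hasFDerivAt_id w).prodMk (hasFDerivAt_const q w))
  have h2 := HasFDerivAt.comp w (hφ.differentiableAt_coordFun hw hw hq).hasFDerivAt h1
  have h3 : (coordFun p φ ∘ fun x : 𝔼 => (x, x, q)) =ᶠ[𝓝 w] fun _ => 0 := by
    filter_upwards [(isOpen_extChartAt_target p).mem_nhds hw] with x hx
    exact hφ.coordFun_diag hx hq
  have h4 := (h2.congr_of_eventuallyEq h3.symm).unique (hasFDerivAt_const 0 w)
  have h5 := congrArg (fun L : 𝔼 →L[ℝ] ℂ => L a) h4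
  simp only [ContinuousLinearMap.comp_apply, ContinuousLinearMap.prod_apply,
    ContinuousLinearMap.id_apply, _root_.zero_apply] at h5
  have h6 : ((a, a, 0) : 𝔼 × 𝔼 × 𝔼) = (a, 0, 0) + (0, a, 0) := by simp
  rw [h6, map_add, hφ.fderiv_coordFun_fst hw hq] at h5
  exact (neg_eq_of_add_eq_zero_right h5).symm

end

lemma fderiv_apply_eq_mul {E : Type*} [NormedAddCommGroup E] [NormedSpace ℝ E] {f : E → ℂ}
    {x y v v' : E} (hx : DifferentiableAt ℝ f x) (hy : DifferentiableAt ℝ f y) {l : ℂ}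
    (h : ∀ᶠ t : ℝ in 𝓝 0, f (x + t • v) = l * f (y + t • v')) :
    fderiv ℝ f x v = l * fderiv ℝ f y v' := by
  have h1 : HasDerivAt (fun t : ℝ => f (x + t • v)) (fderiv ℝ f x v) 0 :=
    hx.hasFDerivAt.hasLineDerivAt v
  have h2 : HasDerivAt (fun t : ℝ => f (y + t • v')) (fderiv ℝ f y v') 0 :=
    hy.hasFDerivAt.hasLineDerivAt v'
  exact (h1.congr_of_eventuallyEq (EventuallyEq.symm h)).unique (h2.const_mul l)

lemma exists_ball_conic {u₀ : 𝔼} {P : 𝔼 → 𝔼 → 𝔼 → Prop}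
    (h : ∀ q, ‖q‖ = 1 → ∀ᶠ z : 𝔼 × 𝔼 × 𝔼 in 𝓝 (u₀, u₀, q), P z.1 z.2.1 z.2.2) :
    ∃ r > 0, ∀ u ∈ ball u₀ r, ∀ w ∈ ball u₀ r, ∀ q, ‖q‖ = 1 → P u w q := by
  have h1 : ∀ᶠ z : 𝔼 × 𝔼 in 𝓝 (u₀, u₀), ∀ q ∈ sphere (0 : 𝔼) 1, P z.1 z.2 q := by
    refine (isCompact_sphere (0 : 𝔼) 1).eventually_forall_of_forall_eventually fun q hq => ?_
    have hc : Continuous fun z : (𝔼 × 𝔼) × 𝔼 => (z.1.1, z.1.2, z.2) := by fun_prop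
    exact (hc.tendsto ((u₀, u₀), q)).eventually (h q (by simpa using hq))
  obtain ⟨r, hr, hr'⟩ := eventually_nhds_iff_ball.1 h1
  refine ⟨r, hr, fun u hu w hw q hq => hr' (u, w) ?_ q (by simpa using hq)⟩
  rw [← ball_prod_same]
  exact ⟨hu, hw⟩

lemma exists_ball_fderiv_pos {T : Set 𝔼} (hT : IsOpen T) {u₀ : 𝔼} (hu₀ : u₀ ∈ T)
    {φ : 𝔼 × 𝔼 × 𝔼 → ℂ} (hφ : SmoothOn φ (T ×ˢ T ×ˢ {0}ᶜ))
    (hhom : ∀ u ∈ T, ∀ w ∈ T, ∀ q, q ≠ 0 → ∀ l : ℝ, 0 < l → φ (u, w, l • q) = l * φ (u, w, q))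
    {L : 𝔼 →L[ℝ] 𝔼 × 𝔼 × 𝔼} (hL : ∀ q, (L q).2.2 = 0)
    (hpos : ∀ q, q ≠ 0 → 0 < (fderiv ℝ φ (u₀, u₀, q) (L q)).re) :
    ∃ r > 0, ball u₀ r ⊆ T ∧ ∀ u ∈ ball u₀ r, ∀ w ∈ ball u₀ r, ∀ q, q ≠ 0 →
      0 < (fderiv ℝ φ (u, w, q) (L q)).re := by
  have hopen : IsOpen (T ×ˢ T ×ˢ ({0}ᶜ : Set 𝔼)) := hT.prod (hT.prod isOpen_compl_singleton)
  have hne : ∀ q : 𝔼, ‖q‖ = 1 → q ≠ 0 := fun q hq h0 => by simp [h0] at hq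
  obtain ⟨r₁, hr₁, h₁⟩ := exists_ball_conic (u₀ := u₀)
    (P := fun u w q => 0 < (fderiv ℝ φ (u, w, q) (L q)).re) fun q hq => by
    have hm : (u₀, u₀, q) ∈ T ×ˢ T ×ˢ ({0}ᶜ : Set 𝔼) := ⟨hu₀, hu₀, hne q hq⟩
    have hc : ContinuousAt (fun z : 𝔼 × 𝔼 × 𝔼 => (fderiv ℝ φ z (L z.2.2)).re) (u₀, u₀, q) := by
      have := (hφ.continuousOn_fderiv_of_isOpen hopen (by simp)).continuousAt (hopen.mem_nhds hm)
      exact Complex.continuous_re.continuousAt.comp (this.clm_apply (by fun_prop))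
    exact hc.eventually (lt_mem_nhds (hpos q (hne q hq)))
  obtain ⟨r₂, hr₂, h₂⟩ := isOpen_iff.1 hT u₀ hu₀
  refine ⟨min r₁ r₂, lt_min hr₁ hr₂, (ball_subset_ball (min_le_right _ _)).trans h₂,
    fun u hu w hw q hq => ?_⟩
  have huT := h₂ (ball_subset_ball (min_le_right _ _) hu)
  have hwT := h₂ (ball_subset_ball (min_le_right _ _) hw)
  have hq0 : 0 < ‖q‖ := norm_pos_iff.2 hq
  set θ := ‖q‖⁻¹ • q
  have hθq : ‖q‖ • θ = q := norm_smul_inv_smul_self hq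
  have hθ1 : ‖θ‖ = 1 := norm_inv_smul_self hq
  have hθ0 := hne θ hθ1
  have key := h₁ u (ball_subset_ball (min_le_left _ _) hu) w
    (ball_subset_ball (min_le_left _ _) hw) θ hθ1
  have hdiff : ∀ q', q' ≠ 0 → DifferentiableAt ℝ φ (u, w, q') := fun q' hq' =>
    (hasFDerivAt_of_isOpen hφ hopen (mk_mem_prod huT (mk_mem_prod hwT hq'))).differentiableAt
  have e1 : fderiv ℝ φ (u, w, q) (L q) = (‖q‖ : ℂ) * fderiv ℝ φ (u, w, θ) (L q) := by
    refine fderiv_apply_eq_mul (hdiff q hq) (hdiff θ hθ0) ?_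
    have c1 : ContinuousAt (fun t : ℝ => u + t • (L q).1) 0 := by fun_prop
    have c2 : ContinuousAt (fun t : ℝ => w + t • (L q).2.1) 0 := by fun_prop
    filter_upwards [c1.eventually (hT.mem_nhds (by simpa)), c2.eventually (hT.mem_nhds (by simpa))]
      with t h3 h4
    have := hhom _ h3 _ h4 θ hθ0 ‖q‖ hq0
    rw [hθq] at this
    convert this using 2
    · ext1
      · rfl
      · ext1
        · rfl
        · change q + t • (L q).2.2 = q
          simp [hL]
    · congr 1
      ext1
      · rfl
      · ext1
        · rfl
        · change θ + t • (L q).2.2 = θ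
          simp [hL]
  have e2 : L q = ‖q‖ • L θ := by rw [← map_smul, hθq]
  rw [e1, e2, map_smul]
  simp only [real_smul, Complex.re_ofReal_mul]
  positivity

lemma eq_of_pow_eq_const {f : ℝ → ℂ} {S : Set ℝ} (hS : IsPreconnected S) (hf : ContinuousOn f S)
    {n : ℕ} (hn : 0 < n) {a : ℂ} (h : ∀ t ∈ S, f t ^ n = a) {t t' : ℝ} (ht : t ∈ S) (ht' : t' ∈ S) :
    f t = f t' := by
  have hfin : ((Polynomial.nthRoots n a).toFinset : Set ℂ).Finite := Finset.finite_toSet _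
  have hsub : f '' S ⊆ ((Polynomial.nthRoots n a).toFinset : Set ℂ) := by
    rintro _ ⟨x, hx, rfl⟩
    simp [Polynomial.mem_nthRoots hn, h x hx]
  exact (hfin.countable.isTotallyDisconnected _ hsub (hS.image f hf)) (mem_image_of_mem f ht)
    (mem_image_of_mem f ht')

section

/-- A function on `T'M` in the coordinates of the chart at `p`. -/
def coordSymbol (p : M) (a : CotFun d M) (z : 𝔼 × 𝔼) : ℂ :=
  a (σ[p] z.1) (covec p (σ[p] z.1) z.2)

/-- The matrix of mixed derivatives of `φ` in the coordinates of the chart at `p`. -/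
def coordMixed (p : M) (φ : M → CotFun d M) (z : 𝔼 × 𝔼 × 𝔼) :
    Matrix (Fin d) (Fin d) ℂ := mixedDeriv φ p p (σ[p] z.1) (σ[p] z.2.1)
    (covec p (σ[p] z.2.1) z.2.2)

lemma mixedDeriv_smul {φ : M → CotFun d M}
    (hφ : ∀ (x y : M) (η : Cotangent d y), η ≠ 0 → ∀ l : ℝ, 0 < l → φ x y (l • η) = l * φ x y η)
    (p q x y : M) {η : Cotangent d y} (hη : η ≠ 0) {l : ℝ} (hl : 0 < l) :
    mixedDeriv φ p q x y (l • η) = mixedDeriv φ p q x y η := by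
  have key : ∀ (X : M) (ζ : Cotangent d y), deriv (fun τ : ℝ => φ X y (l • η + τ • ζ)) 0 =
      deriv (fun τ : ℝ => φ X y (η + τ • ζ)) 0 := by
    intro X ζ
    obtain ⟨Z, hZ⟩ : ∃ Z, η Z ≠ 0 := by
      by_contra! h
      exact hη (ContinuousLinearMap.ext h)
    have hev : ∀ᶠ τ : ℝ in 𝓝 0, η Z + (l⁻¹ * τ) * ζ Z ≠ 0 := by
      have : ContinuousAt (fun τ : ℝ => η Z + (l⁻¹ * τ) * ζ Z) 0 := by fun_prop
      exact this.eventually_ne (by simpa)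
    have h1 : (fun τ : ℝ => φ X y (l • η + τ • ζ)) =ᶠ[𝓝 0]
        fun τ => (l : ℂ) * φ X y (η + (l⁻¹ * τ) • ζ) := by
      filter_upwards [hev] with τ hτ
      rw [← hφ X y (η + (l⁻¹ * τ) • ζ) (fun h0 => hτ (by
        have := congrArg (fun L : Cotangent d y => L Z) h0
        simpa using this)) l hl, smul_add, smul_smul, ← mul_assoc, mul_inv_cancel₀ hl.ne', one_mul]
    rw [h1.deriv_eq, deriv_const_mul_field,
      deriv_comp_mul_left l⁻¹ (fun τ : ℝ => φ X y (η + τ • ζ)) 0, mul_zero, real_smul,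
      ← mul_assoc, ← ofReal_mul, mul_inv_cancel₀ hl.ne', ofReal_one, one_mul]
  ext α β
  simp only [mixedDeriv, of_apply, key]

lemma coordMixed_apply (p : M) (φ : M → CotFun d M) {u w : 𝔼} (q : 𝔼)
    (hu : u ∈ τ[p]) (α β : Fin d) :
    coordMixed p φ (u, w, q) α β = deriv (fun t : ℝ => deriv (fun τ : ℝ =>
      coordFun p φ (u + t • stdVec α, w, q + τ • stdVec β)) 0) 0 := by
  simp only [coordMixed, mixedDeriv, of_apply, κ[p].right_inv hu, coordFun, covec_add, covec_smul]

variable {ε : ℝ} {φ χ v : M → CotFun d M} {s : CotFun d M}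
  {c : ℕ → CotFun d M}

/-- The homogeneous weight in the coordinates of the chart at `p`. -/
def coordWeight (p : M) (v : M → CotFun d M) (z : 𝔼 × 𝔼 × 𝔼) : ℂ :=
  coordFun p v (z.1, z.2.1, (coordHam p z.2)⁻¹ • z.2.2)

lemma HasPolyhomogeneousExpansion.exists_bound (hs : HasPolyhomogeneousExpansion s c) (p : M)
    (N : ℕ) {K : Set 𝔼} (hK : IsCompact K) (hKT : K ⊆ τ[p]) : ∃ C : ℝ,
    ∀ w ∈ K, ∀ q, 1 ≤ ‖q‖ → ‖coordSymbol p s (w, q) -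
      ∑ k ∈ Finset.range N, coordSymbol p (c k) (w, q)‖ ≤ C * (‖q‖ ^ N)⁻¹ := by
  obtain ⟨C, hC⟩ := hs.remainder N p K hK hKT 0 0
  refine ⟨C, fun w hw q hq => ?_⟩
  have := hC w hw q hq
  rw [norm_iteratedFDeriv_zero, norm_iteratedFDeriv_zero] at this
  refine this.trans_eq ?_
  rw [Nat.cast_zero, sub_zero, Real.rpow_neg (norm_nonneg q), Real.rpow_natCast]

lemma exists_localKernel (hφ : IsLeviCivitaPhase ε φ) (hχ : IsCutoff χ) (hv : IsWeight φ χ v)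
    (hs : HasPolyhomogeneousExpansion s c) {p : M} {u₀ : 𝔼} (hu₀ : u₀ ∈ τ[p]) :
    ∃ O : Set 𝔼, u₀ ∈ O ∧ O ⊆ τ[p] ∧
      LocalKernel O (coordFun p φ) (coordWeight p v) (coordFun p fun x y η => χ x y η * v x y η)
        (coordHam p) (coordSymbol p s) (fun k => coordSymbol p (c k)) ∧
      (∀ w ∈ O, ∀ q, q ≠ 0 → coordWeight p v (w, w, q) = 1) ∧
      ∀ u ∈ O, ∀ w ∈ O, ∀ q, q ≠ 0 → coordWeight p v (u, w, q) ^ 4 =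
        ((density d p (σ[p] u) : ℂ) ^ 2)⁻¹ * (density d p (σ[p] w) : ℂ) ^ 2 *
          (coordMixed p φ (u, w, q)).det ^ 2 := by
  set T := τ[p]
  have hT : IsOpen T := isOpen_extChartAt_target p
  have hcov : ∀ w ∈ T, ∀ q : 𝔼, q ≠ 0 → covec p (σ[p] w) q ≠ 0 :=
    fun w hw q hq => covec_ne_zero (κ[p].map_target hw) hq
  have hhom : ∀ u ∈ T, ∀ w ∈ T, ∀ q : 𝔼, q ≠ 0 → ∀ l : ℝ, 0 < l →
      coordFun p φ (u, w, l • q) = l * coordFun p φ (u, w, q) := fun u _ w hw q hq l hl => by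
    rw [coordFun, covec_smul, hφ.homogeneous _ _ _ (hcov w hw q hq) l hl]
    rfl
  have hsm := hφ.smooth.contDiffOn p
  obtain ⟨r₁, hr₁, hr₁T, h₁⟩ := exists_ball_fderiv_pos hT hu₀ hsm hhom
    (L := (ContinuousLinearMap.id ℝ 𝔼).prod (0 : 𝔼 →L[ℝ] 𝔼 × 𝔼)) (fun q => rfl) fun q hq => by
      change 0 < (fderiv ℝ (coordFun p φ) (u₀, u₀, q) (q, 0, 0)).re
      rw [hφ.fderiv_coordFun_fst hu₀ hq, ofReal_re, real_inner_self_eq_norm_sq]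
      positivity
  obtain ⟨r₂, hr₂, -, h₂⟩ := exists_ball_fderiv_pos hT hu₀ hsm hhom
    (L := (0 : 𝔼 →L[ℝ] 𝔼).prod ((-ContinuousLinearMap.id ℝ 𝔼).prod (0 : 𝔼 →L[ℝ] 𝔼)))
    (fun q => rfl) fun q hq => by
      change 0 < (fderiv ℝ (coordFun p φ) (u₀, u₀, q) (0, -q, 0)).re
      rw [hφ.fderiv_coordFun_snd hu₀ hq, inner_neg_right, Complex.ofReal_neg, neg_neg,
        ofReal_re, real_inner_self_eq_norm_sq]
      positivity
  obtain ⟨r, hr, hone⟩ := hχ.eq_one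
  obtain ⟨r₃, hr₃, h₃⟩ : ∃ r₃ > 0, ∀ u ∈ ball u₀ r₃, u ∈ T → dist (σ[p] u) (σ[p] u₀) < r / 2 := by
    have hc := (continuousOn_extChartAt_symm (I := 𝓡 d) p).continuousAt (hT.mem_nhds hu₀)
    obtain ⟨r₃, hr₃, h⟩ := continuousAt_iff.1 hc (r / 2) (by positivity)
    exact ⟨r₃, hr₃, fun u hu _ => h hu⟩
  set O := ball u₀ (min r₁ (min r₂ r₃))
  have hO1 : O ⊆ ball u₀ r₁ := ball_subset_ball (min_le_left _ _)
  have hO2 : O ⊆ ball u₀ r₂ := ball_subset_ball ((min_le_right _ _).trans (min_le_left _ _))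
  have hO3 : O ⊆ ball u₀ r₃ := ball_subset_ball ((min_le_right _ _).trans (min_le_right _ _))
  have hOT : O ⊆ T := hO1.trans hr₁T
  have hO3' : O ×ˢ O ×ˢ ({0}ᶜ : Set 𝔼) ⊆ T ×ˢ T ×ˢ {0}ᶜ :=
    prod_mono hOT (prod_mono hOT subset_rfl)
  have hO2' : O ×ˢ ({0}ᶜ : Set 𝔼) ⊆ T ×ˢ {0}ᶜ := prod_mono hOT subset_rfl
  have hchi : ∀ u ∈ O, ∀ w ∈ O, ∀ q, 1 ≤ coordHam p (w, q) →
      coordFun p χ (u, w, q) = 1 := fun u hu w hw q hq => by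
    refine hone _ _ _ ?_ hq
    have a1 := h₃ u (hO3 hu) (hOT hu)
    have a2 := h₃ w (hO3 hw) (hOT hw)
    rw [dist_comm] at a2
    linarith [dist_triangle (σ[p] u) (σ[p] u₀) (σ[p] w)]
  have hhpos : ∀ w ∈ T, ∀ q, q ≠ 0 → 0 < coordHam p (w, q) :=
    fun w hw q hq => coordHam_pos hw hq
  have hpow : ∀ u ∈ O, ∀ w ∈ O, ∀ q, q ≠ 0 → 1 ≤ coordHam p (w, q) →
      coordFun p v (u, w, q) ^ 4 = ((density d p (σ[p] u) : ℂ) ^ 2)⁻¹ *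
          (density d p (σ[p] w) : ℂ) ^ 2 *
          (coordMixed p φ (u, w, q)).det ^ 2 := fun u hu w hw q hq hq1 => by
    refine hv.pow_four _ _ _ (hcov w (hOT hw) q hq) ?_ p p
      (κ[p].map_target (hOT hu)) (κ[p].map_target (hOT hw))
    exact (hchi u hu w hw q hq1).trans_ne one_ne_zero
  have hmix : ∀ u w : 𝔼, w ∈ T → ∀ q, q ≠ 0 → ∀ l : ℝ, 0 < l →
      coordMixed p φ (u, w, l • q) = coordMixed p φ (u, w, q) := fun u w hw q hq l hl => by
    rw [coordMixed, covec_smul, mixedDeriv_smul hφ.homogeneous _ _ _ _ (hcov w hw q hq) hl]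
    rfl
  have hvec : ∀ w ∈ T, ∀ q : 𝔼, q ≠ 0 → (coordHam p (w, q))⁻¹ • q ≠ 0 :=
    fun w hw q hq => smul_ne_zero (inv_ne_zero (hhpos w hw q hq).ne') hq
  have hvec1 : ∀ w ∈ T, ∀ q : 𝔼, q ≠ 0 →
      coordHam p (w, (coordHam p (w, q))⁻¹ • q) = 1 := fun w hw q hq => by
    have := hhpos w hw q hq
    rw [coordHam_smul p w q (inv_nonneg.2 this.le), inv_mul_cancel₀ this.ne']
  have hsmall : ∀ u ∈ O, ∀ w ∈ O, ∀ q, q ≠ 0 → 1 ≤ coordHam p (w, q) →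
      coordFun p v (u, w, q) = coordWeight p v (u, w, q) := fun u hu w hw q hq hq1 => by
    have hpos := hhpos w (hOT hw) q hq
    set q₁ := (coordHam p (w, q))⁻¹ • q with hq₁
    have hq₁0 : q₁ ≠ 0 := hvec w (hOT hw) q hq
    have hcont : ContinuousOn (fun t : ℝ => coordFun p v (u, w, t • q₁)) (Ici 1) := by
      refine (hv.smooth.contDiffOn p).continuousOn.comp (by fun_prop) fun t ht => ?_
      exact ⟨hOT hu, hOT hw, smul_ne_zero (zero_lt_one.trans_le ht).ne' hq₁0⟩
    have := eq_of_pow_eq_const isPreconnected_Ici hcont (n := 4) (by norm_num)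
      (a := ((density d p (σ[p] u) : ℂ) ^ 2)⁻¹ * (density d p (σ[p] w) : ℂ) ^ 2 *
          (coordMixed p φ (u, w, q₁)).det ^ 2) (fun t ht => by
        have ht0 : (0 : ℝ) < t := zero_lt_one.trans_le ht
        rw [hpow u hu w hw _ (smul_ne_zero ht0.ne' hq₁0), hmix u w (hOT hw) q₁ hq₁0 t ht0]
        rw [coordHam_smul p w q₁ ht0.le, hvec1 w (hOT hw) q hq, mul_one]
        exact ht) (t := coordHam p (w, q)) (t' := 1) hq1 (by simp)
    rw [one_smul, hq₁, smul_smul, mul_inv_cancel₀ hpos.ne', one_smul] at this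
    exact this
  have hO0 : u₀ ∈ O := mem_ball_self (lt_min hr₁ (lt_min hr₂ hr₃))
  have hhs := (contDiffOn_coordHam (d := d) p)
  refine ⟨O, hO0, hOT, ⟨isOpen_ball, hsm.mono hO3', fun u hu w hw => hhom u (hOT hu) w (hOT hw),
    fun u _ w hw q hq => hφ.im_nonneg _ _ _ (hcov w (hOT hw) q hq),
    fun u hu w hw => h₁ u (hO1 hu) w (hO1 hw), fun u hu w hw q hq => ?_, hhs.mono hO2',
    fun w hw => hhpos w (hOT hw), fun w _ q _ l hl => coordHam_smul p w q hl.le, ?_,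
    fun u _ w hw q hq l hl => ?_, ?_, fun u hu w hw q hq hq1 => ?_, fun u _ w hw q hq hq1 => ?_,
    (hs.smooth p).continuousOn.mono hO2', fun k => (hs.smooth_component k p).mono hO2',
    fun k w hw q hq l hl => ?_, fun N K hK hKO => hs.exists_bound p N hK (hKO.trans hOT)⟩,
    fun w hw q hq => hv.diagonal _ _ (hcov w (hOT hw) _ (hvec w (hOT hw) q hq)),
    fun u hu w hw q hq => ?_⟩
  · have := h₂ u (hO2 hu) w (hO2 hw) q hq
    have e : ((0 : 𝔼 →L[ℝ] 𝔼).prod ((-ContinuousLinearMap.id ℝ 𝔼).prod (0 : 𝔼 →L[ℝ] 𝔼))) q =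
      -((0, q, 0) : 𝔼 × 𝔼 × 𝔼) := by ext1 <;> simp
    rw [e, map_neg, Complex.neg_re] at this
    linarith
  · refine ContDiffOn.comp (g := coordFun p v) (f := fun z : 𝔼 × 𝔼 × 𝔼 =>
      (z.1, z.2.1, (coordHam p z.2)⁻¹ • z.2.2)) (hv.smooth.contDiffOn p) ?_
      fun z hz => ⟨hOT hz.1, hOT hz.2.1, hvec _ (hOT hz.2.1) _ hz.2.2⟩
    have h1 : SmoothOn (fun z : 𝔼 × 𝔼 × 𝔼 => coordHam p z.2) (O ×ˢ O ×ˢ {0}ᶜ) :=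
      (hhs.mono hO2').comp contDiffOn_snd fun z hz => hz.2
    exact contDiffOn_fst.prodMk ((contDiff_fst.comp contDiff_snd).contDiffOn.prodMk
      ((h1.inv fun z hz => (hhpos _ (hOT hz.2.1) _ hz.2.2).ne').smul
        (contDiff_snd.comp contDiff_snd).contDiffOn))
  · have hpos := hhpos w (hOT hw) q hq
    rw [coordWeight, coordWeight]
    simp only
    rw [coordHam_smul p w q hl.le, smul_smul]
    congr 3
    field_simp
  · exact ((hχ.smooth.contDiffOn p).continuousOn.mul (hv.smooth.contDiffOn p).continuousOn).mono
      hO3'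
  · rw [← hsmall u hu w hw q hq hq1]
    change coordFun p χ (u, w, q) * coordFun p v (u, w, q) = _
    rw [hchi u hu w hw q hq1, one_mul]
  · change coordFun p χ (u, w, q) * coordFun p v (u, w, q) = _
    rw [show coordFun p χ (u, w, q) = 0 from hχ.eq_zero _ _ _ (hcov w (hOT hw) q hq) hq1, zero_mul]
  · change c k _ (covec p _ (l • q)) = _
    rw [covec_smul, hs.homogeneous k _ _ (hcov w (hOT hw) q hq) l hl]
    rfl
  · have hpos := hhpos w (hOT hw) q hq
    rw [coordWeight]
    simp only
    rw [hpow u hu w hw _ (hvec w (hOT hw) q hq) (hvec1 w (hOT hw) q hq).ge,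
      hmix u w (hOT hw) q hq _ (inv_pos.2 hpos)]

end

section

lemma isBigO_pow_succ_of_hasDerivAt {E : Type*} [NormedAddCommGroup E] [NormedSpace ℝ E]
    {g g' : ℝ → E} {n : ℕ} (hg : ∀ᶠ t in 𝓝 (0 : ℝ), HasDerivAt g (g' t) t) (h0 : g 0 = 0)
    (h : g' =O[𝓝 0] fun t : ℝ => t ^ n) : g =O[𝓝 0] fun t : ℝ => t ^ (n + 1) := by
  obtain ⟨C, hC⟩ := h.bound
  obtain ⟨r, hr, hr'⟩ := eventually_nhds_iff_ball.1 (hg.and hC)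
  refine IsBigO.of_bound C ?_
  filter_upwards [ball_mem_nhds (0 : ℝ) hr] with t ht
  have hsub : ∀ x ∈ closedBall (0 : ℝ) |t|, x ∈ ball (0 : ℝ) r := fun x hx => by
    simp only [mem_closedBall, mem_ball, dist_zero_right, norm_eq_abs] at hx ht ⊢
    exact hx.trans_lt ht
  have hC0 : ∀ x ∈ closedBall (0 : ℝ) |t|, ‖g' x‖ ≤ C * |t| ^ n := fun x hx => by
    have h1 := (hr' x (hsub x hx)).2
    rcases le_or_gt 0 C with hC0 | hC0
    · refine h1.trans (mul_le_mul_of_nonneg_left ?_ hC0)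
      rw [norm_pow, norm_eq_abs]
      exact pow_le_pow_left₀ (abs_nonneg x) (by simpa using hx) n
    · have h2 := hr' t ht
      have h3 : ‖t ^ n‖ = 0 := by
        have := (norm_nonneg _).trans h2.2
        nlinarith [norm_nonneg (t ^ n)]
      have h4 : t = 0 ∧ n ≠ 0 := by
        rw [norm_eq_zero] at h3
        exact ⟨eq_zero_of_pow_eq_zero h3, fun hn => by simp [hn] at h3⟩
      have h5 : x = 0 := by simpa [h4.1] using hx
      rw [h5, zero_pow h4.2, norm_zero, mul_zero] at h1
      rw [h4.1, abs_zero, zero_pow h4.2, mul_zero, h5]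
      exact h1
  have := (convex_closedBall (0 : ℝ) |t|).norm_image_sub_le_of_norm_hasDerivWithin_le
    (fun x hx => (hr' x (hsub x hx)).1.hasDerivWithinAt) hC0
    (mem_closedBall_self (abs_nonneg t)) (y := t) (by simp)
  rw [h0, sub_zero, sub_zero] at this
  rw [norm_pow, pow_succ, ← mul_assoc]
  exact this

/-- The acceleration of geodesics, as a function of position and velocity. -/
def spray (p : M) (z : 𝔼 × 𝔼) : 𝔼 := -connection p z.1 z.2 z.2

/-- The third derivative of geodesics, as a function of position and velocity. -/
def jerk (p : M) (z : 𝔼 × 𝔼) : 𝔼 := fderiv ℝ (spray p) z (z.2, spray p z)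

lemma spray_smul (p : M) (u a : 𝔼) (t : ℝ) : spray p (u, t • a) = t ^ 2 • spray p (u, a) := by
  simp only [spray, connection_smul_left, connection_smul_right, smul_smul, smul_neg, sq]

lemma contDiffOn_spray (p : M) : SmoothOn (spray (d := d) p) (τ[p] ×ˢ univ) := by
  unfold spray
  exact (ContDiffOn.comp (g := fun z : 𝔼 × 𝔼 × 𝔼 => connection p z.1 z.2.1 z.2.2)
    (f := fun z : 𝔼 × 𝔼 => (z.1, z.2, z.2)) (contDiffOn_connection p) (by fun_prop)
      fun z hz => ⟨hz.1, trivial⟩).neg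

lemma isOpen_phaseSpace (p : M) :
    IsOpen (τ[p] ×ˢ (univ : Set 𝔼)) := (isOpen_extChartAt_target p).prod isOpen_univ

lemma contDiffOn_jerk (p : M) : SmoothOn (jerk (d := d) p) (τ[p] ×ˢ univ) :=
  ((contDiffOn_spray p).fderiv_of_isOpen (isOpen_phaseSpace p) (by simp)).clm_apply
    (contDiffOn_snd.prodMk (contDiffOn_spray p))

lemma differentiableAt_spray {p : M} {u : 𝔼} (hu : u ∈ τ[p]) (a : 𝔼) :
    DifferentiableAt ℝ (spray (d := d) p) (u, a) :=
  (hasFDerivAt_of_isOpen (contDiffOn_spray p) (isOpen_phaseSpace p) ⟨hu, trivial⟩).differentiableAt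

lemma jerk_smul {p : M} {u : 𝔼} (hu : u ∈ τ[p]) (a : 𝔼) (t : ℝ) :
    jerk p (u, t • a) = t ^ 3 • jerk p (u, a) := by
  have h1 : HasDerivAt (fun r : ℝ => spray p ((u, t • a) + r • (t • a, t ^ 2 • spray p (u, a))))
      (jerk p (u, t • a)) 0 := by
    have := (differentiableAt_spray hu (t • a)).hasFDerivAt.hasLineDerivAt
      (t • a, t ^ 2 • spray p (u, a))
    rw [← spray_smul p u a t] at this ⊢
    exact this
  have h2 : HasDerivAt (fun r : ℝ => spray p ((u, a) + r • (a, spray p (u, a))))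
      (jerk p (u, a)) 0 :=
    (differentiableAt_spray hu a).hasFDerivAt.hasLineDerivAt (a, spray p (u, a))
  have h3 : HasDerivAt (fun r : ℝ => t ^ 2 • spray p ((u, a) + (t * r) • (a, spray p (u, a))))
      (t ^ 2 • (t • jerk p (u, a))) 0 := by
    have h2' : HasDerivAt (fun r : ℝ => spray p ((u, a) + r • (a, spray p (u, a))))
      (jerk p (u, a)) (t * 0) := by simpa using h2
    have h4 : HasDerivAt (fun r : ℝ => t * r) t 0 := by
      simpa using (hasDerivAt_id (0 : ℝ)).const_mul t
    exact (HasDerivAt.scomp (0 : ℝ) h2' h4).const_smul (t ^ 2)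
  have h5 : (fun r : ℝ => spray p ((u, t • a) + r • (t • a, t ^ 2 • spray p (u, a)))) =
      fun r : ℝ => t ^ 2 • spray p ((u, a) + (t * r) • (a, spray p (u, a))) := by
    ext1 r
    have : (u, t • a) + r • (t • a, t ^ 2 • spray p (u, a)) =
        (u + (t * r) • a, t • (a + (t * r) • spray p (u, a))) := by
      rw [Prod.smul_mk, Prod.mk_add_mk, smul_add, smul_smul, smul_smul, smul_smul]
      ring_nf
    rw [this, spray_smul]
    rfl
  rw [h5] at h1
  rw [h1.unique h3, smul_smul]
  ring_nf

lemma IsCoordGeodesic.isBigO_sub_taylor {p : M} {δ : ℝ} (hδ : 0 < δ)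
    {c v ζ : ℝ → 𝔼} (h : IsCoordGeodesic p (Ioo (-δ) δ) c v ζ) :
    (fun t : ℝ => c t - (c 0 + t • v 0 + (t ^ 2 / 2) • spray p (c 0, v 0) +
      (t ^ 3 / 6) • jerk p (c 0, v 0))) =O[𝓝 0] fun t : ℝ => t ^ 4 := by
  have hI : Ioo (-δ) δ ∈ 𝓝 (0 : ℝ) := Ioo_mem_nhds (by linarith) hδ
  have h0 := mem_of_mem_nhds hI
  have hspray : ∀ t ∈ Ioo (-δ) δ, HasDerivAt (fun t => spray p (c t, v t))
      (jerk p (c t, v t)) t := fun t ht =>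
    (differentiableAt_spray (h.mem t ht) (v t)).hasFDerivAt.comp_hasDerivAt
      (f := fun t => (c t, v t)) t ((h.pos t ht).prodMk (h.vel t ht))
  have hjerk : DifferentiableAt ℝ (fun t => jerk p (c t, v t)) 0 := by
    have h1 : DifferentiableAt ℝ (jerk p) (c 0, v 0) :=
      (hasFDerivAt_of_isOpen (contDiffOn_jerk p) (isOpen_phaseSpace p) ⟨h.mem 0 h0,
        trivial⟩).differentiableAt
    exact (h1.hasFDerivAt.comp_hasDerivAt (f := fun t => (c t, v t)) 0
      ((h.pos 0 h0).prodMk (h.vel 0 h0))).differentiableAt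
  have e1 : (fun t => jerk p (c t, v t) - jerk p (c 0, v 0)) =O[𝓝 0] fun t : ℝ => t ^ 1 := by
    simpa using hjerk.isBigO_sub
  have e2 := isBigO_pow_succ_of_hasDerivAt (g := fun t => spray p (c t, v t) -
    (spray p (c 0, v 0) + t • jerk p (c 0, v 0))) (mem_of_superset hI fun t ht =>
      ((hspray t ht).sub (((hasDerivAt_id t).smul_const _).const_add _)).congr_deriv (by simp))
    (by simp) e1
  have e3 := isBigO_pow_succ_of_hasDerivAt (g := fun t => v t - (v 0 + t • spray p (c 0, v 0) +
    (t ^ 2 / 2) • jerk p (c 0, v 0))) (g' := fun t => spray p (c t, v t) -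
    (spray p (c 0, v 0) + t • jerk p (c 0, v 0))) (mem_of_superset hI fun t ht => by
      refine ((h.vel t ht).sub ((((hasDerivAt_id t).smul_const _).const_add _).add
        ((((hasDerivAt_id t).pow 2).div_const 2).smul_const _))).congr_deriv ?_
      simp [spray]) (by simp) e2
  refine isBigO_pow_succ_of_hasDerivAt (g' := fun t => v t - (v 0 + t • spray p (c 0, v 0) +
    (t ^ 2 / 2) • jerk p (c 0, v 0))) (mem_of_superset hI fun t ht => ?_) (by simp) e3
  refine ((h.pos t ht).sub (((((hasDerivAt_id t).smul_const _).const_add _).add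
        ((((hasDerivAt_id t).pow 2).div_const 2).smul_const _)).add
        ((((hasDerivAt_id t).pow 3).div_const 6).smul_const _))).congr_deriv ?_
  have : (3 * t ^ 2 / 6 : ℝ) = t ^ 2 / 2 := by ring
  simp [this]

/-- The third order Taylor polynomial of the exponential map at `u₀`, precomposed with `A`. -/
def normalMap (p : M) (u₀ : 𝔼) (A : 𝔼 →L[ℝ] 𝔼) (z : 𝔼) : 𝔼 :=
  u₀ + A z + (1 / 2 : ℝ) • spray p (u₀, A z) + (1 / 6 : ℝ) • jerk p (u₀, A z)

lemma contDiff_normalMap {p : M} {u₀ : 𝔼} (hu₀ : u₀ ∈ τ[p])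
    (A : 𝔼 →L[ℝ] 𝔼) : Smooth (normalMap p u₀ A) := by
  have h1 : Smooth fun z : 𝔼 => spray p (u₀, A z) := by
    exact contDiffOn_univ.1 (ContDiffOn.comp (g := spray p) (f := fun z : 𝔼 => (u₀, A z))
      (contDiffOn_spray p) (contDiff_const.prodMk A.contDiff).contDiffOn fun z _ => ⟨hu₀, trivial⟩)
  have h2 : Smooth fun z : 𝔼 => jerk p (u₀, A z) := by
    exact contDiffOn_univ.1 (ContDiffOn.comp (g := jerk p) (f := fun z : 𝔼 => (u₀, A z))
      (contDiffOn_jerk p) (contDiff_const.prodMk A.contDiff).contDiffOn fun z _ => ⟨hu₀, trivial⟩)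
  unfold normalMap
  exact ((contDiff_const.add A.contDiff).add (h1.const_smul _)).add (h2.const_smul _)

lemma normalMap_smul {p : M} {u₀ : 𝔼} (hu₀ : u₀ ∈ τ[p])
    (A : 𝔼 →L[ℝ] 𝔼) (t : ℝ) (z : 𝔼) : normalMap p u₀ A (t • z) = u₀ + t • A z +
    (t ^ 2 / 2) • spray p (u₀, A z) + (t ^ 3 / 6) • jerk p (u₀, A z) := by
  rw [normalMap, map_smul, spray_smul, jerk_smul hu₀, smul_smul, smul_smul]
  ring_nf

lemma normalMap_zero {p : M} {u₀ : 𝔼} (hu₀ : u₀ ∈ τ[p])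
    (A : 𝔼 →L[ℝ] 𝔼) : normalMap p u₀ A 0 = u₀ := by
  have := normalMap_smul hu₀ A 0 0
  simpa using this

lemma fderiv_normalMap_zero {p : M} {u₀ : 𝔼} (hu₀ : u₀ ∈ τ[p])
    (A : 𝔼 →L[ℝ] 𝔼) : fderiv ℝ (normalMap p u₀ A) 0 = A := by
  ext1 z
  have h1 := ((contDiff_normalMap hu₀ A).differentiable (by simp) 0).hasFDerivAt.hasLineDerivAt z
  have h2 : HasDerivAt (fun t : ℝ => u₀ + t • A z + (t ^ 2 / 2) • spray p (u₀, A z) +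
      (t ^ 3 / 6) • jerk p (u₀, A z)) (A z) 0 := by
    refine (((((hasDerivAt_id (0 : ℝ)).smul_const _).const_add _).add
        ((((hasDerivAt_id (0 : ℝ)).pow 2).div_const 2).smul_const _)).add
        ((((hasDerivAt_id (0 : ℝ)).pow 3).div_const 6).smul_const _)).congr_deriv ?_
    simp
  refine HasDerivAt.unique h1 ?_
  have h3 : (fun t : ℝ => normalMap p u₀ A (0 + t • z)) = _ :=
    funext fun t => (congrArg _ (zero_add _)).trans (normalMap_smul hu₀ A t z)
  rw [h3]
  exact h2

variable {ε : ℝ} {φ : M → CotFun d M}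

lemma IsLeviCivitaPhase.isBigO_normalMap {p : M} {u₀ : 𝔼} (hu₀ : u₀ ∈ τ[p]) (A : 𝔼 →L[ℝ] 𝔼)
    (hφ : IsLeviCivitaPhase ε φ) {q : 𝔼} (hq : q ≠ 0)
    (z : 𝔼) : (fun t : ℝ => coordFun p φ (normalMap p u₀ A (t • z), u₀, q) -
      (((t * inner ℝ q (A z) : ℝ) : ℂ) + I * ((ε / 2 * coordHam p (u₀, q) *
        (t ^ 2 * metricForm p u₀ (A z) (A z)) : ℝ) : ℂ))) =O[𝓝[>] 0] fun t : ℝ => t ^ 4 := by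
  obtain ⟨δ, hδ, c, v, ζ, h, hc0, hv0, hζ0⟩ := exists_isCoordGeodesic hu₀ (A z) q
  have hζ : ζ 0 ≠ 0 := hζ0 ▸ hq
  have h0 : (0 : ℝ) ∈ Ioo (-δ) δ := ⟨by linarith, hδ⟩
  have hev := (hφ.eventually_eq h hδ hζ).filter_mono
    (nhdsWithin_mono 0 (Ioi_subset_Ici_self (a := (0 : ℝ))))
  have hcF := h.isBigO_sub_taylor hδ
  rw [hc0, hv0] at hcF hev
  rw [hζ0] at hev
  have hstrict : HasStrictFDerivAt (coordFun p φ) (fderiv ℝ (coordFun p φ) (u₀, u₀, q))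
      (u₀, u₀, q) := by
    have hopen : IsOpen (τ[p] ×ˢ τ[p] ×ˢ ({0}ᶜ : Set 𝔼)) := (isOpen_extChartAt_target p).prod
        ((isOpen_extChartAt_target p).prod isOpen_compl_singleton)
    exact ((hφ.smooth.contDiffOn p).contDiffAt (hopen.mem_nhds (mk_mem_prod hu₀
      (mk_mem_prod hu₀ hq)))).hasStrictFDerivAt (by simp)
  have ht1 : Tendsto (fun t : ℝ => (normalMap p u₀ A (t • z), u₀, q)) (𝓝 0) (𝓝 (u₀, u₀, q)) := by
    have : Continuous fun t : ℝ => (normalMap p u₀ A (t • z), u₀, q) :=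
      ((contDiff_normalMap hu₀ A).continuous.comp (by fun_prop)).prodMk continuous_const
    simpa [normalMap_zero hu₀] using this.tendsto 0
  have ht2 : Tendsto (fun t : ℝ => (c t, u₀, q)) (𝓝 0) (𝓝 (u₀, u₀, q)) := by
    have h1 := (h.pos 0 h0).continuousAt.prodMk (continuousAt_const (y := (u₀, q)))
    rw [ContinuousAt] at h1
    rwa [hc0] at h1
  have h1 := hstrict.isBigO_sub.comp_tendsto (ht1.prodMk_nhds ht2)
  have h2 : (fun t : ℝ => coordFun p φ (normalMap p u₀ A (t • z), u₀, q) -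
      coordFun p φ (c t, u₀, q)) =O[𝓝 0] fun t : ℝ => t ^ 4 := by
    refine h1.trans (IsBigO.trans ?_ hcF)
    refine IsBigO.of_bound 1 (.of_forall fun t => ?_)
    simp only [Function.comp_apply, Prod.mk_sub_mk, sub_self, one_mul, normalMap_smul hu₀]
    rw [Prod.norm_def, ← norm_neg, neg_sub]
    simp
  refine (h2.mono nhdsWithin_le_nhds).congr' ?_ EventuallyEq.rfl
  filter_upwards [hev] with t ht
  rw [ht]

end

lemma det_matrix_of (X : 𝔼 →L[ℝ] 𝔼) :
    (Matrix.of fun i j : Fin d => X (stdVec j) i).det = X.det := by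
  have h : (Matrix.of fun i j : Fin d => X (stdVec j) i) =
      LinearMap.toMatrix (EuclideanSpace.basisFun (Fin d) ℝ).toBasis
        (EuclideanSpace.basisFun (Fin d) ℝ).toBasis (X : 𝔼 →ₗ[ℝ] 𝔼) := by
    ext i j
    simp [LinearMap.toMatrix_apply]
  rw [h, LinearMap.det_toMatrix]

lemma det_adjoint (X : 𝔼 →L[ℝ] 𝔼) : (adjoint X).det = X.det := by
  rw [← det_matrix_of, ← det_matrix_of, ← Matrix.det_transpose]
  congr 1
  ext i j
  have := adjoint_inner_left X (stdVec j) (stdVec i)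
  simpa [EuclideanSpace.inner_single_right, EuclideanSpace.inner_single_left] using this

open scoped MatrixOrder in
/-- An orthonormal coframe in the chart at `p`. -/
lemma exists_frame {p : M} {u : 𝔼} (hu : u ∈ τ[p]) :
    ∃ B : 𝔼 ≃L[ℝ] 𝔼, (∀ a b, metricForm p u a b = inner ℝ (B a) (B b)) ∧
      |(B : 𝔼 →L[ℝ] 𝔼).det| = density d p (σ[p] u) := by
  set G := metricMatrix (d := d) p (σ[p] u) with hG
  have hpd : G.PosDef := posDef_metricMatrix (κ[p].map_target hu)
  obtain ⟨b, hb⟩ := CStarAlgebra.nonneg_iff_eq_star_mul_self.mp hpd.posSemidef.nonneg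
  set L := Matrix.toEuclideanCLM (𝕜 := ℝ) b with hL
  have hin : ∀ x y, metricForm p u x y = inner ℝ (L x) (L y) := fun x y => by
    have h1 : adjoint L ∘L L = Matrix.toEuclideanCLM (𝕜 := ℝ) G := by
      rw [hb, map_mul, map_star]
      rfl
    rw [← adjoint_inner_right, ← ContinuousLinearMap.comp_apply, h1,
      metricForm_eq_matrixForm, ← hG, matrixForm_apply]
    simp only [PiLp.inner_apply, Matrix.ofLp_toEuclideanCLM, Matrix.mulVec, dotProduct,
      RCLike.inner_apply, conj_trivial, sum_mul]
    refine sum_congr rfl fun μ _ => sum_congr rfl fun ν _ => ?_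
    ring
  have hinj : Function.Injective L := by
    refine (injective_iff_map_eq_zero L).2 fun x hx => ?_
    by_contra h0
    have := metricForm_pos hu h0
    rw [hin, hx, inner_zero_left] at this
    exact lt_irrefl _ this
  set B := (LinearEquiv.ofInjectiveEndo (L : 𝔼 →ₗ[ℝ] 𝔼) hinj).toContinuousLinearEquiv
  have hBL : (B : 𝔼 →L[ℝ] 𝔼) = L := by
    ext1 x
    rfl
  refine ⟨B, fun x y => hin x y, ?_⟩
  have h1 : (B : 𝔼 →L[ℝ] 𝔼).det = b.det := by
    rw [hBL, ← det_matrix_of]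
    congr 1
    ext i j
    simp [hL, Matrix.ofLp_toEuclideanCLM]
  rw [h1, density, ← hG, hb, det_mul, Matrix.star_eq_conjTranspose,
    Matrix.det_conjTranspose, star_trivial, Real.sqrt_mul_self_eq_abs]

lemma coordHam_adjoint {p : M} {u : 𝔼} (hu : u ∈ τ[p])
    {B : 𝔼 ≃L[ℝ] 𝔼} (hB : ∀ a b, metricForm p u a b = inner ℝ (B a) (B b)) (θ : 𝔼) :
    coordHam p (u, ⟪B⟫† θ) = ‖θ‖ := by
  have hy := κ[p].map_target hu
  set y := σ[p] u
  set q := ⟪B⟫† θ with hq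
  set X : TangentSpace (𝓡 d) y := (coordDiff p y).inverse (B.symm θ) with hX
  have hXZ : ∀ a, inner ℝ X ((coordDiff p y).inverse a) = inner ℝ θ (B a) := fun a => by
    rw [hX, ← metricForm_apply, hB, B.apply_symm_apply]
  have h1 := sum_metricMatrix_inv_mul hy X
  have h2 : ∀ α, inner ℝ X (coordVec p y α) = q α := fun α => by
    rw [coordVec, hXZ]
    have := adjoint_inner_left (B : 𝔼 →L[ℝ] 𝔼) (stdVec α) θ
    rw [← hq] at this
    simpa [EuclideanSpace.inner_single_right] using this.symm
  simp only [h2] at h1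
  have h3 : ‖X‖ ^ 2 = ‖θ‖ ^ 2 := by
    rw [← real_inner_self_eq_norm_sq, ← real_inner_self_eq_norm_sq, hX, hXZ, B.apply_symm_apply]
  change √(cometric y (covec p y q)) = _
  rw [cometric_covec hy, h1, h3, sqrt_sq (norm_nonneg θ)]

/-- The matrix of mixed second derivatives of a function of two variables in `ℝᵈ`. -/
def mixedMatrix (f : 𝔼 × 𝔼 → ℂ) (x : 𝔼 × 𝔼) : Matrix (Fin d) (Fin d) ℂ :=
  Matrix.of fun i j => fderiv ℝ (fun x => fderiv ℝ f x (0, stdVec j)) x (stdVec i, 0)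

lemma mixedMatrix_eq {f : 𝔼 × 𝔼 → ℂ} {x : 𝔼 × 𝔼} (hf : ContDiffAt ℝ ∞ f x) (i j : Fin d) :
    mixedMatrix f x i j = fderiv ℝ (fderiv ℝ f) x (stdVec i, 0) (0, stdVec j) := by
  have h : DifferentiableAt ℝ (fderiv ℝ f) x :=
    (hf.fderiv_right (m := ∞) (by simp)).differentiableAt (by simp)
  have := (h.hasFDerivAt.clm_apply (hasFDerivAt_const ((0, stdVec j) : 𝔼 × 𝔼) x)).fderiv
  rw [mixedMatrix, of_apply, this]
  simp

lemma mixedMatrix_comp {Φ : 𝔼 × 𝔼 → ℂ} {F : 𝔼 → 𝔼} {L : 𝔼 →L[ℝ] 𝔼} {z θ : 𝔼}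
    (hF : Smooth F) (hΦ : ContDiffAt ℝ ∞ Φ (F z, L θ)) :
    mixedMatrix (fun x => Φ (F x.1, L x.2)) (z, θ) =
      ((Matrix.of fun i j : Fin d => fderiv ℝ F z (stdVec j) i).map ((↑) : ℝ → ℂ)).transpose *
        mixedMatrix Φ (F z, L θ) *
        (Matrix.of fun i j : Fin d => L (stdVec j) i).map ((↑) : ℝ → ℂ) := by
  have hG : Smooth fun x : 𝔼 × 𝔼 => (F x.1, L x.2) :=
    (hF.comp contDiff_fst).prodMk (L.contDiff.comp contDiff_snd)
  have hGd : ∀ x : 𝔼 × 𝔼, HasFDerivAt (fun x : 𝔼 × 𝔼 => (F x.1, L x.2))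
      (((fderiv ℝ F x.1).comp (ContinuousLinearMap.fst ℝ 𝔼 𝔼)).prod
        (L.comp (ContinuousLinearMap.snd ℝ 𝔼 𝔼))) x := fun x =>
    ((hF.differentiable (by simp) x.1).hasFDerivAt.comp x hasFDerivAt_fst).prodMk
      (L.hasFDerivAt.comp x hasFDerivAt_snd)
  have hev : ∀ᶠ x in 𝓝 (z, θ), DifferentiableAt ℝ Φ (F x.1, L x.2) := by
    have h1 : ∀ᶠ y in 𝓝 (F z, L θ), DifferentiableAt ℝ Φ y := by
      filter_upwards [(hΦ.of_le (m := 1) (by norm_cast)).eventually (by simp)] with y hy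
      exact hy.differentiableAt (by simp)
    exact (hG.continuous.tendsto (z, θ)).eventually h1
  have hD : DifferentiableAt ℝ (fderiv ℝ Φ) (F z, L θ) :=
    (hΦ.fderiv_right (m := ∞) (by simp)).differentiableAt (by simp)
  ext i j
  have h1 : (fun x : 𝔼 × 𝔼 => fderiv ℝ (fun x => Φ (F x.1, L x.2)) x (0, stdVec j)) =ᶠ[𝓝 (z, θ)]
      fun x => fderiv ℝ Φ (F x.1, L x.2) (0, L (stdVec j)) := by
    filter_upwards [hev] with x hx
    have := (hx.hasFDerivAt.comp x (hGd x)).fderiv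
    rw [show (fun x => Φ (F x.1, L x.2)) = Φ ∘ fun x : 𝔼 × 𝔼 => (F x.1, L x.2) from rfl, this]
    simp
  have h2 := ((HasFDerivAt.comp (g := fderiv ℝ Φ) (f := fun x : 𝔼 × 𝔼 => (F x.1, L x.2)) (z, θ)
    hD.hasFDerivAt (hGd (z, θ))).clm_apply
      (hasFDerivAt_const ((0, L (stdVec j)) : 𝔼 × 𝔼) (z, θ))).fderiv
  have h3 : mixedMatrix (fun x => Φ (F x.1, L x.2)) (z, θ) i j =
      fderiv ℝ (fderiv ℝ Φ) (F z, L θ) (fderiv ℝ F z (stdVec i), 0) (0, L (stdVec j)) := by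
    rw [mixedMatrix, of_apply, h1.fderiv_eq]
    refine (congrArg (fun X : 𝔼 × 𝔼 →L[ℝ] ℂ => X (stdVec i, 0)) h2).trans ?_
    simp
  set Q := fderiv ℝ (fderiv ℝ Φ) (F z, L θ) with hQ
  have h4 : ∀ a : 𝔼, ((a, 0) : 𝔼 × 𝔼) = ∑ α, a α • (stdVec α, 0) := fun a => by
    conv_lhs => rw [show ((a, 0) : 𝔼 × 𝔼) = ContinuousLinearMap.inl ℝ 𝔼 𝔼 a from rfl,
      eq_sum_stdVec a, map_sum]
    exact sum_congr rfl fun α _ => map_smul _ _ _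
  have h5 : ∀ a : 𝔼, ((0, a) : 𝔼 × 𝔼) = ∑ α, a α • (0, stdVec α) := fun a => by
    conv_lhs => rw [show ((0, a) : 𝔼 × 𝔼) = ContinuousLinearMap.inr ℝ 𝔼 𝔼 a from rfl,
      eq_sum_stdVec a, map_sum]
    exact sum_congr rfl fun α _ => map_smul _ _ _
  rw [h3, h4, h5, Matrix.mul_apply, map_sum]
  simp only [map_smul, map_sum, _root_.sum_apply, _root_.smul_apply, Matrix.mul_apply,
    Matrix.transpose_apply, Matrix.map_apply, of_apply, mixedMatrix_eq hΦ, ← hQ,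
    real_smul, sum_mul, mul_sum]
  refine sum_congr rfl fun α _ => sum_congr rfl fun β _ => ?_
  ring

lemma hasDerivAt_norm_line {θ : 𝔼} (hθ : θ ≠ 0) (v : 𝔼) :
    HasDerivAt (fun r : ℝ => ‖θ + r • v‖) (inner ℝ θ v / ‖θ‖) 0 := by
  have h1 : HasDerivAt (fun r : ℝ => θ + r • v) v 0 := by
    simpa using ((hasDerivAt_id (0 : ℝ)).smul_const v).const_add θ
  have h2 := h1.norm_sq.sqrt (by simpa using hθ)
  simp only [sqrt_sq (norm_nonneg _)] at h2
  refine h2.congr_deriv ?_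
  have : ‖θ‖ ≠ 0 := norm_ne_zero_iff.2 hθ
  simp
  field_simp

/-- The mixed derivatives of a function whose jet is that of a Levi-Civita phase function. -/
lemma isBigO_mixedMatrix {a ε : ℝ} (ha : 0 < a) {f : 𝔼 × 𝔼 → ℂ} (hf : SmoothOn f (ball 0 a ×ˢ {0}ᶜ))
    (hjet : ∀ z θ, θ ≠ 0 → (fun t : ℝ => f (t • z, θ) - (t * (inner ℝ z θ : ℝ) +
      I * ε / 2 * t ^ 2 * ‖θ‖ * ‖z‖ ^ 2)) =O[𝓝[>] 0] fun t : ℝ => t ^ 4)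
    (z : 𝔼) {θ : 𝔼} (hθ : θ ≠ 0) (i j : Fin d) :
    (fun t : ℝ => mixedMatrix f (t • z, θ) i j - ((if i = j then 1 else 0) +
      I * ε * t * ((z i * θ j / ‖θ‖ : ℝ) : ℂ))) =O[𝓝[>] 0] fun t : ℝ => t ^ 3 := by
  set U : Set (ℝ × 𝔼 × 𝔼) := (fun x => (x.1 • x.2.1, x.2.2)) ⁻¹' (ball 0 a ×ˢ {0}ᶜ)
  have hopen : IsOpen (ball (0 : 𝔼) a ×ˢ ({0}ᶜ : Set 𝔼)) := isOpen_ball.prod isOpen_compl_singleton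
  have hUo : IsOpen U := hopen.preimage (by fun_prop)
  set S : ℝ × 𝔼 × 𝔼 → ℂ := fun x => f (x.1 • x.2.1, x.2.2) - (((x.1 * inner ℝ x.2.1 x.2.2 : ℝ) : ℂ)
    +
    I * ε / 2 * ((x.1 ^ 2 * ‖x.2.2‖ * ‖x.2.1‖ ^ 2 : ℝ) : ℂ)) with hS
  have hSs : SmoothOn S U := by
    refine (hf.comp (f := fun x : ℝ × 𝔼 × 𝔼 => (x.1 • x.2.1, x.2.2)) (by fun_prop)
      fun x hx => hx).sub ?_
    have h1 : SmoothOn (fun x : ℝ × 𝔼 × 𝔼 => ‖x.2.2‖) U :=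
      ContDiffOn.norm ℝ (contDiff_snd.comp contDiff_snd).contDiffOn fun x hx => hx.2
    have h2 : SmoothOn (fun x : ℝ × 𝔼 × 𝔼 => ‖x.2.1‖ ^ 2) U :=
      (contDiff_fst.comp contDiff_snd).contDiffOn.norm_sq ℝ
    have h3 : SmoothOn (fun x : ℝ × 𝔼 × 𝔼 => x.1 * inner ℝ x.2.1 x.2.2) U :=
      contDiff_fst.contDiffOn.mul ((contDiff_fst.comp contDiff_snd).inner ℝ
        (contDiff_snd.comp contDiff_snd)).contDiffOn
    exact (ofRealCLM.contDiff.comp_contDiffOn h3).add (contDiffOn_const.mul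
      (ofRealCLM.contDiff.comp_contDiffOn (((contDiff_fst.pow 2).contDiffOn.mul h1).mul h2)))
  have hfd : ∀ x ∈ ball (0 : 𝔼) a ×ˢ ({0}ᶜ : Set 𝔼), ContDiffAt ℝ ∞ f x := fun x hx =>
    hf.contDiffAt (hopen.mem_nhds hx)
  have hUj : ∀ z' θ', θ' ≠ 0 → ((0 : ℝ), (z', θ')) ∈ U := fun z' θ' h => by
    refine ⟨?_, h⟩
    simpa using ha
  have hne : ∀ᶠ q : 𝔼 × 𝔼 in 𝓝 (z, θ), q.2 ≠ 0 := continuousAt_snd.eventually_ne hθ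
  set D : ℝ × 𝔼 × 𝔼 → ℂ := dirDeriv ((0 : ℝ), ((0 : 𝔼), (stdVec j : 𝔼))) S
  have hO1 : ∀ᶠ q : 𝔼 × 𝔼 in 𝓝 (z, θ), (fun t : ℝ => D (t, q)) =O[𝓝[>] 0]
      fun t : ℝ => t ^ (3 + 1) := by
    filter_upwards [hne] with q hq
    refine isBigO_dirDeriv hUo hSs 3 (hUj q.1 q.2 hq) ?_ _
    have : ∀ᶠ q' : 𝔼 × 𝔼 in 𝓝 q, q'.2 ≠ 0 := continuousAt_snd.eventually_ne hq
    filter_upwards [this] with q' hq'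
    refine (hjet q'.1 q'.2 hq').congr_left fun t => ?_
    simp only [hS]
    push_cast
    ring
  have hO2 := isBigO_dirDeriv hUo (ContDiffOn.dirDeriv hUo hSs _) 3 (hUj z θ hθ) hO1 (stdVec i, 0)
  have hDeq : ∀ x ∈ U, D x = fderiv ℝ f (x.1 • x.2.1, x.2.2) (0, stdVec j) -
      (((x.1 * x.2.1 j : ℝ) : ℂ) + I * ε / 2 *
        ((x.1 ^ 2 * (x.2.2 j / ‖x.2.2‖) * ‖x.2.1‖ ^ 2 : ℝ) : ℂ)) := by
    rintro ⟨t, w, q⟩ hx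
    have e1 := (hasFDerivAt_of_isOpen hSs hUo hx).hasLineDerivAt ((0 : ℝ), ((0 : 𝔼), (stdVec j :
      𝔼)))
    have e2 := ((hfd _ hx).differentiableAt (by simp)).hasFDerivAt.hasLineDerivAt
      ((0 : 𝔼), (stdVec j : 𝔼))
    have e3 : HasDerivAt (fun r : ℝ => t * inner ℝ w (q + r • stdVec j)) (t * w j) 0 := by
      have := (((hasDerivAt_id (0 : ℝ)).smul_const (stdVec j : 𝔼)).const_add q)
      have := ((hasDerivAt_const (0 : ℝ) w).inner ℝ this).const_mul t
      refine this.congr_deriv ?_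
      simp [EuclideanSpace.inner_single_right]
    have e4 := ((hasDerivAt_norm_line hx.2 (stdVec j)).const_mul (t ^ 2)).mul_const (‖w‖ ^ 2)
    have e5 := HasDerivAt.sub e2 (e3.ofReal_comp.add (e4.ofReal_comp.const_mul (I * ε / 2)))
    have e6 : (fun r : ℝ => S ((t, w, q) + r • ((0 : ℝ), ((0 : 𝔼), (stdVec j : 𝔼))))) =
      fun r : ℝ => f ((t • w, q) + r • ((0 : 𝔼), (stdVec j : 𝔼))) -
        (((t * inner ℝ w (q + r • stdVec j) : ℝ) : ℂ) + I * ε / 2 *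
          ((t ^ 2 * ‖q + r • stdVec j‖ * ‖w‖ ^ 2 : ℝ) : ℂ)) := by
      ext1 r
      simp [hS]
    have e7 : HasDerivAt (fun r : ℝ => S ((t, w, q) + r • ((0 : ℝ), ((0 : 𝔼), (stdVec j : 𝔼)))))
      (D (t, w, q)) 0 := e1
    rw [e6] at e7
    refine (e7.unique e5).trans ?_
    simp [EuclideanSpace.inner_single_right]
  have hball : ∀ᶠ t : ℝ in 𝓝[>] 0, (t, z, θ) ∈ U := by
    have hc : Continuous fun t : ℝ => (t, z, θ) := by fun_prop
    exact (hc.continuousAt.eventually (hUo.mem_nhds (hUj z θ hθ))).filter_mono nhdsWithin_le_nhds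
  have hmain : (fun t : ℝ => (t : ℂ) * (mixedMatrix f (t • z, θ) i j - ((if i = j then 1 else 0) +
      I * ε * t * ((z i * θ j / ‖θ‖ : ℝ) : ℂ)))) =O[𝓝[>] 0] fun t : ℝ => t ^ 4 := by
    refine hO2.congr' ?_ EventuallyEq.rfl
    filter_upwards [hball] with t ht
    have e1 := (hasFDerivAt_of_isOpen (ContDiffOn.dirDeriv hUo hSs ((0 : ℝ), ((0 : 𝔼), (stdVec j :
      𝔼)))) hUo ht).hasLineDerivAt ((0 : ℝ), ((stdVec i : 𝔼), (0 : 𝔼)))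
    have e1' : HasDerivAt (fun r : ℝ => D ((t, z, θ) + r • ((0 : ℝ), ((stdVec i : 𝔼), (0 : 𝔼)))))
      (dirDeriv ((0 : ℝ), ((stdVec i : 𝔼), (0 : 𝔼))) D (t, z, θ)) 0 := e1
    have hfd2 : DifferentiableAt ℝ (fun x => fderiv ℝ f x (0, stdVec j)) (t • z, θ) :=
      (((hfd _ ht).fderiv_right (m := ∞) (by simp)).clm_apply contDiffAt_const).differentiableAt
        (by simp)
    have e2 := hfd2.hasFDerivAt.hasLineDerivAt (t • ((stdVec i : 𝔼), (0 : 𝔼)))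
    have e3 : HasDerivAt (fun r : ℝ => t * (z j + r * (stdVec i : 𝔼) j)) (t * (stdVec i : 𝔼) j) 0 :=
      by
      simpa using (((hasDerivAt_id (0 : ℝ)).mul_const ((stdVec i : 𝔼) j)).const_add (z j)).const_mul
        t
    have e4 : HasDerivAt (fun r : ℝ => t ^ 2 * (θ j / ‖θ‖) * ‖z + r • stdVec i‖ ^ 2)
        (t ^ 2 * (θ j / ‖θ‖) * (2 * z i)) 0 := by
      have := (((hasDerivAt_id (0 : ℝ)).smul_const (stdVec i : 𝔼)).const_add z).norm_sq.const_mul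
        (t ^ 2 * (θ j / ‖θ‖))
      refine this.congr_deriv ?_
      simp [EuclideanSpace.inner_single_right]
    have e5 := HasDerivAt.sub e2 (e3.ofReal_comp.add (e4.ofReal_comp.const_mul (I * ε / 2)))
    have hc : ContinuousAt (fun r : ℝ => (t, z, θ) + r • ((0 : ℝ), ((stdVec i : 𝔼), (0 : 𝔼)))) 0 :=
      by
      fun_prop
    have e6 := (e1'.congr_of_eventuallyEq (f₁ := fun r : ℝ => fderiv ℝ f ((t • z, θ) +
        r • t • ((stdVec i : 𝔼), (0 : 𝔼))) (0, stdVec j) - (((t * (z j + r * (stdVec i : 𝔼) j) : ℝ)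
          : ℂ) +
        I * ε / 2 * ((t ^ 2 * (θ j / ‖θ‖) * ‖z + r • stdVec i‖ ^ 2 : ℝ) : ℂ))) (by
      filter_upwards [hc.eventually (hUo.mem_nhds (by simpa using ht))] with r hr
      rw [hDeq _ hr]
      simp [smul_comm r t])).unique e5
    rw [e6, map_smul, mixedMatrix, of_apply]
    simp [eq_comm (a := j)]
    split_ifs <;> push_cast <;> ring
  obtain ⟨C, hC⟩ := hmain.bound
  refine IsBigO.of_bound C ?_
  filter_upwards [hC, self_mem_nhdsWithin] with t ht ht0
  have ht0 : (0 : ℝ) < t := ht0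
  rw [norm_mul, norm_real, norm_pow, norm_of_nonneg ht0.le] at ht
  rw [norm_pow, norm_of_nonneg ht0.le]
  refine le_of_mul_le_mul_left (ht.trans_eq (by ring)) ht0

lemma isBigO_det_sub {N : ℝ → Matrix (Fin d) (Fin d) ℂ} {l : Filter ℝ} (hl : l ≤ 𝓝 0) {κ : ℂ}
    {z θ : Fin d → ℂ}
    (hN : ∀ i j, (fun t : ℝ => N t i j - ((if i = j then 1 else 0) + κ * t * (z i * θ j))) =O[l]
      fun t : ℝ => t ^ 3) :
    (fun t : ℝ => (N t).det - (1 + κ * t * ∑ i, z i * θ i)) =O[l] fun t : ℝ => t ^ 3 := by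
  set P : ℝ → Fin d → Fin d → ℂ := fun t i j => (if i = j then 1 else 0) + κ * t * (z i * θ j) with
    hP
  have hdet : ContDiff ℝ 1 fun X : Fin d → Fin d → ℂ => (Matrix.of X).det := by
    rw [← contDiffOn_univ]
    exact contDiffOn_det fun i j => by
      simp only [of_apply]
      fun_prop
  have hPc : Tendsto P l (𝓝 (P 0)) := by
    have : Continuous P := by fun_prop
    exact (this.tendsto 0).mono_left hl
  have hO : (fun t => (fun i j => N t i j : Fin d → Fin d → ℂ) - P t) =O[l] fun t : ℝ => t ^ 3 :=
    isBigO_pi.2 fun i => isBigO_pi.2 fun j => hN i j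
  have hNc : Tendsto (fun t => (fun i j => N t i j : Fin d → Fin d → ℂ)) l (𝓝 (P 0)) := by
    have h0 : Tendsto (fun t : ℝ => t ^ 3) l (𝓝 0) := by
      have : Continuous fun t : ℝ => t ^ 3 := by fun_prop
      simpa using (this.tendsto 0).mono_left hl
    simpa using (hO.trans_tendsto h0).add hPc
  have h1 := (hdet.contDiffAt (x := P 0)).hasStrictFDerivAt (by simp)
  have h2 := (h1.isBigO_sub.comp_tendsto (hNc.prodMk_nhds hPc)).trans hO
  refine h2.congr_left fun t => ?_
  have h3 : (Matrix.of (P t)).det = 1 + κ * t * ∑ i, z i * θ i := by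
    have := Matrix.det_one_add_replicateCol_mul_replicateRow (ι := Unit) (fun i => κ * t * z i) θ
    have e : (1 + Matrix.replicateCol Unit (fun i => κ * t * z i) * Matrix.replicateRow Unit θ :
        Matrix (Fin d) (Fin d) ℂ) = Matrix.of (P t) := by
      ext i j
      simp [Matrix.mul_apply, Matrix.one_apply, hP, mul_assoc]
    rw [e] at this
    rw [this, dotProduct, mul_sum]
    congr 1
    exact sum_congr rfl fun i _ => by ring
  change (N t).det - (Matrix.of (P t)).det = _
  rw [h3]

/-- The second order expansion of a branch of `(E²)^{1/4}`. -/
lemma isBigO_fourth_root {l : Filter ℝ} (hl : l ≤ 𝓝 0) {W E : ℝ → ℂ} {κ : ℂ}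
    (hW : Tendsto W l (𝓝 1)) (hpow : ∀ᶠ t in l, W t ^ 4 = E t ^ 2)
    (hE : (fun t : ℝ => E t - (1 + κ * t)) =O[l] fun t : ℝ => t ^ 3) :
    (fun t : ℝ => W t - (1 + κ / 2 * t - κ ^ 2 / 8 * t ^ 2)) =O[l] fun t : ℝ => t ^ 3 := by
  have hcont : ∀ {g : ℝ → ℂ}, Continuous g → Tendsto g l (𝓝 (g 0)) := fun hg =>
    (hg.tendsto 0).mono_left hl
  have h0 : Tendsto (fun t : ℝ => t ^ 3) l (𝓝 0) := by
    have : Continuous fun t : ℝ => t ^ 3 := by fun_prop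
    simpa using (this.tendsto 0).mono_left hl
  have hE1 : Tendsto E l (𝓝 1) := by
    simpa using (hE.trans_tendsto h0).add (hcont (g := fun t : ℝ => 1 + κ * t) (by fun_prop))
  have hsq : ∀ᶠ t in l, W t ^ 2 = E t := by
    have : Tendsto (fun t => W t ^ 2 + E t) l (𝓝 (1 ^ 2 + 1)) := (hW.pow 2).add hE1
    filter_upwards [hpow, this.eventually_ne (show (1 ^ 2 + 1 : ℂ) ≠ 0 by norm_num)] with t h1 h2
    have : (W t ^ 2 - E t) * (W t ^ 2 + E t) = 0 := by linear_combination h1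
    exact sub_eq_zero.1 ((mul_eq_zero.1 this).resolve_right h2)
  set P : ℝ → ℂ := fun t => 1 + κ / 2 * t - κ ^ 2 / 8 * t ^ 2 with hP
  have hP1 : Tendsto (fun t => W t + P t) l (𝓝 (1 + 1)) := by
    refine hW.add ?_
    simpa [hP] using hcont (g := P) (by fun_prop)
  have hq : (fun t : ℝ => E t - P t ^ 2) =O[l] fun t : ℝ => t ^ 3 := by
    have h1 : (fun t : ℝ => ((t ^ 3 : ℝ) : ℂ) * (κ ^ 3 / 8 - κ ^ 4 / 64 * t)) =O[l]
        fun t : ℝ => t ^ 3 := by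
      have h2 : (fun t : ℝ => κ ^ 3 / 8 - κ ^ 4 / 64 * t) =O[l] fun _ => (1 : ℝ) :=
        (hcont (g := fun t : ℝ => κ ^ 3 / 8 - κ ^ 4 / 64 * t) (by fun_prop)).isBigO_one ℝ
      have h3 : (fun t : ℝ => ((t ^ 3 : ℝ) : ℂ)) =O[l] fun t : ℝ => t ^ 3 :=
        IsBigO.of_bound 1 (.of_forall fun t => by simp)
      simpa using h3.mul h2
    refine (hE.add h1).congr_left fun t => ?_
    simp only [hP]
    push_cast
    ring
  have hinv : (fun t => (W t + P t)⁻¹) =O[l] fun _ => (1 : ℝ) :=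
    (hP1.inv₀ (by norm_num)).isBigO_one ℝ
  refine ((hinv.mul hq).congr' ?_ (.of_forall fun t => one_mul _))
  filter_upwards [hsq, hP1.eventually_ne (show (1 + 1 : ℂ) ≠ 0 by norm_num)] with t h1 h2
  rw [← h1, inv_mul_eq_iff_eq_mul₀ h2]
  ring

/-- The transport of a test function by a diffeomorphism onto its image. -/
lemma exists_pushforward {F : 𝔼 → 𝔼} (hF : Smooth F) {N : Set 𝔼} (hN : IsOpen N)
    (hinj : InjOn F N) (hdet : ∀ z ∈ N, (fderiv ℝ F z).det ≠ 0) {k : 𝔼 → ℂ}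
    (hk : Smooth k) (hkc : HasCompactSupport k) (hkN : tsupport k ⊆ N) :
    ∃ g : 𝔼 → ℂ, Smooth g ∧ HasCompactSupport g ∧ tsupport g ⊆ F '' tsupport k ∧
      (∀ z ∈ N, g (F z) = k z) ∧
      ∀ H : 𝔼 → ℂ, ∫ u, H u * g u = ∫ z, ((|(fderiv ℝ F z).det| : ℝ) : ℂ) * (H (F z) * k z) := by
  classical
  set g : 𝔼 → ℂ := fun u => if u ∈ F '' N then k (Function.invFunOn F N u) else 0 with hg
  have hgF : ∀ z ∈ N, g (F z) = k z := fun z hz => by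
    have h1 : F z ∈ F '' N := mem_image_of_mem F hz
    have h2 : Function.invFunOn F N (F z) = z :=
      hinj (Function.invFunOn_mem h1) hz (Function.invFunOn_eq h1)
    simp only [hg, if_pos h1, h2]
  have hsupp : Function.support g ⊆ F '' tsupport k := fun u hu => by
    by_cases h : u ∈ F '' N
    · obtain ⟨z, hz, rfl⟩ := h
      refine mem_image_of_mem F (subset_tsupport k ?_)
      rwa [Function.mem_support, hgF z hz] at hu
    · exact absurd (by simp only [hg, if_neg h]) hu
  have hK : IsCompact (F '' tsupport k) := hkc.isCompact.image hF.continuous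
  have htsupp : tsupport g ⊆ F '' tsupport k := closure_minimal hsupp hK.isClosed
  refine ⟨g, contDiff_iff_contDiffAt.2 fun u => ?_, hK.of_isClosed_subset (isClosed_tsupport g)
    htsupp, htsupp, hgF, fun H => ?_⟩
  · by_cases hu : u ∈ F '' tsupport k
    · obtain ⟨z, hz, rfl⟩ := hu
      set E := (fderiv ℝ F z).toContinuousLinearEquivOfDetNeZero (hdet z (hkN hz))
      have hd : HasFDerivAt F (E : 𝔼 →L[ℝ] 𝔼) z := (hF.differentiable (by simp) z).hasFDerivAt
      have hs : HasStrictFDerivAt F (E : 𝔼 →L[ℝ] 𝔼) z :=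
        (hF.contDiffAt (x := z)).hasStrictFDerivAt' hd (by simp)
      have hinv := (hF.contDiffAt (x := z)).to_localInverse hd (by simp)
      have h0 : hs.localInverse F E z (F z) = z := hs.localInverse_apply_image
      have hcont : Tendsto (hs.localInverse F E z) (𝓝 (F z)) (𝓝 z) := hs.localInverse_tendsto
      have hev : g =ᶠ[𝓝 (F z)] k ∘ hs.localInverse F E z := by
        filter_upwards [hcont (hN.mem_nhds (hkN hz)), hs.eventually_right_inverse] with u h1 h2
        rw [Function.comp_apply, ← hgF _ h1, h2]
      exact ((hk.contDiffAt (x := hs.localInverse F E z (F z))).comp (F z)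
        hinv).congr_of_eventuallyEq
        hev
    · refine (contDiffAt_const (c := (0 : ℂ))).congr_of_eventuallyEq ?_
      filter_upwards [hK.isClosed.isOpen_compl.mem_nhds hu] with u' hu'
      by_contra h
      exact hu' (hsupp h)
  · have h1 : ∫ u, H u * g u = ∫ u in F '' N, H u * g u := by
      refine (setIntegral_eq_integral_of_forall_compl_eq_zero fun u hu => ?_).symm
      simp only [hg, if_neg hu, mul_zero]
    have h2 : ∫ z, ((|(fderiv ℝ F z).det| : ℝ) : ℂ) * (H (F z) * k z) =
        ∫ z in N, ((|(fderiv ℝ F z).det| : ℝ) : ℂ) * (H (F z) * k z) := by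
      refine (setIntegral_eq_integral_of_forall_compl_eq_zero fun z hz => ?_).symm
      rw [image_eq_zero_of_notMem_tsupport (fun h => hz (hkN h)), mul_zero, mul_zero]
    rw [h1, h2, integral_image_eq_integral_abs_det_fderiv_smul volume hN.measurableSet
      (fun z _ => (hF.differentiable (by simp) z).hasFDerivAt.hasFDerivWithinAt) hinj]
    refine setIntegral_congr_fun hN.measurableSet fun z hz => ?_
    simp only [hgF z hz, real_smul]

section

variable {ε : ℝ} {φ χ v : M → CotFun d M} {s : CotFun d M}
  {c : ℕ → CotFun d M}

lemma coordMixed_eq_mixedMatrix (hφ : IsLeviCivitaPhase ε φ) {p : M} {u w q : 𝔼}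
    (hu : u ∈ τ[p]) (hw : w ∈ τ[p]) (hq : q ≠ 0) :
    coordMixed p φ (u, w, q) = mixedMatrix (fun x : 𝔼 × 𝔼 => coordFun p φ (x.1, w, x.2)) (u, q) :=
      by
  set T := τ[p]
  have hT : IsOpen T := isOpen_extChartAt_target p
  have hopen : IsOpen (T ×ˢ ({0}ᶜ : Set 𝔼)) := hT.prod isOpen_compl_singleton
  set Φ := fun x : 𝔼 × 𝔼 => coordFun p φ (x.1, w, x.2) with hΦ
  have hs : SmoothOn Φ (T ×ˢ {0}ᶜ) := (hφ.smooth.contDiffOn p).comp (by fun_prop)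
    fun x hx => ⟨hx.1, hw, hx.2⟩
  have hsm : ∀ u' ∈ T, ContDiffAt ℝ ∞ Φ (u', q) := fun u' hu' =>
    hs.contDiffAt (hopen.mem_nhds (mk_mem_prod hu' hq))
  ext α β
  have h1 : ∀ᶠ t : ℝ in 𝓝 0, deriv (fun τ : ℝ =>
      coordFun p φ (u + t • stdVec α, w, q + τ • stdVec β)) 0 =
      fderiv ℝ Φ ((u, q) + t • ((stdVec α : 𝔼), (0 : 𝔼))) (0, stdVec β) := by
    have hc : ContinuousAt (fun t : ℝ => u + t • (stdVec α : 𝔼)) 0 := by fun_prop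
    filter_upwards [hc.eventually (hT.mem_nhds (by simpa))] with t ht
    have h2 := ((hsm _ ht).differentiableAt (by simp)).hasFDerivAt.hasLineDerivAt
      ((0 : 𝔼), (stdVec β : 𝔼))
    have h3 : HasDerivAt (fun τ : ℝ => Φ ((u + t • stdVec α, q) + τ • ((0 : 𝔼), (stdVec β : 𝔼))))
      (fderiv ℝ Φ (u + t • stdVec α, q) ((0 : 𝔼), (stdVec β : 𝔼))) 0 := h2
    have h4 := h3.deriv
    simpa [hΦ] using h4
  rw [coordMixed_apply p φ q hu, EventuallyEq.deriv_eq h1, mixedMatrix, of_apply]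
  have h5 : DifferentiableAt ℝ (fun x => fderiv ℝ Φ x ((0 : 𝔼), (stdVec β : 𝔼))) (u, q) :=
    (((hsm u hu).fderiv_right (m := ∞) (by simp)).clm_apply contDiffAt_const).differentiableAt
      (by simp)
  exact HasDerivAt.deriv (h5.hasFDerivAt.hasLineDerivAt ((stdVec α : 𝔼), (0 : 𝔼)))

/-- The Riemannian density in the coordinates given by `normalMap`. -/
def normalDensity (p : M) (u₀ : 𝔼) (A : 𝔼 →L[ℝ] 𝔼) (z : 𝔼) : ℝ :=
  √((metricMatrix (d := d) p (σ[p] (normalMap p u₀ A z))).det *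
    (fderiv ℝ (normalMap p u₀ A) z).det ^ 2)

lemma normalDensity_eq (p : M) (u₀ : 𝔼) (A : 𝔼 →L[ℝ] 𝔼) (z : 𝔼) :
    normalDensity p u₀ A z = density d p (σ[p] (normalMap p u₀ A z)) *
      |(fderiv ℝ (normalMap p u₀ A) z).det| := by
  rw [normalDensity, Real.sqrt_mul' _ (sq_nonneg _), Real.sqrt_sq_eq_abs]
  rfl

lemma density_pos {p y : M} (hy : y ∈ κ[p].source) : 0 < density d p y :=
  sqrt_pos.2 (posDef_metricMatrix hy).det_pos

lemma normalDensity_pos {p : M} {u₀ : 𝔼} {A : 𝔼 →L[ℝ] 𝔼} {z : 𝔼} (hz : normalMap p u₀ A z ∈ τ[p])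
    (hdet : (fderiv ℝ (normalMap p u₀ A) z).det ≠ 0) : 0 < normalDensity p u₀ A z := by
  rw [normalDensity_eq]
  exact mul_pos (density_pos (κ[p].map_target hz)) (abs_pos.2 hdet)

lemma contDiff_det_fderiv {F : 𝔼 → 𝔼} (hF : Smooth F) : Smooth fun z => (fderiv ℝ F z).det := by
  simp only [← det_matrix_of]
  rw [← contDiffOn_univ]
  refine contDiffOn_det fun i j => contDiffOn_univ.2 ?_
  simp only [of_apply]
  exact (EuclideanSpace.proj i : 𝔼 →L[ℝ] ℝ).contDiff.comp
    ((hF.fderiv_right (m := ∞) (by simp)).clm_apply contDiff_const)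

lemma contDiffOn_normalDensity {p : M} {u₀ : 𝔼} (hu₀ : u₀ ∈ τ[p]) (A : 𝔼 →L[ℝ] 𝔼) {N : Set 𝔼}
    (hN : ∀ z ∈ N, normalMap p u₀ A z ∈ τ[p])
    (hdet : ∀ z ∈ N, (fderiv ℝ (normalMap p u₀ A) z).det ≠ 0) :
    SmoothOn (normalDensity p u₀ A) N := by
  have hF := contDiff_normalMap hu₀ A
  refine ContDiffOn.sqrt (ContDiffOn.mul ?_ ((contDiff_det_fderiv hF).pow 2).contDiffOn)
    fun z hz => (mul_pos (posDef_metricMatrix (κ[p].map_target (hN z hz))).det_pos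
      (by have := hdet z hz; positivity)).ne'
  exact contDiffOn_det fun i j => ContDiffOn.comp
    (g := fun u => metricMatrix (d := d) p (σ[p] u) i j)
    (contDiffOn_metricMatrix p i j) hF.contDiffOn hN

lemma det_map_ofReal (X : 𝔼 →L[ℝ] 𝔼) :
    ((Matrix.of fun i j : Fin d => X (stdVec j) i).map ((↑) : ℝ → ℂ)).det = ((X.det : ℝ) : ℂ) := by
  rw [← det_matrix_of]
  exact (RingHom.map_det Complex.ofRealHom _).symm

/-- A function on `M × T'M` at the point of coordinates `u₀`, in the coordinates for `x` given by
`normalMap` and for covectors with components in the frame `B`. -/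
def normalFun (p : M) (u₀ : 𝔼) (B : 𝔼 ≃L[ℝ] 𝔼) (a : 𝔼 × 𝔼 × 𝔼 → ℂ) (x : 𝔼 × 𝔼) : ℂ :=
  a (normalMap p u₀ ⟪B.symm⟫ x.1, u₀, ⟪B⟫† x.2)

lemma inner_adjoint_symm (B : 𝔼 ≃L[ℝ] 𝔼) (θ z : 𝔼) : inner ℝ (⟪B⟫† θ) (B.symm z) = inner ℝ θ z := by
  rw [adjoint_inner_left]
  simp

lemma adjoint_ne_zero (B : 𝔼 ≃L[ℝ] 𝔼) {θ : 𝔼} (hθ : θ ≠ 0) : ⟪B⟫† θ ≠ 0 := fun h => by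
  have := inner_adjoint_symm B θ θ
  rw [h, inner_zero_left] at this
  exact hθ (inner_self_eq_zero.1 this.symm)

lemma normalDensity_zero {p : M} {u₀ : 𝔼} (hu₀ : u₀ ∈ τ[p]) {B : 𝔼 ≃L[ℝ] 𝔼}
    (hB : |(B : 𝔼 →L[ℝ] 𝔼).det| = density d p (σ[p] u₀)) : normalDensity p u₀ ⟪B.symm⟫ 0 = 1 := by
  rw [normalDensity_eq, fderiv_normalMap_zero hu₀, normalMap_zero hu₀, ← hB, ← abs_mul]
  have h : (B : 𝔼 →L[ℝ] 𝔼).det * (B.symm : 𝔼 →L[ℝ] 𝔼).det = 1 := by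
    rw [ContinuousLinearMap.det, ContinuousLinearMap.det, ← LinearMap.det_comp]
    have : ((B : 𝔼 →L[ℝ] 𝔼) : 𝔼 →ₗ[ℝ] 𝔼) ∘ₗ ((B.symm : 𝔼 →L[ℝ] 𝔼) : 𝔼 →ₗ[ℝ] 𝔼) = LinearMap.id := by
      ext1 x
      exact B.apply_symm_apply x
    rw [this, LinearMap.det_id]
  rw [h, abs_one]

end

section

variable {ε : ℝ} {φ : M → CotFun d M}

lemma contDiff_normalCoord {p : M} {u₀ : 𝔼} (hu₀ : u₀ ∈ τ[p])
    (B : 𝔼 ≃L[ℝ] 𝔼) : Smooth fun x : 𝔼 × 𝔼 => (normalMap p u₀ ⟪B.symm⟫ x.1, u₀, ⟪B⟫† x.2) :=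
  ((contDiff_normalMap hu₀ _).comp contDiff_fst).prodMk (contDiff_const.prodMk
    ((⟪B⟫†).contDiff.comp contDiff_snd))

lemma isBigO_normalPhase (hφ : IsLeviCivitaPhase ε φ) {p : M} {u₀ : 𝔼}
    (hu₀ : u₀ ∈ τ[p]) {B : 𝔼 ≃L[ℝ] 𝔼}
    (hB : ∀ a b, metricForm p u₀ a b = inner ℝ (B a) (B b)) (z : 𝔼) {θ : 𝔼} (hθ : θ ≠ 0) :
    (fun t : ℝ => normalFun p u₀ B (coordFun p φ) (t • z, θ) - (t * (inner ℝ z θ : ℝ) +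
      I * ε / 2 * t ^ 2 * ‖θ‖ * ‖z‖ ^ 2)) =O[𝓝[>] 0] fun t : ℝ => t ^ 4 := by
  have h := hφ.isBigO_normalMap hu₀ (B.symm : 𝔼 →L[ℝ] 𝔼) (adjoint_ne_zero B hθ) z
  refine h.congr_left fun t => ?_
  have e1 : inner ℝ (⟪B⟫† θ) ((B.symm : 𝔼 →L[ℝ] 𝔼) z) =
      inner ℝ z θ := (inner_adjoint_symm B θ z).trans (real_inner_comm _ _)
  have e2 : metricForm p u₀ ((B.symm : 𝔼 →L[ℝ] 𝔼) z) ((B.symm : 𝔼 →L[ℝ] 𝔼) z) = ‖z‖ ^ 2 := by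
    rw [hB, ← real_inner_self_eq_norm_sq]
    simp
  rw [e1, e2, coordHam_adjoint hu₀ hB, normalFun]
  push_cast
  ring

lemma exists_ball_normalPhase (hφ : IsLeviCivitaPhase ε φ) {p : M} {u₀ : 𝔼} {O : Set 𝔼}
    (hO : IsOpen O) (hu₀ : u₀ ∈ O) (hOT : O ⊆ τ[p]) (B : 𝔼 ≃L[ℝ] 𝔼) :
    ∃ r > 0, MapsTo (normalMap p u₀ ⟪B.symm⟫) (ball 0 r) O ∧ ∀ z ∈ ball (0 : 𝔼) r, ∀ θ, θ ≠ 0 →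
        ‖θ‖ ^ 2 / 2 < (fderiv ℝ (normalFun p u₀ B (coordFun p φ)) (z, θ) (θ, 0)).re := by
  set f := normalFun p u₀ B (coordFun p φ) with hf
  set F := normalMap p u₀ ⟪B.symm⟫ with hFdef
  have hu₀T := hOT hu₀
  have hF : Smooth F := contDiff_normalMap hu₀T _
  have hF0 : F 0 = u₀ := normalMap_zero hu₀T _
  set T := F ⁻¹' O with hT
  have hTo : IsOpen T := hO.preimage hF.continuous
  have hT0 : (0 : 𝔼) ∈ T := by rw [hT, mem_preimage, hF0]; exact hu₀
  have hfs : SmoothOn f (T ×ˢ {0}ᶜ) := ContDiffOn.comp (hφ.smooth.contDiffOn p)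
    (contDiff_normalCoord hu₀T B).contDiffOn fun x hx => ⟨hOT hx.1, hu₀T, adjoint_ne_zero B hx.2⟩
  have hfd : ∀ z ∈ T, ∀ θ, θ ≠ 0 → DifferentiableAt ℝ f (z, θ) := fun z hz θ hθ =>
    (hasFDerivAt_of_isOpen hfs (hTo.prod isOpen_compl_singleton) (mk_mem_prod hz
      hθ)).differentiableAt
  set Ψ : 𝔼 × 𝔼 × 𝔼 → ℂ := fun x => f (x.1, x.2.2) - ((inner ℝ x.1 x.2.2 / 2 : ℝ) : ℂ) with hΨ
  have hΨs : SmoothOn Ψ (T ×ˢ T ×ˢ {0}ᶜ) := by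
    refine (hfs.comp (f := fun x : 𝔼 × 𝔼 × 𝔼 => (x.1, x.2.2)) (by fun_prop)
      fun x hx => ⟨hx.1, hx.2.2⟩).sub (ofRealCLM.contDiff.comp_contDiffOn ?_)
    exact ((contDiff_fst.inner ℝ (contDiff_snd.comp contDiff_snd)).div_const 2).contDiffOn
  have key : ∀ z ∈ T, ∀ w ∈ T, ∀ θ, θ ≠ 0 → (fderiv ℝ Ψ (z, w, θ) (θ, 0, 0)).re =
      (fderiv ℝ f (z, θ) (θ, 0)).re - ‖θ‖ ^ 2 / 2 := fun z hz w hw θ hθ => by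
    have e1 : HasDerivAt (fun t : ℝ => Ψ ((z, w, θ) + t • (θ, 0, 0)))
        (fderiv ℝ Ψ (z, w, θ) (θ, 0, 0)) 0 :=
      (hasFDerivAt_of_isOpen hΨs (hTo.prod (hTo.prod isOpen_compl_singleton)) (mk_mem_prod hz
        (mk_mem_prod hw hθ))).hasLineDerivAt _
    have e2 : HasDerivAt (fun t : ℝ => f ((z, θ) + t • (θ, 0))) (fderiv ℝ f (z, θ) (θ, 0)) 0 :=
      (hfd z hz θ hθ).hasFDerivAt.hasLineDerivAt _
    have e3 : HasDerivAt (fun t : ℝ => inner ℝ (z + t • θ) θ / 2) (‖θ‖ ^ 2 / 2) 0 := by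
      have := ((((hasDerivAt_id (0 : ℝ)).smul_const θ).const_add z).inner ℝ
        (hasDerivAt_const (0 : ℝ) θ)).div_const 2
      refine this.congr_deriv ?_
      simp
    have e4 := e2.sub e3.ofReal_comp
    have e5 : (fun t : ℝ => Ψ ((z, w, θ) + t • (θ, 0, 0))) =
        fun t : ℝ => f ((z, θ) + t • (θ, 0)) - ((inner ℝ (z + t • θ) θ / 2 : ℝ) : ℂ) := by
      ext1 t
      simp [hΨ]
    rw [e5] at e1
    rw [e1.unique e4, Complex.sub_re, ofReal_re]
  have hpos : ∀ θ, θ ≠ 0 → 0 < (fderiv ℝ Ψ (0, 0, θ) (θ, 0, 0)).re := fun θ hθ => by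
    have e1 : HasDerivAt (fun t : ℝ => f ((0, θ) + t • (θ, 0))) (fderiv ℝ f (0, θ) (θ, 0)) 0 :=
      (hfd 0 hT0 θ hθ).hasFDerivAt.hasLineDerivAt _
    set q := ⟪B⟫† θ with hq
    have hF' : HasFDerivAt F (B.symm : 𝔼 →L[ℝ] 𝔼) (0 + (0 : ℝ) • θ) := by
      rw [zero_smul, add_zero]
      have := (hF.differentiable (by simp) 0).hasFDerivAt
      rwa [hFdef, fderiv_normalMap_zero hu₀T] at this
    have h2 : HasDerivAt (fun t : ℝ => F (0 + t • θ)) (B.symm θ) 0 := by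
      exact (HasFDerivAt.comp_hasDerivAt (f := fun t : ℝ => 0 + t • θ) 0 hF'
        (((hasDerivAt_id (0 : ℝ)).smul_const θ).const_add 0)).congr_deriv (by simp)
    have h3 : HasFDerivAt (coordFun p φ) (fderiv ℝ (coordFun p φ) (u₀, u₀, q))
        (F (0 + (0 : ℝ) • θ), u₀, q) := by
      rw [zero_smul, add_zero, hF0]
      exact (hφ.differentiableAt_coordFun hu₀T hu₀T (adjoint_ne_zero B hθ)).hasFDerivAt
    have h4 := HasFDerivAt.comp_hasDerivAt (f := fun t : ℝ => (F (0 + t • θ), u₀, q)) 0 h3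
      (h2.prodMk (hasDerivAt_const (0 : ℝ) (u₀, q)))
    have e2 : (fun t : ℝ => f ((0, θ) + t • (θ, 0))) =
        coordFun p φ ∘ fun t : ℝ => (F (0 + t • θ), u₀, q) := by
      ext1 t
      simp [hf, normalFun, ← hFdef, hq]
    rw [e2] at e1
    rw [key 0 hT0 0 hT0 θ hθ, e1.unique h4]
    have h5 := hφ.fderiv_coordFun_fst hu₀T (adjoint_ne_zero B hθ) (B.symm θ)
    rw [← hq] at h5
    have h6 : ((B.symm θ, 0) : 𝔼 × 𝔼 × 𝔼) = (B.symm θ, 0, 0) := rfl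
    rw [h6, h5, hq, inner_adjoint_symm, ofReal_re, real_inner_self_eq_norm_sq]
    have : 0 < ‖θ‖ := norm_pos_iff.2 hθ
    nlinarith
  obtain ⟨r, hr, hrT, h⟩ := exists_ball_fderiv_pos hTo hT0 hΨs (fun z hz w hw θ hθ l hl => by
      have hh : f (z, l • θ) = l * f (z, θ) := by
        simp only [hf, normalFun, coordFun, map_smul, covec_smul]
        exact hφ.homogeneous _ _ _ (covec_ne_zero (κ[p].map_target hu₀T)
          (adjoint_ne_zero B hθ)) l hl
      simp only [hΨ, hh, inner_smul_right]
      push_cast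
      ring) (L := (ContinuousLinearMap.id ℝ 𝔼).prod (0 : 𝔼 →L[ℝ] 𝔼 × 𝔼)) (fun θ => rfl)
    (fun θ hθ => hpos θ hθ)
  refine ⟨r, hr, hrT, fun z hz θ hθ => ?_⟩
  have h1 : 0 < (fderiv ℝ Ψ (z, 0, θ) (θ, 0, 0)).re := h z hz 0 (mem_ball_self hr) θ hθ
  rw [key z (hrT hz) 0 hT0 θ hθ] at h1
  linarith

/-- The local injectivity radius of `normalMap`. -/
lemma exists_ball_injOn_normalMap {p : M} {u₀ : 𝔼} (hu₀ : u₀ ∈ τ[p])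
    (B : 𝔼 ≃L[ℝ] 𝔼) : ∃ r > 0, InjOn (normalMap p u₀ ⟪B.symm⟫) (ball 0 r) ∧
      ∀ z ∈ ball (0 : 𝔼) r, (fderiv ℝ (normalMap p u₀ ⟪B.symm⟫) z).det ≠ 0 := by
  set F := normalMap p u₀ ⟪B.symm⟫ with hF
  have hFs : Smooth F := contDiff_normalMap hu₀ _
  have hd : HasFDerivAt F ⟪B.symm⟫ 0 := by
    have := (hFs.differentiable (by simp) 0).hasFDerivAt
    rwa [hF, fderiv_normalMap_zero hu₀] at this
  have hs : HasStrictFDerivAt F ⟪B.symm⟫ 0 :=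
    (hFs.contDiffAt (x := 0)).hasStrictFDerivAt' hd (by simp)
  set e := hs.toOpenPartialHomeomorph F
  have h1 : e.source ∈ 𝓝 (0 : 𝔼) := e.open_source.mem_nhds hs.mem_toOpenPartialHomeomorph_source
  have h2 : ∀ᶠ z in 𝓝 (0 : 𝔼), (fderiv ℝ F z).det ≠ 0 := by
    refine (contDiff_det_fderiv hFs).continuous.continuousAt.eventually_ne ?_
    rw [hF, fderiv_normalMap_zero hu₀]
    exact B.symm.toLinearEquiv.isUnit_det'.ne_zero
  obtain ⟨r, hr, h⟩ := eventually_nhds_iff_ball.1 (Eventually.and h1 h2)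
  exact ⟨r, hr, fun x hx y hy hxy => e.injOn (h x hx).1 (h y hy).1 hxy, fun z hz => (h z hz).2⟩

variable {V b : 𝔼[d] × 𝔼[d] × 𝔼[d] → ℂ}
  {s : 𝔼[d] × 𝔼[d] → ℂ}
  {c : ℕ → 𝔼[d] × 𝔼[d] → ℂ}
  {O : Set 𝔼[d]} {u₀ : 𝔼[d]} {p : M}

lemma LocalKernel.exists_symbol_remainder {h : 𝔼 × 𝔼 → ℝ} {φ : 𝔼 × 𝔼 × 𝔼 → ℂ}
    (hL : LocalKernel O φ V b h s c) (hu₀ : u₀ ∈ O) (B : 𝔼 ≃L[ℝ] 𝔼) : ∃ C : ℝ, ∀ θ, 1 ≤ ‖θ‖ →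
      ‖s (u₀, ⟪B⟫† θ) - ∑ k ∈ Finset.range 3, c k (u₀, ⟪B⟫† θ)‖ ≤ C * (‖θ‖ ^ 3)⁻¹ := by
  set L := ⟪B⟫†
  set m := ‖(B.symm : 𝔼 →L[ℝ] 𝔼)‖
  have hnorm : ∀ θ, ‖θ‖ ≤ m * ‖L θ‖ := fun θ => by
    rcases eq_or_ne θ 0 with rfl | hθ
    · simp
    have h1 : ‖θ‖ ^ 2 ≤ ‖L θ‖ * (m * ‖θ‖) := by
      rw [← real_inner_self_eq_norm_sq, ← inner_adjoint_symm B]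
      exact (real_inner_le_norm _ _).trans (mul_le_mul_of_nonneg_left
        ((B.symm : 𝔼 →L[ℝ] 𝔼).le_opNorm θ) (norm_nonneg _))
    have h2 : 0 < ‖θ‖ := norm_pos_iff.2 hθ
    nlinarith
  obtain ⟨C, hC⟩ := hL.s_rem 3 {u₀} isCompact_singleton (by simpa)
  set D : 𝔼 → ℂ := fun θ => s (u₀, L θ) - ∑ k ∈ Finset.range 3, c k (u₀, L θ)
  have hmaps : ∀ θ ∈ ({0}ᶜ : Set 𝔼), (u₀, L θ) ∈ O ×ˢ ({0}ᶜ : Set 𝔼) := fun θ hθ =>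
    ⟨hu₀, adjoint_ne_zero B hθ⟩
  have hDc : ContinuousOn D {0}ᶜ :=
    (hL.s_cont.comp (f := fun θ => (u₀, L θ)) (by fun_prop) hmaps).sub
      (continuousOn_finsetSum _ fun k _ => (hL.c_smooth k).continuousOn.comp
        (f := fun θ => (u₀, L θ)) (by fun_prop) hmaps)
  obtain ⟨C', hC'⟩ := (isCompact_annulus (d := d) 1 m).exists_bound_of_continuousOn
    (hDc.mono fun θ hθ h0 => by
      rw [mem_singleton_iff] at h0
      have := hθ.1
      rw [h0, norm_zero] at this
      linarith)
  have hm0 : 0 ≤ m := norm_nonneg _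
  refine ⟨max |C| |C'| * m ^ 3, fun θ hθ => ?_⟩
  have hθ0 : 0 < ‖θ‖ := zero_lt_one.trans_le hθ
  rcases le_or_gt 1 ‖L θ‖ with h1 | h1
  · have h0 : 0 < ‖L θ‖ := zero_lt_one.trans_le h1
    refine (hC u₀ rfl (L θ) h1).trans ?_
    rw [← div_eq_mul_inv, ← div_eq_mul_inv, div_le_div_iff₀ (by positivity) (by positivity)]
    have h2 := pow_le_pow_left₀ hθ0.le (hnorm θ) 3
    rw [mul_pow] at h2
    calc C * ‖θ‖ ^ 3 ≤ max |C| |C'| * ‖θ‖ ^ 3 :=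
          mul_le_mul_of_nonneg_right ((le_abs_self C).trans (le_max_left _ _)) (by positivity)
      _ ≤ max |C| |C'| * (m ^ 3 * ‖L θ‖ ^ 3) := mul_le_mul_of_nonneg_left h2 (by positivity)
      _ = _ := by ring
  · have h2 : ‖θ‖ ≤ m := (hnorm θ).trans (mul_le_of_le_one_right hm0 h1.le)
    refine (hC' θ ⟨hθ, h2⟩).trans ?_
    rw [← div_eq_mul_inv, le_div_iff₀ (by positivity)]
    have h3 := pow_le_pow_left₀ hθ0.le h2 3
    exact mul_le_mul ((le_abs_self C').trans (le_max_right _ _)) h3 (by positivity) (by positivity)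

lemma exists_flatModel (hε : 0 < ε) (hφ : IsLeviCivitaPhase ε φ)
    (hL : LocalKernel O (coordFun p φ) V b (coordHam p) s c) (hu₀ : u₀ ∈ O) (hOT : O ⊆ τ[p])
    (hV : ∀ q, q ≠ 0 → V (u₀, u₀, q) = 1)
    (hpow : ∀ u ∈ O, ∀ q, q ≠ 0 → V (u, u₀, q) ^ 4 = ((density d p (σ[p] u) : ℂ) ^ 2)⁻¹ *
          (density d p (σ[p] u₀) : ℂ) ^ 2 * (coordMixed p φ (u, u₀, q)).det ^ 2)
    {B : 𝔼 ≃L[ℝ] 𝔼} (hB : ∀ a b, metricForm p u₀ a b = inner ℝ (B a) (B b))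
    (hdet : |(B : 𝔼 →L[ℝ] 𝔼).det| = density d p (σ[p] u₀)) :
    ∃ a > 0, MapsTo (normalMap p u₀ ⟪B.symm⟫) (ball 0 a) O ∧
      InjOn (normalMap p u₀ ⟪B.symm⟫) (ball 0 a) ∧
      (∀ z ∈ ball (0 : 𝔼) a, (fderiv ℝ (normalMap p u₀ ⟪B.symm⟫) z).det ≠ 0) ∧
      ∀ k : ContDiffBump (0 : 𝔼), k.rOut = a / 2 → FlatModel ε a (a / 2)
        (normalFun p u₀ B (coordFun p φ))
        (fun x => normalFun p u₀ B V x * (√(normalDensity p u₀ ⟪B.symm⟫ x.1) : ℝ) * (k x.1 : ℝ))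
        (fun x => normalFun p u₀ B b x * (√(normalDensity p u₀ ⟪B.symm⟫ x.1) : ℝ) * (k x.1 : ℝ))
        (fun θ => s (u₀, ⟪B⟫† θ)) (fun j θ => c j (u₀, ⟪B⟫† θ)) := by
  have hT : IsOpen τ[p] := isOpen_extChartAt_target p
  have hu₀T := hOT hu₀
  obtain ⟨r₁, hr₁, h₁, hgrad⟩ := exists_ball_normalPhase hφ hL.isOpen hu₀ hOT B
  obtain ⟨r₂, hr₂, h₂, h₃⟩ := exists_ball_injOn_normalMap hu₀T B
  set F := normalMap p u₀ ⟪B.symm⟫ with hFdef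
  set L := ⟪B⟫† with hLdef
  set ρ := normalDensity p u₀ ⟪B.symm⟫ with hρ
  set f := normalFun p u₀ B (coordFun p φ)
  have hF : Smooth F := contDiff_normalMap hu₀T _
  have hF0 : F 0 = u₀ := normalMap_zero hu₀T _
  set a := min r₁ r₂
  have ha0 : 0 < a := lt_min hr₁ hr₂
  have hb1 : ball (0 : 𝔼) a ⊆ ball 0 r₁ := ball_subset_ball (min_le_left _ _)
  have hb2 : ball (0 : 𝔼) a ⊆ ball 0 r₂ := ball_subset_ball (min_le_right _ _)
  have hFO : ∀ z ∈ ball (0 : 𝔼) a, F z ∈ O := fun z hz => h₁ (hb1 hz)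
  have hdetF : ∀ z ∈ ball (0 : 𝔼) a, (fderiv ℝ F z).det ≠ 0 := fun z hz => h₃ z (hb2 hz)
  refine ⟨a, ha0, fun z hz => hFO z hz, h₂.mono hb2, hdetF, fun k hk => ?_⟩
  have hopen : IsOpen (ball (0 : 𝔼) a ×ˢ ({0}ᶜ : Set 𝔼)) := isOpen_ball.prod isOpen_compl_singleton
  have hcoord := contDiff_normalCoord hu₀T B
  have hmaps : ∀ x ∈ ball (0 : 𝔼) a ×ˢ ({0}ᶜ : Set 𝔼), (F x.1, u₀, L x.2) ∈ O ×ˢ O ×ˢ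
    ({0}ᶜ : Set 𝔼) := fun x hx => ⟨hFO x.1 hx.1, hu₀, adjoint_ne_zero B hx.2⟩
  have hρpos : ∀ z ∈ ball (0 : 𝔼) a, 0 < ρ z := fun z hz =>
    normalDensity_pos (hOT (hFO z hz)) (hdetF z hz)
  have hρs : SmoothOn (fun x : 𝔼 × 𝔼 => ((√(ρ x.1) : ℝ) : ℂ)) (ball 0 a ×ˢ {0}ᶜ) := by
    have h1 : SmoothOn (fun z => √(ρ z)) (ball 0 a) :=
      (contDiffOn_normalDensity hu₀T _ (fun z hz => hOT (hFO z hz)) hdetF).sqrt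
        fun z hz => (hρpos z hz).ne'
    exact ofRealCLM.contDiff.comp_contDiffOn (h1.comp contDiffOn_fst fun x hx => hx.1)
  have hfs : SmoothOn f (ball 0 a ×ˢ {0}ᶜ) := hL.φ_smooth.comp hcoord.contDiffOn hmaps
  have hks : Smooth fun x : 𝔼 × 𝔼 => ((k x.1 : ℝ) : ℂ) :=
    ofRealCLM.contDiff.comp (k.contDiff.comp contDiff_fst)
  have hktsupp : tsupport (fun x : 𝔼 × 𝔼 => ((k x.1 : ℝ) : ℂ)) ⊆ Prod.fst ⁻¹' ball (0 : 𝔼) a := by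
    have h1 : tsupport (fun z : 𝔼 => ((k z : ℝ) : ℂ)) ⊆ closedBall 0 (a / 2) := by
      rw [← hk, ← k.tsupport_eq]
      exact closure_mono fun z hz => by simpa using hz
    exact (tsupport_comp_subset (fun z : 𝔼 => ((k z : ℝ) : ℂ)) continuous_fst).trans
      (preimage_mono (h1.trans (closedBall_subset_ball (by linarith))))
  have hkt : tsupport (fun x : 𝔼 × 𝔼 => ((k x.1 : ℝ) : ℂ)) ∩ (univ ×ˢ {0}ᶜ) ⊆
    ball (0 : 𝔼) a ×ˢ ({0}ᶜ : Set 𝔼) := fun x hx => ⟨hktsupp hx.1, hx.2.2⟩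
  have hkz : ∀ z ∉ closedBall (0 : 𝔼) (a / 2), k z = 0 := fun z hz => by
    refine k.zero_of_le_dist ?_
    rw [hk]
    exact (not_le.1 hz).le
  have hin : ∀ z, k z ≠ 0 → z ∈ ball (0 : 𝔼) a := fun z hz => by
    by_contra h
    exact hz (hkz z fun h' => h (closedBall_subset_ball (by linarith) h'))
  have hWs : SmoothOn (fun x : 𝔼 × 𝔼 => normalFun p u₀ B V x * (√(ρ x.1) : ℝ) * (k x.1 : ℝ))
      (univ ×ˢ {0}ᶜ) :=
    contDiffOn_mul_of_tsupport hopen hks ((hL.V_smooth.comp hcoord.contDiffOn hmaps).mul hρs) hkt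
  have hham : ∀ θ, coordHam p (u₀, L θ) = ‖θ‖ := coordHam_adjoint hu₀T hB
  have hjet : ∀ z θ, θ ≠ 0 → (fun t : ℝ => f (t • z, θ) - (t * (inner ℝ z θ : ℝ) +
      I * ε / 2 * t ^ 2 * ‖θ‖ * ‖z‖ ^ 2)) =O[𝓝[>] 0] fun t : ℝ => t ^ 4 :=
    fun z θ hθ => isBigO_normalPhase hφ hu₀T hB z hθ
  refine ⟨hε, by positivity, by linarith, hfs, fun z hz θ hθ l hl => ?_, fun z hz θ hθ =>
    hL.φ_im _ (hFO z hz) _ hu₀ _ (adjoint_ne_zero B hθ), fun z hz => hgrad z (hb1 hz), hjet,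
    hWs, fun z hz θ => by simp [hkz z hz], fun z θ hθ l hl => ?_, fun z θ hθ => ?_,
    fun z θ hθ => ?_, ?_, fun z hz θ => by simp [hkz z hz], fun z θ hθ hθ1 => ?_, ?_,
    fun j => ?_, fun j θ hθ l hl => ?_, hL.exists_symbol_remainder hu₀ B⟩
  · have := hL.φ_hom _ (hFO z hz) _ hu₀ _ (adjoint_ne_zero B hθ) l hl
    rw [← map_smul] at this
    exact this
  · by_cases hz : k z = 0
    · simp [hz]
    · have := hL.V_hom _ (hFO z (hin z hz)) _ hu₀ _ (adjoint_ne_zero B hθ) l hl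
      rw [← map_smul] at this
      simp only [normalFun]
      rw [this]
  · set κ : ℂ := I * ε * ((inner ℝ z θ : ℝ) / ‖θ‖) with hκ
    set E : ℝ → ℂ := fun t => (mixedMatrix f (t • z, θ)).det
    have hE' : (fun t : ℝ => E t - (1 + κ * t)) =O[𝓝[>] 0] fun t : ℝ => t ^ 3 := by
      have h1 := isBigO_det_sub (l := 𝓝[>] 0) nhdsWithin_le_nhds (κ := I * ε)
        (z := fun i => (z i : ℂ)) (θ := fun i => (θ i : ℂ) / ‖θ‖) (N := fun t => mixedMatrix f (t •
          z, θ))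
        fun i j => (isBigO_mixedMatrix ha0 hfs hjet z hθ i j).congr_left fun t => by
          push_cast
          ring
      refine h1.congr_left fun t => ?_
      have h2 : ∑ i, (z i : ℂ) * ((θ i : ℂ) / ‖θ‖) = ((inner ℝ z θ : ℝ) : ℂ) / ‖θ‖ := by
        rw [PiLp.inner_apply, Complex.ofReal_sum, Finset.sum_div]
        refine sum_congr rfl fun i _ => ?_
        simp only [RCLike.inner_apply, conj_trivial]
        push_cast
        ring
      rw [h2, hκ]
      ring
    have hline : Continuous fun t : ℝ => (t • z, θ) := by fun_prop
    have hW1 : Tendsto (fun t : ℝ => normalFun p u₀ B V (t • z, θ) *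
        (√(ρ (t • z)) : ℝ) * (k (t • z) : ℝ)) (𝓝[>] 0) (𝓝 1) := by
      have h1 := (hWs.continuousOn.continuousAt ((isOpen_univ.prod isOpen_compl_singleton).mem_nhds
        (mk_mem_prod (mem_univ ((0 : ℝ) • z)) hθ))).comp
          (f := fun t : ℝ => (t • z, θ)) hline.continuousAt
      have h2 := h1.tendsto.mono_left (nhdsWithin_le_nhds (s := Ioi 0))
      have h3 : normalFun p u₀ B V ((0 : ℝ) • z, θ) * (√(ρ ((0 : ℝ) • z)) : ℝ) *
          (k ((0 : ℝ) • z) : ℝ) = 1 := by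
        rw [zero_smul, hρ, normalDensity_zero hu₀T hdet, k.one_of_mem_closedBall
          (mem_closedBall_self k.rIn_pos.le), normalFun, ← hFdef, hF0, hV _ (adjoint_ne_zero B hθ)]
        simp
      rw [← h3]
      exact h2
    have hpow' : ∀ᶠ t : ℝ in 𝓝[>] 0, (normalFun p u₀ B V (t • z, θ) *
        (√(ρ (t • z)) : ℝ) * (k (t • z) : ℝ)) ^ 4 = E t ^ 2 := by
      have hc : ContinuousAt (fun t : ℝ => t • z) 0 := by fun_prop
      have hc0 : Tendsto (fun t : ℝ => t • z) (𝓝[>] 0) (𝓝 0) := by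
        have := hc.tendsto.mono_left (nhdsWithin_le_nhds (s := Ioi 0))
        rwa [zero_smul] at this
      filter_upwards [hc0 (ball_mem_nhds _ ha0), hc0 (closedBall_mem_nhds _ k.rIn_pos)] with t h1 h2
      set ζ := t • z
      have hζO := hFO ζ h1
      have hζ0 : L θ ≠ 0 := adjoint_ne_zero B hθ
      have hΦ : ContDiffAt ℝ ∞ (fun x : 𝔼 × 𝔼 => coordFun p φ (x.1, u₀, x.2)) (F ζ, L θ) :=
        (hL.φ_smooth.comp (f := fun x : 𝔼 × 𝔼 => (x.1, u₀, x.2)) (s := O ×ˢ {0}ᶜ) (by fun_prop)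
          fun x hx => ⟨hx.1, hu₀, hx.2⟩).contDiffAt
            ((hL.isOpen.prod isOpen_compl_singleton).mem_nhds (mk_mem_prod hζO hζ0))
      have e1 : E t = ((fderiv ℝ F ζ).det : ℂ) * (coordMixed p φ (F ζ, u₀, L θ)).det *
          (L.det : ℂ) := by
        rw [coordMixed_eq_mixedMatrix hφ (hOT hζO) hu₀T hζ0, ← det_map_ofReal, ← det_map_ofReal,
          ← Matrix.det_transpose, ← det_mul, ← det_mul, ← mixedMatrix_comp hF hΦ]
        rfl
      have e2 : L.det ^ 2 = density d p (σ[p] u₀) ^ 2 := by rw [hLdef, det_adjoint, ← hdet, sq_abs]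
      have e2' : (L.det : ℂ) ^ 2 = (density d p (σ[p] u₀) : ℂ) ^ 2 := by exact_mod_cast e2
      have e3 : √(ρ ζ) ^ 4 = density d p (σ[p] (F ζ)) ^ 2 * (fderiv ℝ F ζ).det ^ 2 := by
        rw [show √(ρ ζ) ^ 4 = (√(ρ ζ) ^ 2) ^ 2 by ring, sq_sqrt (hρpos ζ h1).le, hρ,
          normalDensity_eq, mul_pow, sq_abs]
      have e3' : ((√(ρ ζ) : ℝ) : ℂ) ^ 4 =
          (density d p (σ[p] (F ζ)) : ℂ) ^ 2 * ((fderiv ℝ F ζ).det : ℂ) ^ 2 := by exact_mod_cast e3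
      have e4 : (density d p (σ[p] (F ζ)) : ℂ) ≠ 0 :=
        ofReal_ne_zero.2 (density_pos (κ[p].map_target (hOT hζO))).ne'
      rw [k.one_of_mem_closedBall h2, ofReal_one, mul_one, mul_pow, e3', normalFun, ← hFdef,
        ← hLdef, hpow _ hζO _ hζ0, e1, mul_pow, mul_pow, e2']
      field_simp
    refine (isBigO_fourth_root nhdsWithin_le_nhds hW1 hpow' hE').congr_left fun t => ?_
    rw [hκ]
    simp only [mul_pow, I_sq]
    ring
  · by_cases hz : k z = 0
    · simp [hz]
    · have hθ0 : θ ≠ 0 := fun h => by rw [h, norm_zero] at hθ; linarith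
      have := hL.b_eq _ (hFO z (hin z hz)) _ hu₀ _ (adjoint_ne_zero B hθ0) (by rw [hham]; exact hθ)
      simp only [normalFun]
      rw [this]
  · exact continuousOn_mul_of_tsupport hopen hks.continuous
      ((hL.b_cont.comp hcoord.continuous.continuousOn hmaps).mul hρs.continuousOn) hkt
  · by_cases hz : k z = 0
    · simp [hz]
    · have := hL.b_zero _ (hFO z (hin z hz)) _ hu₀ _ (adjoint_ne_zero B hθ) (by rw [hham]; exact
        hθ1)
      simp only [normalFun]
      rw [this, zero_mul, zero_mul]
  · exact hL.s_cont.comp (f := fun θ => (u₀, L θ)) (by fun_prop)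
      fun θ hθ => ⟨hu₀, adjoint_ne_zero B hθ⟩
  · exact (hL.c_smooth j).continuousOn.comp (f := fun θ => (u₀, L θ)) (by fun_prop)
      fun θ hθ => ⟨hu₀, adjoint_ne_zero B hθ⟩
  · have := hL.c_hom j _ hu₀ _ (adjoint_ne_zero B hθ) l hl
    rw [← map_smul] at this
    exact this

end

lemma integral_eq_abs_det_mul_integral_comp (X : 𝔼 →L[ℝ] 𝔼) (hX : X.det ≠ 0) (g : 𝔼 → ℂ) :
    ∫ q, g q = ((|X.det| : ℝ) : ℂ) * ∫ q, g (X q) := by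
  set E := X.toContinuousLinearEquivOfDetNeZero hX
  have hEX : ∀ q, E q = X q := fun q => rfl
  have himg : X '' univ = univ := by
    rw [image_univ]
    exact E.surjective.range_eq
  have h := integral_image_eq_integral_abs_det_fderiv_smul volume MeasurableSet.univ
    (fun x _ => X.hasFDerivAt.hasFDerivWithinAt) (E.injective.injOn) g (f := X)
  rw [himg, Measure.restrict_univ] at h
  rw [h, integral_smul, real_smul]

lemma density_transition {p p' : M} {u : 𝔼} (hu : u ∈ overlap d p p') :
    density d p (σ[p] u) = |(fderiv ℝ (transition d p p') u).det| * density d p' (σ[p] u) := by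
  set D := fderiv ℝ (transition d p p') u with hD
  set y := σ[p] u with hy
  set m : Matrix (Fin d) (Fin d) ℝ := Matrix.of fun i j => D (stdVec j) i with hm
  have h1 : metricMatrix (d := d) p y = m.transpose * metricMatrix p' y * m := by
    ext μ ν
    have h2 := metricForm_transition hu (stdVec μ) (stdVec ν)
    rw [metricForm_eq_matrixForm, metricForm_eq_matrixForm, ← hy, matrixForm_stdVec,
      matrixForm_apply, transition, κ[p'].left_inv hu.2, ← hy] at h2
    rw [h2, Matrix.mul_apply]
    simp only [Matrix.mul_apply, Matrix.transpose_apply, hm, of_apply, sum_mul]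
    rw [sum_comm]
    refine sum_congr rfl fun α _ => sum_congr rfl fun β _ => ?_
    rw [hD]
    ring
  rw [density, density, h1, det_mul, det_mul, Matrix.det_transpose, hm, det_matrix_of,
    show D.det * (metricMatrix (d := d) p' y).det * D.det =
      D.det ^ 2 * (metricMatrix (d := d) p' y).det by ring, sqrt_mul (sq_nonneg _),
    Real.sqrt_sq_eq_abs]

lemma injOn_transition (p p' : M) :
    InjOn (transition d p p') (overlap d p p') := fun u hu u' hu' h => by
  rw [← transition_comp_transition hu, h, transition_comp_transition hu']

lemma det_fderiv_transition_ne_zero {p p' : M} {u : 𝔼} (hu : u ∈ overlap d p p') :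
    (fderiv ℝ (transition d p p') u).det ≠ 0 := fun h => by
  have h1 := density_transition hu
  rw [h, abs_zero, zero_mul] at h1
  exact (sqrt_pos.2 (posDef_metricMatrix (κ[p].map_target hu.1)).det_pos).ne' h1

lemma continuousOn_density (p : M) : ContinuousOn (fun u => density d p (σ[p] u)) τ[p] :=
  (contDiffOn_det (contDiffOn_metricMatrix (d := d) p)).continuousOn.sqrt

lemma aemeasurable_symm (p : M) (ρ : 𝔼 → ENNReal) : AEMeasurable σ[p]
    ((volume.restrict τ[p]).withDensity ρ) := ((continuousOn_extChartAt_symm p).aemeasurable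
    (isOpen_extChartAt_target p).measurableSet).mono_ac (withDensity_absolutelyContinuous _ _)

lemma chartVolume_apply (p : M) {A : Set M} (hA : MeasurableSet A) : chartVolume d p A =
    ∫⁻ u in σ[p] ⁻¹' A ∩ τ[p], ENNReal.ofReal (density d p (σ[p] u)) := by
  have hT : MeasurableSet τ[p] := (isOpen_extChartAt_target p).measurableSet
  rw [chartVolume, Measure.map_apply_of_aemeasurable (aemeasurable_symm p _) hA]
  have hm : NullMeasurableSet (σ[p] ⁻¹' A) (volume.restrict τ[p]) :=
    ((continuousOn_extChartAt_symm p).aemeasurable hT).nullMeasurable hA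
  rw [withDensity_apply', Measure.restrict_restrict₀ hm]

lemma measurableSet_preimage_symm (p : M) {A : Set M} (hA : MeasurableSet A) :
    MeasurableSet (σ[p] ⁻¹' A ∩ τ[p]) := by
  have hT : MeasurableSet τ[p] := (isOpen_extChartAt_target p).measurableSet
  have h1 : Measurable (τ[p].domRestrict σ[p]) :=
    (continuousOn_iff_continuous_domRestrict.1 (continuousOn_extChartAt_symm p)).measurable
  have h2 := hT.subtype_image (h1 hA)
  convert h2 using 1
  ext u
  simp [domRestrict, and_comm]

lemma chartVolume_eq_of_subset {p p' : M} {A : Set M} (hA : MeasurableSet A)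
    (h : A ⊆ κ[p].source) (h' : A ⊆ κ[p'].source) : chartVolume d p' A = chartVolume d p A := by
  rw [chartVolume_apply p hA, chartVolume_apply p' hA]
  set S := σ[p] ⁻¹' A ∩ τ[p]
  have hsub : S ⊆ overlap d p p' := fun u hu => ⟨hu.2, h' hu.1⟩
  have himg : σ[p'] ⁻¹' A ∩ κ[p'].target = transition d p p' '' S := by
    ext w
    constructor
    · rintro ⟨hw, hwT⟩
      refine ⟨κ[p] (σ[p'] w), ⟨?_, κ[p].map_source (h hw)⟩, ?_⟩
      · rw [mem_preimage, κ[p].left_inv (h hw)]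
        exact hw
      · rw [transition, κ[p].left_inv (h hw), κ[p'].right_inv hwT]
    · rintro ⟨u, hu, rfl⟩
      refine ⟨?_, (mem_overlap_transition (hsub hu)).1⟩
      rw [mem_preimage, transition, κ[p'].left_inv (hsub hu).2]
      exact hu.1
  have hmeas : MeasurableSet S := measurableSet_preimage_symm p hA
  rw [himg, lintegral_image_eq_lintegral_abs_det_fderiv_mul volume hmeas (fun u hu =>
    (hasFDerivAt_transition (hsub hu)).hasFDerivWithinAt) ((injOn_transition p p').mono hsub)]
  refine setLIntegral_congr_fun hmeas fun u hu => ?_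
  rw [transition, κ[p'].left_inv (hsub hu).2, density_transition (hsub hu),
    ENNReal.ofReal_mul (abs_nonneg _)]

lemma chartVolume_compl_source (p : M) : chartVolume d p κ[p].sourceᶜ = 0 := by
  have h : σ[p] ⁻¹' κ[p].sourceᶜ ∩ τ[p] = ∅ :=
    eq_empty_of_forall_notMem fun u hu => hu.1 (κ[p].map_target hu.2)
  rw [chartVolume_apply p (isOpen_extChartAt_source p).measurableSet.compl, h,
    Measure.restrict_empty, lintegral_zero_measure]

lemma restrict_riemannianVolume (p : M) :
    (riemannianVolume d M).restrict κ[p].source = chartVolume d p := by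
  set S := κ[p].source
  have hSm : MeasurableSet S := (isOpen_extChartAt_source p).measurableSet
  have h1 : (chartVolume d p).restrict S = chartVolume d p := by
    rw [Measure.restrict_eq_self_of_ae_mem]
    exact chartVolume_compl_source p
  have hle : chartVolume d p ≤ riemannianVolume d M := le_iSup (chartVolume d) p
  have h2 : riemannianVolume d M ≤ chartVolume d p + (riemannianVolume d M).restrict Sᶜ := by
    refine iSup_le fun p' => Measure.le_iff.2 fun A hA => ?_
    rw [← measure_inter_add_sdiff A hSm, Measure.add_apply, Measure.restrict_apply hA, ← sdiff_eq]
    refine add_le_add ?_ ((le_iSup (chartVolume d) p') _)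
    set S' := κ[p'].source
    have hSm' : MeasurableSet S' := (isOpen_extChartAt_source p').measurableSet
    have h3 : chartVolume d p' (A ∩ S) ≤ chartVolume d p' (A ∩ S ∩ S') := by
      rw [← measure_inter_add_sdiff (A ∩ S) hSm']
      have h5 : chartVolume d p' ((A ∩ S) \ S') = 0 := measure_mono_null (fun x hx => hx.2)
        (chartVolume_compl_source p')
      rw [h5, add_zero]
    refine h3.trans ?_
    rw [chartVolume_eq_of_subset ((hA.inter hSm).inter hSm') (p := p)
      (inter_subset_left.trans inter_subset_right) inter_subset_right]
    exact measure_mono (inter_subset_left.trans inter_subset_left)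
  refine le_antisymm ?_ ?_
  · refine (Measure.restrict_mono subset_rfl h2).trans ?_
    rw [Measure.restrict_add, h1, Measure.restrict_restrict hSm, inter_compl_self,
      Measure.restrict_empty, add_zero]
  · rw [← h1]
    exact Measure.restrict_mono subset_rfl hle

lemma integral_chartVolume (p : M) (H : M → ℂ) : ∫ y, H y ∂(chartVolume d p) =
    ∫ u in τ[p], (density d p (σ[p] u) : ℂ) * H (σ[p] u) := by
  set T := τ[p] with hTdef
  set σ := σ[p]
  have hT : MeasurableSet T := (isOpen_extChartAt_target p).measurableSet
  set ρ : 𝔼 → ENNReal := fun u => ENNReal.ofReal (density d p (σ u)) with hρ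
  have hemb : MeasurableEmbedding (fun u : T => σ u) := by
    have h1 := (chartAt 𝔼 p).symm.isOpenEmbedding_restrict.measurableEmbedding
    have h2 : (chartAt 𝔼 p).symm.source = T := by simp [hTdef]
    have h3 : ∀ T' : Set 𝔼, T' = T → MeasurableEmbedding (fun u : T' => σ u) →
      MeasurableEmbedding (fun u : T => σ u) := by rintro _ rfl h; exact h
    refine h3 _ h2 ?_
    exact h1
  have h1 : (volume.restrict T).withDensity ρ = (volume.withDensity ρ).restrict T :=
    (restrict_withDensity hT ρ).symm
  have h2 : chartVolume d p = ((volume.withDensity ρ).comap ((↑) : T → 𝔼)).map (fun u : T => σ u) :=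
    by
    have h3 := aemeasurable_symm (d := d) p ρ
    rw [h1, ← map_comap_subtype_coe hT] at h3
    rw [chartVolume, ← hρ, h1, ← map_comap_subtype_coe hT,
      AEMeasurable.map_map_of_aemeasurable h3 measurable_subtype_coe.aemeasurable]
    rfl
  have hae : AEMeasurable ρ (volume.restrict T) :=
    ((continuousOn_density p).aemeasurable hT).ennreal_ofReal
  rw [h2, hemb.integral_map, integral_subtype_comap hT (fun u => H (σ u)), ← h1,
    integral_withDensity_eq_integral_toReal_smul₀ hae (.of_forall fun u => ENNReal.ofReal_lt_top)]
  refine integral_congr_ae (.of_forall fun u => ?_)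
  simp only [hρ, real_smul]
  rw [ENNReal.toReal_ofReal (show 0 ≤ density d p (σ u) from sqrt_nonneg _)]

/-- Integration of functions supported in a chart. -/
lemma integral_riemannianVolume (p : M) {H : M → ℂ}
    (hH : ∀ y ∉ κ[p].source, H y = 0) : ∫ y, H y ∂(riemannianVolume d M) =
    ∫ u in τ[p], (density d p (σ[p] u) : ℂ) * H (σ[p] u) := by
  rw [← setIntegral_eq_integral_of_forall_compl_eq_zero hH, restrict_riemannianVolume,
    integral_chartVolume]

open Classical in
/-- The extension by zero of a function given in the chart at `p`. -/
def chartExtend (p : M) (f : 𝔼 → ℂ) (y : M) : ℂ := if y ∈ κ[p].source then f (κ[p] y) else 0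

lemma chartExtend_symm (p : M) (f : 𝔼 → ℂ) {u : 𝔼} (hu : u ∈ τ[p]) :
    chartExtend p f (σ[p] u) = f u := by
  rw [chartExtend, if_pos (κ[p].map_target hu), κ[p].right_inv hu]

lemma chartExtend_eq_zero (p : M) (f : 𝔼 → ℂ) {y : M} (hy : y ∉ κ[p].source) :
    chartExtend p f y = 0 := if_neg hy

lemma contMDiff_chartExtend (p : M) {f : 𝔼 → ℂ} (hf : Smooth f)
    (hfc : HasCompactSupport f) (hfT : tsupport f ⊆ τ[p]) :
    ContMDiff (𝓡 d) 𝓘(ℝ, ℂ) ∞ (chartExtend p f) := by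
  intro y
  by_cases hy : y ∈ κ[p].source
  · have h1 : ContMDiffAt (𝓡 d) 𝓘(ℝ, ℂ) ∞ (f ∘ κ[p]) y :=
      hf.contMDiff.contMDiffAt.comp y (contMDiffAt_extChartAt' (by simpa using hy))
    refine h1.congr_of_eventuallyEq ?_
    filter_upwards [(isOpen_extChartAt_source p).mem_nhds hy] with z hz
    rw [chartExtend, if_pos hz]
    rfl
  · set K := σ[p] '' tsupport f
    have hKc : IsCompact K := hfc.isCompact.image_of_continuousOn
      ((continuousOn_extChartAt_symm p).mono hfT)
    have hyK : y ∉ K := by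
      rintro ⟨u, hu, rfl⟩
      exact hy (κ[p].map_target (hfT hu))
    refine (contMDiffAt_const (c := (0 : ℂ))).congr_of_eventuallyEq ?_
    filter_upwards [hKc.isClosed.isOpen_compl.mem_nhds hyK] with z hz
    by_cases hzs : z ∈ κ[p].source
    · rw [chartExtend, if_pos hzs]
      refine image_eq_zero_of_notMem_tsupport fun h => hz ⟨_, h, κ[p].left_inv hzs⟩
    · exact chartExtend_eq_zero p f hzs

/-- The fibre integral, computed in another chart. -/
lemma integral_covec_self {p y : M} (hy : y ∈ κ[p].source)
    (G : Cotangent d y → ℂ) : (density d p y : ℂ) * ∫ q, G (covec y y q) =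
      (density d y y : ℂ) * ∫ q, G (covec p y q) := by
  set w := κ[p] y with hw
  have hσ : σ[p] w = y := κ[p].left_inv hy
  have hwD : w ∈ overlap d p y := ⟨κ[p].map_source hy, by
      rw [mem_preimage, hσ]
      exact mem_extChartAt_source y⟩
  set X := adjoint (fderiv ℝ (transition d p y) w) with hX
  have hdet : X.det = (fderiv ℝ (transition d p y) w).det := det_adjoint _
  have h0 := density_transition hwD
  rw [hσ] at h0
  rw [integral_eq_abs_det_mul_integral_comp X (hdet ▸ det_fderiv_transition_ne_zero hwD)
    fun q => G (covec p y q), hdet, h0]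
  simp only [covec_eq_covec_transition hy (mem_extChartAt_source (I := 𝓡 d) y), ← hw, ← hX]
  push_cast
  ring

/-- The regularised operator in local coordinates. -/
lemma regularisedOp_chartExtend (φ χ v : M → CotFun d M)
    (s : CotFun d M) (p : M) (δ : ℝ) {f : 𝔼 → ℂ} (hf : tsupport f ⊆ τ[p]) (u : 𝔼) :
    regularisedOp φ χ v s δ (chartExtend p f) (σ[p] u) =
      ((2 * π : ℂ) ^ d)⁻¹ * ∫ w, (∫ q, kernelFun (coordFun p φ)
        (coordFun p fun x y η => χ x y η * v x y η) (coordHam p) (coordSymbol p s) δ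
          (u, w, q)) * f w := by
  rw [regularisedOp, integral_riemannianVolume p fun y hy => by
    rw [chartExtend_eq_zero p f hy, mul_zero], ← integral_const_mul]
  refine Eq.trans ?_ (setIntegral_eq_integral_of_forall_compl_eq_zero (s := τ[p]) fun w hw => by
      rw [image_eq_zero_of_notMem_tsupport fun h => hw (hf h), mul_zero, mul_zero])
  refine setIntegral_congr_fun (isOpen_extChartAt_target p).measurableSet fun w hw => ?_
  have h1 := integral_covec_self (κ[p].map_target hw) fun η => cexp (I *
    φ (σ[p] u) (σ[p] w) η) * s (σ[p] w) η * χ (σ[p] u) (σ[p] w) η *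
    v (σ[p] u) (σ[p] w) η * exp (-δ * hamiltonian (σ[p] w) η)
  have h2 : (density d (σ[p] w) (σ[p] w) : ℂ) ≠ 0 := ofReal_ne_zero.2
      (sqrt_pos.2 (posDef_metricMatrix (d := d) (mem_extChartAt_source (I := 𝓡 d) _)).det_pos).ne'
  have h3 : (∫ q, kernelFun (coordFun p φ) (coordFun p fun x y η => χ x y η * v x y η)
      (coordHam p) (coordSymbol p s) δ (u, w, q)) = ∫ q, (fun η => cexp (I *
    φ (σ[p] u) (σ[p] w) η) * s (σ[p] w) η * χ (σ[p] u) (σ[p] w) η *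
    v (σ[p] u) (σ[p] w) η * exp (-δ * hamiltonian (σ[p] w) η))
      (covec p (σ[p] w) q) := integral_congr_ae (.of_forall fun q => by
      simp only [kernelFun, coordFun, coordSymbol, coordHam]
      ring)
  have h4 : ((2 * π : ℂ) ^ d) ≠ 0 := by simp [Real.pi_ne_zero]
  simp only [chartExtend_symm p f hw]
  rw [h3]
  rw [show ∀ a b c e : ℂ, a * (b / c * e) = (a * b) / c * e from fun a b c e => by ring]
  erw [h1]
  push_cast
  field_simp

/-- The hypothesis on the operator, in local coordinates. -/
lemma IsIdentityModSmoothing.exists_kernel {φ χ v : M → CotFun d M}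
    {s : CotFun d M} (hid : IsIdentityModSmoothing φ χ v s) (p : M) :
    ∃ R : 𝔼 × 𝔼 → ℂ, ContinuousOn R (τ[p] ×ˢ τ[p]) ∧
      ∀ f : 𝔼 → ℂ, Smooth f → HasCompactSupport f → tsupport f ⊆ τ[p] → ∀ u ∈ τ[p],
        Tendsto (fun δ => ∫ w, (∫ q, kernelFun (coordFun p φ)
          (coordFun p fun x y η => χ x y η * v x y η) (coordHam p) (coordSymbol p s) δ
            (u, w, q)) * f w) (𝓝[>] 0) (𝓝 ((2 * π : ℂ) ^ d * (f u + ∫ w, R (u, w) * f w))) := by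
  obtain ⟨K, hK, hlim⟩ := hid
  refine ⟨fun z => K (σ[p] z.1, σ[p] z.2) * density d p (σ[p] z.2), ?_, fun f hf hfc hfT u hu => ?_⟩
  · have h1 : ContinuousOn (fun z : 𝔼 × 𝔼 => σ[p] z.1) (τ[p] ×ˢ τ[p]) :=
      (continuousOn_extChartAt_symm p).comp continuousOn_fst fun z hz => hz.1
    have h2 : ContinuousOn (fun z : 𝔼 × 𝔼 => σ[p] z.2) (τ[p] ×ˢ τ[p]) :=
      (continuousOn_extChartAt_symm p).comp continuousOn_snd fun z hz => hz.2
    exact (hK.continuous.comp_continuousOn (h1.prodMk h2)).mul (continuous_ofReal.comp_continuousOn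
        ((continuousOn_density p).comp continuousOn_snd fun z hz => hz.2))
  · have h1 := (hlim _ (contMDiff_chartExtend p hf hfc hfT) (σ[p] u)).const_mul ((2 * π : ℂ) ^ d)
    have h4 : ((2 * π : ℂ) ^ d) ≠ 0 := by simp [Real.pi_ne_zero]
    simp only [regularisedOp_chartExtend φ χ v s p _ hfT, mul_inv_cancel_left₀ h4] at h1
    rw [chartExtend_symm p f hu, integral_riemannianVolume p fun y hy => by
      rw [chartExtend_eq_zero p f hy, mul_zero]] at h1
    convert h1 using 4
    refine (setIntegral_eq_integral_of_forall_compl_eq_zero (s := τ[p]) fun w hw => by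
        rw [image_eq_zero_of_notMem_tsupport fun h => hw (hfT h), mul_zero]).symm.trans ?_
    refine setIntegral_congr_fun (isOpen_extChartAt_target p).measurableSet fun w hw => ?_
    simp only [chartExtend_symm p f hw]
    ring

lemma integral_eq_pow_mul_integral_smul (f : 𝔼 → ℂ) {r : ℝ} (hr : 0 < r) :
    ∫ z, f z = (r : ℂ) ^ d * ∫ z, f (r • z) := by
  rw [Measure.integral_comp_smul_of_nonneg volume f r (hR := hr.le), finrank_euclideanSpace_fin,
    real_smul]
  push_cast
  rw [mul_inv_cancel_left₀ (pow_ne_zero _ (ofReal_ne_zero.2 hr.ne'))]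

lemma IsTest.contDiff_wavelet {Ψ : 𝔼 → ℂ} (h : IsTest Ψ) : Smooth (wavelet Ψ) := by
  obtain ⟨S, hS⟩ := h.exists_schwartz
  rw [funext hS]
  exact (S.smooth ⊤).comp (contDiff_const_smul _)

lemma IsTest.integral_wavelet {Ψ : 𝔼 → ℂ} (h : IsTest Ψ) : ∫ z, wavelet Ψ z = 0 := by
  have h1 := h.integral_exp_mul_wavelet 0
  rw [image_eq_zero_of_notMem_tsupport h.zero_notMem, mul_zero] at h1
  simpa using h1

lemma IsTest.tendsto_integral_smul {Ψ : 𝔼 → ℂ} (h : IsTest Ψ) {H : 𝔼 → ℂ} (hH : Continuous H)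
    (hHc : HasCompactSupport H) :
    Tendsto (fun r : ℝ => ∫ z, H (r • z) * wavelet Ψ z) (𝓝[>] 0) (𝓝 0) := by
  obtain ⟨C, hC⟩ := hHc.exists_bound_of_continuous hH
  have h1 : Tendsto (fun r : ℝ => ∫ z, H (r • z) * wavelet Ψ z) (𝓝[>] 0)
      (𝓝 (∫ z, H 0 * wavelet Ψ z)) := by
    refine tendsto_integral_filter_of_dominated_convergence (fun z => C * ‖wavelet Ψ z‖)
      (.of_forall fun r => ((hH.comp (continuous_const_smul r)).mul
        h.continuous_wavelet).aestronglyMeasurable) (.of_forall fun r =>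
        Eventually.of_forall fun z => ?_) (h.integrable_wavelet.norm.const_mul C)
      (.of_forall fun z => ?_)
    · rw [norm_mul]
      exact mul_le_mul_of_nonneg_right (hC _) (norm_nonneg _)
    · have h2 : Continuous fun r : ℝ => H (r • z) * wavelet Ψ z := by fun_prop
      have h3 := h2.tendsto 0
      rw [zero_smul] at h3
      exact h3.mono_left nhdsWithin_le_nhds
  rwa [integral_const_mul, h.integral_wavelet, mul_zero] at h1

/-- The action of an identity modulo smoothing operators on rescaled wavelets. -/
lemma LocalKernel.isLittleO_wavelet {O : Set 𝔼} {φ V b : 𝔼 × 𝔼 × 𝔼 → ℂ} {h : 𝔼 × 𝔼 → ℝ}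
    {s : 𝔼 × 𝔼 → ℂ} {c : ℕ → 𝔼 × 𝔼 → ℂ} (hL : LocalKernel O φ V b h s c) (hd : 2 ≤ d) {κ : ℂ}
    {R : 𝔼 × 𝔼 → ℂ} (hR : ContinuousOn R (O ×ˢ O))
    (hlim : ∀ f : 𝔼 → ℂ, Smooth f → HasCompactSupport f → tsupport f ⊆ O → ∀ u ∈ O,
      Tendsto (fun δ : ℝ => ∫ w, (∫ q, kernelFun φ b h s δ (u, w, q)) * f w)
      (𝓝[>] 0) (𝓝 (κ * (f u + ∫ w, R (u, w) * f w))))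
    {F : 𝔼 → 𝔼} (hF : Smooth F) {a : ℝ} (ha : 0 < a) (hmaps : MapsTo F (ball 0 a) O)
    (hinj : InjOn F (ball 0 a)) (hdet : ∀ z ∈ ball (0 : 𝔼) a, (fderiv ℝ F z).det ≠ 0)
    {u₀ : 𝔼} (hF0 : F 0 = u₀) {m : 𝔼 → ℂ} (hm : SmoothOn m (ball 0 a)) (hm0 : m 0 = 1)
    (k : ContDiffBump (0 : 𝔼)) (hk : k.rOut = a / 2) {X : 𝔼 →L[ℝ] 𝔼}
    (hX : |(fderiv ℝ F 0).det| * |X.det| = 1) {Ψ : 𝔼 → ℂ} (hΨ : IsTest Ψ) :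
    (fun r : ℝ => (∫ θ, s (u₀, X (r⁻¹ • θ)) * ∫ z, cexp (I *
      φ (F (r • z), u₀, X (r⁻¹ • θ))) * (b (F (r • z), u₀, X (r⁻¹ • θ)) * m (r • z) * k (r • z)) *
        wavelet Ψ z) - κ * wavelet Ψ 0) =o[𝓝[>] 0] fun r : ℝ => r ^ 2 := by
  have h0a : (0 : 𝔼) ∈ ball (0 : 𝔼) a := mem_ball_self ha
  have hu₀ : u₀ ∈ O := hF0 ▸ hmaps h0a
  have hkC : Smooth fun z : 𝔼 => ((k z : ℝ) : ℂ) := ofRealCLM.contDiff.comp k.contDiff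
  have hktsupp : tsupport (fun z : 𝔼 => ((k z : ℝ) : ℂ)) ⊆ closedBall 0 (a / 2) := by
    rw [← hk, ← k.tsupport_eq]
    exact closure_mono fun z hz => by simpa using hz
  have hkball : tsupport (fun z : 𝔼 => ((k z : ℝ) : ℂ)) ⊆ ball 0 a :=
    hktsupp.trans (closedBall_subset_ball (by linarith))
  have hkc : HasCompactSupport fun z : 𝔼 => ((k z : ℝ) : ℂ) :=
    (isCompact_closedBall (0 : 𝔼) (a / 2)).of_isClosed_subset (isClosed_tsupport _) hktsupp
  have hk0 : k 0 = 1 := k.one_of_mem_closedBall (mem_closedBall_self k.rIn_pos.le)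
  set D : 𝔼 → ℝ := fun z => |(fderiv ℝ F z).det|
  have hDs : SmoothOn (fun z => (D z : ℂ)⁻¹) (ball 0 a) := by
    refine ContDiffOn.inv (ofRealCLM.contDiff.comp_contDiffOn ?_) fun z hz =>
      ofReal_ne_zero.2 (abs_pos.2 (hdet z hz)).ne'
    intro z hz
    exact ((contDiff_det_fderiv hF).contDiffAt.abs (hdet z hz)).contDiffWithinAt
  set W : 𝔼 → ℂ := fun z => (D z : ℂ)⁻¹ * m z * k z with hW
  have hWs : Smooth W := contDiffOn_univ.1
    (contDiffOn_mul_of_tsupport isOpen_ball hkC (hDs.mul hm) fun z hz => hkball hz.1)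
  have hDW : ∀ z, (D z : ℂ) * W z = m z * k z := fun z => by
    by_cases hz : z ∈ ball (0 : 𝔼) a
    · rw [hW]
      simp only
      rw [mul_assoc, mul_inv_cancel_left₀ (ofReal_ne_zero.2 (abs_pos.2 (hdet z hz)).ne')]
    · have h1 : ((k z : ℝ) : ℂ) = 0 := image_eq_zero_of_notMem_tsupport
        (f := fun z : 𝔼 => ((k z : ℝ) : ℂ)) fun h' => hz (hkball h')
      simp [hW, h1]
  set H : 𝔼 → ℂ := fun z => R (F z, u₀) * m z * k z with hH
  have hHc : Continuous H := by
    rw [← continuousOn_univ]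
    refine continuousOn_mul_of_tsupport isOpen_ball hkC.continuous (ContinuousOn.mul ?_
      hm.continuousOn) fun z hz => hkball hz.1
    exact hR.comp (f := fun z => (F z, u₀)) (by have := hF.continuous; fun_prop)
      fun z hz => ⟨hmaps hz, hu₀⟩
  have hXne : ((|X.det| : ℝ) : ℂ) ≠ 0 := ofReal_ne_zero.2 (right_ne_zero_of_mul_eq_one hX)
  have hX0 : X.det ≠ 0 := abs_ne_zero.1 (right_ne_zero_of_mul_eq_one hX)
  have hW0 : W 0 = ((|X.det| : ℝ) : ℂ) := by
    have h1 := hDW 0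
    rw [hm0, hk0, one_mul] at h1
    have h2 : ((D 0 : ℝ) : ℂ) * ((|X.det| : ℝ) : ℂ) = ((1 : ℝ) : ℂ) := by rw [← ofReal_mul, hX]
    exact mul_left_cancel₀ (ofReal_ne_zero.2 (left_ne_zero_of_mul_eq_one hX)) (h1.trans h2.symm)
  have hkey : ∀ r : ℝ, 0 < r → (∫ θ, s (u₀, X (r⁻¹ • θ)) * ∫ z, cexp (I *
      φ (F (r • z), u₀, X (r⁻¹ • θ))) * (b (F (r • z), u₀, X (r⁻¹ • θ)) * m (r • z) * k (r • z)) *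
        wavelet Ψ z) - κ * wavelet Ψ 0 = κ * ((|X.det| : ℝ) : ℂ)⁻¹ * ((r : ℂ) ^ d *
        ∫ z, H (r • z) * wavelet Ψ z) := fun r hr => by
    have hr0 : (r : ℂ) ^ d ≠ 0 := pow_ne_zero _ (ofReal_ne_zero.2 hr.ne')
    set τ : 𝔼 → ℂ := fun z => W z * wavelet Ψ (r⁻¹ • z) with hτ
    have hτs : Smooth τ := hWs.mul (hΨ.contDiff_wavelet.comp (contDiff_const_smul _))
    have hτt : tsupport τ ⊆ tsupport fun z : 𝔼 => ((k z : ℝ) : ℂ) :=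
      closure_mono fun z hz h' => hz (by
        have h1 : ((k z : ℝ) : ℂ) = 0 := h'
        simp [hτ, hW, h1])
    obtain ⟨g, hgs, hgc, hgt, hgF, hgi⟩ := exists_pushforward hF isOpen_ball hinj hdet hτs
      (hkc.of_isClosed_subset (isClosed_tsupport _) hτt) (hτt.trans hkball)
    have hgO : tsupport g ⊆ O := hgt.trans
      ((image_mono (hτt.trans hkball)).trans hmaps.image_subset)
    have hpush : ∀ G : 𝔼 → ℂ, ∫ u, G u * g u =
        (r : ℂ) ^ d * ∫ z, G (F (r • z)) * (m (r • z) * k (r • z)) * wavelet Ψ z := fun G => by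
      rw [hgi, integral_eq_pow_mul_integral_smul _ hr]
      congr 1
      refine integral_congr_ae (.of_forall fun z => ?_)
      simp only [hτ, inv_smul_smul₀ hr.ne']
      rw [← hDW]
      ring
    have h1 := hL.transposed_eq (by omega) hR hlim hgs hgc hgO hu₀
    rw [hpush, ← hF0, hgF 0 h0a, hF0, integral_eq_abs_det_mul_integral_comp X hX0,
      integral_eq_pow_mul_integral_smul _ (inv_pos.2 hr)] at h1
    simp only [hpush, hτ, smul_zero, hW0] at h1
    have h2 : ∀ θ, s (u₀, X (r⁻¹ • θ)) * ((r : ℂ) ^ d * ∫ z, cexp (I *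
        φ (F (r • z), u₀, X (r⁻¹ • θ))) * b (F (r • z), u₀, X (r⁻¹ • θ)) *
          (m (r • z) * k (r • z)) * wavelet Ψ z) = (r : ℂ) ^ d * (s (u₀, X (r⁻¹ • θ)) *
        ∫ z, cexp (I * φ (F (r • z), u₀, X (r⁻¹ • θ))) *
          (b (F (r • z), u₀, X (r⁻¹ • θ)) * m (r • z) * k (r • z)) * wavelet Ψ z) := fun θ => by
      simp only [mul_assoc]
      ring
    simp only [h2] at h1
    rw [integral_const_mul] at h1
    push_cast at h1
    rw [inv_pow, inv_mul_cancel_left₀ hr0] at h1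
    have h3 : (∫ z, H (r • z) * wavelet Ψ z) =
        ∫ z, R (F (r • z), u₀) * (m (r • z) * k (r • z)) * wavelet Ψ z := by
      simp only [hH, mul_assoc]
    rw [h3, sub_eq_iff_eq_add]
    refine mul_left_cancel₀ hXne (h1.trans ?_)
    field_simp
    ring
  have hJ := hΨ.tendsto_integral_smul hHc (hkc.mul_left)
  have h1 : (fun r : ℝ => κ * ((|X.det| : ℝ) : ℂ)⁻¹ * ((r : ℂ) ^ d *
        ∫ z, H (r • z) * wavelet Ψ z)) =o[𝓝[>] 0] fun r : ℝ => r ^ 2 := by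
    refine IsLittleO.const_mul_left ?_ _
    have h2 : (fun r : ℝ => (r : ℂ) ^ d) =O[𝓝[>] 0] fun r : ℝ => r ^ 2 := by
      refine IsBigO.of_bound 1 ?_
      filter_upwards [Ioo_mem_nhdsGT one_pos] with r hr
      rw [norm_pow, norm_pow, norm_real, one_mul, norm_of_nonneg hr.1.le]
      exact pow_le_pow_of_le_one hr.1.le hr.2.le hd
    have h3 := h2.mul_isLittleO ((isLittleO_one_iff ℝ).2 hJ)
    simpa using h3
  refine h1.congr' ?_ EventuallyEq.rfl
  filter_upwards [self_mem_nhdsWithin] with r hr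
  exact (hkey r hr).symm

lemma coordSymbol_extChartAt (a : CotFun d M) (y : M) (q : 𝔼) :
    coordSymbol y a (κ[y] y, q) = a y (covec y y q) := by
  rw [coordSymbol]
  simp only
  rw [extChartAt_to_inv]

lemma coordHam_extChartAt (y : M) (q : 𝔼) :
    coordHam y (κ[y] y, q) = hamiltonian y (covec y y q) := by
  rw [coordHam]
  simp only
  rw [extChartAt_to_inv]

lemma adjoint_adjoint_symm (B : 𝔼 ≃L[ℝ] 𝔼) (q : 𝔼) : ⟪B⟫† (⟪B.symm⟫† q) = q := by
  refine ext_inner_right ℝ fun x => ?_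
  rw [adjoint_inner_left, adjoint_inner_left]
  simp

end

end LeviCivita

open LeviCivita

theorem theorem6p2 {d : ℕ} (hd : 2 ≤ d)
    {M : Type*} [MetricSpace M] [CompactSpace M] [ConnectedSpace M]
    [ChartedSpace (EuclideanSpace ℝ (Fin d)) M] [IsManifold (𝓡 d) ∞ M]
    [Bundle.RiemannianBundle (fun x : M => TangentSpace (𝓡 d) x)]
    [IsContMDiffRiemannianBundle (𝓡 d) ∞ (EuclideanSpace ℝ (Fin d))
      (fun x : M => TangentSpace (𝓡 d) x)]
    [IsRiemannianManifold (𝓡 d) M] [MeasurableSpace M] [BorelSpace M]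
    (ε : ℝ) (hε : 0 < ε)
    (φ χ v : M → (y : M) → LeviCivita.Cotangent d y → ℂ)
    (hφ : LeviCivita.IsLeviCivitaPhase ε φ)
    (hχ : LeviCivita.IsCutoff χ)
    (hv : LeviCivita.IsWeight φ χ v)
    (s : (y : M) → LeviCivita.Cotangent d y → ℂ)
    (c : ℕ → (y : M) → LeviCivita.Cotangent d y → ℂ)
    (hs : LeviCivita.HasPolyhomogeneousExpansion s c)
    (hid : LeviCivita.IsIdentityModSmoothing φ χ v s)
    (y : M) (η : LeviCivita.Cotangent d y) (hη : η ≠ 0) :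
    c 2 y η =
      (((((d : ℝ) - 1) * ((d : ℝ) - 2) * ε ^ 2) / (8 * LeviCivita.cometric y η) : ℝ) : ℂ) := by
  have hu₀ : extChartAt (𝓡 d) y y ∈ (extChartAt (𝓡 d) y).target := mem_extChartAt_target y
  set u₀ := extChartAt (𝓡 d) y y
  obtain ⟨O, hu₀O, hOT, hL, hV, hpow⟩ := exists_localKernel hφ hχ hv hs hu₀
  obtain ⟨B, hB, hBdet⟩ := exists_frame (p := y) hu₀
  obtain ⟨a, ha, hmaps, hinj, hdet, hflat⟩ := exists_flatModel hε hφ hL hu₀O hOT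
    (fun q hq => hV u₀ hu₀O q hq) (fun u hu q hq => hpow u hu u₀ hu₀O q hq) hB hBdet
  obtain ⟨R, hR, hlim⟩ := hid.exists_kernel y
  set k : ContDiffBump (0 : EuclideanSpace ℝ (Fin d)) := ⟨a / 4, a / 2, by positivity, by linarith⟩
  have hF0 := normalMap_zero hu₀ B.symm.toContinuousLinearMap
  have hρ0 := normalDensity_zero hu₀ hBdet
  obtain ⟨q, rfl⟩ := exists_covec_eq (mem_extChartAt_source (I := 𝓡 d) y) η
  set θ := ContinuousLinearMap.adjoint B.symm.toContinuousLinearMap q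
  have hq : ContinuousLinearMap.adjoint B.toContinuousLinearMap θ = q := adjoint_adjoint_symm B q
  have hθ0 : θ ≠ 0 := fun h => hη (by
    rw [← hq, h, map_zero]
    ext X
    simp [covec])
  have hcom : cometric y (covec y y q) = ‖θ‖ ^ 2 := by
    have h1 : √(cometric y (covec y y q)) = ‖θ‖ := by
      rw [← coordHam_adjoint hu₀ hB θ, hq, coordHam_extChartAt]
      rfl
    rw [← h1, Real.sq_sqrt (Real.sqrt_pos.1 (h1 ▸ norm_pos_iff.2 hθ0)).le]
  have key := (hflat k rfl).component_two_eq hd (fun Ψ hΨ =>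
    hL.isLittleO_wavelet hd (hR.mono (Set.prod_mono hOT hOT))
      (fun f hf hfc hfO u hu => hlim f hf hfc (hfO.trans hOT) u (hOT hu))
      (contDiff_normalMap hu₀ _) ha hmaps hinj hdet hF0 (Complex.ofRealCLM.contDiff.comp_contDiffOn
        ((contDiffOn_normalDensity hu₀ _ (fun z hz => hOT (hmaps hz)) hdet).sqrt
          fun z hz => (normalDensity_pos (hOT (hmaps hz)) (hdet z hz)).ne')) (by simp [hρ0]) k rfl
      (by rw [det_adjoint, hBdet, mul_comm, ← hρ0, normalDensity_eq, hF0]) hΨ) hθ0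
  rw [hcom, ← coordSymbol_extChartAt (c 2)]
  simpa only [hq] using key
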